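/- Notation. On $\mathbb R^2$ let $\Lambda=(-\Delta)^{1/2}$, $\mathcal R_j=\partial_j\Lambda^{-1}$ and $\mathcal R^\perp\theta=(-\mathcal R_2\theta,\mathcal R_1\theta)$. Fix $1/2<s<1$. Fix nonnegative test functions $\phi_0,\chi\in\mathcal D(\mathbb R^2)$ with $\phi_0=1$ on $|x|\le2$, $\phi_0=0$ on $|x|\ge3$, $\chi=1$ on $|x|\le1$, $\chi=0$ on $|x|\ge2$, and $\rho\in\mathcal D(\mathbb R^2)$ supported in $[-1,1]^2$ with $\int\rho=1$. Put $\chi_R(x)=\chi(x/R)$, $\rho_\varepsilon(x)=\varepsilon^{-2}\rho(x/\varepsilon)$ and $B=\{\phi_0(\cdot-k):k\in\mathbb Z^2\}$, and for $\phi\in B$ $$A_\phi(w)=\int_{\mathbb R^2}\Big(\frac{|w|^2}{2}\phi+\frac{|\Lambda^sw|^2}{2}\phi\Big)\,dx,\qquad \|w\|_{H^s_{uloc}}^2=\sup_{\phi\in B}A_\phi(w).$$ Let $w_0\in H^s_{uloc}(\mathbb R^2)$ with $\theta_0=\Lambda^sw_0\in L^\infty(\mathbb R^2)$. For $R>1$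 and $\varepsilon>0$ consider the equation $(SQG)_{R,\varepsilon}$ $$\partial_tw=-(\Lambda^{-s}\nabla)\cdot\big(\Lambda^sw\;\mathcal R^\perp\Lambda^sw\big)-\Lambda w,\qquad w|_{t=0}=w_{0,R,\varepsilon}:=(w_0\chi_R)*\rho_\varepsilon .$$ A weak solution on $[0,T]$ is a function $w$ with $w\in L^\infty([0,T];L^2)$ and $\theta=\Lambda^sw\in L^\infty([0,T];L^2\cap L^\infty)\cap L^2([0,T];\dot H^{1/2})$ such that, with $u=\mathcal R^\perp\theta$, for all $\eta\in\mathcal D(\mathbb R^2)$ and all $t\in[0,T]$, $$\int w(t)\eta\,dx=\int w_{0,R,\varepsilon}\,\eta\,dx+\int_0^t\!\Big(\int\theta u\cdot\Lambda^{-s}\nabla\eta\,dx-\int w\,\Lambda\eta\,dx\Big)d\tau .$$ Theorem. There are constants $C,c\ge 0$, depending only on $\|\theta_0\|_{L^\infty}$ and $\|w_0\|_{H^s_{uloc}}$ (and on $s,\phi_0,\chi,\rho$), and monotone in the sense that they can be chosen uniformly for all data with $\|\theta_0\|_{L^\infty}\le M$ and $\|w_0\|_{H^s_{uloc}}\le N$,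 such that for all $R>1$, $\varepsilon>0$, $T>0$ and every weak solution $w=w_{R,\varepsilon}$ of $(SQG)_{R,\varepsilon}$ on $[0,T]$ the following holds. (1) For every $\phi\in B$ the function $t\mapsto A_\phi(w(t))$ is absolutely continuous on $[0,T]$, and for almost every $t\in(0,T)$ $$\partial_tA_\phi(w(t))\le C\,\|w(t)\|_{H^s_{uloc}}^2 .$$ (2) For all $t\in[0,T]$: $\|w(t)\|^2_{H^s_{uloc}}\le\|w(0)\|^2_{H^s_{uloc}}\,e^{Ct}$ and $\|w(t)\|^2_{H^s_{uloc}}\le c\,e^{Ct}$. (3) $\displaystyle\sup_{\phi\in B}\int_0^T\!\!\int\phi\,|\Lambda^{s+1/2}w|^2\,dx\,dt\le c\,e^{CT}$. -/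

import Mathlib

open MeasureTheory
open scoped FourierTransform ENNReal NNReal

namespace SQG

noncomputable section

/-- The Euclidean plane. -/
abbrev Plane : Type := EuclideanSpace ℝ (Fin 2)

/-- Real-valued test functions: smooth and compactly supported. -/
def IsTest (η : Plane → ℝ) : Prop :=
  ContDiff ℝ ((⊤ : ℕ∞) : WithTop ℕ∞) η ∧ HasCompactSupport η

/-- The Fourier multiplier operator with symbol `m`, on test functions. The frequency `ξ` is that
of the Fourier transform `∫ exp (-2πi⟨x, ξ⟩) η x dx`. All symbols used below satisfy
`m (-ξ) = conj (m ξ)`, so that the inverse transform is real already. -/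
def multiplier (m : Plane → ℂ) (η : Plane → ℝ) (x : Plane) : ℝ :=
  (𝓕⁻ (fun ξ : Plane => m ξ * 𝓕 (fun y : Plane => (η y : ℂ)) ξ) x).re

/-- `Λ^σ η = (-Δ)^(σ/2) η` for a test function `η`: the multiplier with symbol `|2πξ|^σ`. -/
def fracLapTest (σ : ℝ) : (Plane → ℝ) → Plane → ℝ :=
  multiplier fun ξ => (((2 * Real.pi * ‖ξ‖) ^ σ : ℝ) : ℂ)

/-- `Λ^(-s) ∂_j η` for a test function `η`: the multiplier with symbol `2πi ξ_j |2πξ|^(-s)`. -/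
def fracGradTest (s : ℝ) (j : Fin 2) : (Plane → ℝ) → Plane → ℝ :=
  multiplier fun ξ =>
    Complex.I * ((2 * Real.pi * ξ j : ℝ) : ℂ) * (((2 * Real.pi * ‖ξ‖) ^ (-s) : ℝ) : ℂ)

/-- The Riesz transform `R_j η = ∂_j Λ^(-1) η` of a test function `η`: symbol `i ξ_j / |ξ|`. -/
def rieszTest (j : Fin 2) : (Plane → ℝ) → Plane → ℝ :=
  multiplier fun ξ => Complex.I * ((ξ j / ‖ξ‖ : ℝ) : ℂ)

/-- `g = Λ^σ f` in the sense of distributions (the symbol of `Λ^σ` is even, so that `Λ^σ` is its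
own transpose). For `0 < σ` the function `Λ^σ η` is continuous and `O(|x|^(-2-σ))`, and the
pairing with `f` converges absolutely for each uniformly locally square integrable `f`. -/
def IsFracLap (σ : ℝ) (f g : Plane → ℝ) : Prop :=
  ∀ η : Plane → ℝ, IsTest η → ∫ x, g x * η x = ∫ x, f x * fracLapTest σ η x

/-- `u = R^⊥ θ = (-R_2 θ, R_1 θ)` in the sense of distributions (each `R_j` is minus its own
transpose). -/
def IsRieszPerp (θ : Plane → ℝ) (u : Plane → Plane) : Prop :=
  ∀ η : Plane → ℝ, IsTest η →
    (∫ x, u x 0 * η x = ∫ x, θ x * rieszTest 1 η x) ∧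
    (∫ x, u x 1 * η x = -∫ x, θ x * rieszTest 0 η x)

/-- The localizing function: a nonnegative test function, equal to `1` on `|x| ≤ 2` and to `0` on
`|x| ≥ 3`. -/
structure IsLocalizer (φ₀ : Plane → ℝ) : Prop where
  test : IsTest φ₀
  nonneg : ∀ x, 0 ≤ φ₀ x
  eq_one : ∀ x, ‖x‖ ≤ 2 → φ₀ x = 1
  eq_zero : ∀ x, 3 ≤ ‖x‖ → φ₀ x = 0

/-- The truncation profile: a nonnegative test function, equal to `1` on `|x| ≤ 1` and to `0` on
`|x| ≥ 2`. -/
structure IsTruncation (χ : Plane → ℝ) : Prop where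
  test : IsTest χ
  nonneg : ∀ x, 0 ≤ χ x
  eq_one : ∀ x, ‖x‖ ≤ 1 → χ x = 1
  eq_zero : ∀ x, 2 ≤ ‖x‖ → χ x = 0

/-- The mollifying profile: a test function supported in `[-1,1]²` with integral `1`. -/
structure IsMollifier (ρ : Plane → ℝ) : Prop where
  test : IsTest ρ
  support : ∀ x : Plane, ρ x ≠ 0 → ∀ i, |x i| ≤ 1
  integral_eq_one : ∫ x, ρ x = 1

/-- The integer translate `φ₀ (x - k)`. -/
def translate (φ₀ : Plane → ℝ) (k : Fin 2 → ℤ) (x : Plane) : ℝ :=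
  φ₀ (x - WithLp.toLp 2 fun i => (k i : ℝ))

/-- The localized energy `A_φ(w) = ∫ (|w|²/2 φ + |θ|²/2 φ) dx`, where `θ = Λ^s w`. -/
def locEnergy (φ w θ : Plane → ℝ) : ℝ≥0∞ :=
  ∫⁻ x, ENNReal.ofReal (w x ^ 2 / 2 * φ x + θ x ^ 2 / 2 * φ x)

/-- The squared norm `‖w‖²_{H^s_uloc}`: the supremum of `A_φ(w)` over the integer translates `φ`
of `φ₀`, where `θ = Λ^s w`. -/
def ulocNormSq (φ₀ w θ : Plane → ℝ) : ℝ≥0∞ :=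
  ⨆ k : Fin 2 → ℤ, locEnergy (translate φ₀ k) w θ

/-- The truncated and regularized datum `w_{0,R,ε} = (w₀ χ_R) * ρ_ε`, where `χ_R x = χ (x / R)`
and `ρ_ε x = ε⁻² ρ (x / ε)`. -/
def truncDatum (χ ρ : Plane → ℝ) (R ε : ℝ) (w₀ : Plane → ℝ) (x : Plane) : ℝ :=
  ∫ y, (ε ^ 2)⁻¹ * ρ (ε⁻¹ • (x - y)) * (χ (R⁻¹ • y) * w₀ y)

/-- `w` is a weak solution on `[0,T]` of
`∂_t w = -(Λ^(-s) ∇) · (Λ^s w  R^⊥ Λ^s w) - Λ w`, `w(0) = wInit`, of finite energy and with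
`Λ^s w` bounded. Here `θ = Λ^s w`, `u = R^⊥ θ`, and `v = Λ^(1/2) θ = Λ^(s + 1/2) w`. -/
structure IsWeakSolution (s T : ℝ) (wInit : Plane → ℝ)
    (w θ : ℝ → Plane → ℝ) (u : ℝ → Plane → Plane) (v : ℝ → Plane → ℝ) : Prop where
  /-- joint measurability in time and space -/
  meas_w : AEStronglyMeasurable (Function.uncurry w)
    ((volume.restrict (Set.Ioo 0 T)).prod volume)
  meas_θ : AEStronglyMeasurable (Function.uncurry θ)
    ((volume.restrict (Set.Ioo 0 T)).prod volume)
  meas_u : AEStronglyMeasurable (Function.uncurry u)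
    ((volume.restrict (Set.Ioo 0 T)).prod volume)
  meas_v : AEStronglyMeasurable (Function.uncurry v)
    ((volume.restrict (Set.Ioo 0 T)).prod volume)
  /-- `θ = Λ^s w` and `u = R^⊥ θ` -/
  frac : ∀ t ∈ Set.Icc 0 T, IsFracLap s (w t) (θ t)
  riesz : ∀ t ∈ Set.Icc 0 T, IsRieszPerp (θ t) (u t)
  memLp_w : ∀ t ∈ Set.Icc 0 T, MemLp (w t) 2 volume
  memLp_θ : ∀ t ∈ Set.Icc 0 T, MemLp (θ t) 2 volume
  memLp_u : ∀ t ∈ Set.Icc 0 T, MemLp (u t) 2 volume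
  /-- `w` and `θ` are in `L^∞([0,T]; L²)`, and `θ` is in `L^∞([0,T]; L^∞)` -/
  bound : ∃ K : ℝ≥0, ∀ t ∈ Set.Icc 0 T, eLpNorm (w t) 2 volume ≤ K ∧
    eLpNorm (θ t) 2 volume ≤ K ∧ eLpNorm (θ t) ⊤ volume ≤ K
  /-- `θ` is in `L²([0,T]; Ḣ^(1/2))` -/
  half : ∀ᵐ t, t ∈ Set.Ioo 0 T → MemLp (v t) 2 volume ∧ IsFracLap (1 / 2) (θ t) (v t)
  half_bound : ∫⁻ t in Set.Ioo 0 T, ∫⁻ x, ENNReal.ofReal (v t x ^ 2) < ⊤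
  /-- the equation and the initial condition, tested against `η` and integrated in time -/
  equation : ∀ η : Plane → ℝ, IsTest η → ∀ t ∈ Set.Icc 0 T,
    ∫ x, w t x * η x = (∫ x, wInit x * η x) +
      ∫ τ in (0 : ℝ)..t, ((∫ x, θ τ x * ∑ j, u τ x j * fracGradTest s j η x) -
        ∫ x, w τ x * fracLapTest 1 η x)

end

end SQG

namespace SQG

open Filter Topology Complex
open scoped ComplexConjugate SchwartzMap

noncomputable section

/-- The Fourier transform of a real function. -/
def hat (η : Plane → ℝ) : Plane → ℂ := 𝓕 (fun y : Plane => (η y : ℂ))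

/-- Symbols of polynomial growth whose multiplier maps real functions to real functions. -/
structure IsSymb (m : Plane → ℂ) : Prop where
  meas : Measurable m
  bound : ∃ C : ℝ, 0 ≤ C ∧ ∀ ξ, ‖m ξ‖ ≤ C * (1 + ‖ξ‖) ^ 4
  herm : ∀ ξ, m (-ξ) = conj (m ξ)

lemma IsTest.continuous {η : Plane → ℝ} (h : IsTest η) : Continuous η := h.1.continuous

lemma IsTest.exists_schwartz {η : Plane → ℝ} (h : IsTest η) :
    ∃ S : 𝓢(Plane, ℂ), (S : Plane → ℂ) = fun x => (η x : ℂ) := by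
  have h2 : HasCompactSupport (fun x => (η x : ℂ)) := h.2.comp_left (g := fun r : ℝ => (r : ℂ)) (by simp)
  exact ⟨h2.toSchwartzMap (Complex.ofRealCLM.contDiff.comp h.1), rfl⟩

lemma IsTest.hat_decay {η : Plane → ℝ} (h : IsTest η) (k : ℕ) :
    ∃ C : ℝ, 0 ≤ C ∧ ∀ ξ, (1 + ‖ξ‖) ^ k * ‖hat η ξ‖ ≤ C := by
  obtain ⟨S, hS⟩ := h.exists_schwartz
  have h1 := fun ξ => SchwartzMap.one_add_le_sup_seminorm_apply (𝕜 := ℝ) (m := (k, 0)) le_rfl le_rfl (𝓕 S) ξ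
  have h2 : ((𝓕 S : 𝓢(Plane, ℂ)) : Plane → ℂ) = hat η := by
    rw [SchwartzMap.fourier_coe, hS]; rfl
  have h3 := fun ξ => h1 ξ
  simp only [norm_iteratedFDeriv_zero, h2] at h3
  exact ⟨_, (by positivity : (0 : ℝ) ≤ (1 + ‖(0 : Plane)‖) ^ k * ‖hat η 0‖).trans (h3 0), h3⟩

lemma IsTest.continuous_hat {η : Plane → ℝ} (h : IsTest η) : Continuous (hat η) := by
  obtain ⟨S, hS⟩ := h.exists_schwartz
  have h2 : ((𝓕 S : 𝓢(Plane, ℂ)) : Plane → ℂ) = hat η := by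
    rw [SchwartzMap.fourier_coe, hS]; rfl
  rw [← h2]; exact (𝓕 S).continuous

lemma integrable_of_decay {E : Type*} [NormedAddCommGroup E] {F : Plane → E}
    (hF : AEStronglyMeasurable F volume) {C : ℝ} (h : ∀ ξ, (1 + ‖ξ‖) ^ 3 * ‖F ξ‖ ≤ C) :
    Integrable F := by
  have h3 : Integrable (fun ξ : Plane => C * (1 + ‖ξ‖) ^ (-(3 : ℝ))) :=
    (integrable_one_add_norm (by simp; norm_num)).const_mul C
  refine h3.mono' hF (.of_forall fun ξ => ?_)
  have h0 : 0 < (1 + ‖ξ‖) ^ 3 := by positivity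
  rw [Real.rpow_neg (by positivity), ← div_eq_mul_inv, le_div_iff₀ (by positivity), mul_comm]
  exact_mod_cast h ξ

lemma IsSymb.decay {m : Plane → ℂ} (hm : IsSymb m) {η : Plane → ℝ} (h : IsTest η) (k : ℕ) :
    ∃ C : ℝ, 0 ≤ C ∧ ∀ ξ, (1 + ‖ξ‖) ^ k * ‖m ξ * hat η ξ‖ ≤ C := by
  obtain ⟨C, hC, h1⟩ := hm.bound
  obtain ⟨D, hD, h2⟩ := h.hat_decay (k + 4)
  refine ⟨C * D, by positivity, fun ξ => ?_⟩
  calc (1 + ‖ξ‖) ^ k * ‖m ξ * hat η ξ‖ = (1 + ‖ξ‖) ^ k * (‖m ξ‖ * ‖hat η ξ‖) := by rw [norm_mul]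
    _ ≤ (1 + ‖ξ‖) ^ k * (C * (1 + ‖ξ‖) ^ 4 * ‖hat η ξ‖) := by gcongr; exact h1 ξ
    _ = C * ((1 + ‖ξ‖) ^ (k + 4) * ‖hat η ξ‖) := by ring
    _ ≤ C * D := by gcongr; exact h2 ξ

lemma IsSymb.aesm {m : Plane → ℂ} (hm : IsSymb m) {η : Plane → ℝ} (h : IsTest η) :
    AEStronglyMeasurable (fun ξ => m ξ * hat η ξ) volume :=
  (hm.meas.mul h.continuous_hat.measurable).aestronglyMeasurable

lemma IsSymb.integrable {m : Plane → ℂ} (hm : IsSymb m) {η : Plane → ℝ} (h : IsTest η) :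
    Integrable (fun ξ => m ξ * hat η ξ) := by
  obtain ⟨C, -, hC⟩ := hm.decay h 3
  exact integrable_of_decay (hm.aesm h) hC

lemma memLp_two_of_bound {E : Type*} [NormedAddCommGroup E] {F : Plane → E} (hF : Integrable F)
    {C : ℝ} (h : ∀ ξ, ‖F ξ‖ ≤ C) : MemLp F 2 volume := by
  rw [memLp_two_iff_integrable_sq_norm hF.1]
  refine (hF.norm.const_mul C).mono' (hF.1.norm.pow 2) (.of_forall fun ξ => ?_)
  rw [Real.norm_of_nonneg (by positivity), pow_two]
  gcongr; exact h ξ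

lemma IsSymb.memLp {m : Plane → ℂ} (hm : IsSymb m) {η : Plane → ℝ} (h : IsTest η) :
    MemLp (fun ξ => m ξ * hat η ξ) 2 volume := by
  obtain ⟨C, -, hC⟩ := hm.decay h 0
  exact memLp_two_of_bound (hm.integrable h) (C := C) (by simpa using hC)

lemma hat_neg (η : Plane → ℝ) (ξ : Plane) : hat η (-ξ) = conj (hat η ξ) := by
  simp only [hat, Real.fourier_eq', ← integral_conj]
  congr 1 with x
  simp only [smul_eq_mul, map_mul, conj_ofReal, ← exp_conj, inner_neg_right]
  congr 2
  simp

lemma conj_fourierInv_of_herm {k : Plane → ℂ} (hk : ∀ ξ, k (-ξ) = conj (k ξ)) (x : Plane) :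
    conj (𝓕⁻ k x) = 𝓕⁻ k x := by
  simp only [Real.fourierInv_eq', ← integral_conj]
  rw [← integral_neg_eq_self]
  congr 1 with ξ
  simp only [smul_eq_mul, map_mul, hk, conj_conj, ← exp_conj, inner_neg_left]
  congr 2
  simp [Complex.conj_ofNat]

lemma IsSymb.coe_multiplier {m : Plane → ℂ} (hm : IsSymb m) (η : Plane → ℝ) (x : Plane) :
    (multiplier m η x : ℂ) = 𝓕⁻ (fun ξ => m ξ * hat η ξ) x := by
  have := conj_fourierInv_of_herm (k := fun ξ => m ξ * hat η ξ)
    (fun ξ => by simp [hm.herm, hat_neg]) x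
  exact Complex.conj_eq_iff_re.mp this

/-- The Fourier transform of a square integrable real function. -/
def ft (f : Plane → ℝ) : Plane → ℂ := by
  classical
  exact if h : MemLp (fun x => (f x : ℂ)) 2 volume then
    ((𝓕 (h.toLp _) : Lp ℂ 2 (volume : Measure Plane)) : Plane → ℂ) else 0

lemma memLp_ofReal {f : Plane → ℝ} (hf : MemLp f 2 volume) :
    MemLp (fun x => (f x : ℂ)) 2 volume := hf.ofReal

lemma memLp_ft (f : Plane → ℝ) : MemLp (ft f) 2 volume := by
  unfold ft
  split_ifs with h
  · exact Lp.memLp _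
  · exact MemLp.zero

lemma ft_of_memLp {f : Plane → ℝ} (hf : MemLp f 2 volume) :
    ft f = ((𝓕 ((memLp_ofReal hf).toLp _) : Lp ℂ 2 (volume : Measure Plane)) : Plane → ℂ) := by
  unfold ft
  rw [dif_pos (memLp_ofReal hf)]

lemma parseval {f g : Plane → ℝ} (hf : MemLp f 2 volume) (hg : MemLp g 2 volume) :
    ∫ ξ, ft f ξ * conj (ft g ξ) = ((∫ x, f x * g x : ℝ) : ℂ) := by
  have h := Lp.inner_fourier_eq ((memLp_ofReal hg).toLp _) ((memLp_ofReal hf).toLp _)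
  rw [L2.inner_def, L2.inner_def] at h
  rw [ft_of_memLp hf, ft_of_memLp hg]
  simp only [RCLike.inner_apply] at h
  rw [h, ← integral_complex_ofReal]
  apply integral_congr_ae
  filter_upwards [(memLp_ofReal hg).coeFn_toLp, (memLp_ofReal hf).coeFn_toLp] with x h1 h2
  rw [h1, h2]; simp

lemma integral_norm_ft_sq {f : Plane → ℝ} (hf : MemLp f 2 volume) :
    ∫ ξ, ‖ft f ξ‖ ^ 2 = ∫ x, f x ^ 2 := by
  have h := parseval hf hf
  have h1 : ∀ ξ, ft f ξ * conj (ft f ξ) = ((‖ft f ξ‖ ^ 2 : ℝ) : ℂ) := fun ξ => by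
    rw [Complex.mul_conj, Complex.normSq_eq_norm_sq]
  simp_rw [h1] at h
  rw [integral_complex_ofReal] at h
  have := Complex.ofReal_injective h
  rw [this]; congr 1 with x; ring

lemma integral_fourierInv_mul {k g : Plane → ℂ} (hk : Integrable k) (hg : Integrable g) :
    ∫ x, 𝓕⁻ k x * g x = ∫ ξ, k ξ * 𝓕⁻ g ξ := by
  have h := VectorFourier.integral_fourierIntegral_smul_eq_flip (μ := (volume : Measure Plane))
    (ν := (volume : Measure Plane)) (L := -(innerₗ Plane)) (f := k) (g := g) (e := Real.fourierChar)
    Real.continuous_fourierChar (by simpa using! continuous_inner.neg) hk hg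
  have e1 : 𝓕⁻ k = VectorFourier.fourierIntegral Real.fourierChar volume (-(innerₗ Plane)) k := rfl
  have e2 : 𝓕⁻ g = VectorFourier.fourierIntegral Real.fourierChar volume (-(innerₗ Plane)).flip g := by
    ext x
    simp [Real.fourierInv_eq, VectorFourier.fourierIntegral, real_inner_comm]
  rw [e1, e2]
  exact h

lemma ft_eq_of_fourierInv {k : Plane → ℂ} (hk : Integrable k) (hk2 : MemLp k 2 volume)
    {f : Plane → ℝ} (hf : ∀ x, (f x : ℂ) = 𝓕⁻ k x) : MemLp f 2 volume ∧ ft f =ᵐ[volume] k := by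
  set K : Lp ℂ 2 (volume : Measure Plane) := hk2.toLp k
  set F : Lp ℂ 2 (volume : Measure Plane) := 𝓕⁻ K with hF
  have hcont : Continuous (𝓕⁻ k) := by
    have h := VectorFourier.fourierIntegral_continuous (μ := (volume : Measure Plane))
      (L := -(innerₗ Plane)) (f := k) (e := Real.fourierChar)
      Real.continuous_fourierChar (by simpa using! continuous_inner.neg) hk
    convert h using 1
    ext x
    simp [Real.fourierInv_eq, VectorFourier.fourierIntegral]
  have hae : (F : Plane → ℂ) =ᵐ[volume] 𝓕⁻ k := by
    apply ae_eq_of_integral_contDiff_smul_eq ((Lp.memLp F).locallyIntegrable (by norm_num))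
      hcont.locallyIntegrable
    intro g hg1 hg2
    obtain ⟨S, hS⟩ := IsTest.exists_schwartz (η := g) ⟨hg1, hg2⟩
    have h1 : (F : 𝓢'(Plane, ℂ)) S = (K : 𝓢'(Plane, ℂ)) (𝓕⁻ S) := by
      rw [hF, ← Lp.fourierInv_toTemperedDistribution_eq, TemperedDistribution.fourierInv_apply]
    rw [Lp.toTemperedDistribution_apply, Lp.toTemperedDistribution_apply] at h1
    have h2 : ∫ x, (𝓕⁻ S) x • K x = ∫ x, k x * 𝓕⁻ (S : Plane → ℂ) x := by
      apply integral_congr_ae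
      filter_upwards [hk2.coeFn_toLp] with x hx
      rw [hx, ← SchwartzMap.fourierInv_coe, smul_eq_mul, mul_comm]
    rw [h2, ← integral_fourierInv_mul hk S.integrable] at h1
    simp only [hS, smul_eq_mul] at h1
    simp only [Complex.real_smul]
    rw [h1]
    congr 1 with x; ring
  have hfF : (fun x => (f x : ℂ)) =ᵐ[volume] F := by
    filter_upwards [hae] with x hx
    rw [hx, hf]
  have hfL : MemLp (fun x => (f x : ℂ)) 2 volume := (memLp_congr_ae hfF).mpr (Lp.memLp F)
  have hf2 : MemLp f 2 volume := by simpa using hfL.re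
  refine ⟨hf2, ?_⟩
  rw [ft_of_memLp hf2]
  have : (memLp_ofReal hf2).toLp _ = F := by
    apply Lp.ext
    exact (memLp_ofReal hf2).coeFn_toLp.trans hfF
  rw [this, hF, FourierTransform.fourier_fourierInv_eq]
  exact hk2.coeFn_toLp

lemma IsSymb.memLp_multiplier {m : Plane → ℂ} (hm : IsSymb m) {η : Plane → ℝ} (h : IsTest η) :
    MemLp (multiplier m η) 2 volume :=
  (ft_eq_of_fourierInv (hm.integrable h) (hm.memLp h) (hm.coe_multiplier η)).1

lemma IsSymb.ft_multiplier {m : Plane → ℂ} (hm : IsSymb m) {η : Plane → ℝ} (h : IsTest η) :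
    ft (multiplier m η) =ᵐ[volume] fun ξ => m ξ * hat η ξ :=
  (ft_eq_of_fourierInv (hm.integrable h) (hm.memLp h) (hm.coe_multiplier η)).2

lemma IsSymb.integral_mul {m : Plane → ℂ} (hm : IsSymb m) {η : Plane → ℝ} (h : IsTest η)
    {f : Plane → ℝ} (hf : MemLp f 2 volume) :
    ((∫ x, f x * multiplier m η x : ℝ) : ℂ) = ∫ ξ, ft f ξ * conj (m ξ * hat η ξ) := by
  rw [← parseval hf (hm.memLp_multiplier h)]
  apply integral_congr_ae
  filter_upwards [hm.ft_multiplier h] with ξ hξ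
  rw [hξ]

lemma isSymb_one : IsSymb (fun _ => 1) :=
  ⟨measurable_const, ⟨1, zero_le_one, fun ξ => by
    simp only [norm_one, one_mul]; exact one_le_pow₀ (by linarith [norm_nonneg ξ])⟩, by simp⟩

lemma IsTest.integrable {η : Plane → ℝ} (h : IsTest η) : Integrable η :=
  h.continuous.integrable_of_hasCompactSupport h.2

lemma IsTest.memLp {η : Plane → ℝ} (h : IsTest η) (p : ℝ≥0∞) : MemLp η p volume :=
  h.continuous.memLp_of_hasCompactSupport h.2

lemma IsTest.multiplier_one {η : Plane → ℝ} (h : IsTest η) : multiplier (fun _ => 1) η = η := by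
  have h0 : Integrable (hat η) := by simpa using isSymb_one.integrable h
  ext x
  apply Complex.ofReal_injective
  rw [isSymb_one.coe_multiplier]
  simp only [one_mul]
  have := Continuous.fourierInv_fourier_eq (f := fun y : Plane => (η y : ℂ))
    (Complex.continuous_ofReal.comp h.continuous) h.integrable.ofReal h0
  exact congrFun this x

lemma IsTest.ft_eq {η : Plane → ℝ} (h : IsTest η) : ft η =ᵐ[volume] hat η := by
  have := isSymb_one.ft_multiplier h
  rw [h.multiplier_one] at this
  simpa using this

/-- The partial derivative in the `j`-th direction. -/
def pd (j : Fin 2) (f : Plane → ℝ) (x : Plane) : ℝ := fderiv ℝ f x (EuclideanSpace.single j 1)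

/-- The convolution of a function with a kernel. -/
def cv (h ρ : Plane → ℝ) (x : Plane) : ℝ := ∫ y, h y * ρ (x - y)

/-- The `L²` norm. -/
def n2 (f : Plane → ℝ) : ℝ := Real.sqrt (∫ x, f x ^ 2)

lemma n2_nonneg (f : Plane → ℝ) : 0 ≤ n2 f := Real.sqrt_nonneg _

lemma n2_sq (f : Plane → ℝ) : n2 f ^ 2 = ∫ x, f x ^ 2 :=
  Real.sq_sqrt (integral_nonneg fun _ => sq_nonneg _)

lemma integral_abs_mul_le {f g : Plane → ℝ} (hf : MemLp f 2 volume) (hg : MemLp g 2 volume) :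
    ∫ x, |f x| * |g x| ≤ n2 f * n2 g := by
  have h := integral_mul_norm_le_Lp_mul_Lq (μ := (volume : Measure Plane)) (f := f) (g := g)
    Real.HolderConjugate.two_two (by simpa using hf) (by simpa using hg)
  simpa [n2, Real.sqrt_eq_rpow] using h

lemma abs_integral_mul_le {f g : Plane → ℝ} (hf : MemLp f 2 volume) (hg : MemLp g 2 volume) :
    |∫ x, f x * g x| ≤ n2 f * n2 g := by
  refine (abs_integral_le_integral_abs).trans ?_
  simp_rw [abs_mul]
  exact integral_abs_mul_le hf hg

lemma n2_eq_ft {f : Plane → ℝ} (hf : MemLp f 2 volume) : n2 f ^ 2 = ∫ ξ, ‖ft f ξ‖ ^ 2 := by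
  rw [n2_sq, integral_norm_ft_sq hf]

lemma cv_eq_convolution (h ρ : Plane → ℝ) :
    cv h ρ = convolution h ρ (ContinuousLinearMap.mul ℝ ℝ) volume := by
  ext x; rfl

lemma cv_apply_sub (h ρ : Plane → ℝ) (x : Plane) : cv h ρ x = ∫ z, h (x - z) * ρ z := by
  unfold cv
  rw [← integral_sub_left_eq_self (fun z => h (x - z) * ρ z) volume x]
  simp

lemma cv_comm (h ρ : Plane → ℝ) : cv h ρ = cv ρ h := by
  ext x
  rw [cv_apply_sub, cv]
  simp_rw [mul_comm]

lemma cv_contDiff {h ρ : Plane → ℝ} (hh : LocallyIntegrable h volume) (hρ : IsTest ρ) :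
    ContDiff ℝ ((⊤ : ℕ∞) : WithTop ℕ∞) (cv h ρ) := by
  rw [cv_eq_convolution]
  exact hρ.2.contDiff_convolution_right _ hh hρ.1

lemma IsTest.cv {η ρ : Plane → ℝ} (hη : IsTest η) (hρ : IsTest ρ) : IsTest (cv η ρ) := by
  refine ⟨cv_contDiff hη.integrable.locallyIntegrable hρ, ?_⟩
  rw [cv_eq_convolution]
  exact hη.2.convolution _ hρ.2

lemma IsTest.pd {η : Plane → ℝ} (h : IsTest η) (j : Fin 2) : IsTest (pd j η) := by
  constructor
  · exact (h.1.fderiv_right (m := ((⊤ : ℕ∞) : WithTop ℕ∞)) (by simp)).clm_apply contDiff_const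
  · exact (h.2.fderiv ℝ).comp_left (g := fun L : Plane →L[ℝ] ℝ => L (EuclideanSpace.single j 1)) (by simp)

lemma IsTest.differentiable {η : Plane → ℝ} (h : IsTest η) : Differentiable ℝ η :=
  h.1.differentiable (by simp)

lemma pd_cv {h ρ : Plane → ℝ} (hh : LocallyIntegrable h volume) (hρ : IsTest ρ) (j : Fin 2) :
    pd j (cv h ρ) = cv h (pd j ρ) := by
  ext x
  have h1 := hρ.2.hasFDerivAt_convolution_right (ContinuousLinearMap.mul ℝ ℝ) hh
    (hρ.1.of_le (by exact_mod_cast le_top)) x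
  rw [← cv_eq_convolution] at h1
  unfold pd
  rw [h1.fderiv, convolution_precompR_apply _ hh (hρ.2.fderiv ℝ)
    (hρ.1.continuous_fderiv (by simp))]
  rfl

lemma IsTest.neg_arg {η : Plane → ℝ} (h : IsTest η) : IsTest (fun x => η (-x)) :=
  ⟨h.1.comp contDiff_neg, h.2.comp_homeomorph (Homeomorph.neg Plane)⟩

lemma IsTest.comp_sub {η : Plane → ℝ} (h : IsTest η) (a : Plane) : IsTest (fun x => η (x - a)) :=
  ⟨h.1.comp (contDiff_id.sub contDiff_const), h.2.comp_homeomorph (Homeomorph.subRight a)⟩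

lemma IsTest.sub_comp {η : Plane → ℝ} (h : IsTest η) (a : Plane) : IsTest (fun x => η (a - x)) := by
  have := (h.neg_arg).comp_sub a
  simpa using this

lemma IsTest.mul_contDiff {η f : Plane → ℝ} (h : IsTest η)
    (hf : ContDiff ℝ ((⊤ : ℕ∞) : WithTop ℕ∞) f) : IsTest (fun x => η x * f x) :=
  ⟨h.1.mul hf, h.2.mul_right⟩

lemma hat_comp_sub {η : Plane → ℝ} (a ξ : Plane) :
    hat (fun x => η (x - a)) ξ = cexp (↑(-2 * Real.pi * inner ℝ a ξ) * I) * hat η ξ := by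
  simp only [hat, Real.fourier_eq']
  rw [← integral_add_right_eq_self _ a, ← integral_const_mul]
  congr 1 with x
  simp only [add_sub_cancel_right, smul_eq_mul, ← mul_assoc, ← Complex.exp_add, inner_add_left]
  congr 2
  push_cast; ring

lemma hat_neg_arg {η : Plane → ℝ} (ξ : Plane) : hat (fun x => η (-x)) ξ = conj (hat η ξ) := by
  rw [← hat_neg]
  simp only [hat, Real.fourier_eq']
  rw [← integral_neg_eq_self]
  simp

lemma IsTest.hat_cv {η ρ : Plane → ℝ} (hη : Integrable η) (hρ : Integrable ρ) (ξ : Plane) :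
    hat (SQG.cv η ρ) ξ = hat η ξ * hat ρ ξ := by
  have h := Real.fourier_mul_convolution_eq (R := ℂ) (f₁ := fun x => (η x : ℂ)) (f₂ := fun x => (ρ x : ℂ))
    hη.ofReal hρ.ofReal ξ
  unfold hat
  rw [← h]
  refine congrArg (fun k : Plane → ℂ => 𝓕 k ξ) (funext fun x => ?_)
  simp only [SQG.cv, convolution]
  rw [← integral_complex_ofReal]
  simp

lemma IsTest.hat_pd {η : Plane → ℝ} (h : IsTest η) (j : Fin 2) (ξ : Plane) :
    hat (SQG.pd j η) ξ = I * ((2 * Real.pi * ξ j : ℝ) : ℂ) * hat η ξ := by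
  obtain ⟨S, hS⟩ := h.exists_schwartz
  have h1 := SchwartzMap.fourier_lineDerivOp_eq S (EuclideanSpace.single j (1 : ℝ))
  have h2 := congrArg (fun G : 𝓢(Plane, ℂ) => G ξ) h1
  simp only [SchwartzMap.fourier_coe, smul_apply] at h2
  have e1 : (fun y => ((SQG.pd j η y : ℝ) : ℂ)) =
      (LineDeriv.lineDerivOp (EuclideanSpace.single j (1 : ℝ)) S : 𝓢(Plane, ℂ)) := by
    ext y
    rw [SchwartzMap.lineDerivOp_apply_eq_fderiv, hS]
    have h3 := (Complex.ofRealCLM.hasFDerivAt.comp y (h.differentiable y).hasFDerivAt)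
    have h4 : HasFDerivAt (fun x => (η x : ℂ)) (Complex.ofRealCLM.comp (fderiv ℝ η y)) y := h3
    rw [h4.fderiv]
    rfl
  unfold hat
  rw [e1, h2]
  rw [SchwartzMap.smulLeftCLM_apply_apply (by fun_prop), SchwartzMap.fourier_coe, hS]
  simp only [PiLp.inner_apply, smul_eq_mul, Complex.real_smul]
  simp
  ring

lemma isSymb_pd (j : Fin 2) : IsSymb (fun ξ => I * ((2 * Real.pi * ξ j : ℝ) : ℂ)) := by
  refine ⟨by fun_prop, ⟨2 * Real.pi, by positivity, fun ξ => ?_⟩, fun ξ => by simp [Complex.conj_ofNat]⟩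
  have h1 : |ξ j| ≤ ‖ξ‖ := by simpa using PiLp.norm_apply_le ξ j
  have h2 : ‖ξ‖ ≤ (1 + ‖ξ‖) ^ 4 := by
    calc ‖ξ‖ ≤ (1 + ‖ξ‖) ^ 1 := by linarith
      _ ≤ _ := pow_le_pow_right₀ (by linarith [norm_nonneg ξ]) (by norm_num)
  simp only [norm_mul, norm_I, one_mul, norm_real, Real.norm_eq_abs, abs_two, abs_of_pos Real.pi_pos]
  gcongr; linarith

lemma IsTest.pd_eq_multiplier {η : Plane → ℝ} (h : IsTest η) (j : Fin 2) :
    SQG.pd j η = multiplier (fun ξ => I * ((2 * Real.pi * ξ j : ℝ) : ℂ)) η := by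
  ext x
  apply Complex.ofReal_injective
  rw [(isSymb_pd j).coe_multiplier]
  have h0 := (h.pd j).multiplier_one
  have h1 := isSymb_one.coe_multiplier (SQG.pd j η) x
  rw [h0] at h1
  rw [h1]
  refine congrArg (fun k : Plane → ℂ => 𝓕⁻ k x) (funext fun ξ => ?_)
  rw [h.hat_pd]; ring

lemma multiplier_comp_sub (m : Plane → ℂ) (η : Plane → ℝ) (a x : Plane) :
    multiplier m (fun y => η (y - a)) x = multiplier m η (x - a) := by
  unfold multiplier
  congr 1
  change 𝓕⁻ (fun ξ => m ξ * hat (fun y => η (y - a)) ξ) x = 𝓕⁻ (fun ξ => m ξ * hat η ξ) (x - a)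
  simp only [Real.fourierInv_eq', hat_comp_sub]
  congr 1 with ξ
  simp only [smul_eq_mul]
  rw [show m ξ * (cexp (↑(-2 * Real.pi * inner ℝ a ξ) * I) * hat η ξ) =
    cexp (↑(-2 * Real.pi * inner ℝ a ξ) * I) * (m ξ * hat η ξ) by ring, ← mul_assoc, ← Complex.exp_add]
  congr 2
  rw [inner_sub_right, real_inner_comm a ξ]
  push_cast; ring

/-- Convolving an inverse Fourier transform with an integrable function. -/
lemma integral_mul_fourierInv_sub {P : Plane → ℝ} (hP : Integrable P) {q : Plane → ℂ}
    (hq : Integrable q) (y : Plane) :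
    ∫ x, (P x : ℂ) * 𝓕⁻ q (y - x) = 𝓕⁻ (fun ξ => hat P ξ * q ξ) y := by
  simp only [Real.fourierInv_eq', hat, Real.fourier_eq', smul_eq_mul]
  simp_rw [← integral_const_mul]
  rw [integral_integral_swap]
  · congr 1 with ξ
    rw [← integral_mul_const, ← integral_const_mul]
    congr 1 with x
    rw [show ((P x : ℂ) * (cexp (↑(2 * Real.pi * inner ℝ ξ (y - x)) * I) * q ξ)) =
      cexp (↑(2 * Real.pi * inner ℝ ξ (y - x)) * I) * (P x * q ξ) by ring,
      show cexp (↑(2 * Real.pi * inner ℝ ξ y) * I) * (cexp (↑(-2 * Real.pi * inner ℝ x ξ) * I) * ↑(P x) * q ξ)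
      = cexp (↑(2 * Real.pi * inner ℝ ξ y) * I) * cexp (↑(-2 * Real.pi * inner ℝ x ξ) * I) * (P x * q ξ) by ring,
      ← Complex.exp_add]
    congr 2
    rw [inner_sub_right, real_inner_comm ξ x]
    push_cast; ring
  · have h1 : Integrable (fun p : Plane × Plane => (P p.1 : ℂ) * q p.2) (volume.prod volume) :=
      hP.ofReal.mul_prod hq
    refine h1.mono ?_ (.of_forall fun p => ?_)
    · have : AEStronglyMeasurable (fun p : Plane × Plane =>
          cexp (↑(2 * Real.pi * inner ℝ p.2 (y - p.1)) * I) * ((P p.1 : ℂ) * q p.2)) (volume.prod volume) :=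
        (Continuous.aestronglyMeasurable (by fun_prop)).mul h1.1
      refine this.congr (.of_forall fun p => ?_)
      simp only [Function.uncurry]; ring
    · simp only [Function.uncurry, norm_mul, Complex.norm_exp_ofReal_mul_I, one_mul, le_refl]

lemma cv_multiplier_eq {P : Plane → ℝ} (hP : Integrable P) {m : Plane → ℂ} (hm : IsSymb m)
    {ρ : Plane → ℝ} (hρ : IsTest ρ) (y : Plane) :
    (cv P (multiplier m ρ) y : ℂ) = 𝓕⁻ (fun ξ => hat P ξ * (m ξ * hat ρ ξ)) y := by
  rw [← integral_mul_fourierInv_sub hP (hm.integrable hρ), cv, ← integral_complex_ofReal]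
  congr 1 with x
  rw [Complex.ofReal_mul, hm.coe_multiplier]

lemma multiplier_cv {m : Plane → ℂ} (hm : IsSymb m) {ζ ρ : Plane → ℝ} (hζ : IsTest ζ)
    (hρ : IsTest ρ) : multiplier m (cv ζ ρ) = cv ζ (multiplier m ρ) := by
  ext y
  apply Complex.ofReal_injective
  rw [cv_multiplier_eq hζ.integrable hm hρ, hm.coe_multiplier]
  refine congrArg (fun k : Plane → ℂ => 𝓕⁻ k y) (funext fun ξ => ?_)
  rw [IsTest.hat_cv hζ.integrable hρ.integrable]; ring

lemma lintegral_mul_sq_le {α : Type*} [MeasurableSpace α] {μ : Measure α} {k F : α → ℝ≥0∞}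
    (hk : AEMeasurable k μ) (hF : AEMeasurable F μ) :
    (∫⁻ a, k a * F a ∂μ) ^ 2 ≤ (∫⁻ a, k a ∂μ) * ∫⁻ a, k a * F a ^ 2 ∂μ := by
  have h := ENNReal.lintegral_mul_le_Lp_mul_Lq μ Real.HolderConjugate.two_two
    (f := fun a => k a ^ (1 / 2 : ℝ)) (g := fun a => k a ^ (1 / 2 : ℝ) * F a)
    (hk.pow_const _) ((hk.pow_const _).mul hF)
  have e : ∀ t : ℝ≥0∞, (t ^ (1 / 2 : ℝ)) ^ (2 : ℝ) = t := fun t => by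
    rw [← ENNReal.rpow_mul]; norm_num
  have e2 : ∀ t : ℝ≥0∞, t ^ (1 / 2 : ℝ) * t ^ (1 / 2 : ℝ) = t := fun t => by
    rw [← ENNReal.rpow_add_of_nonneg _ _ (by norm_num) (by norm_num)]; norm_num
  simp only [Pi.mul_apply, ← mul_assoc, e2, ENNReal.mul_rpow_of_nonneg _ _ (zero_le_two : (0 : ℝ) ≤ 2), e] at h
  calc _ ≤ _ := pow_le_pow_left' h 2
    _ = _ := by
      rw [mul_pow]
      simp only [← ENNReal.rpow_natCast, Nat.cast_ofNat, e]

lemma integral_mul_cv {h ζ k : Plane → ℝ} (hh : MemLp h 2 volume) (hζ : Integrable ζ)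
    (hk : Continuous k) (hk2 : MemLp k 2 volume) :
    ∫ y, h y * cv ζ k y = ∫ x, ζ x * ∫ y, h y * k (y - x) := by
  unfold cv
  simp_rw [← integral_const_mul]
  rw [integral_integral_swap]
  · congr 1 with x
    congr 1 with y
    ring
  · have hm : AEStronglyMeasurable (Function.uncurry fun y x : Plane => h y * (ζ x * k (y - x)))
        (volume.prod volume) :=
      hh.1.comp_fst.mul (hζ.1.comp_snd.mul (Continuous.aestronglyMeasurable (by fun_prop)))
    have hkx : ∀ x, MemLp (fun y => k (y - x)) 2 volume := fun x =>
      hk2.comp_measurePreserving (measurePreserving_sub_right volume x)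
    have hn : ∀ x, n2 (fun y => k (y - x)) = n2 k := fun x => by
      unfold n2; rw [integral_sub_right_eq_self (fun y => k y ^ 2) x]
    rw [integrable_prod_iff' hm]
    constructor
    · refine .of_forall fun x => ?_
      have := (hh.integrable_mul (hkx x)).const_mul (ζ x)
      refine this.congr (.of_forall fun y => ?_)
      simp only [Function.uncurry, Pi.mul_apply]; ring
    · refine (hζ.norm.mul_const (n2 h * n2 k)).mono' hm.norm.prod_swap.integral_prod_right' (.of_forall fun x => ?_)
      rw [Real.norm_of_nonneg (integral_nonneg fun _ => norm_nonneg _)]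
      have := integral_abs_mul_le hh (hkx x)
      rw [hn] at this
      calc ∫ y, ‖Function.uncurry (fun y x : Plane => h y * (ζ x * k (y - x))) (y, x)‖
          = ∫ y, ‖ζ x‖ * (|h y| * |k (y - x)|) := by
            congr 1 with y
            simp only [Function.uncurry, norm_mul, Real.norm_eq_abs]; ring
        _ ≤ ‖ζ x‖ * (n2 h * n2 k) := by
            rw [integral_const_mul]; gcongr

lemma lintegral_cv_sq_le {h ρ : Plane → ℝ} (hh : AEStronglyMeasurable h volume)
    (hρ : AEStronglyMeasurable ρ volume) (B : Set Plane) :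
    ∫⁻ x in B, ‖cv h ρ x‖ₑ ^ 2 ≤
      (∫⁻ z, ‖ρ z‖ₑ) * ∫⁻ z, ‖ρ z‖ₑ * ∫⁻ x in B, ‖h (x - z)‖ₑ ^ 2 := by
  have hm : AEMeasurable (fun p : Plane × Plane => ‖h (p.1 - p.2)‖ₑ) (volume.prod volume) :=
    (hh.comp_quasiMeasurePreserving
      (quasiMeasurePreserving_sub_of_right_invariant volume volume)).enorm
  have hm2 : AEMeasurable (fun p : Plane × Plane => ‖h (p.1 - p.2)‖ₑ) ((volume.restrict B).prod volume) := by
    have : ((volume : Measure Plane).restrict B).prod (volume : Measure Plane) =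
        ((volume : Measure Plane).prod volume).restrict (B ×ˢ Set.univ) := by
      rw [← Measure.prod_restrict, Measure.restrict_univ]
    rw [this]; exact hm.restrict
  calc ∫⁻ x in B, ‖cv h ρ x‖ₑ ^ 2
      ≤ ∫⁻ x in B, (∫⁻ z, ‖ρ z‖ₑ * ‖h (x - z)‖ₑ) ^ 2 := by
        gcongr with x
        rw [cv_apply_sub]
        refine (enorm_integral_le_lintegral_enorm _).trans_eq ?_
        simp_rw [enorm_mul, mul_comm]
    _ ≤ ∫⁻ x in B, (∫⁻ z, ‖ρ z‖ₑ) * ∫⁻ z, ‖ρ z‖ₑ * ‖h (x - z)‖ₑ ^ 2 := by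
        gcongr with x
        refine lintegral_mul_sq_le hρ.enorm ?_
        exact (hh.comp_quasiMeasurePreserving
          (quasiMeasurePreserving_sub_left_of_right_invariant volume x)).enorm
    _ = (∫⁻ z, ‖ρ z‖ₑ) * ∫⁻ x in B, ∫⁻ z, ‖ρ z‖ₑ * ‖h (x - z)‖ₑ ^ 2 := by
        rw [lintegral_const_mul'']
        exact (hρ.enorm.comp_snd.mul (hm2.pow_const 2)).lintegral_prod_right'
    _ = (∫⁻ z, ‖ρ z‖ₑ) * ∫⁻ z, ‖ρ z‖ₑ * ∫⁻ x in B, ‖h (x - z)‖ₑ ^ 2 := by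
        rw [lintegral_lintegral_swap (hρ.enorm.comp_snd.mul (hm2.pow_const 2))]
        congr 1
        refine lintegral_congr fun z => ?_
        rw [lintegral_const_mul'']
        exact ((hh.comp_quasiMeasurePreserving
          (measurePreserving_sub_right volume z).quasiMeasurePreserving).enorm.restrict).pow_const 2

lemma lintegral_enorm_eq {ρ : Plane → ℝ} (hρ : Integrable ρ) :
    ∫⁻ z, ‖ρ z‖ₑ = ENNReal.ofReal (∫ z, |ρ z|) := by
  rw [← ofReal_integral_norm_eq_lintegral_enorm hρ]; rfl

lemma lintegral_enorm_sq_eq {f : Plane → ℝ} (hf : MemLp f 2 volume) :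
    ∫⁻ z, ‖f z‖ₑ ^ 2 = ENNReal.ofReal (n2 f ^ 2) := by
  rw [n2_sq, ofReal_integral_eq_lintegral_ofReal hf.integrable_sq (.of_forall fun _ => sq_nonneg _)]
  refine lintegral_congr fun x => ?_
  rw [← ofReal_norm, ← ENNReal.ofReal_pow (norm_nonneg _), Real.norm_eq_abs, sq_abs]

lemma memLp_two_of_lintegral_le {f : Plane → ℝ} (hf : AEStronglyMeasurable f volume) {C : ℝ}
    (hC : 0 ≤ C) (h : ∫⁻ z, ‖f z‖ₑ ^ 2 ≤ ENNReal.ofReal (C ^ 2)) : MemLp f 2 volume ∧ n2 f ≤ C := by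
  have h1 : MemLp f 2 volume := by
    rw [memLp_two_iff_integrable_sq_norm hf]
    refine ⟨hf.norm.pow 2, ?_⟩
    refine lt_of_le_of_lt ?_ (h.trans_lt ENNReal.ofReal_lt_top)
    refine lintegral_mono fun x => ?_
    rw [enorm_pow, enorm_norm]
  refine ⟨h1, ?_⟩
  rw [lintegral_enorm_sq_eq h1, ENNReal.ofReal_le_ofReal_iff (by positivity)] at h
  exact (sq_le_sq₀ (n2_nonneg _) hC).mp h

lemma aestronglyMeasurable_cv {h ρ : Plane → ℝ} (hh : AEStronglyMeasurable h volume)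
    (hρ : AEStronglyMeasurable ρ volume) : AEStronglyMeasurable (cv h ρ) volume := by
  have : AEStronglyMeasurable (fun p : Plane × Plane => h p.2 * ρ (p.1 - p.2)) (volume.prod volume) :=
    hh.comp_snd.mul (hρ.comp_quasiMeasurePreserving
      (quasiMeasurePreserving_sub_of_right_invariant volume volume))
  exact this.integral_prod_right'

lemma memLp_cv_aux {h ρ : Plane → ℝ} (hh : MemLp h 2 volume) (hρ : Integrable ρ) :
    MemLp (cv h ρ) 2 volume ∧ n2 (cv h ρ) ≤ (∫ z, |ρ z|) * n2 h := by
  have h0 : 0 ≤ ∫ z, |ρ z| := integral_nonneg fun _ => abs_nonneg _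
  refine memLp_two_of_lintegral_le (aestronglyMeasurable_cv hh.1 hρ.1)
    (mul_nonneg h0 (n2_nonneg h)) ?_
  have h1 := lintegral_cv_sq_le hh.1 hρ.1 Set.univ
  simp only [Measure.restrict_univ] at h1
  refine h1.trans ?_
  have : ∀ z, ∫⁻ x, ‖h (x - z)‖ₑ ^ 2 = ENNReal.ofReal (n2 h ^ 2) := fun z => by
    rw [lintegral_sub_right_eq_self (fun x => ‖h x‖ₑ ^ 2) z, lintegral_enorm_sq_eq hh]
  simp_rw [this]
  rw [lintegral_mul_const'' _ hρ.1.enorm, lintegral_enorm_eq hρ, ← ENNReal.ofReal_mul h0,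
    ← ENNReal.ofReal_mul h0]
  apply le_of_eq; congr 1; ring

lemma memLp_cv {h ρ : Plane → ℝ} (hh : MemLp h 2 volume) (hρ : Integrable ρ) :
    MemLp (cv h ρ) 2 volume := (memLp_cv_aux hh hρ).1

lemma n2_cv_le {h ρ : Plane → ℝ} (hh : MemLp h 2 volume) (hρ : Integrable ρ) :
    n2 (cv h ρ) ≤ (∫ z, |ρ z|) * n2 h := (memLp_cv_aux hh hρ).2

/-- Mollifiers at scale `δ`. -/
structure IsMoll (G δ : ℝ) (ρ : Plane → ℝ) : Prop where
  test : IsTest ρ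
  nonneg : ∀ x, 0 ≤ ρ x
  even : ∀ x, ρ (-x) = ρ x
  supp : ∀ x, ρ x ≠ 0 → ‖x‖ ≤ δ
  int : ∫ x, ρ x = 1
  grad : ∀ j, ∫ x, |pd j ρ x| ≤ G / δ

lemma exists_isMoll : ∃ G : ℝ, 0 ≤ G ∧ ∀ δ : ℝ, 0 < δ → ∃ ρ, IsMoll G δ ρ := by
  let b : ContDiffBump (0 : Plane) := ⟨1 / 2, 1, by norm_num, by norm_num⟩
  let r : Plane → ℝ := b.normed volume
  have hr : IsTest r := ⟨b.contDiff_normed, b.hasCompactSupport_normed⟩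
  have hint : ∀ (δ : ℝ), 0 < δ → ∀ f : Plane → ℝ, ∫ x, (δ ^ 2)⁻¹ * f (δ⁻¹ • x) = ∫ x, f x := by
    intro δ hδ f
    rw [integral_const_mul, Measure.integral_comp_inv_smul]
    simp only [finrank_euclideanSpace, Fintype.card_fin, abs_of_pos (pow_pos hδ 2), smul_eq_mul]
    rw [← mul_assoc, inv_mul_cancel₀ (by positivity), one_mul]
  refine ⟨∑ j, ∫ x, |pd j r x|, Finset.sum_nonneg fun j _ => integral_nonneg fun _ => abs_nonneg _,
    fun δ hδ => ⟨fun x => (δ ^ 2)⁻¹ * r (δ⁻¹ • x), ?_, fun x => ?_, fun x => ?_, fun x hx => ?_, ?_, fun j => ?_⟩⟩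
  · refine ⟨contDiff_const.mul (hr.1.comp (contDiff_const_smul _)), ?_⟩
    refine HasCompactSupport.mul_left ?_
    exact hr.2.comp_homeomorph (Homeomorph.smulOfNeZero δ⁻¹ (by positivity))
  · have := b.nonneg_normed (μ := volume) (δ⁻¹ • x)
    positivity
  · simp only [smul_neg, r, b.normed_neg]
  · have h1 : r (δ⁻¹ • x) ≠ 0 := fun h => hx (by simp [h])
    have h2 : δ⁻¹ • x ∈ Function.support r := h1
    rw [b.support_normed_eq] at h2
    simp only [Metric.mem_ball, dist_zero_right, norm_smul, norm_inv, Real.norm_eq_abs, abs_of_pos hδ, b] at h2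
    rw [inv_mul_lt_iff₀ hδ] at h2
    linarith
  · rw [hint δ hδ r]; exact b.integral_normed
  · have h1 : ∀ x, pd j (fun x => (δ ^ 2)⁻¹ * r (δ⁻¹ • x)) x = δ⁻¹ * ((δ ^ 2)⁻¹ * pd j r (δ⁻¹ • x)) := by
      intro x
      have h2 : HasFDerivAt (fun x : Plane => r (δ⁻¹ • x))
          ((fderiv ℝ r (δ⁻¹ • x)).comp (δ⁻¹ • ContinuousLinearMap.id ℝ Plane)) x :=
        (hr.differentiable (δ⁻¹ • x)).hasFDerivAt.comp x ((hasFDerivAt_id x).const_smul δ⁻¹)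
      unfold pd
      rw [(h2.const_mul _).fderiv]
      simp; ring
    simp_rw [h1, abs_mul, abs_of_pos (inv_pos.mpr hδ), abs_of_pos (inv_pos.mpr (pow_pos hδ 2))]
    rw [integral_const_mul, hint δ hδ (fun x => |pd j r x|), div_eq_inv_mul]
    gcongr
    exact Finset.single_le_sum (f := fun j => ∫ x, |pd j r x|) (fun j _ => integral_nonneg fun _ => abs_nonneg _) (Finset.mem_univ j)

lemma IsMoll.integral_abs {G δ : ℝ} {ρ : Plane → ℝ} (h : IsMoll G δ ρ) : ∫ x, |ρ x| = 1 := by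
  rw [← h.int]; congr 1 with x; exact abs_of_nonneg (h.nonneg x)

lemma IsMoll.norm_hat_le {G δ : ℝ} {ρ : Plane → ℝ} (h : IsMoll G δ ρ) (ξ : Plane) : ‖hat ρ ξ‖ ≤ 1 := by
  rw [← h.integral_abs, hat, Real.fourier_eq']
  refine (norm_integral_le_integral_norm _).trans_eq ?_
  congr 1 with x
  rw [norm_smul, Complex.norm_exp_ofReal_mul_I, one_mul, norm_real, Real.norm_eq_abs]

lemma IsMoll.norm_hat_sub_one_le {G δ : ℝ} {ρ : Plane → ℝ} (h : IsMoll G δ ρ) (ξ : Plane) :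
    ‖hat ρ ξ - 1‖ ≤ 2 * Real.pi * δ * ‖ξ‖ := by
  have h1 : hat ρ ξ - 1 = ∫ x, (cexp (↑(-2 * Real.pi * inner ℝ x ξ) * I) - 1) * (ρ x : ℂ) := by
    have : (1 : ℂ) = ∫ x, (ρ x : ℂ) := by rw [integral_complex_ofReal, h.int]; simp
    rw [hat, Real.fourier_eq']
    simp_rw [sub_mul, one_mul, smul_eq_mul]
    rw [integral_sub, ← this]
    · have : Integrable (fun x => cexp (↑(-2 * Real.pi * inner ℝ x ξ) * I) * (ρ x : ℂ)) :=
        h.test.integrable.ofReal.bdd_mul (c := 1)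
          (Continuous.aestronglyMeasurable (by fun_prop)) (.of_forall fun x => by rw [Complex.norm_exp_ofReal_mul_I])
      exact this
    · exact h.test.integrable.ofReal
  rw [h1]
  calc _ ≤ ∫ x, ‖(cexp (↑(-2 * Real.pi * inner ℝ x ξ) * I) - 1) * (ρ x : ℂ)‖ := norm_integral_le_integral_norm _
    _ ≤ ∫ x, (2 * Real.pi * δ * ‖ξ‖) * ρ x := by
      apply integral_mono_of_nonneg (.of_forall fun _ => norm_nonneg _) (h.test.integrable.const_mul _)
      refine .of_forall fun x => ?_
      simp only [norm_mul, norm_real, Real.norm_eq_abs, abs_of_nonneg (h.nonneg x)]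
      by_cases hx : ρ x = 0
      · simp [hx]
      have h2 := h.supp x hx
      have h3 := h.nonneg x
      gcongr
      rw [mul_comm _ I]
      refine (Real.norm_exp_I_mul_ofReal_sub_one_le).trans ?_
      rw [Real.norm_eq_abs, abs_mul, abs_mul, abs_of_pos Real.pi_pos]
      have h4 := abs_real_inner_le_norm x ξ
      calc |(-2 : ℝ)| * Real.pi * |inner ℝ x ξ| ≤ 2 * Real.pi * (‖x‖ * ‖ξ‖) := by
            rw [abs_neg, abs_two]; gcongr
        _ ≤ 2 * Real.pi * (δ * ‖ξ‖) := by gcongr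
        _ = _ := by ring
    _ = _ := by rw [integral_const_mul, h.int, mul_one]

/-- An integrable function whose inverse Fourier transform vanishes is null. -/
lemma ae_eq_zero_of_fourierInv {k : Plane → ℂ} (hk : Integrable k) (h : ∀ x, 𝓕⁻ k x = 0) :
    k =ᵐ[volume] 0 := by
  apply ae_eq_zero_of_integral_contDiff_smul_eq_zero hk.locallyIntegrable
  intro g hg1 hg2
  obtain ⟨S, hS⟩ := IsTest.exists_schwartz (η := g) ⟨hg1, hg2⟩
  have h1 := integral_fourierInv_mul hk (𝓕 S).integrable
  have h2 : 𝓕⁻ ((𝓕 S : 𝓢(Plane, ℂ)) : Plane → ℂ) = fun x => (g x : ℂ) := by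
    rw [← SchwartzMap.fourierInv_coe, FourierTransform.fourierInv_fourier_eq, hS]
  rw [h2] at h1
  simp only [h, zero_mul, integral_zero] at h1
  rw [h1]
  congr 1 with x
  rw [Complex.real_smul, mul_comm]

/-- Uniqueness for distributions whose Fourier transforms are functions. -/
lemma ae_eq_zero_of_integral_hat {H : Plane → ℂ}
    (hi : ∀ η, IsTest η → Integrable (fun ξ => H ξ * conj (hat η ξ)))
    (h : ∀ η, IsTest η → ∫ ξ, H ξ * conj (hat η ξ) = 0) : H =ᵐ[volume] 0 := by
  have key : ∀ η, IsTest η → ∀ᵐ ξ, H ξ * conj (hat η ξ) = 0 := by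
    intro η hη
    refine ae_eq_zero_of_fourierInv (hi η hη) fun x => ?_
    rw [← h _ (hη.comp_sub x), Real.fourierInv_eq']
    congr 1 with ξ
    rw [hat_comp_sub, map_mul, smul_eq_mul, ← Complex.exp_conj, real_inner_comm]
    simp only [map_mul, conj_ofReal, conj_I]
    rw [show ((-2 * Real.pi * inner ℝ x ξ : ℝ) : ℂ) * -I = ((2 * Real.pi * inner ℝ x ξ : ℝ) : ℂ) * I by push_cast; ring]
    ring
  obtain ⟨G, -, hG⟩ := exists_isMoll
  choose ρ hρ using fun n : ℕ => hG (1 / ((n : ℝ) + 1)) (by positivity)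
  have h2 : ∀ᵐ ξ, ∀ n, H ξ * conj (hat (ρ n) ξ) = 0 := ae_all_iff.mpr fun n => key _ (hρ n).test
  filter_upwards [h2] with ξ hξ
  have h3 : Tendsto (fun n : ℕ => 2 * Real.pi * (1 / ((n : ℝ) + 1)) * ‖ξ‖) atTop (𝓝 (2 * Real.pi * 0 * ‖ξ‖)) :=
    (tendsto_one_div_add_atTop_nhds_zero_nat.const_mul _).mul_const _
  rw [mul_zero, zero_mul] at h3
  obtain ⟨n, hn⟩ := (h3.eventually_lt_const (u := 1) zero_lt_one).exists
  have h4 := (hρ n).norm_hat_sub_one_le ξ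
  have h5 : hat (ρ n) ξ ≠ 0 := fun h0 => by
    rw [h0] at h4; simp at h4; simp at hn; linarith
  have := hξ n
  simpa [h5] using this

lemma ft_unique {f : Plane → ℝ} (hf : MemLp f 2 volume) {H : Plane → ℂ}
    (hi : ∀ η, IsTest η → Integrable (fun ξ => H ξ * conj (hat η ξ)))
    (h : ∀ η, IsTest η → ((∫ x, f x * η x : ℝ) : ℂ) = ∫ ξ, H ξ * conj (hat η ξ)) :
    ft f =ᵐ[volume] H := by
  have h1 : ∀ η, IsTest η → Integrable (fun ξ => ft f ξ * conj (hat η ξ)) := fun η hη => by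
    have := isSymb_one.memLp hη
    simp only [one_mul] at this
    exact (memLp_ft f).integrable_mul this.star
  have := ae_eq_zero_of_integral_hat (H := fun ξ => ft f ξ - H ξ)
    (fun η hη => by simp_rw [sub_mul]; exact (h1 η hη).sub (hi η hη))
    (fun η hη => by
      simp_rw [sub_mul]
      rw [integral_sub (h1 η hη) (hi η hη), ← h η hη]
      have := isSymb_one.integral_mul hη hf
      rw [hη.multiplier_one] at this
      simp only [one_mul] at this
      rw [this, sub_self])
  filter_upwards [this] with ξ hξ
  simpa [sub_eq_zero] using hξ

lemma integrable_ft_mul {f : Plane → ℝ} {m : Plane → ℂ} (hm : IsSymb m) {η : Plane → ℝ}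
    (hη : IsTest η) : Integrable (fun ξ => ft f ξ * conj (m ξ * hat η ξ)) :=
  (memLp_ft f).integrable_mul (hm.memLp hη).star

lemma ft_of_multiplier {f g : Plane → ℝ} (hf : MemLp f 2 volume) (hg : MemLp g 2 volume)
    {m : Plane → ℂ} (hm : IsSymb m)
    (h : ∀ η, IsTest η → ∫ x, g x * η x = ∫ x, f x * multiplier m η x) :
    ft g =ᵐ[volume] fun ξ => conj (m ξ) * ft f ξ := by
  refine ft_unique hg (fun η hη => ?_) (fun η hη => ?_)
  · refine (integrable_ft_mul hm hη (f := f)).congr (.of_forall fun ξ => ?_)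
    simp only [map_mul]; ring
  · rw [h η hη, hm.integral_mul hη hf]
    congr 1 with ξ
    simp only [map_mul]; ring

lemma integral_ft_mul_hat {f η : Plane → ℝ} (hf : MemLp f 2 volume) (hη : IsTest η) :
    ((∫ x, f x * η x : ℝ) : ℂ) = ∫ ξ, ft f ξ * conj (hat η ξ) := by
  have := isSymb_one.integral_mul hη hf
  rw [hη.multiplier_one] at this
  simpa only [one_mul] using this

lemma memLp_fun_sub {f g : Plane → ℝ} {p : ℝ≥0∞} (hf : MemLp f p volume) (hg : MemLp g p volume) :
    MemLp (fun x => f x - g x) p volume := hf.sub hg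

lemma ft_sub {f g : Plane → ℝ} (hf : MemLp f 2 volume) (hg : MemLp g 2 volume) :
    ft (fun x => f x - g x) =ᵐ[volume] fun ξ => ft f ξ - ft g ξ := by
  have hi := fun (f : Plane → ℝ) (η : Plane → ℝ) (hη : IsTest η) =>
    (by simpa only [one_mul] using integrable_ft_mul (f := f) isSymb_one hη :
      Integrable (fun ξ => ft f ξ * conj (hat η ξ)))
  refine ft_unique (memLp_fun_sub hf hg) (fun η hη => ?_) (fun η hη => ?_)
  · simp_rw [sub_mul]; exact (hi f η hη).sub (hi g η hη)
  · have h1 : Integrable (fun x => f x * η x) := hf.integrable_mul (hη.memLp 2)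
    have h2 : Integrable (fun x => g x * η x) := hg.integrable_mul (hη.memLp 2)
    simp_rw [sub_mul]
    rw [integral_sub (hi f η hη) (hi g η hη), integral_sub h1 h2, Complex.ofReal_sub, integral_ft_mul_hat hf hη,
      integral_ft_mul_hat hg hη]

lemma integral_cv_mul {f ρ η : Plane → ℝ} (hf : MemLp f 2 volume) (hρ : Continuous ρ)
    (hρ2 : MemLp ρ 2 volume) (hη : Integrable η) :
    ∫ x, cv f ρ x * η x = ∫ y, f y * cv η (fun z => ρ (-z)) y := by
  have hk2 : MemLp (fun z => ρ (-z)) 2 volume := hρ2.comp_measurePreserving (Measure.measurePreserving_neg volume)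
  have hk1 : Continuous (fun z => ρ (-z)) := hρ.comp continuous_neg
  rw [integral_mul_cv hf hη hk1 hk2]
  congr 1 with x
  simp only [cv, neg_sub]
  ring

lemma ft_cv {f ρ : Plane → ℝ} (hf : MemLp f 2 volume) (hρ : IsTest ρ) :
    ft (cv f ρ) =ᵐ[volume] fun ξ => hat ρ ξ * ft f ξ := by
  have e : ∀ η, IsTest η → ∀ ξ, hat ρ ξ * ft f ξ * conj (hat η ξ) =
      ft f ξ * conj (1 * hat (cv η (fun z => ρ (-z))) ξ) := fun η hη ξ => by
    rw [IsTest.hat_cv hη.integrable hρ.neg_arg.integrable, hat_neg_arg]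
    simp only [one_mul, map_mul, conj_conj]; ring
  refine ft_unique (memLp_cv hf hρ.integrable) (fun η hη => ?_) (fun η hη => ?_)
  · simp_rw [e η hη]
    exact integrable_ft_mul isSymb_one (hη.cv hρ.neg_arg)
  · simp_rw [e η hη]
    rw [integral_cv_mul hf hρ.continuous (hρ.memLp 2) hη.integrable,
      integral_ft_mul_hat hf (hη.cv hρ.neg_arg)]
    simp

/-- A sequence of mollifiers with scale tending to zero. -/
structure IsMollSeq (G : ℝ) (δ : ℕ → ℝ) (ρ : ℕ → Plane → ℝ) : Prop where
  pos : ∀ n, 0 < δ n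
  le_one : ∀ n, δ n ≤ 1
  moll : ∀ n, IsMoll G (δ n) (ρ n)
  lim : Tendsto δ atTop (𝓝 0)

lemma exists_isMollSeq : ∃ G δ ρ, 0 ≤ G ∧ IsMollSeq G δ ρ := by
  obtain ⟨G, hG0, hG⟩ := exists_isMoll
  choose ρ hρ using fun n : ℕ => hG (1 / ((n : ℝ) + 1)) (by positivity)
  refine ⟨G, _, ρ, hG0, fun n => by positivity, fun n => ?_, hρ, tendsto_one_div_add_atTop_nhds_zero_nat⟩
  rw [div_le_one (by positivity)]; linarith [(Nat.cast_nonneg n : (0 : ℝ) ≤ n)]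

lemma IsMollSeq.tendsto_hat {G : ℝ} {δ : ℕ → ℝ} {ρ : ℕ → Plane → ℝ} (h : IsMollSeq G δ ρ) (ξ : Plane) :
    Tendsto (fun n => hat (ρ n) ξ) atTop (𝓝 1) := by
  rw [tendsto_iff_norm_sub_tendsto_zero]
  have h3 : Tendsto (fun n => 2 * Real.pi * δ n * ‖ξ‖) atTop (𝓝 (2 * Real.pi * 0 * ‖ξ‖)) :=
    (h.lim.const_mul _).mul_const _
  rw [mul_zero, zero_mul] at h3
  exact squeeze_zero (fun _ => norm_nonneg _) (fun n => (h.moll n).norm_hat_sub_one_le ξ) h3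

lemma IsMollSeq.tendsto_cv {G : ℝ} {δ : ℕ → ℝ} {ρ : ℕ → Plane → ℝ} (h : IsMollSeq G δ ρ)
    {f : Plane → ℝ} (hf : MemLp f 2 volume) :
    Tendsto (fun n => n2 (fun x => cv f (ρ n) x - f x)) atTop (𝓝 0) := by
  have h0 : ∀ n, n2 (fun x => cv f (ρ n) x - f x) ^ 2 = ∫ ξ, ‖hat (ρ n) ξ - 1‖ ^ 2 * ‖ft f ξ‖ ^ 2 := by
    intro n
    have hc := memLp_cv hf (h.moll n).test.integrable
    rw [n2_eq_ft (memLp_fun_sub hc hf)]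
    apply integral_congr_ae
    filter_upwards [ft_sub hc hf, ft_cv hf (h.moll n).test] with ξ h1 h2
    rw [h1, h2, ← mul_pow, ← norm_mul]; ring_nf
  have h1 : Tendsto (fun n => ∫ ξ, ‖hat (ρ n) ξ - 1‖ ^ 2 * ‖ft f ξ‖ ^ 2) atTop (𝓝 (∫ ξ : Plane, (0 : ℝ))) := by
    have hI : Integrable (fun ξ => ‖ft f ξ‖ ^ 2) := (memLp_two_iff_integrable_sq_norm (memLp_ft f).1).mp (memLp_ft f)
    refine tendsto_integral_of_dominated_convergence (fun ξ => 4 * ‖ft f ξ‖ ^ 2) (fun n => ?_) (hI.const_mul 4)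
      (fun n => .of_forall fun ξ => ?_) (.of_forall fun ξ => ?_)
    · exact (((h.moll n).test.continuous_hat.sub continuous_const).norm.pow 2).aestronglyMeasurable.mul hI.1
    · rw [Real.norm_of_nonneg (by positivity)]
      gcongr
      have : ‖hat (ρ n) ξ - 1‖ ≤ 2 := (norm_sub_le _ _).trans (by
        have := (h.moll n).norm_hat_le ξ
        rw [norm_one]; linarith)
      calc _ ≤ (2 : ℝ) ^ 2 := by gcongr
        _ = 4 := by norm_num
    · have := (((h.tendsto_hat ξ).sub_const 1).norm.pow 2).mul_const (‖ft f ξ‖ ^ 2)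
      simpa using this
  rw [integral_zero] at h1
  simp_rw [← h0] at h1
  have := h1.sqrt
  simpa [Real.sqrt_sq (n2_nonneg _)] using this

/-! ### The singular kernel of the fractional Laplacian -/

/-- The kernel `|z|^(-2-σ)`, truncated near the origin by a factor `|z|^a`. -/
def krn (a σ : ℝ) (z : Plane) : ℝ := (min 1 ‖z‖) ^ a * ‖z‖ ^ (-2 - σ)

lemma krn_nonneg (a σ : ℝ) (z : Plane) : 0 ≤ krn a σ z := by unfold krn; positivity

lemma integrable_krn {a σ : ℝ} (hσ : 0 < σ) (ha : σ < a) : Integrable (krn a σ) := by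
  unfold krn
  rw [integrable_fun_norm_addHaar (μ := (volume : Measure Plane)) (f := fun y => (min 1 y) ^ a * y ^ (-2 - σ))]
  simp only [finrank_euclideanSpace, Fintype.card_fin, smul_eq_mul, Nat.add_one_sub_one, pow_one]
  rw [← Set.Ioc_union_Ioi_eq_Ioi (zero_le_one : (0 : ℝ) ≤ 1)]
  apply IntegrableOn.union
  · have h1 : IntegrableOn (fun y : ℝ => y ^ (a - 1 - σ)) (Set.Ioc 0 1) := by
      rw [← intervalIntegrable_iff_integrableOn_Ioc_of_le zero_le_one]
      exact intervalIntegral.intervalIntegrable_rpow' (by linarith)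
    refine h1.congr_fun (fun y hy => ?_) measurableSet_Ioc
    simp only
    rw [min_eq_right hy.2, ← Real.rpow_add hy.1,
      show a - 1 - σ = 1 + (a + (-2 - σ)) by ring, Real.rpow_add hy.1, Real.rpow_one]
  · have h1 : IntegrableOn (fun y : ℝ => y ^ (-1 - σ)) (Set.Ioi 1) :=
      integrableOn_Ioi_rpow_of_lt (by linarith) zero_lt_one
    refine h1.congr_fun (fun y hy => ?_) measurableSet_Ioi
    have hy1 : (1 : ℝ) < y := hy
    simp only
    rw [min_eq_left hy1.le, Real.one_rpow, one_mul, ← Real.rpow_one_add' (by linarith) (by linarith)]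
    congr 1; ring

/-- The function whose integral defines the normalizing constant. -/
def phase (σ : ℝ) (ξ z : Plane) : ℝ := (2 - 2 * Real.cos (inner ℝ z ξ)) * ‖z‖ ^ (-2 - σ)

lemma phase_nonneg (σ : ℝ) (ξ z : Plane) : 0 ≤ phase σ ξ z := by
  have := Real.cos_le_one (inner ℝ z ξ)
  exact mul_nonneg (by linarith) (by positivity)

lemma integrable_phase {σ : ℝ} (hσ : 0 < σ) (hσ2 : σ < 2) (ξ : Plane) : Integrable (phase σ ξ) := by
  refine ((integrable_krn hσ hσ2).const_mul (4 + ‖ξ‖ ^ 2)).mono' ?_ (.of_forall fun z => ?_)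
  · unfold phase; exact Measurable.aestronglyMeasurable (by fun_prop)
  · rw [Real.norm_of_nonneg (phase_nonneg _ _ _), phase, krn, ← mul_assoc]
    gcongr
    have h1 := Real.one_sub_sq_div_two_le_cos (x := inner ℝ z ξ)
    have h2 := Real.neg_one_le_cos (inner ℝ z ξ)
    have h3 := abs_real_inner_le_norm z ξ
    have h4 : (inner ℝ z ξ) ^ 2 ≤ ‖z‖ ^ 2 * ‖ξ‖ ^ 2 := by
      rw [← sq_abs, ← mul_pow]; gcongr
    rw [Real.rpow_two]
    rcases le_total 1 ‖z‖ with h | h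
    · rw [min_eq_left h]; nlinarith [sq_nonneg ‖ξ‖]
    · rw [min_eq_right h]; nlinarith [sq_nonneg ‖z‖]

/-- The normalizing constant of the singular integral. -/
def kcon (σ : ℝ) : ℝ := ∫ z, phase σ (EuclideanSpace.single 0 1) z

lemma integral_phase {σ : ℝ} (hσ : 0 < σ) (ξ : Plane) :
    ∫ z, phase σ ξ z = kcon σ * ‖ξ‖ ^ σ := by
  rcases eq_or_ne ξ 0 with rfl | hξ
  · simp [phase, Real.zero_rpow hσ.ne']
  have hp : 0 < ‖ξ‖ := norm_pos_iff.mpr hξ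
  set e : Plane := EuclideanSpace.single 0 1
  set ω : Plane := ‖ξ‖⁻¹ • ξ
  have hω : ‖ω‖ = ‖e‖ := by
    simp [ω, e, norm_smul, hp.ne']
  have h1 : ∫ z, phase σ ω z = kcon σ := by
    set A := (ℝ ∙ (ω - e))ᗮ.reflection
    have hA : A ω = e := Submodule.reflection_sub hω
    have h2 := A.measurePreserving.integral_comp A.toHomeomorph.measurableEmbedding (phase σ e)
    rw [kcon, ← h2]
    congr 1 with z
    unfold phase
    have : inner ℝ z ω = inner ℝ (A z) e := by rw [← hA, A.inner_map_map]
    rw [this, A.norm_map]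
  have h2 := Measure.integral_comp_smul (volume : Measure Plane) (phase σ ω) ‖ξ‖
  have h3 : ∀ z, phase σ ω (‖ξ‖ • z) = ‖ξ‖ ^ (-2 - σ) * phase σ ξ z := by
    intro z
    have h4 : inner ℝ (‖ξ‖ • z) ω = inner ℝ z ξ := by
      simp only [ω, inner_smul_left, inner_smul_right, conj_trivial]
      field_simp
    unfold phase
    rw [h4, norm_smul, norm_norm, Real.mul_rpow (norm_nonneg _) (norm_nonneg _)]; ring
  simp_rw [h3] at h2
  rw [integral_const_mul, h1] at h2
  simp only [finrank_euclideanSpace, Fintype.card_fin, smul_eq_mul] at h2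
  rw [abs_of_pos (by positivity)] at h2
  have h5 : ‖ξ‖ ^ (-2 - σ) = (‖ξ‖ ^ 2)⁻¹ * (‖ξ‖ ^ σ)⁻¹ := by
    rw [← Real.rpow_natCast, ← Real.rpow_neg hp.le, ← Real.rpow_neg hp.le, ← Real.rpow_add hp]
    congr 1
  rw [h5] at h2
  have h6 : 0 < ‖ξ‖ ^ σ := by positivity
  field_simp at h2
  linarith

lemma kcon_pos {σ : ℝ} (hσ : 0 < σ) (hσ2 : σ < 2) : 0 < kcon σ := by
  unfold kcon
  rw [integral_pos_iff_support_of_nonneg (fun z => phase_nonneg _ _ z) (integrable_phase hσ hσ2 _)]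
  set U : Set Plane := {z | 0 < z 0 ∧ z 0 < 1}
  have hU : IsOpen U := by
    apply IsOpen.inter
    · exact isOpen_lt (g := fun z : Plane => z 0) continuous_const (by fun_prop)
    · exact isOpen_lt (f := fun z : Plane => z 0) (by fun_prop) continuous_const
  have hne : U.Nonempty := ⟨EuclideanSpace.single 0 (1 / 2), by simp [U]; norm_num⟩
  refine (hU.measure_pos volume hne).trans_le (measure_mono fun z hz => ?_)
  have h1 : inner ℝ z (EuclideanSpace.single 0 (1 : ℝ)) = z 0 := by
    rw [PiLp.inner_apply, Fin.sum_univ_two]; simp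
  have h2 : Real.cos (z 0) < 1 := by
    have := Real.cos_lt_cos_of_nonneg_of_le_pi (x := 0) (y := z 0) le_rfl (by linarith [hz.2, Real.pi_gt_three]) hz.1
    simpa using this
  have h3 : z ≠ 0 := fun h => by rw [h] at hz; simp [U] at hz
  have h4 : 0 < ‖z‖ := norm_pos_iff.mpr h3
  simp only [Function.mem_support, phase, h1]
  have : 0 < ‖z‖ ^ (-2 - σ) := by positivity
  exact (mul_pos (by linarith) this).ne'

/-- Symmetric second differences. -/
def d2 (η : Plane → ℝ) (z x : Plane) : ℝ := 2 * η x - η (x + z) - η (x - z)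

lemma norm_sq_le_pow {x : ℝ} (hx : 0 ≤ x) {σ : ℝ} (h0 : 0 ≤ σ) (h4 : σ ≤ 4) : x ^ σ ≤ (1 + x) ^ 4 := by
  calc x ^ σ ≤ (1 + x) ^ σ := Real.rpow_le_rpow hx (by linarith) h0
    _ ≤ (1 + x) ^ (4 : ℝ) := Real.rpow_le_rpow_of_exponent_le (by linarith) h4
    _ = (1 + x) ^ 4 := by norm_cast

/-- The symbol of `Λ^σ`. -/
def lamS (σ : ℝ) (ξ : Plane) : ℂ := (((2 * Real.pi * ‖ξ‖) ^ σ : ℝ) : ℂ)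

lemma isSymb_lamS {σ : ℝ} (h0 : 0 ≤ σ) (h4 : σ ≤ 4) : IsSymb (lamS σ) := by
  unfold lamS
  refine ⟨by fun_prop, ⟨(2 * Real.pi) ^ σ, by positivity, fun ξ => ?_⟩, fun ξ => by simp⟩
  rw [norm_real, Real.norm_of_nonneg (by positivity), Real.mul_rpow (by positivity) (norm_nonneg _)]
  gcongr
  exact norm_sq_le_pow (norm_nonneg _) h0 h4

lemma fracLapTest_eq (σ : ℝ) : fracLapTest σ = multiplier (lamS σ) := rfl

lemma conj_lamS (σ : ℝ) (ξ : Plane) : conj (lamS σ ξ) = lamS σ ξ := by simp [lamS]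

lemma IsTest.d2_eq {η : Plane → ℝ} (h : IsTest η) (z x : Plane) :
    (d2 η z x : ℂ) = ∫ ξ, cexp (↑(2 * Real.pi * inner ℝ ξ x) * I) * hat η ξ *
      ((2 - 2 * Real.cos (inner ℝ z ((2 * Real.pi) • ξ)) : ℝ) : ℂ) := by
  have h0 : Integrable (hat η) := by simpa using isSymb_one.integrable h
  have h1 : ∀ y, (η y : ℂ) = ∫ ξ, cexp (↑(2 * Real.pi * inner ℝ ξ y) * I) * hat η ξ := fun y => by
    have := isSymb_one.coe_multiplier η y
    rw [h.multiplier_one] at this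
    rw [this, Real.fourierInv_eq']
    simp
  have h2 : ∀ y, Integrable fun ξ => cexp (↑(2 * Real.pi * inner ℝ ξ y) * I) * hat η ξ := fun y =>
    h0.bdd_mul (c := 1) (Continuous.aestronglyMeasurable (by fun_prop))
      (.of_forall fun x => by rw [Complex.norm_exp_ofReal_mul_I])
  have h3 : (d2 η z x : ℂ) = 2 * η x - η (x + z) - η (x - z) := by simp [d2]
  rw [h3, h1 x, h1 (x + z), h1 (x - z), ← integral_const_mul, ← integral_sub ((h2 _).const_mul _) (h2 _)]
  have h5 : Integrable fun ξ => 2 * (cexp (↑(2 * Real.pi * inner ℝ ξ x) * I) * hat η ξ) -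
      cexp (↑(2 * Real.pi * inner ℝ ξ (x + z)) * I) * hat η ξ := ((h2 _).const_mul _).sub (h2 _)
  rw [← integral_sub h5 (h2 _)]
  congr 1 with ξ
  rw [inner_add_right, inner_sub_right, mul_add, mul_sub]
  push_cast
  rw [Complex.cos, add_mul, sub_mul, Complex.exp_add, Complex.exp_sub, inner_smul_right, real_inner_comm z ξ,
    show -(((2 * Real.pi * inner ℝ z ξ : ℝ) : ℂ)) * I = -(((2 * Real.pi * inner ℝ z ξ : ℝ) : ℂ) * I) by ring,
    Complex.exp_neg]
  push_cast
  field_simp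
  ring

lemma fracLapTest_eq_integral {σ : ℝ} (hσ : 0 < σ) (hσ2 : σ < 2) {η : Plane → ℝ} (h : IsTest η)
    (x : Plane) : kcon σ * fracLapTest σ η x = ∫ z, d2 η z x * ‖z‖ ^ (-2 - σ) := by
  apply Complex.ofReal_injective
  have hs := isSymb_lamS hσ.le (by linarith : σ ≤ 4)
  have hm : AEStronglyMeasurable (Function.uncurry fun z ξ : Plane =>
      cexp (↑(2 * Real.pi * inner ℝ ξ x) * I) * hat η ξ * ((phase σ ((2 * Real.pi) • ξ) z : ℝ) : ℂ))
      (volume.prod volume) := by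
    have := h.continuous_hat
    have h2 : Measurable fun p : Plane × Plane => phase σ ((2 * Real.pi) • p.2) p.1 := by
      unfold phase; fun_prop
    exact (((by fun_prop : Continuous fun p : Plane × Plane =>
      cexp (↑(2 * Real.pi * inner ℝ p.2 x) * I) * hat η p.2).measurable).mul
      (Complex.measurable_ofReal.comp h2)).aestronglyMeasurable
  calc ((kcon σ * fracLapTest σ η x : ℝ) : ℂ)
      = ∫ ξ, ∫ z, cexp (↑(2 * Real.pi * inner ℝ ξ x) * I) * hat η ξ *
          ((phase σ ((2 * Real.pi) • ξ) z : ℝ) : ℂ) := by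
        rw [Complex.ofReal_mul, fracLapTest_eq, hs.coe_multiplier, Real.fourierInv_eq', ← integral_const_mul]
        congr 1 with ξ
        rw [integral_const_mul, integral_complex_ofReal, integral_phase hσ, norm_smul, Real.norm_of_nonneg (by positivity), lamS]
        push_cast
        simp only [smul_eq_mul]
        ring
    _ = ∫ z, ∫ ξ, cexp (↑(2 * Real.pi * inner ℝ ξ x) * I) * hat η ξ *
          ((phase σ ((2 * Real.pi) • ξ) z : ℝ) : ℂ) := by
        rw [integral_integral_swap]
        rw [integrable_prod_iff (by exact hm.prod_swap)]
        refine ⟨.of_forall fun ξ => (Integrable.const_mul (𝕜 := ℂ) (integrable_phase hσ hσ2 ((2 * Real.pi) • ξ)).ofReal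
          (cexp (↑(2 * Real.pi * inner ℝ ξ x) * I) * hat η ξ)), ?_⟩
        have e : ∀ ξ, ∫ z, ‖cexp (↑(2 * Real.pi * inner ℝ ξ x) * I) * hat η ξ *
          ((phase σ ((2 * Real.pi) • ξ) z : ℝ) : ℂ)‖ = kcon σ * ‖lamS σ ξ * hat η ξ‖ := fun ξ => by
          simp only [norm_mul, Complex.norm_exp_ofReal_mul_I, one_mul, norm_real, Real.norm_of_nonneg (phase_nonneg _ _ _)]
          rw [integral_const_mul, integral_phase hσ, norm_smul, Real.norm_of_nonneg (by positivity : (0 : ℝ) ≤ 2 * Real.pi), lamS, norm_real,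
            Real.norm_of_nonneg (by positivity)]
          ring
        simp only [Function.uncurry]
        simp_rw [e]
        exact (hs.integrable h).norm.const_mul _
    _ = _ := by
        rw [← integral_complex_ofReal]
        congr 1 with z
        push_cast
        rw [h.d2_eq, ← integral_mul_const]
        congr 1 with ξ
        unfold phase
        push_cast
        ring

/-- Uniformly locally integrable functions. -/
structure ULI (h : Plane → ℝ) : Prop where
  meas : AEStronglyMeasurable h volume
  bound : ∀ r : ℝ, ∃ C : ℝ≥0, ∀ a, ∫⁻ x in Metric.closedBall a r, ‖h x‖ₑ ≤ C

lemma ULI.locallyIntegrable {h : Plane → ℝ} (hh : ULI h) : LocallyIntegrable h volume := by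
  intro x
  refine ⟨Metric.closedBall x 1, Metric.closedBall_mem_nhds x one_pos, hh.meas.restrict, ?_⟩
  obtain ⟨C, hC⟩ := hh.bound 1
  exact (hC x).trans_lt ENNReal.coe_lt_top

lemma ULI.integrable_mul {h η : Plane → ℝ} (hh : ULI h) (hη : Continuous η) (hc : HasCompactSupport η) :
    Integrable (fun x => h x * η x) := by
  have := hh.locallyIntegrable.integrable_smul_right_of_hasCompactSupport hη hc
  simpa [smul_eq_mul] using this

lemma ULI.of_memLp {h : Plane → ℝ} (hh : MemLp h 2 volume) : ULI h := by
  refine ⟨hh.1, fun r => ?_⟩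
  have hv : volume (Metric.closedBall (0 : Plane) r) < ⊤ := measure_closedBall_lt_top
  refine ⟨(volume (Metric.closedBall (0 : Plane) r) + eLpNorm h 2 volume ^ 2).toNNReal, fun a => ?_⟩
  rw [ENNReal.coe_toNNReal (ENNReal.add_ne_top.mpr ⟨hv.ne, ENNReal.pow_ne_top hh.2.ne⟩)]
  have e : ∀ t : ℝ≥0∞, t ≤ 1 + t ^ 2 := fun t => by
    rcases le_total t 1 with h | h
    · exact h.trans le_self_add
    · refine le_trans ?_ le_add_self
      rw [pow_two]; exact le_mul_of_one_le_left' h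
  calc ∫⁻ x in Metric.closedBall a r, ‖h x‖ₑ ≤ ∫⁻ x in Metric.closedBall a r, (1 + ‖h x‖ₑ ^ 2) := lintegral_mono fun x => e _
    _ = volume (Metric.closedBall a r) + ∫⁻ x in Metric.closedBall a r, ‖h x‖ₑ ^ 2 := by
      rw [lintegral_add_left measurable_const]; simp
    _ ≤ _ := by
      rw [Measure.addHaar_closedBall_center]
      gcongr
      refine (setLIntegral_le_lintegral _ _).trans ?_
      rw [lintegral_enorm_sq_eq hh, n2_sq]
      rw [eLpNorm_eq_lintegral_rpow_enorm_toReal (by norm_num) (by norm_num)]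
      simp only [ENNReal.toReal_ofNat]
      rw [← ENNReal.rpow_natCast, ← ENNReal.rpow_mul]
      norm_num
      rw [← n2_sq, ← lintegral_enorm_sq_eq hh]

/-- A test function localized in a ball, with bounds on its variation. -/
structure Loc (Φ : Plane → ℝ) (a : Plane) (r L : ℝ) : Prop where
  test : IsTest Φ
  supp : ∀ x, Φ x ≠ 0 → ‖x - a‖ ≤ r
  r_pos : 0 < r
  bd : ∀ x, |Φ x| ≤ L
  d1 : ∀ x y, |Φ x - Φ y| ≤ L * min 1 ‖x - y‖
  dd2 : ∀ z x, |d2 Φ z x| ≤ L * (min 1 ‖z‖) ^ 2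
  pd_le : ∀ j x, |pd j Φ x| ≤ L

lemma Loc.L_nonneg {Φ : Plane → ℝ} {a : Plane} {r L : ℝ} (h : Loc Φ a r L) : 0 ≤ L :=
  (abs_nonneg _).trans (h.bd 0)

lemma abs_d2_le {Φ : Plane → ℝ} (h : IsTest Φ) {K : ℝ≥0} (hK : LipschitzWith K (fderiv ℝ Φ)) (z x : Plane) :
    |d2 Φ z x| ≤ 2 * K * ‖z‖ ^ 2 := by
  have hd : ∀ y, HasFDerivAt (fun y => Φ (x + y) + Φ (x - y)) (fderiv ℝ Φ (x + y) - fderiv ℝ Φ (x - y)) y := by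
    intro y
    have h1 : HasFDerivAt (fun y => Φ (x + y)) (fderiv ℝ Φ (x + y)) y := by
      have := (h.differentiable (x + y)).hasFDerivAt.comp y ((hasFDerivAt_id y).const_add x)
      exact this.congr_fderiv (by ext v; simp)
    have h2 : HasFDerivAt (fun y => Φ (x - y)) (-fderiv ℝ Φ (x - y)) y := by
      have := (h.differentiable (x - y)).hasFDerivAt.comp y ((hasFDerivAt_id y).const_sub x)
      refine this.congr_fderiv ?_
      ext v; simp
    rw [sub_eq_add_neg]
    exact h1.add h2
  have := (convex_closedBall (0 : Plane) ‖z‖).norm_image_sub_le_of_norm_hasFDerivWithin_le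
    (f := fun y => Φ (x + y) + Φ (x - y)) (C := 2 * K * ‖z‖)
    (fun y _ => (hd y).hasFDerivWithinAt) (fun y hy => ?_) (x := 0) (y := z) (by simp) (by simp)
  · rw [Real.norm_eq_abs] at this
    simp only [add_zero, sub_zero] at this
    rw [d2, ← abs_neg, show -(2 * Φ x - Φ (x + z) - Φ (x - z)) = Φ (x + z) + Φ (x - z) - (Φ x + Φ x) by ring]
    linarith
  · have h3 := hK.dist_le_mul (x + y) (x - y)
    rw [dist_eq_norm, dist_eq_norm, show x + y - (x - y) = (2 : ℝ) • y by rw [two_smul]; abel, norm_smul] at h3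
    refine h3.trans ?_
    have : ‖y‖ ≤ ‖z‖ := by simpa using hy
    rw [Real.norm_of_nonneg zero_le_two]
    nlinarith [K.2, mul_le_mul_of_nonneg_left this K.2]

lemma exists_loc {Φ : Plane → ℝ} (h : IsTest Φ) :
    ∃ r L : ℝ, 0 < r ∧ 0 ≤ L ∧ ∀ a, Loc (fun x => Φ (x - a)) a r L := by
  obtain ⟨r, hr, hr'⟩ : ∃ r : ℝ, 0 < r ∧ ∀ x, Φ x ≠ 0 → ‖x‖ ≤ r := by
    obtain ⟨r, hr⟩ := h.2.isCompact.isBounded.subset_closedBall (0 : Plane)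
    refine ⟨max r 1, by positivity, fun x hx => ?_⟩
    have := hr (subset_tsupport _ hx)
    simp at this
    exact this.trans (le_max_left _ _)
  obtain ⟨B, hB⟩ := h.continuous.bounded_above_of_compact_support h.2
  have hB0 : 0 ≤ B := (norm_nonneg _).trans (hB 0)
  obtain ⟨K1, hK1⟩ := ContDiff.lipschitzWith_of_hasCompactSupport h.2 h.1 (by simp)
  obtain ⟨K2, hK2⟩ := ContDiff.lipschitzWith_of_hasCompactSupport (h.2.fderiv ℝ)
    (h.1.fderiv_right (m := ((⊤ : ℕ∞) : WithTop ℕ∞)) (by simp)) (by simp)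
  have hpd : ∀ j x, |pd j Φ x| ≤ K1 := fun j x => by
    have h1 := norm_fderiv_le_of_lipschitz ℝ hK1 (x₀ := x)
    have h2 := (fderiv ℝ Φ x).le_opNorm (EuclideanSpace.single j 1)
    simp only [PiLp.norm_single, norm_one, mul_one] at h2
    exact h2.trans h1
  refine ⟨r, 4 * B + K1 + 2 * K2, hr, by positivity, fun a => ⟨h.comp_sub a, fun x hx => hr' _ hx, hr, fun x => ?_, fun x y => ?_, fun z x => ?_, fun j x => ?_⟩⟩
  · have := hB (x - a)
    rw [Real.norm_eq_abs] at this
    linarith [K1.2, K2.2]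
  · have h1 := hB (x - a)
    have h2 := hB (y - a)
    rw [Real.norm_eq_abs, abs_le] at h1 h2
    have h3 := hK1.dist_le_mul (x - a) (y - a)
    rw [dist_eq_norm, dist_eq_norm, sub_sub_sub_cancel_right, Real.norm_eq_abs] at h3
    rcases le_total 1 ‖x - y‖ with h | h
    · rw [min_eq_left h, abs_le]
      constructor <;> linarith [K1.2, K2.2]
    · rw [min_eq_right h]
      refine h3.trans ?_
      gcongr
      linarith [K2.2]
  · have h0 := hB (x - a)
    have h1 := hB (x - a + z)
    have h2 := hB (x - a - z)
    rw [Real.norm_eq_abs, abs_le] at h0 h1 h2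
    have h3 := abs_d2_le h hK2 z (x - a)
    have e : d2 (fun x => Φ (x - a)) z x = d2 Φ z (x - a) := by
      unfold d2; simp only [add_sub_right_comm, sub_right_comm]
    rw [e]
    rcases le_total 1 ‖z‖ with h | h
    · rw [min_eq_left h, abs_le, d2]
      constructor <;> linarith [K1.2, K2.2]
    · rw [min_eq_right h]
      refine h3.trans ?_
      gcongr
      linarith [K1.2]
  · have e : pd j (fun x => Φ (x - a)) x = pd j Φ (x - a) := by
      unfold pd
      rw [fderiv_comp_sub]
    rw [e]
    have := hpd j (x - a)
    linarith [K2.2]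

lemma lintegral_mul_d2_le {h Φ : Plane → ℝ} {a : Plane} {r L : ℝ} (hΦ : Loc Φ a r L) {C : ℝ≥0}
    (hm : AEStronglyMeasurable h volume)
    (hC : ∀ a, ∫⁻ x in Metric.closedBall a r, ‖h x‖ₑ ≤ C) (z : Plane) :
    ∫⁻ y, ‖h y * d2 Φ z y‖ₑ ≤ ENNReal.ofReal (3 * C * L * (min 1 ‖z‖) ^ 2) := by
  have hL := hΦ.L_nonneg
  set B1 := Metric.closedBall a r
  set B2 := Metric.closedBall (a - z) r
  set B3 := Metric.closedBall (a + z) r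
  set K := ENNReal.ofReal (L * (min 1 ‖z‖) ^ 2)
  have hb : ∀ y, ‖h y * d2 Φ z y‖ₑ ≤ K * (B1.indicator (fun y => ‖h y‖ₑ) y +
      (B2.indicator (fun y => ‖h y‖ₑ) y + B3.indicator (fun y => ‖h y‖ₑ) y)) := by
    intro y
    by_cases h0 : d2 Φ z y = 0
    · simp [h0]
    have h1 : ‖d2 Φ z y‖ₑ ≤ K := by
      rw [← ofReal_norm]; exact ENNReal.ofReal_le_ofReal (hΦ.dd2 z y)
    rw [enorm_mul, mul_comm]
    refine mul_le_mul' h1 ?_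
    have h2 : y ∈ B1 ∨ y ∈ B2 ∨ y ∈ B3 := by
      by_contra hc
      push Not at hc
      apply h0
      have e1 : Φ y = 0 := by
        by_contra h; exact hc.1 (by simpa [B1, dist_eq_norm] using hΦ.supp y h)
      have e2 : Φ (y + z) = 0 := by
        by_contra h
        refine hc.2.1 ?_
        have := hΦ.supp _ h
        simp only [B2, Metric.mem_closedBall, dist_eq_norm]
        rwa [show y - (a - z) = y + z - a by abel]
      have e3 : Φ (y - z) = 0 := by
        by_contra h
        refine hc.2.2 ?_
        have := hΦ.supp _ h
        simp only [B3, Metric.mem_closedBall, dist_eq_norm]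
        rwa [show y - (a + z) = y - z - a by abel]
      simp [d2, e1, e2, e3]
    rcases h2 with h2 | h2 | h2
    · rw [Set.indicator_of_mem h2]; exact le_self_add
    · rw [Set.indicator_of_mem h2]; exact le_self_add.trans le_add_self
    · rw [Set.indicator_of_mem h2]; exact le_add_self.trans le_add_self
  have hB : ∀ b, AEMeasurable ((Metric.closedBall b r).indicator (fun y => ‖h y‖ₑ)) volume := fun b =>
    hm.enorm.indicator Metric.isClosed_closedBall.measurableSet
  calc _ ≤ ∫⁻ y, K * (B1.indicator (fun y => ‖h y‖ₑ) y +
      (B2.indicator (fun y => ‖h y‖ₑ) y + B3.indicator (fun y => ‖h y‖ₑ) y)) := lintegral_mono hb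
    _ = K * ((∫⁻ y in B1, ‖h y‖ₑ) + ((∫⁻ y in B2, ‖h y‖ₑ) + ∫⁻ y in B3, ‖h y‖ₑ)) := by
      rw [lintegral_const_mul' _ _ ENNReal.ofReal_ne_top, lintegral_add_left' (hB a), lintegral_add_left' (hB _),
        lintegral_indicator Metric.isClosed_closedBall.measurableSet,
        lintegral_indicator Metric.isClosed_closedBall.measurableSet,
        lintegral_indicator Metric.isClosed_closedBall.measurableSet]
    _ ≤ K * (C + (C + C)) := by gcongr <;> apply hC
    _ = _ := by
      rw [show (C : ℝ≥0∞) + (C + C) = ENNReal.ofReal (3 * C) by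
        rw [← ENNReal.coe_add, ← ENNReal.coe_add, ← ENNReal.ofReal_coe_nnreal]; congr 1; push_cast; ring,
        ← ENNReal.ofReal_mul (by positivity)]
      congr 1; ring

lemma Loc.of_test {ζ : Plane → ℝ} (h : IsTest ζ) : ∃ r L, Loc ζ 0 r L := by
  obtain ⟨r, L, -, -, h1⟩ := exists_loc h
  exact ⟨r, L, by simpa using h1 0⟩

lemma krn_two (σ : ℝ) (z : Plane) : krn 2 σ z = (min 1 ‖z‖) ^ 2 * ‖z‖ ^ (-2 - σ) := by
  simp [krn]

lemma IsTest.continuous_d2 {η : Plane → ℝ} (h : IsTest η) :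
    Continuous fun p : Plane × Plane => d2 η p.1 p.2 := by
  have := h.continuous
  unfold d2; fun_prop

lemma ULI.integrable_mul_d2 {h ζ : Plane → ℝ} (hh : ULI h) (hζ : IsTest ζ) (z : Plane) :
    Integrable (fun y => h y * d2 ζ z y) := by
  obtain ⟨r, L, hloc⟩ := Loc.of_test hζ
  obtain ⟨C, hC⟩ := hh.bound r
  refine ⟨hh.meas.mul (hζ.continuous_d2.comp (by fun_prop : Continuous fun y : Plane => (z, y))).aestronglyMeasurable, ?_⟩
  exact (lintegral_mul_d2_le hloc hh.meas hC z).trans_lt ENNReal.ofReal_lt_top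

lemma ULI.fracLap_aux {h ζ : Plane → ℝ} (hh : ULI h) (hζ : IsTest ζ) {σ : ℝ} (hσ : 0 < σ) (hσ2 : σ < 2) :
    Integrable (fun p : Plane × Plane => h p.1 * (d2 ζ p.2 p.1 * ‖p.2‖ ^ (-2 - σ))) (volume.prod volume) := by
  obtain ⟨r, L, hloc⟩ := Loc.of_test hζ
  obtain ⟨C, hC⟩ := hh.bound r
  have hm : AEStronglyMeasurable (fun p : Plane × Plane => h p.1 * (d2 ζ p.2 p.1 * ‖p.2‖ ^ (-2 - σ)))
      (volume.prod volume) := by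
    refine hh.meas.comp_fst.mul (AEStronglyMeasurable.mul ?_ ?_)
    · exact (hζ.continuous_d2.comp continuous_swap).aestronglyMeasurable
    · exact (by fun_prop : Measurable fun p : Plane × Plane => ‖p.2‖ ^ (-2 - σ)).aestronglyMeasurable
  rw [integrable_prod_iff' hm]
  refine ⟨.of_forall fun z => ?_, ?_⟩
  · refine ((hh.integrable_mul_d2 hζ z).mul_const (‖z‖ ^ (-2 - σ))).congr (.of_forall fun y => ?_)
    simp only; ring
  · refine ((integrable_krn hσ hσ2).const_mul (3 * C * L)).mono' hm.norm.prod_swap.integral_prod_right' (.of_forall fun z => ?_)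
    rw [Real.norm_of_nonneg (integral_nonneg fun _ => norm_nonneg _)]
    have h1 := lintegral_mul_d2_le hloc hh.meas hC z
    rw [← ofReal_integral_norm_eq_lintegral_enorm (hh.integrable_mul_d2 hζ z), ENNReal.ofReal_le_ofReal_iff
      (by have := hloc.L_nonneg; positivity)] at h1
    calc _ = (∫ y, ‖h y * d2 ζ z y‖) * ‖z‖ ^ (-2 - σ) := by
          rw [← integral_mul_const]
          congr 1 with y
          rw [← mul_assoc, norm_mul (h y * d2 ζ z y), Real.norm_of_nonneg (by positivity : (0 : ℝ) ≤ ‖z‖ ^ (-2 - σ))]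
      _ ≤ (3 * C * L * (min 1 ‖z‖) ^ 2) * ‖z‖ ^ (-2 - σ) := by gcongr
      _ = _ := by rw [krn_two]; ring

lemma ULI.integrable_fracLap {h ζ : Plane → ℝ} (hh : ULI h) (hζ : IsTest ζ) {σ : ℝ} (hσ : 0 < σ) (hσ2 : σ < 2) :
    Integrable (fun z => (∫ y, h y * d2 ζ z y) * ‖z‖ ^ (-2 - σ)) := by
  refine (hh.fracLap_aux hζ hσ hσ2).integral_prod_right.congr (.of_forall fun z => ?_)
  simp only
  rw [← integral_mul_const]
  congr 1 with y; ring

lemma ULI.integrable_mul_fracLap {h ζ : Plane → ℝ} (hh : ULI h) (hζ : IsTest ζ) {σ : ℝ} (hσ : 0 < σ) (hσ2 : σ < 2) :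
    Integrable (fun y => h y * fracLapTest σ ζ y) := by
  refine ((hh.fracLap_aux hζ hσ hσ2).integral_prod_left.const_mul (kcon σ)⁻¹).congr (.of_forall fun y => ?_)
  simp only
  rw [integral_const_mul, ← fracLapTest_eq_integral hσ hσ2 hζ]
  field_simp [(kcon_pos hσ hσ2).ne']

lemma ULI.integral_mul_fracLap {h ζ : Plane → ℝ} (hh : ULI h) (hζ : IsTest ζ) {σ : ℝ} (hσ : 0 < σ) (hσ2 : σ < 2) :
    kcon σ * ∫ y, h y * fracLapTest σ ζ y = ∫ z, (∫ y, h y * d2 ζ z y) * ‖z‖ ^ (-2 - σ) := by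
  rw [← integral_const_mul]
  simp_rw [mul_left_comm (kcon σ), fracLapTest_eq_integral hσ hσ2 hζ, ← integral_const_mul]
  rw [integral_integral_swap (hh.fracLap_aux hζ hσ hσ2)]
  congr 1 with z
  rw [← integral_mul_const]
  congr 1 with y; ring

lemma ULI.comp_add {h : Plane → ℝ} (hh : ULI h) (z : Plane) : ULI (fun x => h (x + z)) := by
  refine ⟨hh.meas.comp_quasiMeasurePreserving (measurePreserving_add_right volume z).quasiMeasurePreserving, fun r => ?_⟩
  obtain ⟨C, hC⟩ := hh.bound r
  refine ⟨C, fun a => le_trans (le_of_eq ?_) (hC (a + z))⟩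
  rw [← lintegral_indicator Metric.isClosed_closedBall.measurableSet,
    ← lintegral_indicator Metric.isClosed_closedBall.measurableSet,
    ← lintegral_add_right_eq_self ((Metric.closedBall (a + z) r).indicator fun x => ‖h x‖ₑ) z]
  congr 1 with x
  simp only [Set.indicator, Metric.mem_closedBall, dist_add_right]

lemma IsTest.comp_add {η : Plane → ℝ} (h : IsTest η) (a : Plane) : IsTest (fun x => η (x + a)) := by
  simpa using h.comp_sub (-a)

lemma ULI.integral_mul_d2 {h ζ : Plane → ℝ} (hh : ULI h) (hζ : IsTest ζ) (z : Plane) :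
    ∫ x, h x * d2 ζ z x = ∫ x, (h x - h (x + z)) * (ζ x - ζ (x + z)) := by
  have i1 : Integrable fun x => h x * ζ x := hh.integrable_mul hζ.continuous hζ.2
  have i2 : Integrable fun x => h x * ζ (x + z) := hh.integrable_mul (hζ.comp_add z).continuous (hζ.comp_add z).2
  have i3 : Integrable fun x => h x * ζ (x - z) := hh.integrable_mul (hζ.comp_sub z).continuous (hζ.comp_sub z).2
  have i4 : Integrable fun x => h (x + z) * ζ x := (hh.comp_add z).integrable_mul hζ.continuous hζ.2
  have i5 : Integrable fun x => h (x + z) * ζ (x + z) :=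
    (hh.comp_add z).integrable_mul (hζ.comp_add z).continuous (hζ.comp_add z).2
  have e1 : ∫ x, h (x + z) * ζ (x + z) = ∫ x, h x * ζ x := integral_add_right_eq_self (fun x => h x * ζ x) z
  have e2 : ∫ x, h (x + z) * ζ x = ∫ x, h x * ζ (x - z) := by
    rw [← integral_add_right_eq_self (fun x => h x * ζ (x - z)) z]; simp
  have l : ∫ x, h x * d2 ζ z x = 2 * (∫ x, h x * ζ x) - (∫ x, h x * ζ (x + z)) - ∫ x, h x * ζ (x - z) := by
    rw [← integral_const_mul, ← integral_sub (i1.const_mul 2) i2,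
      ← integral_sub (f := fun x => 2 * (h x * ζ x) - h x * ζ (x + z)) ((i1.const_mul 2).sub i2) i3]
    congr 1 with x
    unfold d2; ring
  have r : ∫ x, (h x - h (x + z)) * (ζ x - ζ (x + z)) = (∫ x, h x * ζ x) - (∫ x, h x * ζ (x + z)) -
      ((∫ x, h (x + z) * ζ x) - ∫ x, h (x + z) * ζ (x + z)) := by
    rw [← integral_sub i1 i2, ← integral_sub i4 i5, ← integral_sub (f := fun x => h x * ζ x - h x * ζ (x + z))
      (g := fun x => h (x + z) * ζ x - h (x + z) * ζ (x + z)) (i1.sub i2) (i4.sub i5)]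
    congr 1 with x
    ring
  rw [l, r, e1, e2]; ring

/-- If `g = Λ^σ w`, then mollifications are related by the singular integral. -/
lemma ULI.cv_fracLap {w g ρ : Plane → ℝ} (hw : ULI w) {σ : ℝ} (hσ : 0 < σ) (hσ2 : σ < 2)
    (hg : IsFracLap σ w g) (hρ : IsTest ρ) (x : Plane) :
    Integrable (fun z => d2 (cv w ρ) z x * ‖z‖ ^ (-2 - σ)) ∧
    kcon σ * cv g ρ x = ∫ z, d2 (cv w ρ) z x * ‖z‖ ^ (-2 - σ) := by
  have hr := hρ.sub_comp x
  have e : ∀ z, ∫ y, w y * d2 (fun y => ρ (x - y)) z y = d2 (cv w ρ) z x := by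
    intro z
    have i : ∀ x', Integrable fun y => w y * ρ (x' - y) := fun x' =>
      hw.integrable_mul (hρ.sub_comp x').continuous (hρ.sub_comp x').2
    unfold d2 cv
    rw [← integral_const_mul, ← integral_sub ((i x).const_mul 2) (i _),
      ← integral_sub (f := fun y => 2 * (w y * ρ (x - y)) - w y * ρ (x + z - y)) (((i x).const_mul 2).sub (i _)) (i _)]
    congr 1 with y
    beta_reduce
    rw [show x - (y + z) = x - z - y by abel, show x - (y - z) = x + z - y by abel]
    ring
  have h1 := hw.integrable_fracLap hr hσ hσ2
  have h2 := hw.integral_mul_fracLap hr hσ hσ2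
  simp_rw [e] at h1 h2
  refine ⟨h1, ?_⟩
  rw [← h2, cv, hg _ hr]

/-- The commutator of a multiplication with the singular integral. -/
def comm (σ : ℝ) (ψ f : Plane → ℝ) (x : Plane) : ℝ :=
  ∫ z, ((ψ x - ψ (x + z)) * f (x + z) + (ψ x - ψ (x - z)) * f (x - z)) * ‖z‖ ^ (-2 - σ)

lemma IsTest.integrable_d2 {η : Plane → ℝ} (h : IsTest η) {σ : ℝ} (hσ : 0 < σ) (hσ2 : σ < 2) (x : Plane) :
    Integrable (fun z => d2 η z x * ‖z‖ ^ (-2 - σ)) := by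
  obtain ⟨r, L, hloc⟩ := Loc.of_test h
  refine ((integrable_krn hσ hσ2).const_mul L).mono' ?_ (.of_forall fun z => ?_)
  · refine AEStronglyMeasurable.mul (h.continuous_d2.comp (by fun_prop : Continuous fun z : Plane => (z, x))).aestronglyMeasurable ?_
    exact (by fun_prop : Measurable fun z : Plane => ‖z‖ ^ (-2 - σ)).aestronglyMeasurable
  · rw [norm_mul, Real.norm_of_nonneg (by positivity : (0 : ℝ) ≤ ‖z‖ ^ (-2 - σ)), krn_two, ← mul_assoc]
    gcongr
    exact hloc.dd2 z x

lemma fracLapTest_mul {σ : ℝ} (hσ : 0 < σ) (hσ2 : σ < 2) {ψ f : Plane → ℝ}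
    (hψf : IsTest (fun x => ψ x * f x)) (x : Plane) (hi : Integrable (fun z => d2 f z x * ‖z‖ ^ (-2 - σ))) :
    kcon σ * fracLapTest σ (fun x => ψ x * f x) x = ψ x * (∫ z, d2 f z x * ‖z‖ ^ (-2 - σ)) + comm σ ψ f x := by
  rw [fracLapTest_eq_integral hσ hσ2 hψf, ← integral_const_mul, comm, ← sub_eq_iff_eq_add',
    ← integral_sub (hψf.integrable_d2 hσ hσ2 x) (hi.const_mul _)]
  congr 1 with z
  unfold d2; ring

/-! ### Uniformly local bounds -/

/-- The square of `h` has integral at most `S` on all unit balls. -/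
def UB (h : Plane → ℝ) (S : ℝ) : Prop :=
  ∀ a, ∫⁻ x in Metric.closedBall a 1, ‖h x‖ₑ ^ 2 ≤ ENNReal.ofReal S

lemma one_le_volume_ball (z : Plane) : 1 ≤ volume (Metric.closedBall z 1) := by
  rw [EuclideanSpace.volume_closedBall_fin_two]
  simp only [ENNReal.ofReal_one, one_pow, one_mul]
  rw [ENNReal.one_le_ofReal]
  linarith [Real.pi_gt_three]

lemma UB.lintegral_weight {h : Plane → ℝ} {S : ℝ} (hS : UB h S) (hm : AEStronglyMeasurable h volume)
    {ω ω' : Plane → ℝ≥0∞} (hω : Measurable ω) (hω' : Measurable ω')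
    (hle : ∀ x z, ‖x - z‖ ≤ 1 → ω x ≤ ω' z) :
    ∫⁻ x, ω x * ‖h x‖ₑ ^ 2 ≤ (∫⁻ z, ω' z) * ENNReal.ofReal S := by
  have hset : MeasurableSet {p : Plane × Plane | ‖p.1 - p.2‖ ≤ 1} :=
    measurableSet_le (by fun_prop) measurable_const
  have hmeas : AEMeasurable (fun p : Plane × Plane =>
      {p : Plane × Plane | ‖p.1 - p.2‖ ≤ 1}.indicator (fun p => ω p.1 * ‖h p.1‖ₑ ^ 2) p) (volume.prod volume) := by
    refine AEMeasurable.indicator ?_ hset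
    exact (hω.comp measurable_fst).aemeasurable.mul (hm.comp_fst.enorm.pow_const 2)
  calc ∫⁻ x, ω x * ‖h x‖ₑ ^ 2
      ≤ ∫⁻ x, ∫⁻ z, {p : Plane × Plane | ‖p.1 - p.2‖ ≤ 1}.indicator (fun p => ω p.1 * ‖h p.1‖ₑ ^ 2) (x, z) := by
        refine lintegral_mono fun x => ?_
        have : ∀ z, {p : Plane × Plane | ‖p.1 - p.2‖ ≤ 1}.indicator (fun p => ω p.1 * ‖h p.1‖ₑ ^ 2) (x, z)
            = (Metric.closedBall x 1).indicator (fun _ => ω x * ‖h x‖ₑ ^ 2) z := fun z => by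
          simp [Set.indicator, dist_eq_norm, norm_sub_rev]
        simp_rw [this]
        rw [lintegral_indicator Metric.isClosed_closedBall.measurableSet, setLIntegral_const]
        exact le_mul_of_one_le_right' (one_le_volume_ball x)
    _ = ∫⁻ z, ∫⁻ x, {p : Plane × Plane | ‖p.1 - p.2‖ ≤ 1}.indicator (fun p => ω p.1 * ‖h p.1‖ₑ ^ 2) (x, z) :=
        lintegral_lintegral_swap hmeas
    _ ≤ ∫⁻ z, ω' z * ENNReal.ofReal S := by
        refine lintegral_mono fun z => ?_
        calc _ ≤ ∫⁻ x, ω' z * (Metric.closedBall z 1).indicator (fun x => ‖h x‖ₑ ^ 2) x := by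
              refine lintegral_mono fun x => ?_
              by_cases hx : ‖x - z‖ ≤ 1
              · rw [Set.indicator_of_mem (by exact hx), Set.indicator_of_mem (by simpa [dist_eq_norm] using hx)]
                gcongr; exact hle x z hx
              · rw [Set.indicator_of_notMem (by exact hx)]; exact zero_le
          _ = ω' z * ∫⁻ x in Metric.closedBall z 1, ‖h x‖ₑ ^ 2 := by
              rw [lintegral_const_mul'', lintegral_indicator Metric.isClosed_closedBall.measurableSet]
              exact (hm.enorm.pow_const 2).indicator Metric.isClosed_closedBall.measurableSet
          _ ≤ _ := by gcongr; exact hS z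
    _ = _ := lintegral_mul_const _ hω'

lemma UB.lintegral_ball (r : ℝ) : ∃ C : ℝ, 0 ≤ C ∧ ∀ (h : Plane → ℝ) (S : ℝ), AEStronglyMeasurable h volume →
    UB h S → ∀ a, ∫⁻ x in Metric.closedBall a r, ‖h x‖ₑ ^ 2 ≤ ENNReal.ofReal (C * S) := by
  refine ⟨(volume (Metric.closedBall (0 : Plane) (r + 1))).toReal, by positivity, fun h S hm hS a => ?_⟩
  have h1 := hS.lintegral_weight hm (ω := (Metric.closedBall a r).indicator 1)
    (ω' := (Metric.closedBall a (r + 1)).indicator 1)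
    (measurable_one.indicator Metric.isClosed_closedBall.measurableSet)
    (measurable_one.indicator Metric.isClosed_closedBall.measurableSet) (fun x z hxz => by
      by_cases hx : x ∈ Metric.closedBall a r
      · have hz : z ∈ Metric.closedBall a (r + 1) := by
          simp only [Metric.mem_closedBall, dist_eq_norm] at hx ⊢
          calc ‖z - a‖ = ‖(x - a) - (x - z)‖ := by congr 1; abel
            _ ≤ ‖x - a‖ + ‖x - z‖ := norm_sub_le _ _
            _ ≤ r + 1 := by linarith
        rw [Set.indicator_of_mem hx, Set.indicator_of_mem hz]
        exact le_rfl
      · rw [Set.indicator_of_notMem hx]; exact zero_le)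
  rw [lintegral_indicator_one Metric.isClosed_closedBall.measurableSet, Measure.addHaar_closedBall_center] at h1
  rw [ENNReal.ofReal_mul (by positivity), ENNReal.ofReal_toReal measure_closedBall_lt_top.ne]
  refine le_trans (le_of_eq ?_) h1
  rw [← lintegral_indicator Metric.isClosed_closedBall.measurableSet]
  congr 1 with x
  by_cases hx : x ∈ Metric.closedBall a r <;> simp [Set.indicator, hx]

lemma le_ofReal_sqrt {t : ℝ≥0∞} {A : ℝ} (h : t ^ 2 ≤ ENNReal.ofReal A) : t ≤ ENNReal.ofReal (Real.sqrt A) := by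
  by_contra hc
  push Not at hc
  have h1 := ENNReal.pow_lt_pow_left two_ne_zero hc
  rw [← ENNReal.ofReal_pow (Real.sqrt_nonneg _)] at h1
  rcases le_total 0 A with hA | hA
  · rw [Real.sq_sqrt hA] at h1; exact absurd h h1.not_ge
  · rw [ENNReal.ofReal_of_nonpos hA] at h
    exact absurd h (h1.trans_le' zero_le).not_ge

lemma UB.uli {h : Plane → ℝ} {S : ℝ} (hS : UB h S) (hm : AEStronglyMeasurable h volume) : ULI h := by
  refine ⟨hm, fun r => ?_⟩
  obtain ⟨C, hC, hC'⟩ := UB.lintegral_ball r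
  refine ⟨(volume (Metric.closedBall (0 : Plane) r) + ENNReal.ofReal (C * S)).toNNReal, fun a => ?_⟩
  rw [ENNReal.coe_toNNReal (ENNReal.add_ne_top.mpr ⟨measure_closedBall_lt_top.ne, ENNReal.ofReal_ne_top⟩)]
  have e : ∀ t : ℝ≥0∞, t ≤ 1 + t ^ 2 := fun t => by
    rcases le_total t 1 with h | h
    · exact h.trans le_self_add
    · refine le_trans ?_ le_add_self
      rw [pow_two]; exact le_mul_of_one_le_left' h
  calc ∫⁻ x in Metric.closedBall a r, ‖h x‖ₑ ≤ ∫⁻ x in Metric.closedBall a r, (1 + ‖h x‖ₑ ^ 2) := lintegral_mono fun x => e _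
    _ = volume (Metric.closedBall a r) + ∫⁻ x in Metric.closedBall a r, ‖h x‖ₑ ^ 2 := by
      rw [lintegral_add_left measurable_const]; simp
    _ ≤ _ := by
      rw [Measure.addHaar_closedBall_center]
      gcongr
      exact hC' h S hm hS a

lemma UB.far {σ d : ℝ} (hσ : 0 < σ) (hd : 0 < d) : ∃ C : ℝ, 0 ≤ C ∧ ∀ (h : Plane → ℝ) (S : ℝ),
    AEStronglyMeasurable h volume → UB h S → ∀ a,
    ∫⁻ x in {x | d ≤ ‖x - a‖}, ENNReal.ofReal (‖x - a‖ ^ (-2 - σ)) * ‖h x‖ₑ ≤ ENNReal.ofReal (Real.sqrt (C * S)) := by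
  set c : ℝ := (2 / d + 1) ^ (2 + σ)
  have hc : 0 ≤ c := by positivity
  have hint : Integrable (fun z : Plane => c * (1 + ‖z‖) ^ (-(2 + σ))) :=
    (integrable_one_add_norm (by simp; linarith)).const_mul c
  set I : ℝ := ∫ z : Plane, c * (1 + ‖z‖) ^ (-(2 + σ))
  have hI : 0 ≤ I := integral_nonneg fun _ => by positivity
  have hIe : ∀ a : Plane, ∫⁻ z : Plane, ENNReal.ofReal (c * (1 + ‖z - a‖) ^ (-(2 + σ))) = ENNReal.ofReal I := fun a => by
    rw [lintegral_sub_right_eq_self (fun z : Plane => ENNReal.ofReal (c * (1 + ‖z‖) ^ (-(2 + σ)))) a,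
      ofReal_integral_eq_lintegral_ofReal hint (.of_forall fun _ => by positivity)]
  refine ⟨I * I, by positivity, fun h S hm hS a => le_ofReal_sqrt ?_⟩
  set ω : Plane → ℝ≥0∞ := {x | d ≤ ‖x - a‖}.indicator fun x => ENNReal.ofReal (‖x - a‖ ^ (-2 - σ))
  have hset : MeasurableSet {x : Plane | d ≤ ‖x - a‖} := measurableSet_le measurable_const (by fun_prop)
  have hω : Measurable ω := Measurable.indicator (by fun_prop) hset
  have hle : ∀ x z, ‖x - z‖ ≤ 1 → ω x ≤ ENNReal.ofReal (c * (1 + ‖z - a‖) ^ (-(2 + σ))) := by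
    intro x z hxz
    by_cases hx : d ≤ ‖x - a‖
    · simp only [ω]
      rw [Set.indicator_of_mem (by exact hx)]
      apply ENNReal.ofReal_le_ofReal
      have h1 : ‖z - a‖ ≤ ‖x - a‖ + 1 := by
        calc ‖z - a‖ = ‖(x - a) - (x - z)‖ := by congr 1; abel
          _ ≤ ‖x - a‖ + ‖x - z‖ := norm_sub_le _ _
          _ ≤ _ := by linarith
      have hpos : 0 < ‖x - a‖ := hd.trans_le hx
      have h2 : 1 + ‖z - a‖ ≤ (2 / d + 1) * ‖x - a‖ := by
        have : 2 ≤ 2 / d * ‖x - a‖ := by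
          rw [div_mul_eq_mul_div, le_div_iff₀ hd]; linarith
        linarith
      have h3 : (1 + ‖z - a‖) ^ (2 + σ) ≤ c * ‖x - a‖ ^ (2 + σ) := by
        rw [← Real.mul_rpow (by positivity) (by positivity)]
        exact Real.rpow_le_rpow (by positivity) h2 (by linarith)
      rw [show -2 - σ = -(2 + σ) by ring, Real.rpow_neg hpos.le, Real.rpow_neg (by positivity), ← div_eq_mul_inv,
        inv_eq_one_div, div_le_div_iff₀ (by positivity) (by positivity)]
      linarith
    · simp only [ω]
      rw [Set.indicator_of_notMem (by exact hx)]; exact zero_le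
  rw [← lintegral_indicator hset]
  have e : ∀ x, {x | d ≤ ‖x - a‖}.indicator (fun x => ENNReal.ofReal (‖x - a‖ ^ (-2 - σ)) * ‖h x‖ₑ) x = ω x * ‖h x‖ₑ := fun x => by
    by_cases hx : d ≤ ‖x - a‖ <;> simp [ω, Set.indicator, hx]
  simp_rw [e]
  refine (lintegral_mul_sq_le hω.aemeasurable hm.enorm).trans ?_
  have h1 : ∫⁻ x, ω x ≤ ENNReal.ofReal I := by
    rw [← hIe a]; exact lintegral_mono fun x => hle x x (by simp)
  have h2 := hS.lintegral_weight hm hω (by fun_prop) hle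
  rw [hIe] at h2
  calc _ ≤ ENNReal.ofReal I * (ENNReal.ofReal I * ENNReal.ofReal S) := mul_le_mul' h1 h2
    _ = _ := by rw [← mul_assoc, ← ENNReal.ofReal_mul hI, ← ENNReal.ofReal_mul (by positivity)]

lemma UB.mono {h : Plane → ℝ} {S S' : ℝ} (hS : UB h S) (h1 : S ≤ S') : UB h S' := fun a =>
  (hS a).trans (ENNReal.ofReal_le_ofReal h1)

lemma UB.cv {h ρ : Plane → ℝ} {S : ℝ} (hS : UB h S) (hm : AEStronglyMeasurable h volume)
    (hρ : Integrable ρ) (h1 : ∫ x, |ρ x| = 1) : UB (SQG.cv h ρ) S := by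
  intro a
  refine (lintegral_cv_sq_le hm hρ.1 _).trans ?_
  have h2 : ∫⁻ z, ‖ρ z‖ₑ = 1 := by rw [lintegral_enorm_eq hρ, h1, ENNReal.ofReal_one]
  rw [h2, one_mul]
  calc _ ≤ ∫⁻ z, ‖ρ z‖ₑ * ENNReal.ofReal S := by
        gcongr with z
        refine le_trans (le_of_eq ?_) (hS (a - z))
        rw [← lintegral_indicator Metric.isClosed_closedBall.measurableSet,
          ← lintegral_indicator Metric.isClosed_closedBall.measurableSet,
          ← lintegral_sub_right_eq_self ((Metric.closedBall (a - z) 1).indicator fun x => ‖h x‖ₑ ^ 2) z]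
        congr 1 with x
        simp only [Set.indicator, Metric.mem_closedBall, dist_sub_right]
    _ = ENNReal.ofReal S := by
        rw [lintegral_mul_const'' _ hρ.1.enorm, h2, one_mul]

lemma UB.of_memLp {h : Plane → ℝ} (hh : MemLp h 2 volume) : UB h (n2 h ^ 2) := fun a => by
  rw [← lintegral_enorm_sq_eq hh]; exact setLIntegral_le_lintegral _ _

/-! ### Commutator bounds -/

lemma aestronglyMeasurable_comm {σ : ℝ} {ψ f : Plane → ℝ} (hψ : Continuous ψ) (hf : Continuous f) :
    AEStronglyMeasurable (comm σ ψ f) volume := by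
  have : Measurable fun p : Plane × Plane => ((ψ p.1 - ψ (p.1 + p.2)) * f (p.1 + p.2) +
      (ψ p.1 - ψ (p.1 - p.2)) * f (p.1 - p.2)) * ‖p.2‖ ^ (-2 - σ) :=
    Measurable.mul (by fun_prop : Continuous _).measurable (by fun_prop)
  exact this.aestronglyMeasurable.integral_prod_right' (μ := volume) (ν := volume)

lemma enorm_comm_le {σ L : ℝ} {ψ f : Plane → ℝ} (hψ : Continuous ψ) (hf : Continuous f)
    (hd : ∀ x y, |ψ x - ψ y| ≤ L * min 1 ‖x - y‖) {F : Plane → Plane → ℝ≥0∞}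
    (hF : ∀ x z, ψ x ≠ ψ (x + z) → ‖f (x + z)‖ₑ ≤ F x z) (x : Plane) :
    ‖comm σ ψ f x‖ₑ ≤ 2 * ∫⁻ z, ENNReal.ofReal (L * krn 1 σ z) * F x z := by
  set k : Plane → ℝ≥0∞ := fun z => ENNReal.ofReal (‖z‖ ^ (-2 - σ))
  have hm1 : Measurable fun z => ‖(ψ x - ψ (x + z)) * f (x + z)‖ₑ * k z :=
    (by fun_prop : Continuous fun z => (ψ x - ψ (x + z)) * f (x + z)).measurable.enorm.mul (by fun_prop)
  have e2 : ∫⁻ z, ‖(ψ x - ψ (x - z)) * f (x - z)‖ₑ * k z = ∫⁻ z, ‖(ψ x - ψ (x + z)) * f (x + z)‖ₑ * k z := by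
    rw [← lintegral_neg_eq_self]
    simp [k, sub_eq_add_neg]
  calc ‖comm σ ψ f x‖ₑ ≤ ∫⁻ z, ‖((ψ x - ψ (x + z)) * f (x + z) + (ψ x - ψ (x - z)) * f (x - z)) * ‖z‖ ^ (-2 - σ)‖ₑ :=
        enorm_integral_le_lintegral_enorm _
    _ ≤ ∫⁻ z, (‖(ψ x - ψ (x + z)) * f (x + z)‖ₑ * k z + ‖(ψ x - ψ (x - z)) * f (x - z)‖ₑ * k z) := by
        refine lintegral_mono fun z => ?_
        rw [enorm_mul, ← add_mul]
        refine mul_le_mul' (enorm_add_le _ _) (le_of_eq ?_)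
        rw [← ofReal_norm, Real.norm_of_nonneg (by positivity)]
    _ = 2 * ∫⁻ z, ‖(ψ x - ψ (x + z)) * f (x + z)‖ₑ * k z := by
        rw [lintegral_add_left hm1, e2, two_mul]
    _ ≤ _ := by
        gcongr 2 * ?_
        refine lintegral_mono fun z => ?_
        by_cases h0 : ψ x = ψ (x + z)
        · simp [h0]
        rw [enorm_mul, mul_right_comm]
        refine mul_le_mul' ?_ (hF x z h0)
        rw [← ofReal_norm, ← ENNReal.ofReal_mul (norm_nonneg _)]
        apply ENNReal.ofReal_le_ofReal
        rw [krn, ← mul_assoc, Real.rpow_one]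
        gcongr
        have := hd x (x + z)
        simpa using this

lemma lintegral_ofReal_krn {σ L : ℝ} (hσ : 0 < σ) (hσ1 : σ < 1) (hL : 0 ≤ L) :
    ∫⁻ z, ENNReal.ofReal (L * krn 1 σ z) = ENNReal.ofReal (L * ∫ z, krn 1 σ z) := by
  rw [← ofReal_integral_eq_lintegral_ofReal ((integrable_krn hσ hσ1).const_mul L)
    (.of_forall fun z => mul_nonneg hL (krn_nonneg _ _ _)), integral_const_mul]

lemma measurable_krn (a σ : ℝ) : Measurable (krn a σ) := by unfold krn; fun_prop

lemma lintegral_comm_sq_le {σ L : ℝ} (hσ : 0 < σ) (hσ1 : σ < 1) (hL : 0 ≤ L) {ψ f : Plane → ℝ}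
    (hψ : Continuous ψ) (hf : Continuous f)
    (hd : ∀ x y, |ψ x - ψ y| ≤ L * min 1 ‖x - y‖) {F : Plane → Plane → ℝ≥0∞}
    (hFm : Measurable (Function.uncurry F))
    (hF : ∀ x z, ψ x ≠ ψ (x + z) → ‖f (x + z)‖ₑ ≤ F x z) {D : ℝ≥0∞} (hD : ∀ z, ∫⁻ x, F x z ^ 2 ≤ D) :
    ∫⁻ x, ‖comm σ ψ f x‖ₑ ^ 2 ≤ ENNReal.ofReal ((2 * (L * ∫ z, krn 1 σ z)) ^ 2) * D := by
  set K := ENNReal.ofReal (L * ∫ z, krn 1 σ z)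
  have hk : Measurable fun z => ENNReal.ofReal (L * krn 1 σ z) := by
    have := measurable_krn 1 σ; fun_prop
  have hI : 0 ≤ L * ∫ z, krn 1 σ z := mul_nonneg hL (integral_nonneg fun z => krn_nonneg _ _ _)
  calc ∫⁻ x, ‖comm σ ψ f x‖ₑ ^ 2 ≤ ∫⁻ x, 4 * (K * ∫⁻ z, ENNReal.ofReal (L * krn 1 σ z) * F x z ^ 2) := by
        refine lintegral_mono fun x => ?_
        have h1 := enorm_comm_le hψ hf hd hF x (σ := σ)
        calc _ ≤ (2 * ∫⁻ z, ENNReal.ofReal (L * krn 1 σ z) * F x z) ^ 2 := by gcongr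
          _ = 4 * (∫⁻ z, ENNReal.ofReal (L * krn 1 σ z) * F x z) ^ 2 := by rw [mul_pow]; norm_num
          _ ≤ _ := by
            gcongr
            have := lintegral_mul_sq_le (μ := volume) hk.aemeasurable (hFm.of_uncurry_left (x := x)).aemeasurable
            rwa [lintegral_ofReal_krn hσ hσ1 hL] at this
    _ = 4 * (K * ∫⁻ z, ENNReal.ofReal (L * krn 1 σ z) * ∫⁻ x, F x z ^ 2) := by
        rw [lintegral_const_mul' _ _ (by norm_num), lintegral_const_mul' _ _ ENNReal.ofReal_ne_top]
        rw [lintegral_lintegral_swap]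
        · congr 3 with z
          rw [lintegral_const_mul' _ _ ENNReal.ofReal_ne_top]
        · exact ((hk.comp measurable_snd).mul (hFm.pow_const 2)).aemeasurable
    _ ≤ 4 * (K * ∫⁻ z, ENNReal.ofReal (L * krn 1 σ z) * D) := by gcongr with z; exact hD z
    _ = _ := by
        rw [lintegral_mul_const _ hk, lintegral_ofReal_krn hσ hσ1 hL, ENNReal.ofReal_pow (by positivity),
          ENNReal.ofReal_mul (p := 2) (by norm_num)]
        norm_num
        ring

lemma lintegral_comm_le {σ L : ℝ} (hσ : 0 < σ) (hσ1 : σ < 1) (hL : 0 ≤ L) {ψ f : Plane → ℝ}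
    (hψ : Continuous ψ) (hf : Continuous f)
    (hd : ∀ x y, |ψ x - ψ y| ≤ L * min 1 ‖x - y‖) :
    ∫⁻ x, ‖comm σ ψ f x‖ₑ ≤ ENNReal.ofReal (2 * (L * ∫ z, krn 1 σ z)) * ∫⁻ x, ‖f x‖ₑ := by
  set K := ENNReal.ofReal (L * ∫ z, krn 1 σ z)
  have hk : Measurable fun z => ENNReal.ofReal (L * krn 1 σ z) := by
    have := measurable_krn 1 σ; fun_prop
  have hm : Measurable fun p : Plane × Plane => ‖f (p.1 + p.2)‖ₑ :=
    (by fun_prop : Continuous fun p : Plane × Plane => f (p.1 + p.2)).measurable.enorm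
  calc _ ≤ ∫⁻ x, 2 * ∫⁻ z, ENNReal.ofReal (L * krn 1 σ z) * ‖f (x + z)‖ₑ :=
        lintegral_mono fun x => enorm_comm_le hψ hf hd (fun _ _ _ => le_rfl) x
    _ = 2 * ∫⁻ z, ENNReal.ofReal (L * krn 1 σ z) * ∫⁻ x, ‖f x‖ₑ := by
        rw [lintegral_const_mul' _ _ (by norm_num), lintegral_lintegral_swap]
        · congr 2 with z
          rw [lintegral_const_mul' _ _ ENNReal.ofReal_ne_top, lintegral_add_right_eq_self (fun x => ‖f x‖ₑ) z]
        · exact ((hk.comp measurable_snd).mul hm).aemeasurable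
    _ = _ := by
        rw [lintegral_mul_const _ hk, lintegral_ofReal_krn hσ hσ1 hL, ENNReal.ofReal_mul (p := 2) (by norm_num)]
        norm_num
        ring

lemma memLp_comm {σ L : ℝ} (hσ : 0 < σ) (hσ1 : σ < 1) (hL : 0 ≤ L) {ψ f : Plane → ℝ}
    (hψ : Continuous ψ) (hf : Continuous f)
    (hd : ∀ x y, |ψ x - ψ y| ≤ L * min 1 ‖x - y‖) (hf2 : MemLp f 2 volume) :
    MemLp (comm σ ψ f) 2 volume ∧ n2 (comm σ ψ f) ≤ (2 * (L * ∫ z, krn 1 σ z)) * n2 f := by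
  have hI : 0 ≤ L * ∫ z, krn 1 σ z := mul_nonneg hL (integral_nonneg fun z => krn_nonneg _ _ _)
  refine memLp_two_of_lintegral_le (aestronglyMeasurable_comm hψ hf)
    (mul_nonneg (by positivity) (n2_nonneg f)) ?_
  refine (lintegral_comm_sq_le hσ hσ1 hL hψ hf hd (F := fun x z => ‖f (x + z)‖ₑ)
    (D := ENNReal.ofReal (n2 f ^ 2)) ?_ (fun _ _ _ => le_rfl) fun z => ?_).trans_eq ?_
  · exact (by fun_prop : Continuous fun p : Plane × Plane => f (p.1 + p.2)).measurable.enorm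
  · rw [lintegral_add_right_eq_self (fun x => ‖f x‖ₑ ^ 2) z, lintegral_enorm_sq_eq hf2]
  · rw [← ENNReal.ofReal_mul (by positivity)]; congr 1; ring

lemma lintegral_closedBall_add (f : Plane → ℝ≥0∞) (a z : Plane) (r : ℝ) :
    ∫⁻ x in Metric.closedBall a r, f (x + z) = ∫⁻ x in Metric.closedBall (a + z) r, f x := by
  rw [← lintegral_indicator Metric.isClosed_closedBall.measurableSet,
    ← lintegral_indicator Metric.isClosed_closedBall.measurableSet,
    ← lintegral_add_right_eq_self ((Metric.closedBall (a + z) r).indicator f) z]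
  congr 1 with x
  simp only [Set.indicator, Metric.mem_closedBall, dist_add_right]

lemma exists_comm_uloc {σ : ℝ} (hσ : 0 < σ) (hσ1 : σ < 1) (r L : ℝ) : ∃ C : ℝ, 0 ≤ C ∧
    ∀ (ψ : Plane → ℝ) (a : Plane), Loc ψ a r L → ∀ (f : Plane → ℝ) (S : ℝ), Continuous f → 0 ≤ S → UB f S →
    MemLp (comm σ ψ f) 2 volume ∧ n2 (comm σ ψ f) ^ 2 ≤ C * S := by
  obtain ⟨C, hC, hCb⟩ := UB.lintegral_ball r
  refine ⟨(2 * (L * ∫ z, krn 1 σ z)) ^ 2 * (2 * C), by positivity, fun ψ a hψ f S hf hS0 hS => ?_⟩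
  set D := ENNReal.ofReal (2 * C * S)
  set B := Metric.closedBall a r
  have hB : MeasurableSet B := Metric.isClosed_closedBall.measurableSet
  have hset : MeasurableSet {p : Plane × Plane | p.1 ∈ B ∨ p.1 + p.2 ∈ B} :=
    (hB.preimage measurable_fst).union (hB.preimage (by fun_prop))
  have hfm : Measurable fun p : Plane × Plane => ‖f (p.1 + p.2)‖ₑ :=
    (by fun_prop : Continuous fun p : Plane × Plane => f (p.1 + p.2)).measurable.enorm
  have key := lintegral_comm_sq_le hσ hσ1 hψ.L_nonneg hψ.test.continuous hf hψ.d1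
    (F := fun x z => {p : Plane × Plane | p.1 ∈ B ∨ p.1 + p.2 ∈ B}.indicator (fun p => ‖f (p.1 + p.2)‖ₑ) (x, z))
    (D := D) (by exact hfm.indicator hset) (fun x z h => ?_) fun z => ?_
  · have h0 : 0 ≤ (2 * (L * ∫ z, krn 1 σ z)) ^ 2 * (2 * C) * S := by positivity
    have h2 := memLp_two_of_lintegral_le (aestronglyMeasurable_comm hψ.test.continuous hf)
      (Real.sqrt_nonneg ((2 * (L * ∫ z, krn 1 σ z)) ^ 2 * (2 * C) * S))
      (by rw [Real.sq_sqrt h0, mul_assoc, ENNReal.ofReal_mul (by positivity)]; exact key)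
    refine ⟨h2.1, ?_⟩
    rw [← Real.sq_sqrt h0]
    gcongr
    · exact n2_nonneg _
    · exact h2.2
  · rw [Set.indicator_of_mem]
    by_contra hc
    simp only [Set.mem_ofPred_eq, not_or] at hc
    have e1 : ∀ y, y ∉ B → ψ y = 0 := fun y hy => by
      by_contra h0; exact hy (by simpa [B, dist_eq_norm] using hψ.supp y h0)
    exact h (by rw [e1 _ hc.1, e1 _ hc.2])
  · calc _ ≤ ∫⁻ x, (B.indicator (fun x => ‖f (x + z)‖ₑ ^ 2) x + B.indicator (fun x => ‖f x‖ₑ ^ 2) (x + z)) := by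
          refine lintegral_mono fun x => ?_
          by_cases h1 : x ∈ B <;> by_cases h2 : x + z ∈ B <;> simp [Set.indicator, h1, h2]
      _ = (∫⁻ x in Metric.closedBall (a + z) r, ‖f x‖ₑ ^ 2) + ∫⁻ x in B, ‖f x‖ₑ ^ 2 := by
          rw [lintegral_add_left, lintegral_indicator hB, lintegral_add_right_eq_self (B.indicator fun x => ‖f x‖ₑ ^ 2) z,
            lintegral_indicator hB, lintegral_closedBall_add (fun x => ‖f x‖ₑ ^ 2)]
          exact ((by fun_prop : Continuous fun x => f (x + z)).measurable.enorm.pow_const 2).indicator hB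
      _ ≤ ENNReal.ofReal (C * S) + ENNReal.ofReal (C * S) := by
          gcongr <;> exact hCb f S hf.aestronglyMeasurable hS _
      _ = D := by
          rw [← ENNReal.ofReal_add (by positivity) (by positivity)]; congr 1; ring

/-! ### The odd singular integral of order `σ` -/

/-- The integrand of the vector-valued odd singular integral on a plane wave. -/
def oddK (σ : ℝ) (ξ z : Plane) : Plane := (2 * Real.sin (inner ℝ z ξ) * ‖z‖ ^ (-3 - σ)) • z

lemma norm_rpow_mul (σ : ℝ) (z : Plane) : ‖z‖ ^ (-3 - σ) * ‖z‖ ≤ ‖z‖ ^ (-2 - σ) := by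
  rcases eq_or_ne z 0 with rfl | hz
  · simp only [norm_zero, mul_zero]; positivity
  · have h := norm_pos_iff.mpr hz
    rw [← Real.rpow_add_one h.ne']
    apply le_of_eq; congr 1; ring

lemma norm_oddK_le (σ : ℝ) (ξ z : Plane) : ‖oddK σ ξ z‖ ≤ (2 + 2 * ‖ξ‖) * krn 1 σ z := by
  have h0 := norm_rpow_mul σ z
  have h1 : |Real.sin (inner ℝ z ξ)| ≤ (1 + ‖ξ‖) * min 1 ‖z‖ := by
    have h2 := Real.abs_sin_le_one (inner ℝ z ξ)
    have h3 : |Real.sin (inner ℝ z ξ)| ≤ ‖z‖ * ‖ξ‖ := Real.abs_sin_le_abs.trans (abs_real_inner_le_norm z ξ)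
    have := norm_nonneg ξ
    have := norm_nonneg z
    rcases le_total 1 ‖z‖ with h | h
    · rw [min_eq_left h]; linarith
    · rw [min_eq_right h]; nlinarith
  rw [oddK, norm_smul, norm_mul, norm_mul, Real.norm_of_nonneg (by positivity : 0 ≤ ‖z‖ ^ (-3 - σ)), Real.norm_eq_abs,
    Real.norm_eq_abs, abs_of_pos (by norm_num : (0 : ℝ) < 2), krn, Real.rpow_one, mul_assoc]
  calc _ ≤ 2 * ((1 + ‖ξ‖) * min 1 ‖z‖) * ‖z‖ ^ (-2 - σ) := by gcongr
    _ = _ := by ring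

lemma measurable_oddK (σ : ℝ) : Measurable fun p : Plane × Plane => oddK σ p.1 p.2 := by
  unfold oddK; fun_prop

lemma integrable_oddK {σ : ℝ} (hσ : 0 < σ) (hσ1 : σ < 1) (ξ : Plane) : Integrable (oddK σ ξ) :=
  ((integrable_krn hσ hσ1).const_mul _).mono' (by
    exact (measurable_oddK σ).of_uncurry_left.aestronglyMeasurable) (.of_forall fun z => norm_oddK_le σ ξ z)

/-- The normalizing constant of the odd singular integral. -/
def ocon (σ : ℝ) : ℝ := (∫ z, oddK σ (EuclideanSpace.single 0 1) z) 0

lemma integral_oddK_map (σ : ℝ) (A : Plane ≃ₗᵢ[ℝ] Plane) (ξ : Plane) :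
    ∫ z, oddK σ (A ξ) z = A (∫ z, oddK σ ξ z) := by
  have h2 := A.measurePreserving.integral_comp A.toHomeomorph.measurableEmbedding (oddK σ (A ξ))
  have h3 := A.toContinuousLinearEquiv.integral_comp_comm (μ := (volume : Measure Plane)) (oddK σ ξ)
  rw [← h2]
  refine Eq.trans ?_ h3
  congr 1 with z
  simp [oddK, A.inner_map_map, A.norm_map]

lemma integral_oddK {σ : ℝ} (ξ : Plane) (i : Fin 2) :
    (∫ z, oddK σ ξ z) i = ocon σ * (ξ i / ‖ξ‖ * ‖ξ‖ ^ σ) := by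
  rcases eq_or_ne ξ 0 with rfl | hξ
  · simp [oddK]
  have hp : 0 < ‖ξ‖ := norm_pos_iff.mpr hξ
  set e : Plane := EuclideanSpace.single 0 1
  set ω : Plane := ‖ξ‖⁻¹ • ξ
  have hω : ‖e‖ = ‖ω‖ := by
    simp [ω, e, norm_smul, hp.ne']
  have he : ∫ z, oddK σ e z = ocon σ • e := by
    set B := (ℝ ∙ (EuclideanSpace.single 1 1 : Plane))ᗮ.reflection
    have hB : B e = e := by
      apply Submodule.reflection_mem_subspace_eq_self
      rw [Submodule.mem_orthogonal_singleton_iff_inner_right, PiLp.inner_apply, Fin.sum_univ_two]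
      simp [e]
    have h1 := integral_oddK_map σ B e
    rw [hB] at h1
    have h2 := (Submodule.reflection_eq_self_iff _).mp h1.symm
    rw [Submodule.mem_orthogonal_singleton_iff_inner_right, PiLp.inner_apply, Fin.sum_univ_two] at h2
    ext j
    fin_cases j
    · simp [ocon, e]
    · simp at h2; simp [e, h2]
  have h1 : ∫ z, oddK σ ω z = ocon σ • ω := by
    have hA := Submodule.reflection_sub hω
    have h2 := integral_oddK_map σ ((ℝ ∙ (e - ω))ᗮ.reflection) e
    rw [hA, he, map_smul, hA] at h2
    exact h2
  have h2 := Measure.integral_comp_smul (volume : Measure Plane) (oddK σ ω) ‖ξ‖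
  have h3 : ∀ z, oddK σ ω (‖ξ‖ • z) = (‖ξ‖ ^ (-3 - σ) * ‖ξ‖) • oddK σ ξ z := by
    intro z
    have h4 : inner ℝ (‖ξ‖ • z) ω = inner ℝ z ξ := by
      simp only [ω, inner_smul_left, inner_smul_right, conj_trivial]
      field_simp
    unfold oddK
    rw [h4, norm_smul, norm_norm, Real.mul_rpow (norm_nonneg _) (norm_nonneg _), smul_smul, smul_smul]
    congr 1; ring
  simp_rw [h3] at h2
  rw [integral_smul, h1] at h2
  simp only [finrank_euclideanSpace, Fintype.card_fin] at h2
  rw [abs_of_pos (by positivity)] at h2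
  have h5 : ‖ξ‖ ^ (-3 - σ) * ‖ξ‖ = (‖ξ‖ ^ 2)⁻¹ * (‖ξ‖ ^ σ)⁻¹ := by
    rw [← Real.rpow_natCast, ← Real.rpow_neg hp.le, ← Real.rpow_neg hp.le, ← Real.rpow_add hp, ← Real.rpow_add_one hp.ne']
    congr 1; push_cast; ring
  rw [h5] at h2
  have h6 : 0 < ‖ξ‖ ^ σ := by positivity
  have h7 := congrArg (fun v : Plane => v i) h2
  simp only [PiLp.smul_apply, smul_eq_mul, ω] at h7
  field_simp at h7
  field_simp
  linarith

/-- The symbol `i ξ_i / |ξ| (2π|ξ|)^σ`. -/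
def oddS (σ : ℝ) (i : Fin 2) (ξ : Plane) : ℂ := I * ((ξ i / ‖ξ‖ * (2 * Real.pi * ‖ξ‖) ^ σ : ℝ) : ℂ)

lemma abs_coord_div_le (i : Fin 2) (ξ : Plane) : |ξ i / ‖ξ‖| ≤ 1 := by
  rw [abs_div, abs_norm]
  have h1 : |ξ i| ≤ ‖ξ‖ := by simpa using PiLp.norm_apply_le ξ i
  exact div_le_one_of_le₀ h1 (norm_nonneg _)

lemma norm_oddS_le (σ : ℝ) (i : Fin 2) (ξ : Plane) : ‖oddS σ i ξ‖ ≤ ‖lamS σ ξ‖ := by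
  rw [oddS, lamS, norm_mul, norm_I, one_mul, norm_real, norm_real, norm_mul]
  exact mul_le_of_le_one_left (norm_nonneg _) (abs_coord_div_le i ξ)

lemma isSymb_oddS {σ : ℝ} (h0 : 0 ≤ σ) (h4 : σ ≤ 4) (i : Fin 2) : IsSymb (oddS σ i) := by
  obtain ⟨C, hC, h1⟩ := (isSymb_lamS h0 h4).bound
  refine ⟨by unfold oddS; fun_prop, ⟨C, hC, fun ξ => (norm_oddS_le σ i ξ).trans (h1 ξ)⟩, fun ξ => ?_⟩
  simp [oddS, neg_div]

lemma IsTest.d1_eq {η : Plane → ℝ} (h : IsTest η) (z x : Plane) :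
    ((η (x + z) - η (x - z) : ℝ) : ℂ) = ∫ ξ, cexp (↑(2 * Real.pi * inner ℝ ξ x) * I) * hat η ξ *
      (I * ((2 * Real.sin (inner ℝ z ((2 * Real.pi) • ξ)) : ℝ) : ℂ)) := by
  have h0 : Integrable (hat η) := by simpa using isSymb_one.integrable h
  have h1 : ∀ y, (η y : ℂ) = ∫ ξ, cexp (↑(2 * Real.pi * inner ℝ ξ y) * I) * hat η ξ := fun y => by
    have := isSymb_one.coe_multiplier η y
    rw [h.multiplier_one] at this
    rw [this, Real.fourierInv_eq']
    simp
  have h2 : ∀ y, Integrable fun ξ => cexp (↑(2 * Real.pi * inner ℝ ξ y) * I) * hat η ξ := fun y =>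
    h0.bdd_mul (c := 1) (Continuous.aestronglyMeasurable (by fun_prop))
      (.of_forall fun x => by rw [Complex.norm_exp_ofReal_mul_I])
  rw [Complex.ofReal_sub, h1 (x + z), h1 (x - z), ← integral_sub (h2 _) (h2 _)]
  congr 1 with ξ
  rw [inner_add_right, inner_sub_right, mul_add, mul_sub]
  push_cast
  rw [Complex.sin, add_mul, sub_mul, Complex.exp_add, Complex.exp_sub, inner_smul_right, real_inner_comm z ξ,
    show -(((2 * Real.pi * inner ℝ z ξ : ℝ) : ℂ)) * I = -(((2 * Real.pi * inner ℝ z ξ : ℝ) : ℂ) * I) by ring,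
    Complex.exp_neg]
  push_cast
  field_simp
  ring_nf
  simp only [I_sq]
  ring

lemma IsTest.integrable_d1 {η : Plane → ℝ} (h : IsTest η) {σ : ℝ} (hσ : 0 < σ) (hσ1 : σ < 1) (i : Fin 2) (x : Plane) :
    Integrable (fun z => (η (x + z) - η (x - z)) * (‖z‖ ^ (-3 - σ) * z i)) := by
  obtain ⟨r, L, hloc⟩ := Loc.of_test h
  have hc := h.continuous
  refine ((integrable_krn hσ hσ1).const_mul (2 * L)).mono' (Measurable.aestronglyMeasurable (by fun_prop)) (.of_forall fun z => ?_)
  have h1 : |z i| ≤ ‖z‖ := by simpa using PiLp.norm_apply_le z i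
  have h2 := norm_rpow_mul σ z
  have h3 : |η (x + z) - η (x - z)| ≤ 2 * L * min 1 ‖z‖ := by
    have a1 := hloc.d1 (x + z) x
    have a2 := hloc.d1 x (x - z)
    simp only [add_sub_cancel_left, sub_sub_cancel] at a1 a2
    calc _ = |(η (x + z) - η x) + (η x - η (x - z))| := by congr 1; ring
      _ ≤ _ := (abs_add_le _ _).trans (by linarith)
  rw [norm_mul, norm_mul, Real.norm_of_nonneg (by positivity : 0 ≤ ‖z‖ ^ (-3 - σ)), Real.norm_eq_abs, Real.norm_eq_abs]
  have hL := hloc.L_nonneg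
  calc _ ≤ (2 * L * min 1 ‖z‖) * ‖z‖ ^ (-2 - σ) := by
        gcongr
        exact (mul_le_mul_of_nonneg_left h1 (by positivity)).trans h2
    _ = _ := by rw [krn, Real.rpow_one]; ring

lemma oddTest_eq_integral {σ : ℝ} (hσ : 0 < σ) (hσ1 : σ < 1) (i : Fin 2) {η : Plane → ℝ} (h : IsTest η)
    (x : Plane) : ocon σ * multiplier (oddS σ i) η x = ∫ z, (η (x + z) - η (x - z)) * (‖z‖ ^ (-3 - σ) * z i) := by
  apply Complex.ofReal_injective
  have hs := isSymb_oddS hσ.le (by linarith : σ ≤ 4) i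
  have h1 := isSymb_one.decay h 4
  obtain ⟨D, hD, hD'⟩ := h1
  have hi : ∀ ξ, Integrable fun z => oddK σ ξ z i := fun ξ =>
    (EuclideanSpace.proj i : Plane →L[ℝ] ℝ).integrable_comp (integrable_oddK hσ hσ1 ξ)
  have hio : ∀ ξ, ∫ z, oddK σ ξ z i = ocon σ * (ξ i / ‖ξ‖ * ‖ξ‖ ^ σ) := fun ξ => by
    rw [← integral_oddK]
    exact (EuclideanSpace.proj i : Plane →L[ℝ] ℝ).integral_comp_comm (integrable_oddK hσ hσ1 ξ)
  have hmo : Measurable fun p : Plane × Plane => oddK σ ((2 * Real.pi) • p.2) p.1 i := by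
    unfold oddK; fun_prop
  have hm : AEStronglyMeasurable (Function.uncurry fun z ξ : Plane =>
      cexp (↑(2 * Real.pi * inner ℝ ξ x) * I) * hat η ξ * (I * ((oddK σ ((2 * Real.pi) • ξ) z i : ℝ) : ℂ)))
      (volume.prod volume) := by
    have := h.continuous_hat
    exact (((by fun_prop : Continuous fun p : Plane × Plane =>
      cexp (↑(2 * Real.pi * inner ℝ p.2 x) * I) * hat η p.2).measurable).mul
      ((Complex.measurable_ofReal.comp hmo).const_mul I)).aestronglyMeasurable
  calc ((ocon σ * multiplier (oddS σ i) η x : ℝ) : ℂ)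
      = ∫ ξ, ∫ z, cexp (↑(2 * Real.pi * inner ℝ ξ x) * I) * hat η ξ * (I * ((oddK σ ((2 * Real.pi) • ξ) z i : ℝ) : ℂ)) := by
        rw [Complex.ofReal_mul, hs.coe_multiplier, Real.fourierInv_eq', ← integral_const_mul]
        congr 1 with ξ
        rw [integral_const_mul, integral_const_mul, integral_complex_ofReal, hio, norm_smul,
          Real.norm_of_nonneg (by positivity), oddS, PiLp.smul_apply, smul_eq_mul (2 * Real.pi) (ξ i), mul_div_mul_left (ξ i) ‖ξ‖ (by positivity : 2 * Real.pi ≠ 0)]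
        push_cast
        simp only [smul_eq_mul]
        ring
    _ = ∫ z, ∫ ξ, cexp (↑(2 * Real.pi * inner ℝ ξ x) * I) * hat η ξ * (I * ((oddK σ ((2 * Real.pi) • ξ) z i : ℝ) : ℂ)) := by
        rw [integral_integral_swap]
        rw [integrable_prod_iff (by exact hm.prod_swap)]
        refine ⟨.of_forall fun ξ => ((hi ((2 * Real.pi) • ξ)).ofReal.const_mul I).const_mul (cexp (↑(2 * Real.pi * inner ℝ ξ x) * I) * hat η ξ), ?_⟩
        have hdom : Integrable fun ξ => ‖hat η ξ‖ * ((2 + 2 * (2 * Real.pi * ‖ξ‖)) * ∫ z, krn 1 σ z) := by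
          have : Integrable fun ξ : Plane => (2 + 2 * (2 * Real.pi * ‖ξ‖)) * ‖hat η ξ‖ := by
            refine integrable_of_decay (C := 20 * D) ?_ fun ξ => ?_
            · have := h.continuous_hat
              exact (by fun_prop : Continuous _).aestronglyMeasurable
            · have := hD' ξ
              simp only [one_mul] at this
              rw [norm_mul, norm_norm, Real.norm_of_nonneg (by positivity)]
              have h2 : 2 + 2 * (2 * Real.pi * ‖ξ‖) ≤ 20 * (1 + ‖ξ‖) := by
                nlinarith [Real.pi_lt_four, norm_nonneg ξ]
              calc _ ≤ (1 + ‖ξ‖) ^ 3 * ((20 * (1 + ‖ξ‖)) * ‖hat η ξ‖) := by gcongr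
                _ = 20 * ((1 + ‖ξ‖) ^ 4 * ‖hat η ξ‖) := by ring
                _ ≤ _ := by gcongr
          refine (this.mul_const (∫ z, krn 1 σ z)).congr (.of_forall fun ξ => ?_)
          simp only; ring
        refine hdom.mono' hm.prod_swap.norm.integral_prod_right' (.of_forall fun ξ => ?_)
        rw [Real.norm_of_nonneg (integral_nonneg fun _ => norm_nonneg _)]
        simp only [norm_mul, Complex.norm_exp_ofReal_mul_I, one_mul, norm_real, norm_I, Function.uncurry]
        rw [integral_const_mul]
        gcongr
        rw [← integral_const_mul]
        refine integral_mono (hi _).norm ((integrable_krn hσ hσ1).const_mul _) fun z => ?_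
        refine (PiLp.norm_apply_le _ i).trans ((norm_oddK_le _ _ _).trans (le_of_eq ?_))
        rw [norm_smul, Real.norm_of_nonneg (by positivity)]
    _ = _ := by
        rw [← integral_complex_ofReal]
        congr 1 with z
        rw [Complex.ofReal_mul, h.d1_eq, ← integral_mul_const]
        congr 1 with ξ
        simp only [oddK, PiLp.smul_apply, smul_eq_mul]
        push_cast
        ring

lemma ocon_ne_zero {σ : ℝ} (hσ : 0 < σ) (hσ1 : σ < 1) : ocon σ ≠ 0 := by
  intro h0
  let b : ContDiffBump (EuclideanSpace.single 0 1 : Plane) := ⟨1 / 4, 1 / 2, by norm_num, by norm_num⟩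
  have hb : IsTest b := ⟨b.contDiff, b.hasCompactSupport⟩
  have h1 := oddTest_eq_integral hσ hσ1 0 hb 0
  rw [h0, zero_mul] at h1
  have hs : ∀ z : Plane, b z ≠ 0 → 0 < z 0 := fun z hz => by
    have h2 : z ∈ Function.support b := hz
    rw [b.support_eq, Metric.mem_ball, dist_eq_norm] at h2
    have h3 : |z 0 - 1| ≤ ‖z - EuclideanSpace.single 0 1‖ := by
      have := PiLp.norm_apply_le (z - EuclideanSpace.single 0 (1 : ℝ)) 0
      rw [PiLp.sub_apply, Real.norm_eq_abs] at this
      simpa using this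
    have h4 : |z 0 - 1| < 1 / 2 := h3.trans_lt h2
    linarith [(abs_lt.mp h4).1]
  have hz : ∀ z : Plane, 0 < z 0 → 0 < ‖z‖ := fun z h => by
    rw [norm_pos_iff]; rintro rfl; simp at h
  have hnn : ∀ z : Plane, 0 ≤ (b (0 + z) - b (0 - z)) * (‖z‖ ^ (-3 - σ) * z 0) := by
    intro z
    simp only [zero_add, zero_sub]
    rcases lt_or_ge 0 (z 0) with h | h
    · have : b (-z) = 0 := by
        by_contra hc
        have := hs _ hc; simp at this; linarith
      rw [this, sub_zero]
      have := b.nonneg (x := z); positivity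
    · have : b z = 0 := by
        by_contra hc
        have := hs _ hc; linarith
      rw [this, zero_sub, neg_mul, ← mul_neg, ← mul_neg]
      have := b.nonneg (x := -z)
      exact mul_nonneg this (mul_nonneg (by positivity) (by linarith))
  have h2 : 0 < ∫ z, (b (0 + z) - b (0 - z)) * (‖z‖ ^ (-3 - σ) * z 0) := by
    rw [integral_pos_iff_support_of_nonneg hnn (hb.integrable_d1 hσ hσ1 0 0)]
    refine (Metric.isOpen_ball.measure_pos volume ⟨_, Metric.mem_ball_self (x := (EuclideanSpace.single 0 1 : Plane)) (show (0 : ℝ) < 1 / 2 by norm_num)⟩).trans_le (measure_mono fun z hz' => ?_)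
    have h3 : b z ≠ 0 := by
      have : z ∈ Function.support b := by rw [b.support_eq]; exact hz'
      exact this
    have h4 := hs z h3
    have h5 : b (-z) = 0 := by
      by_contra hc
      have := hs _ hc; simp at this; linarith
    have h6 := hz z h4
    have h7 : 0 < b z := lt_of_le_of_ne b.nonneg h3.symm
    simp only [Function.mem_support, zero_add, zero_sub, h5, sub_zero]
    positivity
  rw [← h1] at h2
  exact lt_irrefl _ h2

/-- Away from the support, the multiplier of order `σ` has a kernel decaying like `|z|^(-2-σ)`. -/
lemma exists_abs_oddTest_le {σ : ℝ} (hσ : 0 < σ) (hσ1 : σ < 1) : ∃ C : ℝ, 0 ≤ C ∧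
    ∀ (i : Fin 2) (η : Plane → ℝ), IsTest η → ∀ x, ‖multiplier (oddS σ i) η x‖ₑ ≤
      ENNReal.ofReal C * ∫⁻ y, ‖η y‖ₑ * ENNReal.ofReal (‖x - y‖ ^ (-2 - σ)) := by
  have hc := abs_pos.mpr (ocon_ne_zero hσ hσ1)
  refine ⟨2 / |ocon σ|, by positivity, fun i η h x => ?_⟩
  have h1 := congrArg (fun t : ℝ => ‖t‖ₑ) (oddTest_eq_integral hσ hσ1 i h x)
  simp only [enorm_mul] at h1
  set k : Plane → ℝ≥0∞ := fun z => ENNReal.ofReal (‖z‖ ^ (-2 - σ))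
  have hη := h.continuous
  have e1 : ∫⁻ z, ‖η (x + z)‖ₑ * k z = ∫⁻ y, ‖η y‖ₑ * ENNReal.ofReal (‖x - y‖ ^ (-2 - σ)) := by
    rw [← lintegral_add_left_eq_self (fun y => ‖η y‖ₑ * ENNReal.ofReal (‖x - y‖ ^ (-2 - σ))) x]
    simp [k]
  have e2 : ∫⁻ z, ‖η (x - z)‖ₑ * k z = ∫⁻ z, ‖η (x + z)‖ₑ * k z := by
    rw [← lintegral_neg_eq_self]
    simp [k, sub_eq_add_neg]
  have h2 : ‖∫ z, (η (x + z) - η (x - z)) * (‖z‖ ^ (-3 - σ) * z i)‖ₑ ≤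
      2 * ∫⁻ y, ‖η y‖ₑ * ENNReal.ofReal (‖x - y‖ ^ (-2 - σ)) := by
    calc _ ≤ ∫⁻ z, ‖(η (x + z) - η (x - z)) * (‖z‖ ^ (-3 - σ) * z i)‖ₑ := enorm_integral_le_lintegral_enorm _
      _ ≤ ∫⁻ z, (‖η (x + z)‖ₑ * k z + ‖η (x - z)‖ₑ * k z) := by
        refine lintegral_mono fun z => ?_
        rw [← add_mul, enorm_mul]
        refine mul_le_mul' (enorm_sub_le) ?_
        rw [← ofReal_norm]
        apply ENNReal.ofReal_le_ofReal
        have h1 : |z i| ≤ ‖z‖ := by simpa using PiLp.norm_apply_le z i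
        rw [norm_mul, Real.norm_of_nonneg (by positivity : 0 ≤ ‖z‖ ^ (-3 - σ)), Real.norm_eq_abs]
        exact (mul_le_mul_of_nonneg_left h1 (by positivity)).trans (norm_rpow_mul σ z)
      _ = _ := by
        have hm : Measurable fun z => ‖η (x + z)‖ₑ * k z :=
          (by fun_prop : Continuous fun z => η (x + z)).measurable.enorm.mul (by fun_prop)
        rw [lintegral_add_left hm, e2, e1, two_mul]
  rw [← h1] at h2
  have h3 : ‖ocon σ‖ₑ = ENNReal.ofReal |ocon σ| := by rw [← ofReal_norm]; rfl
  rw [h3] at h2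
  have h4 : ‖multiplier (oddS σ i) η x‖ₑ = ENNReal.ofReal |ocon σ|⁻¹ * (ENNReal.ofReal |ocon σ| * ‖multiplier (oddS σ i) η x‖ₑ) := by
    rw [← mul_assoc, ← ENNReal.ofReal_mul (by positivity), inv_mul_cancel₀ hc.ne', ENNReal.ofReal_one, one_mul]
  rw [h4, div_eq_inv_mul, ENNReal.ofReal_mul (by positivity), mul_assoc]
  simpa using mul_le_mul_right h2 (ENNReal.ofReal |ocon σ|⁻¹)

/-! ### The initial datum -/

lemma ae_le_of_integral_mul_le {h : Plane → ℝ} (hh : LocallyIntegrable h volume) {B : ℝ}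
    (hB : ∀ η, IsTest η → (∀ x, 0 ≤ η x) → ∫ x, η x = 1 → ∫ x, h x * η x ≤ B) : ∀ᵐ x, h x ≤ B := by
  let b : ℕ → ContDiffBump (0 : Plane) := fun n => ⟨1 / (n + 1), 2 / (n + 1), by positivity, by gcongr; norm_num⟩
  have h1 : ∀ᵐ x₀, Tendsto (fun n => convolution ((b n).normed volume) h (ContinuousLinearMap.lsmul ℝ ℝ) volume x₀)
      atTop (𝓝 (h x₀)) := by
    refine ContDiffBump.ae_convolution_tendsto_right_of_locallyIntegrable (K := 2) ?_ ?_ hh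
    · have := (tendsto_one_div_add_atTop_nhds_zero_nat (𝕜 := ℝ)).const_mul 2
      simpa [b, div_eq_mul_inv] using this
    · refine .of_forall fun n => ?_
      simp only [b]
      rw [mul_one_div]
  filter_upwards [h1] with x hx
  refine le_of_tendsto hx (.of_forall fun n => ?_)
  have ht : IsTest ((b n).normed volume) := ⟨(b n).contDiff_normed, (b n).hasCompactSupport_normed⟩
  have h2 := hB _ (ht.sub_comp x) (fun y => (b n).nonneg_normed _)
    (by rw [integral_sub_left_eq_self (fun y => (b n).normed volume y) volume x]; exact (b n).integral_normed)
  refine le_trans (le_of_eq ?_) h2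
  rw [convolution_eq_swap]
  congr 1 with y
  simp [mul_comm]

lemma ae_abs_le_of_integral_mul_le {h : Plane → ℝ} (hh : LocallyIntegrable h volume) {B : ℝ}
    (hB : ∀ η, IsTest η → |∫ x, h x * η x| ≤ B * ∫ x, |η x|) : ∀ᵐ x, |h x| ≤ B := by
  have e : ∀ η : Plane → ℝ, (∀ x, 0 ≤ η x) → ∫ x, |η x| = ∫ x, η x := fun η hη => by
    congr 1 with x; exact abs_of_nonneg (hη x)
  have h1 := ae_le_of_integral_mul_le hh (B := B) fun η h1 h2 h3 => by
    have := (le_abs_self _).trans (hB η h1)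
    rwa [e η h2, h3, mul_one] at this
  have h2 := ae_le_of_integral_mul_le hh.neg (B := B) fun η h1 h2 h3 => by
    have := (neg_le_abs _).trans (hB η h1)
    rw [e η h2, h3, mul_one, ← integral_neg] at this
    simpa using this
  filter_upwards [h1, h2] with x h3 h4
  simp only [Pi.neg_apply] at h4
  exact abs_le.mpr ⟨by linarith, h3⟩

lemma ULI.abs_cv_le {h ρ : Plane → ℝ} (hh : ULI h) (hρ : IsTest ρ) : ∃ D : ℝ, 0 ≤ D ∧ ∀ x, |cv h ρ x| ≤ D := by
  obtain ⟨r, L, hr, hL, hloc⟩ := exists_loc hρ.neg_arg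
  obtain ⟨C, hC⟩ := hh.bound r
  refine ⟨L * C, by positivity, fun x => ?_⟩
  have hlx := hloc x
  rw [← ENNReal.ofReal_le_ofReal_iff (by positivity), ← Real.norm_eq_abs, ofReal_norm]
  calc ‖cv h ρ x‖ₑ ≤ ∫⁻ y, ‖h y * ρ (x - y)‖ₑ := enorm_integral_le_lintegral_enorm _
    _ ≤ ∫⁻ y, ENNReal.ofReal L * (Metric.closedBall x r).indicator (fun y => ‖h y‖ₑ) y := by
        refine lintegral_mono fun y => ?_
        have h1 : ρ (x - y) = ρ (-(y - x)) := by congr 1; abel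
        by_cases h0 : ρ (x - y) = 0
        · simp [h0]
        rw [Set.indicator_of_mem (by simpa [dist_eq_norm] using hlx.supp y (by rwa [h1] at h0)), enorm_mul, mul_comm]
        gcongr
        rw [← ofReal_norm, h1]
        exact ENNReal.ofReal_le_ofReal (hlx.bd y)
    _ = ENNReal.ofReal L * ∫⁻ y in Metric.closedBall x r, ‖h y‖ₑ := by
        rw [lintegral_const_mul' _ _ ENNReal.ofReal_ne_top, lintegral_indicator Metric.isClosed_closedBall.measurableSet]
    _ ≤ ENNReal.ofReal L * C := by gcongr; exact hC x
    _ = _ := by rw [ENNReal.ofReal_mul hL, ENNReal.ofReal_coe_nnreal]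

lemma ULI.d2_cv {h ρ : Plane → ℝ} (hh : ULI h) (hρ : IsTest ρ) (z x : Plane) :
    d2 (cv h ρ) z x = ∫ y, h y * d2 (fun y => ρ (x - y)) z y := by
  have i : ∀ x', Integrable fun y => h y * ρ (x' - y) := fun x' =>
    hh.integrable_mul (hρ.sub_comp x').continuous (hρ.sub_comp x').2
  unfold d2 cv
  rw [← integral_const_mul, ← integral_sub ((i x).const_mul 2) (i _),
    ← integral_sub (f := fun y => 2 * (h y * ρ (x - y)) - h y * ρ (x + z - y)) (((i x).const_mul 2).sub (i _)) (i _)]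
  congr 1 with y
  beta_reduce
  rw [show x - (y + z) = x - z - y by abel, show x - (y - z) = x + z - y by abel]
  ring

lemma ULI.abs_d2_cv_le {h ρ : Plane → ℝ} (hh : ULI h) (hρ : IsTest ρ) :
    ∃ D : ℝ, 0 ≤ D ∧ ∀ z x, |d2 (cv h ρ) z x| ≤ D * (min 1 ‖z‖) ^ 2 := by
  obtain ⟨r, L, hr, hL, hloc⟩ := exists_loc hρ.neg_arg
  obtain ⟨C, hC⟩ := hh.bound r
  refine ⟨3 * C * L, by positivity, fun z x => ?_⟩
  have hlx : Loc (fun y => ρ (x - y)) x r L := by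
    have e : (fun y => ρ (-(y - x))) = fun y => ρ (x - y) := by ext y; congr 1; abel
    rw [← e]; exact hloc x
  rw [hh.d2_cv hρ, ← ENNReal.ofReal_le_ofReal_iff (by positivity), ← Real.norm_eq_abs, ofReal_norm]
  exact (enorm_integral_le_lintegral_enorm _).trans (lintegral_mul_d2_le hlx hh.meas hC z)

/-- The integral of the kernel of `Λ^σ` over the exterior of the unit ball. -/
def farMass (σ : ℝ) : ℝ := ∫ z in {z : Plane | 1 ≤ ‖z‖}, ‖z‖ ^ (-2 - σ)

lemma measurableSet_far : MeasurableSet {z : Plane | 1 ≤ ‖z‖} := measurableSet_le measurable_const (by fun_prop)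

lemma integrableOn_far {σ : ℝ} (hσ : 0 < σ) : IntegrableOn (fun z : Plane => ‖z‖ ^ (-2 - σ)) {z | 1 ≤ ‖z‖} := by
  refine ((integrable_krn hσ (lt_add_one σ)).integrableOn).congr_fun (fun z hz => ?_) measurableSet_far
  simp [krn, min_eq_left (show 1 ≤ ‖z‖ from hz)]

lemma farMass_pos {σ : ℝ} (hσ : 0 < σ) : 0 < farMass σ := by
  unfold farMass
  rw [setIntegral_pos_iff_support_of_nonneg_ae (.of_forall fun z => by positivity) (integrableOn_far hσ)]
  refine (Metric.isOpen_ball.measure_pos volume ⟨_, Metric.mem_ball_self (x := (EuclideanSpace.single 0 2 : Plane)) one_pos⟩).trans_le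
    (measure_mono fun z hz => ?_)
  have h1 : 1 ≤ ‖z‖ := by
    rw [Metric.mem_ball, dist_eq_norm] at hz
    have h2 : ‖(EuclideanSpace.single 0 2 : Plane)‖ = 2 := by simp
    have h3 := norm_sub_norm_le (EuclideanSpace.single 0 2 : Plane) z
    rw [norm_sub_rev] at h3
    linarith
  refine ⟨?_, h1⟩
  have : 0 < ‖z‖ := by linarith
  exact (by positivity : 0 < ‖z‖ ^ (-2 - σ)).ne'

/-- At a near-maximum of a smooth function, the singular integral controls the function. -/
lemma le_of_singular_integral {σ : ℝ} (hσ : 0 < σ) (hσ2 : σ < 2) {f : Plane → ℝ} (hf : Continuous f)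
    {D D' A E : ℝ} (hD : ∀ x, |f x| ≤ D) (hD' : ∀ z x, |d2 f z x| ≤ D' * (min 1 ‖z‖) ^ 2)
    (hA : ∀ x, ∫ z, d2 f z x * ‖z‖ ^ (-2 - σ) ≤ A)
    (hE : ∀ x, ∫ z in {z | 1 ≤ ‖z‖}, (f (x + z) + f (x - z)) * ‖z‖ ^ (-2 - σ) ≤ E) (x : Plane) :
    f x ≤ (A + E) / (2 * farMass σ) := by
  have hκ := farMass_pos hσ
  have hbdd : BddAbove (Set.range f) := ⟨D, by rintro _ ⟨y, rfl⟩; exact (le_abs_self _).trans (hD y)⟩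
  refine (le_ciSup hbdd x).trans ?_
  set m₀ := ⨆ x, f x
  have hle : ∀ y, f y ≤ m₀ := fun y => le_ciSup hbdd y
  set δ : ℕ → ℝ := fun n => 1 / ((n : ℝ) + 1)
  have hδ : Tendsto δ atTop (𝓝 0) := tendsto_one_div_add_atTop_nhds_zero_nat
  have hδ0 : ∀ n, 0 < δ n := fun n => by positivity
  have hD'0 : 0 ≤ D' := by
    have := (abs_nonneg _).trans (hD' (EuclideanSpace.single 0 1) 0)
    simpa using this
  have hme : ∀ c : ℝ, AEStronglyMeasurable (fun z : Plane => min c (D' * (min 1 ‖z‖) ^ 2) * ‖z‖ ^ (-2 - σ))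
      (volume.restrict {z : Plane | 1 ≤ ‖z‖}ᶜ) := fun c => Measurable.aestronglyMeasurable (by fun_prop)
  have hint := ((integrable_krn hσ hσ2).const_mul D')
  set e : ℕ → ℝ := fun n => ∫ z in {z : Plane | 1 ≤ ‖z‖}ᶜ, min (2 * δ n) (D' * (min 1 ‖z‖) ^ 2) * ‖z‖ ^ (-2 - σ)
  have hei : ∀ c : ℝ, 0 ≤ c → IntegrableOn (fun z : Plane => min c (D' * (min 1 ‖z‖) ^ 2) * ‖z‖ ^ (-2 - σ)) {z : Plane | 1 ≤ ‖z‖}ᶜ := by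
    intro c hc
    refine hint.integrableOn.mono' (hme c) (.of_forall fun z => ?_)
    rw [Real.norm_of_nonneg (by positivity), krn_two, ← mul_assoc]
    gcongr
    exact min_le_right _ _
  have he : Tendsto e atTop (𝓝 0) := by
    have h0 : (0 : ℝ) = ∫ z in {z : Plane | 1 ≤ ‖z‖}ᶜ, (0 : ℝ) := by simp
    rw [h0]
    refine tendsto_integral_of_dominated_convergence _ (fun n => hme _) hint.integrableOn
      (fun n => .of_forall fun z => ?_) (.of_forall fun z => ?_)
    · have := (hδ0 n).le
      rw [Real.norm_of_nonneg (by positivity), krn_two, ← mul_assoc]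
      gcongr
      exact min_le_right _ _
    · have h1 : Tendsto (fun n => min (2 * δ n) (D' * (min 1 ‖z‖) ^ 2)) atTop (𝓝 (min (2 * 0) (D' * (min 1 ‖z‖) ^ 2))) :=
        (hδ.const_mul 2).min tendsto_const_nhds
      have h2 := h1.mul_const (‖z‖ ^ (-2 - σ))
      rwa [mul_zero, min_eq_left (by positivity : (0 : ℝ) ≤ D' * (min 1 ‖z‖) ^ 2), zero_mul] at h2
  have key : ∀ n, 2 * farMass σ * (m₀ - δ n) ≤ A + E + e n := by
    intro n
    obtain ⟨y, hy⟩ := exists_lt_of_lt_ciSup (show m₀ - δ n < ⨆ x, f x by linarith [hδ0 n])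
    have hi : Integrable fun z => d2 f z y * ‖z‖ ^ (-2 - σ) := by
      refine hint.mono' (Measurable.aestronglyMeasurable ?_) (.of_forall fun z => ?_)
      · exact Measurable.mul (by unfold d2; fun_prop : Continuous fun z => d2 f z y).measurable (by fun_prop)
      · rw [norm_mul, Real.norm_of_nonneg (by positivity : (0 : ℝ) ≤ ‖z‖ ^ (-2 - σ)), krn_two, ← mul_assoc]
        gcongr; exact hD' z y
    have h1 := hA y
    rw [← integral_add_compl measurableSet_far hi] at h1
    have hi2 : IntegrableOn (fun z => (f (y + z) + f (y - z)) * ‖z‖ ^ (-2 - σ)) {z | 1 ≤ ‖z‖} := by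
      refine ((integrableOn_far hσ).const_mul (2 * D)).mono' (Measurable.aestronglyMeasurable ?_) (.of_forall fun z => ?_)
      · exact Measurable.mul (by fun_prop : Continuous fun z => f (y + z) + f (y - z)).measurable (by fun_prop)
      · rw [norm_mul, Real.norm_of_nonneg (by positivity : (0 : ℝ) ≤ ‖z‖ ^ (-2 - σ))]
        gcongr
        exact (norm_add_le _ _).trans (by linarith [hD (y + z), hD (y - z), Real.norm_eq_abs (f (y + z)), Real.norm_eq_abs (f (y - z))])
    have h2 : ∫ z in {z | 1 ≤ ‖z‖}, d2 f z y * ‖z‖ ^ (-2 - σ) = 2 * f y * farMass σ -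
        ∫ z in {z | 1 ≤ ‖z‖}, (f (y + z) + f (y - z)) * ‖z‖ ^ (-2 - σ) := by
      rw [farMass, ← integral_const_mul, ← integral_sub ((integrableOn_far hσ).const_mul _) hi2]
      congr 1 with z
      unfold d2; ring
    have h3 : -e n ≤ ∫ z in {z : Plane | 1 ≤ ‖z‖}ᶜ, d2 f z y * ‖z‖ ^ (-2 - σ) := by
      simp only [e]
      rw [← integral_neg]
      refine integral_mono (hei _ (by linarith [hδ0 n])).neg hi.integrableOn fun z => ?_
      simp only
      rw [← neg_mul]
      gcongr
      rw [neg_le]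
      refine le_min ?_ ((neg_le_abs _).trans (hD' z y))
      unfold d2
      linarith [hle (y + z), hle (y - z)]
    have h4 := hE y
    have h5 : 2 * farMass σ * (m₀ - δ n) ≤ 2 * f y * farMass σ := by nlinarith
    linarith
  have h6 : 2 * farMass σ * (m₀ - 0) ≤ A + E + 0 :=
    le_of_tendsto_of_tendsto' ((tendsto_const_nhds.sub hδ).const_mul _) (tendsto_const_nhds.add he) key
  rw [le_div_iff₀ (by positivity)]
  linarith

lemma enorm_le_of_ae_abs_le {h : Plane → ℝ} {M : ℝ} (hM : ∀ᵐ x, |h x| ≤ M) : ∀ᵐ x, ‖h x‖ₑ ≤ ENNReal.ofReal M := by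
  filter_upwards [hM] with x hx
  rw [← ofReal_norm]; exact ENNReal.ofReal_le_ofReal hx

lemma abs_integral_mul_le_of_bdd {h η : Plane → ℝ} {M : ℝ} (hM : ∀ᵐ x, |h x| ≤ M) (hη : Integrable η) :
    |∫ x, h x * η x| ≤ M * ∫ x, |η x| := by
  rw [← integral_const_mul]
  refine (abs_integral_le_integral_abs).trans ?_
  refine integral_mono_of_nonneg (.of_forall fun _ => abs_nonneg _) (hη.abs.const_mul M) ?_
  filter_upwards [hM] with x hx
  rw [abs_mul]; gcongr

/-- A uniformly locally square integrable function with bounded `Λ^σ` is bounded. -/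
lemma exists_bound_of_fracLap {σ : ℝ} (hσ : 0 < σ) (hσ2 : σ < 2) (M S : ℝ) (hM : 0 ≤ M) : ∃ B : ℝ, 0 ≤ B ∧
    ∀ w θ : Plane → ℝ, AEStronglyMeasurable w volume → UB w S →
      IsFracLap σ w θ → (∀ᵐ x, |θ x| ≤ M) → ∀ᵐ x, |w x| ≤ B := by
  obtain ⟨C, hC, hfar⟩ := UB.far hσ one_pos
  have hκ := farMass_pos hσ
  have hk := kcon_pos hσ hσ2
  refine ⟨(kcon σ * M + 2 * Real.sqrt (C * S)) / (2 * farMass σ), by positivity, fun w θ hm hS hfl hθ => ?_⟩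
  have hw := hS.uli hm
  have main : ∀ ρ, IsTest ρ → (∀ x, 0 ≤ ρ x) → ∫ x, ρ x = 1 → ∀ x, |cv w ρ x| ≤ (kcon σ * M + 2 * Real.sqrt (C * S)) / (2 * farMass σ) := by
    intro ρ hρ hρ0 hρ1 x
    have hρa : ∫ x, |ρ x| = 1 := by rw [← hρ1]; congr 1 with x; exact abs_of_nonneg (hρ0 x)
    have hf : Continuous (cv w ρ) := (cv_contDiff hw.locallyIntegrable hρ).continuous
    obtain ⟨D, -, hD⟩ := hw.abs_cv_le hρ
    obtain ⟨D', -, hD'⟩ := hw.abs_d2_cv_le hρ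
    have hA : ∀ x, |∫ z, d2 (cv w ρ) z x * ‖z‖ ^ (-2 - σ)| ≤ kcon σ * M := by
      intro x
      rw [← (hw.cv_fracLap hσ hσ2 hfl hρ x).2, abs_mul, abs_of_pos hk]
      gcongr
      refine (abs_integral_mul_le_of_bdd hθ (hρ.sub_comp x).integrable).trans_eq ?_
      rw [integral_sub_left_eq_self (fun y => |ρ y|) volume x, hρa, mul_one]
    have hUB := hS.cv hm hρ.integrable hρa
    have hE : ∀ x, |∫ z in {z | 1 ≤ ‖z‖}, (cv w ρ (x + z) + cv w ρ (x - z)) * ‖z‖ ^ (-2 - σ)| ≤ 2 * Real.sqrt (C * S) := by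
      intro x
      have hfx := hfar (cv w ρ) S hf.aestronglyMeasurable hUB x
      have hset : MeasurableSet {y : Plane | 1 ≤ ‖y - x‖} := measurableSet_le measurable_const (by fun_prop)
      set k : Plane → ℝ≥0∞ := {z : Plane | 1 ≤ ‖z‖}.indicator fun z => ENNReal.ofReal (‖z‖ ^ (-2 - σ))
      have hkm : Measurable k := Measurable.indicator (by fun_prop) measurableSet_far
      have e1 : ∫⁻ z, k z * ‖cv w ρ (x + z)‖ₑ ≤ ENNReal.ofReal (Real.sqrt (C * S)) := by
        refine le_trans (le_of_eq ?_) hfx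
        rw [← lintegral_indicator hset, ← lintegral_add_left_eq_self ({y : Plane | 1 ≤ ‖y - x‖}.indicator
          fun y => ENNReal.ofReal (‖y - x‖ ^ (-2 - σ)) * ‖cv w ρ y‖ₑ) x]
        congr 1 with z
        by_cases hz : 1 ≤ ‖z‖ <;> simp [k, Set.indicator, hz]
      have e2 : ∫⁻ z, k z * ‖cv w ρ (x - z)‖ₑ = ∫⁻ z, k z * ‖cv w ρ (x + z)‖ₑ := by
        rw [← lintegral_neg_eq_self]
        congr 1 with z
        simp [k, Set.indicator]
      rw [← ENNReal.ofReal_le_ofReal_iff (by positivity), ← Real.norm_eq_abs, ofReal_norm]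
      refine (enorm_integral_le_lintegral_enorm _).trans ?_
      rw [← lintegral_indicator measurableSet_far]
      calc _ ≤ ∫⁻ z, (k z * ‖cv w ρ (x + z)‖ₑ + k z * ‖cv w ρ (x - z)‖ₑ) := by
            refine lintegral_mono fun z => ?_
            by_cases hz : 1 ≤ ‖z‖
            · simp only [Set.indicator, Set.mem_ofPred_eq, hz, if_true, k]
              rw [← mul_add, enorm_mul, mul_comm]
              gcongr
              · rw [← ofReal_norm, Real.norm_of_nonneg (by positivity)]
              · exact enorm_add_le _ _
            · simp [Set.indicator, hz]
        _ ≤ ENNReal.ofReal (Real.sqrt (C * S)) + ENNReal.ofReal (Real.sqrt (C * S)) := by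
            have hm' : Measurable fun z => k z * ‖cv w ρ (x + z)‖ₑ :=
              hkm.mul (by fun_prop : Continuous fun z => cv w ρ (x + z)).measurable.enorm
            rw [lintegral_add_left hm', e2]
            gcongr
        _ = _ := by rw [← ENNReal.ofReal_add (by positivity) (by positivity)]; congr 1; ring
    rw [abs_le]
    constructor
    · rw [neg_le]
      have hneg : ∀ z x, d2 (fun x => -cv w ρ x) z x = -d2 (cv w ρ) z x := fun z x => by unfold d2; ring
      refine le_of_singular_integral hσ hσ2 (f := fun x => -cv w ρ x) hf.neg (D := D) (D' := D') (fun x => by simpa using hD x)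
        (fun z x => by rw [hneg, abs_neg]; exact hD' z x) (fun x => ?_) (fun x => ?_) x
      · simp_rw [hneg, neg_mul, integral_neg]
        exact (neg_le_abs _).trans (hA x)
      · refine le_trans (le_of_eq ?_) ((neg_le_abs _).trans (hE x))
        rw [← integral_neg]
        congr 1 with z
        ring
    · exact le_of_singular_integral hσ hσ2 hf hD hD' (fun x => (le_abs_self _).trans (hA x))
        (fun x => (le_abs_self _).trans (hE x)) x
  have h0 : ∀ η, IsTest η → (∀ x, 0 ≤ η x) → ∫ x, η x = 1 → |∫ x, w x * η x| ≤ (kcon σ * M + 2 * Real.sqrt (C * S)) / (2 * farMass σ) := by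
    intro η h1 h2 h3
    have := main (fun x => η (-x)) h1.neg_arg (fun x => h2 _) (by rw [integral_neg_eq_self η]; exact h3) 0
    simpa [cv] using this
  have h1 := ae_le_of_integral_mul_le hw.locallyIntegrable fun η h1 h2 h3 => (le_abs_self _).trans (h0 η h1 h2 h3)
  have h2 := ae_le_of_integral_mul_le hw.locallyIntegrable.neg fun η h1 h2 h3 => by
    have := (neg_le_abs _).trans (h0 η h1 h2 h3)
    rw [← integral_neg] at this
    simpa using this
  filter_upwards [h1, h2] with x h3 h4
  simp only [Pi.neg_apply] at h4
  exact abs_le.mpr ⟨by linarith, h3⟩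

lemma exists_int_near (a : Plane) : ∃ k : Fin 2 → ℤ, ‖a - WithLp.toLp 2 fun i => (k i : ℝ)‖ ≤ 1 := by
  refine ⟨fun i => round (a i), ?_⟩
  rw [EuclideanSpace.norm_eq, Real.sqrt_le_one, Fin.sum_univ_two]
  have h := fun i => abs_sub_round (a i)
  simp only [PiLp.sub_apply, Real.norm_eq_abs]
  nlinarith [h 0, h 1, abs_nonneg (a 0 - round (a 0)), abs_nonneg (a 1 - round (a 1))]

lemma ofReal_le_loc {φ : ℝ} (hφ : φ = 1) (a b : ℝ) :
    ‖a‖ₑ ^ 2 ≤ 2 * ENNReal.ofReal (a ^ 2 / 2 * φ + b ^ 2 / 2 * φ) ∧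
    ‖b‖ₑ ^ 2 ≤ 2 * ENNReal.ofReal (a ^ 2 / 2 * φ + b ^ 2 / 2 * φ) := by
  subst hφ
  have e : ∀ t : ℝ, ‖t‖ₑ ^ 2 = ENNReal.ofReal (t ^ 2) := fun t => by
    rw [← ofReal_norm, ← ENNReal.ofReal_pow (norm_nonneg _), Real.norm_eq_abs, sq_abs]
  have e2 : (2 : ℝ≥0∞) = ENNReal.ofReal 2 := by simp
  rw [e, e, e2, ← ENNReal.ofReal_mul (by norm_num)]
  constructor <;> apply ENNReal.ofReal_le_ofReal <;> nlinarith [sq_nonneg a, sq_nonneg b]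

lemma UB.of_uloc {φ₀ : Plane → ℝ} (hφ₀ : IsLocalizer φ₀) {w θ : Plane → ℝ} {S : ℝ}
    (h : ulocNormSq φ₀ w θ ≤ ENNReal.ofReal S) : UB w (2 * S) ∧ UB θ (2 * S) := by
  have key : ∀ a, ∃ k : Fin 2 → ℤ, ∀ x ∈ Metric.closedBall a 1, translate φ₀ k x = 1 := fun a => by
    obtain ⟨k, hk⟩ := exists_int_near a
    refine ⟨k, fun x hx => hφ₀.eq_one _ ?_⟩
    rw [Metric.mem_closedBall, dist_eq_norm] at hx
    calc _ = ‖(x - a) + (a - WithLp.toLp 2 fun i => (k i : ℝ))‖ := by congr 1; abel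
      _ ≤ _ := (norm_add_le _ _).trans (by linarith)
  have bound : ∀ k : Fin 2 → ℤ, 2 * locEnergy (translate φ₀ k) w θ ≤ ENNReal.ofReal (2 * S) := fun k => by
    rw [ENNReal.ofReal_mul (by norm_num)]
    simpa using mul_le_mul_right ((le_iSup (fun k => locEnergy (translate φ₀ k) w θ) k).trans h) 2
  constructor
  · intro a
    obtain ⟨k, hk⟩ := key a
    refine le_trans ?_ (bound k)
    rw [locEnergy, ← lintegral_const_mul' _ _ (by norm_num)]
    refine le_trans (lintegral_mono_ae ?_) (setLIntegral_le_lintegral (Metric.closedBall a 1) _)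
    filter_upwards [ae_restrict_mem Metric.isClosed_closedBall.measurableSet] with x hx
    exact (ofReal_le_loc (hk x hx) _ _).1
  · intro a
    obtain ⟨k, hk⟩ := key a
    refine le_trans ?_ (bound k)
    rw [locEnergy, ← lintegral_const_mul' _ _ (by norm_num)]
    refine le_trans (lintegral_mono_ae ?_) (setLIntegral_le_lintegral (Metric.closedBall a 1) _)
    filter_upwards [ae_restrict_mem Metric.isClosed_closedBall.measurableSet] with x hx
    exact (ofReal_le_loc (hk x hx) _ _).2

lemma integral_translate (φ₀ : Plane → ℝ) (k : Fin 2 → ℤ) : ∫ x, translate φ₀ k x = ∫ x, φ₀ x := by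
  unfold translate; exact integral_sub_right_eq_self φ₀ _

lemma ulocNormSq_le_of_bdd {φ₀ : Plane → ℝ} (hφ₀ : IsLocalizer φ₀) {w θ : Plane → ℝ} {B : ℝ}
    (hw : ∀ᵐ x, |w x| ≤ B) (hθ : ∀ᵐ x, |θ x| ≤ B) :
    ulocNormSq φ₀ w θ ≤ ENNReal.ofReal (B ^ 2 * ∫ x, φ₀ x) := by
  refine iSup_le fun k => ?_
  have hi : Integrable (translate φ₀ k) := (hφ₀.test.comp_sub _).integrable
  rw [← integral_translate φ₀ k, ← integral_const_mul, ofReal_integral_eq_lintegral_ofReal (hi.const_mul _)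
    (.of_forall fun x => mul_nonneg (sq_nonneg _) (hφ₀.nonneg _))]
  refine lintegral_mono_ae ?_
  filter_upwards [hw, hθ] with x h1 h2
  apply ENNReal.ofReal_le_ofReal
  have h3 := sq_le_sq' (abs_le.mp h1).1 (abs_le.mp h1).2
  have h4 := sq_le_sq' (abs_le.mp h2).1 (abs_le.mp h2).2
  have := hφ₀.nonneg (x - WithLp.toLp 2 fun i => (k i : ℝ))
  calc _ ≤ B ^ 2 / 2 * translate φ₀ k x + B ^ 2 / 2 * translate φ₀ k x := by
        unfold translate; gcongr
    _ = _ := by ring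

lemma ULI.of_bdd {h : Plane → ℝ} (hm : AEStronglyMeasurable h volume) {B : ℝ} (hB : ∀ᵐ x, |h x| ≤ B) : ULI h := by
  refine ⟨hm, fun r => ⟨(ENNReal.ofReal B * volume (Metric.closedBall (0 : Plane) r)).toNNReal, fun a => ?_⟩⟩
  rw [ENNReal.coe_toNNReal (ENNReal.mul_ne_top ENNReal.ofReal_ne_top measure_closedBall_lt_top.ne),
    ← Measure.addHaar_closedBall_center volume a, ← setLIntegral_const]
  exact lintegral_mono_ae (ae_restrict_of_ae (enorm_le_of_ae_abs_le hB))

lemma IsTest.integrable_fracLap {η : Plane → ℝ} (h : IsTest η) {σ : ℝ} (hσ : 0 < σ) (hσ2 : σ < 2) :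
    Integrable (fracLapTest σ η) := by
  have := (ULI.of_bdd (h := fun _ => 1) (B := 1) aestronglyMeasurable_const (by simp)).integrable_mul_fracLap h hσ hσ2
  simpa using this

lemma integral_abs_cv_le {ζ η : Plane → ℝ} (hζ : Integrable ζ) (hη : IsTest η) :
    Integrable (cv ζ η) ∧ ∫ x, |cv ζ η x| ≤ (∫ x, |ζ x|) * ∫ x, |η x| := by
  have hm := aestronglyMeasurable_cv hζ.1 hη.continuous.aestronglyMeasurable
  have h1 : ∫⁻ x, ‖cv ζ η x‖ₑ ≤ ENNReal.ofReal ((∫ x, |ζ x|) * ∫ x, |η x|) := by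
    calc ∫⁻ x, ‖cv ζ η x‖ₑ ≤ ∫⁻ x, ∫⁻ y, ‖ζ y‖ₑ * ‖η (x - y)‖ₑ := by
          refine lintegral_mono fun x => (enorm_integral_le_lintegral_enorm _).trans_eq ?_
          simp_rw [enorm_mul]
      _ = ∫⁻ y, ‖ζ y‖ₑ * ∫⁻ x, ‖η x‖ₑ := by
          rw [lintegral_lintegral_swap]
          · congr 1 with y
            rw [lintegral_const_mul' _ _ enorm_ne_top, lintegral_sub_right_eq_self (fun x => ‖η x‖ₑ) y]
          · have := hη.continuous
            exact hζ.1.comp_snd.enorm.mul (by fun_prop : Continuous fun p : Plane × Plane => η (p.1 - p.2)).measurable.enorm.aemeasurable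
      _ = _ := by
          rw [lintegral_mul_const'' _ hζ.1.enorm, lintegral_enorm_eq hζ, lintegral_enorm_eq hη.integrable,
            ENNReal.ofReal_mul (integral_nonneg fun _ => abs_nonneg _)]
  have hi : Integrable (cv ζ η) := ⟨hm, h1.trans_lt ENNReal.ofReal_lt_top⟩
  refine ⟨hi, ?_⟩
  rwa [lintegral_enorm_eq hi, ENNReal.ofReal_le_ofReal_iff
    (mul_nonneg (integral_nonneg fun _ => abs_nonneg _) (integral_nonneg fun _ => abs_nonneg _))] at h1

/-- Testing a truncation of a bounded function against `Λ^σ ζ`. -/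
lemma abs_integral_truncation_le {σ : ℝ} (hσ : 0 < σ) (hσ1 : σ < 1) {w θ ψ ζ : Plane → ℝ} {B M L : ℝ}
    (hm : AEStronglyMeasurable w volume) (hw : ∀ᵐ x, |w x| ≤ B) (hθ : ∀ᵐ x, |θ x| ≤ M)
    (hfl : IsFracLap σ w θ) (hψ : IsTest ψ) (hL : 0 ≤ L) (hψL : ∀ x, |ψ x| ≤ L)
    (hd : ∀ x y, |ψ x - ψ y| ≤ L * min 1 ‖x - y‖) (hζ : IsTest ζ) :
    |∫ x, w x * ψ x * fracLapTest σ ζ x| ≤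
      (M * L + B * (2 * (L * ∫ z, krn 1 σ z)) / kcon σ) * ∫ x, |ζ x| := by
  have hσ2 : σ < 2 := by linarith
  have hk := kcon_pos hσ hσ2
  have hψζ : IsTest fun x => ψ x * ζ x := hψ.mul_contDiff hζ.1
  have hc1 := lintegral_comm_le hσ hσ1 hL hψ.continuous hζ.continuous hd
  have hI0 : 0 ≤ 2 * (L * ∫ z, krn 1 σ z) := by
    have : 0 ≤ ∫ z, krn 1 σ z := integral_nonneg fun z => krn_nonneg _ _ _
    positivity
  rw [lintegral_enorm_eq hζ.integrable, ← ENNReal.ofReal_mul hI0] at hc1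
  have hci : Integrable (comm σ ψ ζ) :=
    ⟨aestronglyMeasurable_comm hψ.continuous hζ.continuous, hc1.trans_lt ENNReal.ofReal_lt_top⟩
  rw [lintegral_enorm_eq hci, ENNReal.ofReal_le_ofReal_iff
    (mul_nonneg hI0 (integral_nonneg fun _ => abs_nonneg _))] at hc1
  have e : ∀ x, w x * ψ x * fracLapTest σ ζ x = w x * fracLapTest σ (fun x => ψ x * ζ x) x - (kcon σ)⁻¹ * (w x * comm σ ψ ζ x) := by
    intro x
    have h1 := fracLapTest_mul hσ hσ2 hψζ x (hζ.integrable_d2 hσ hσ2 x)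
    rw [← fracLapTest_eq_integral hσ hσ2 hζ] at h1
    field_simp
    linear_combination (-w x) * h1
  have hB0 : 0 ≤ B := by
    obtain ⟨x, hx⟩ := hw.exists
    exact (abs_nonneg _).trans hx
  have hM0 : 0 ≤ M := by
    obtain ⟨x, hx⟩ := hθ.exists
    exact (abs_nonneg _).trans hx
  have i1 := (ULI.of_bdd hm hw).integrable_mul_fracLap hψζ hσ hσ2
  have i2 : Integrable fun x => w x * comm σ ψ ζ x := hci.bdd_mul hm hw
  simp_rw [e]
  rw [integral_sub i1 (i2.const_mul _), integral_const_mul, ← hfl _ hψζ]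
  have b1 : |∫ x, θ x * (ψ x * ζ x)| ≤ M * (L * ∫ x, |ζ x|) := by
    refine (abs_integral_mul_le_of_bdd hθ hψζ.integrable).trans ?_
    gcongr
    rw [← integral_const_mul]
    refine integral_mono hψζ.integrable.abs (hζ.integrable.abs.const_mul _) fun x => ?_
    simp only [abs_mul]
    gcongr; exact hψL x
  have b2 := abs_integral_mul_le_of_bdd hw hci
  calc _ ≤ M * (L * ∫ x, |ζ x|) + (kcon σ)⁻¹ * (B * (2 * (L * ∫ z, krn 1 σ z) * ∫ x, |ζ x|)) := by
        refine (abs_sub _ _).trans (add_le_add b1 ?_)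
        rw [abs_mul, abs_of_pos (inv_pos.mpr hk)]
        gcongr
        exact b2.trans (by gcongr)
    _ = _ := by field_simp

/-- Bounds at the initial time, depending only on the bounds of the datum. -/
lemma exists_initial_bound {s : ℝ} (hs : 0 < s) (hs' : s < 1) {φ₀ χ ρ : Plane → ℝ} (hφ₀ : IsLocalizer φ₀)
    (hχ : IsTruncation χ) (hρ : IsMollifier ρ) (M N : ℝ≥0) : ∃ B : ℝ, 0 ≤ B ∧
    ∀ w₀ θ₀ : Plane → ℝ, AEStronglyMeasurable w₀ volume → IsFracLap s w₀ θ₀ → eLpNorm θ₀ ⊤ volume ≤ M →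
      ulocNormSq φ₀ w₀ θ₀ ≤ (N : ℝ≥0∞) ^ 2 → ∀ R ε : ℝ, 1 < R → 0 < ε → ∀ w θ : Plane → ℝ,
      MemLp w 2 volume → MemLp θ 2 volume → IsFracLap s w θ →
      (∀ η, IsTest η → ∫ x, w x * η x = ∫ x, truncDatum χ ρ R ε w₀ x * η x) →
      (∀ᵐ x, |w x| ≤ B) ∧ ∀ᵐ x, |θ x| ≤ B := by
  obtain ⟨B₀, hB₀, hb⟩ := exists_bound_of_fracLap hs (by linarith : s < 2) (M : ℝ) (2 * (N : ℝ) ^ 2) M.2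
  obtain ⟨r, L, hr, hL, hloc⟩ := exists_loc hχ.test
  have hχL : Loc χ 0 r L := by simpa using hloc 0
  set P := ∫ x, |ρ x|
  have hP : 0 ≤ P := integral_nonneg fun _ => abs_nonneg _
  have hk := kcon_pos hs (by linarith : s < 2)
  have hI : 0 ≤ ∫ z, krn 1 s z := integral_nonneg fun z => krn_nonneg _ _ _
  set K := (M : ℝ) * L + B₀ * (2 * (L * ∫ z, krn 1 s z)) / kcon s
  have hK : 0 ≤ K := by positivity
  refine ⟨L * B₀ * P + K * P, by positivity, fun w₀ θ₀ hm hfl hM hN R ε hR hε w θ hw hθ hwθ hwi => ?_⟩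
  have hθ₀ : ∀ᵐ x, |θ₀ x| ≤ M := by
    have := ae_le_eLpNormEssSup (f := θ₀) (μ := (volume : Measure Plane))
    rw [eLpNorm_exponent_top] at hM
    filter_upwards [this] with x hx
    have h1 := hx.trans hM
    rw [← Real.norm_eq_abs]
    rw [← ofReal_norm, ← ENNReal.ofReal_coe_nnreal] at h1
    exact (ENNReal.ofReal_le_ofReal_iff M.coe_nonneg).mp h1
  have hUB : UB w₀ (2 * (N : ℝ) ^ 2) := by
    refine (UB.of_uloc hφ₀ (hN.trans_eq ?_)).1
    rw [ENNReal.ofReal_pow N.coe_nonneg]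
    simp
  have hw₀ := hb w₀ θ₀ hm hUB hfl hθ₀
  have hRp : 0 < R := by linarith
  -- the truncated datum
  set χR : Plane → ℝ := fun y => χ (R⁻¹ • y)
  have hχR : IsTest χR := ⟨hχ.test.1.comp (contDiff_const_smul _), hχ.test.2.comp_homeomorph (Homeomorph.smulOfNeZero R⁻¹ (inv_ne_zero hRp.ne'))⟩
  have hχRL : ∀ x, |χR x| ≤ L := fun x => hχL.bd _
  have hχRd : ∀ x y, |χR x - χR y| ≤ L * min 1 ‖x - y‖ := fun x y => by
    refine (hχL.d1 _ _).trans ?_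
    gcongr
    rw [← smul_sub, norm_smul, norm_inv, Real.norm_of_nonneg hRp.le]
    exact mul_le_of_le_one_left (norm_nonneg _) (inv_le_one_of_one_le₀ hR.le)
  set ρε : Plane → ℝ := fun y => (ε ^ 2)⁻¹ * ρ (ε⁻¹ • y)
  have hρε : IsTest ρε := ⟨contDiff_const.mul (hρ.test.1.comp (contDiff_const_smul _)),
    (hρ.test.2.comp_homeomorph (Homeomorph.smulOfNeZero ε⁻¹ (inv_ne_zero hε.ne'))).mul_left⟩
  have hρεI : ∫ x, |ρε x| = P := by
    simp only [ρε, abs_mul, abs_of_pos (inv_pos.mpr (pow_pos hε 2))]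
    rw [integral_const_mul, Measure.integral_comp_smul volume (fun x => |ρ x|) ε⁻¹]
    simp only [finrank_euclideanSpace, Fintype.card_fin, smul_eq_mul]
    rw [abs_of_pos (by positivity)]
    field_simp
    rfl
  set p : Plane → ℝ := fun y => χR y * w₀ y
  have hpb : ∀ᵐ y, |p y| ≤ L * B₀ := by
    filter_upwards [hw₀] with y hy
    simp only [p, abs_mul]
    exact mul_le_mul (hχRL y) hy (abs_nonneg _) hL
  have hpi : Integrable p := by
    have := hχR.integrable.bdd_mul hm hw₀
    exact this.congr (.of_forall fun y => mul_comm _ _)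
  have hp2 : MemLp p 2 volume := by
    rw [memLp_two_iff_integrable_sq_norm hpi.1]
    refine (hpi.norm.const_mul (L * B₀)).mono' (hpi.1.norm.pow 2) ?_
    filter_upwards [hpb] with y hy
    rw [Real.norm_of_nonneg (by positivity), pow_two]
    gcongr; exact hy
  have htr : truncDatum χ ρ R ε w₀ = cv p ρε := by
    ext x
    unfold truncDatum cv
    congr 1 with y
    simp only [ρε, p, χR]; ring
  have htrb : ∀ x, |cv p ρε x| ≤ L * B₀ * P := fun x => by
    refine (abs_integral_mul_le_of_bdd hpb (hρε.sub_comp x).integrable).trans_eq ?_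
    rw [integral_sub_left_eq_self (fun y => |ρε y|) volume x, hρεI]
  rw [htr] at hwi
  have hc := (cv_contDiff hpi.locallyIntegrable hρε).continuous
  have hwc : w =ᵐ[volume] cv p ρε := by
    refine ae_eq_of_integral_contDiff_smul_eq (ULI.of_memLp hw).locallyIntegrable hc.locallyIntegrable fun g h1 h2 => ?_
    have := hwi g ⟨h1, h2⟩
    simpa [mul_comm] using this
  refine ⟨?_, ?_⟩
  · filter_upwards [hwc] with x hx
    rw [hx]
    exact (htrb x).trans (le_add_of_nonneg_right (by positivity))
  · have h1 := ae_abs_le_of_integral_mul_le (ULI.of_memLp hθ).locallyIntegrable (B := K * P) fun η hη => ?_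
    · filter_upwards [h1] with x hx
      exact hx.trans (le_add_of_nonneg_left (by positivity))
    set ζ : Plane → ℝ := fun z => ρε (-z)
    have hζ : IsTest ζ := hρε.neg_arg
    rw [hwθ η hη]
    have e1 : ∫ x, w x * fracLapTest s η x = ∫ x, cv p ρε x * fracLapTest s η x := by
      refine integral_congr_ae ?_
      filter_upwards [hwc] with x hx
      rw [hx]
    have hsy := isSymb_lamS hs.le (by linarith : s ≤ 4)
    rw [e1, integral_cv_mul hp2 hρε.continuous (hρε.memLp 2) (hη.integrable_fracLap hs (by linarith)), cv_comm,
      fracLapTest_eq, ← multiplier_cv hsy hζ hη, ← fracLapTest_eq]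
    have h2 := abs_integral_truncation_le hs hs' hm hw₀ hθ₀ hfl hχR hL hχRL hχRd (hζ.cv hη)
    have e2 : ∀ x, p x * fracLapTest s (cv ζ η) x = w₀ x * χR x * fracLapTest s (cv ζ η) x := fun x => by
      simp only [p]; ring
    simp_rw [e2]
    refine h2.trans ?_
    rw [mul_assoc K]
    gcongr
    refine (integral_abs_cv_le hζ.integrable hη).2.trans_eq ?_
    rw [integral_neg_eq_self (fun x => |ρε x|), hρεI]

/-! ### Relations between square integrable functions given by multipliers -/

lemma integral_cv_mul_two {f k ρ : Plane → ℝ} (hf : MemLp f 2 volume) (hk : MemLp k 2 volume) (hρ : IsTest ρ) :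
    ∫ x, cv f ρ x * k x = ∫ x, f x * cv k (fun z => ρ (-z)) x := by
  apply Complex.ofReal_injective
  rw [← parseval (memLp_cv hf hρ.integrable) hk, ← parseval hf (memLp_cv hk hρ.neg_arg.integrable)]
  apply integral_congr_ae
  filter_upwards [ft_cv hf hρ, ft_cv hk hρ.neg_arg] with ξ h1 h2
  rw [h1, h2, hat_neg_arg, map_mul, conj_conj]; ring

lemma IsSymb.continuous_multiplier {m : Plane → ℂ} (hm : IsSymb m) {η : Plane → ℝ} (hη : IsTest η) :
    Continuous (multiplier m η) := by
  have h := VectorFourier.fourierIntegral_continuous (μ := (volume : Measure Plane))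
    (L := -(innerₗ Plane)) (e := Real.fourierChar) Real.continuous_fourierChar
    (by simpa using! continuous_inner.neg) (hm.integrable hη)
  have e1 : 𝓕⁻ (fun ξ => m ξ * hat η ξ) = VectorFourier.fourierIntegral Real.fourierChar volume (-(innerₗ Plane)) (fun ξ => m ξ * hat η ξ) := rfl
  rw [← e1] at h
  exact Complex.continuous_re.comp h

/-- `g` is obtained from `f` by the transpose of the multiplier with symbol `m`. -/
def MulRel (m : Plane → ℂ) (f g : Plane → ℝ) : Prop :=
  ∀ η : Plane → ℝ, IsTest η → ∫ x, g x * η x = ∫ x, f x * multiplier m η x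

lemma MulRel.cv {m : Plane → ℂ} (hm : IsSymb m) {f g ρ : Plane → ℝ} (h : MulRel m f g) (hf : MemLp f 2 volume)
    (hg : MemLp g 2 volume) (hρ : IsTest ρ) : MulRel m (SQG.cv f ρ) (SQG.cv g ρ) := by
  intro η hη
  rw [integral_cv_mul_two hg (hη.memLp 2) hρ, integral_cv_mul_two hf (hm.memLp_multiplier hη) hρ, h _ (hη.cv hρ.neg_arg),
    cv_comm, multiplier_cv hm hρ.neg_arg hη, cv_comm]

lemma MulRel.ft {m : Plane → ℂ} (hm : IsSymb m) {f g : Plane → ℝ} (h : MulRel m f g) (hf : MemLp f 2 volume)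
    (hg : MemLp g 2 volume) : SQG.ft g =ᵐ[volume] fun ξ => conj (m ξ) * SQG.ft f ξ :=
  ft_of_multiplier hf hg hm h

lemma MulRel.integral_multiplier {m m' m'' : Plane → ℂ} (hm : IsSymb m) (hm' : IsSymb m') (hm'' : IsSymb m'')
    (e : ∀ ξ, m'' ξ = m ξ * m' ξ) {f g η : Plane → ℝ} (h : MulRel m f g) (hf : MemLp f 2 volume)
    (hg : MemLp g 2 volume) (hη : IsTest η) :
    ∫ x, g x * multiplier m' η x = ∫ x, f x * multiplier m'' η x := by
  apply Complex.ofReal_injective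
  rw [hm'.integral_mul hη hg, hm''.integral_mul hη hf]
  apply integral_congr_ae
  filter_upwards [h.ft hm hf hg] with ξ h1
  rw [h1, e, map_mul, map_mul, map_mul]; ring

lemma mulRel_test {m : Plane → ℂ} (hm : IsSymb m) (hc : ∀ ξ, conj (m ξ) = m ξ) {f : Plane → ℝ} (hf : IsTest f) :
    MulRel m f (multiplier m f) := by
  intro η hη
  apply Complex.ofReal_injective
  rw [← parseval (hm.memLp_multiplier hf) (hη.memLp 2), hm.integral_mul hη (hf.memLp 2)]
  apply integral_congr_ae
  filter_upwards [hm.ft_multiplier hf, hf.ft_eq, hη.ft_eq] with ξ h1 h2 h3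
  rw [h1, h2, h3, map_mul, hc]; ring

lemma n2_multiplier_sq {m : Plane → ℂ} (hm : IsSymb m) {η : Plane → ℝ} (hη : IsTest η) :
    n2 (multiplier m η) ^ 2 = ∫ ξ, ‖m ξ * hat η ξ‖ ^ 2 := by
  rw [n2_eq_ft (hm.memLp_multiplier hη)]
  apply integral_congr_ae
  filter_upwards [hm.ft_multiplier hη] with ξ h
  rw [h]

lemma n2_test_sq {η : Plane → ℝ} (hη : IsTest η) : n2 η ^ 2 = ∫ ξ, ‖hat η ξ‖ ^ 2 := by
  have := n2_multiplier_sq isSymb_one hη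
  rw [hη.multiplier_one] at this
  simpa using this

lemma n2_multiplier_sq_le {m m' : Plane → ℂ} (hm : IsSymb m) (hm' : IsSymb m') (h : ∀ ξ, ‖m ξ‖ ≤ 1 + ‖m' ξ‖)
    {η : Plane → ℝ} (hη : IsTest η) :
    n2 (multiplier m η) ^ 2 ≤ 2 * n2 η ^ 2 + 2 * n2 (multiplier m' η) ^ 2 := by
  have i0 : Integrable fun ξ => ‖hat η ξ‖ ^ 2 := by
    have := (isSymb_one.memLp hη).integrable_norm_pow (p := 2) (by norm_num)
    simpa using this
  have i1 : Integrable fun ξ => ‖m' ξ * hat η ξ‖ ^ 2 := (hm'.memLp hη).integrable_norm_pow (p := 2) (by norm_num)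
  have i2 : Integrable fun ξ => ‖m ξ * hat η ξ‖ ^ 2 := (hm.memLp hη).integrable_norm_pow (p := 2) (by norm_num)
  rw [n2_multiplier_sq hm hη, n2_multiplier_sq hm' hη, n2_test_sq hη, ← integral_const_mul, ← integral_const_mul,
    ← integral_add (i0.const_mul 2) (i1.const_mul 2)]
  refine integral_mono i2 ((i0.const_mul 2).add (i1.const_mul 2)) fun ξ => ?_
  simp only [norm_mul]
  have h1 := h ξ
  have h2 := norm_nonneg (m ξ)
  have h3 := norm_nonneg (m' ξ)
  calc (‖m ξ‖ * ‖hat η ξ‖) ^ 2 ≤ ((1 + ‖m' ξ‖) * ‖hat η ξ‖) ^ 2 := by gcongr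
    _ = (1 + ‖m' ξ‖) ^ 2 * ‖hat η ξ‖ ^ 2 := by ring
    _ ≤ (2 + 2 * ‖m' ξ‖ ^ 2) * ‖hat η ξ‖ ^ 2 := by gcongr; nlinarith [sq_nonneg (1 - ‖m' ξ‖)]
    _ = _ := by ring

lemma n2_multiplier_le {m : Plane → ℂ} (hm : IsSymb m) (h : ∀ ξ, ‖m ξ‖ ≤ 1) {η : Plane → ℝ} (hη : IsTest η) :
    n2 (multiplier m η) ≤ n2 η := by
  rw [← abs_of_nonneg (n2_nonneg (multiplier m η)), ← abs_of_nonneg (n2_nonneg η), ← sq_le_sq,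
    n2_multiplier_sq hm hη, n2_test_sq hη]
  refine integral_mono ((hm.memLp hη).integrable_norm_pow (p := 2) (by norm_num)) ?_ fun ξ => ?_
  · have := (isSymb_one.memLp hη).integrable_norm_pow (p := 2) (by norm_num)
    simpa using this
  · simp only [norm_mul]
    gcongr
    exact mul_le_of_le_one_left (norm_nonneg _) (h ξ)

lemma n2_add_sq_le {f g : Plane → ℝ} (hf : MemLp f 2 volume) (hg : MemLp g 2 volume) :
    n2 (fun x => f x + g x) ^ 2 ≤ 2 * n2 f ^ 2 + 2 * n2 g ^ 2 := by
  rw [n2_sq, n2_sq, n2_sq, ← integral_const_mul, ← integral_const_mul,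
    ← integral_add (hf.integrable_sq.const_mul 2) (hg.integrable_sq.const_mul 2)]
  refine integral_mono (hf.add hg).integrable_sq ((hf.integrable_sq.const_mul 2).add (hg.integrable_sq.const_mul 2)) fun x => ?_
  nlinarith [sq_nonneg (f x - g x)]

lemma n2_const_mul_sq (c : ℝ) (f : Plane → ℝ) : n2 (fun x => c * f x) ^ 2 = c ^ 2 * n2 f ^ 2 := by
  rw [n2_sq, n2_sq, ← integral_const_mul]
  congr 1 with x; ring

/-! ### The velocity -/

/-- The symbols of the components of `R^⊥`. -/
def uS (j : Fin 2) (ξ : Plane) : ℂ := if j = 0 then oddS 0 1 ξ else -oddS 0 0 ξ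

lemma oddS_zero (i : Fin 2) (ξ : Plane) : oddS 0 i ξ = I * ((ξ i / ‖ξ‖ : ℝ) : ℂ) := by simp [oddS]

lemma rieszTest_eq (i : Fin 2) : rieszTest i = multiplier (oddS 0 i) := by
  unfold rieszTest
  congr 1; ext ξ; rw [oddS_zero]

lemma multiplier_neg (m : Plane → ℂ) (η : Plane → ℝ) (x : Plane) :
    multiplier (fun ξ => -m ξ) η x = -multiplier m η x := by
  unfold multiplier
  simp only [Real.fourierInv_eq', neg_mul, smul_neg, integral_neg, Complex.neg_re]

lemma IsSymb.neg {m : Plane → ℂ} (hm : IsSymb m) : IsSymb fun ξ => -m ξ := by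
  obtain ⟨C, hC, h1⟩ := hm.bound
  exact ⟨hm.meas.neg, ⟨C, hC, fun ξ => by rw [norm_neg]; exact h1 ξ⟩, fun ξ => by simp [hm.herm]⟩

lemma isSymb_uS (j : Fin 2) : IsSymb (uS j) := by
  by_cases h : j = 0
  · have : uS j = oddS 0 1 := by ext ξ; simp [uS, h]
    rw [this]; exact isSymb_oddS le_rfl (by norm_num) 1
  · have : uS j = fun ξ => -oddS 0 0 ξ := by ext ξ; simp [uS, h]
    rw [this]; exact (isSymb_oddS le_rfl (by norm_num) 0).neg

lemma norm_oddS_zero_le (i : Fin 2) (ξ : Plane) : ‖oddS 0 i ξ‖ ≤ 1 := by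
  rw [oddS_zero, norm_mul, norm_I, one_mul, norm_real]
  exact abs_coord_div_le i ξ

lemma norm_uS_le (j : Fin 2) (ξ : Plane) : ‖uS j ξ‖ ≤ 1 := by
  unfold uS
  split_ifs
  · exact norm_oddS_zero_le _ _
  · rw [norm_neg]; exact norm_oddS_zero_le _ _

lemma IsRieszPerp.mulRel {θ : Plane → ℝ} {u : Plane → Plane} (h : IsRieszPerp θ u) (j : Fin 2) :
    MulRel (uS j) θ (fun x => u x j) := by
  intro η hη
  obtain ⟨h0, h1⟩ := h η hη
  fin_cases j
  · have : uS 0 = oddS 0 1 := by ext ξ; simp [uS]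
    simp only [Fin.zero_eta, this, ← rieszTest_eq]
    exact h0
  · have : uS 1 = fun ξ => -oddS 0 0 ξ := by ext ξ; simp [uS]
    simp only [Fin.mk_one, this, multiplier_neg, ← rieszTest_eq, mul_neg, integral_neg]
    exact h1

lemma fracGradTest_eq (s : ℝ) (j : Fin 2) : fracGradTest s j = multiplier (oddS (1 - s) j) := by
  unfold fracGradTest
  congr 1; ext ξ
  rw [oddS, mul_assoc, ← Complex.ofReal_mul]
  congr 2
  rcases eq_or_ne ξ 0 with rfl | h
  · simp
  have hp := norm_pos_iff.mpr h
  rw [show 1 - s = -s + 1 by ring, Real.rpow_add_one (by positivity)]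
  field_simp

lemma sum_uS_mul (ξ : Plane) : ∑ j, uS j ξ * (I * ((2 * Real.pi * ξ j : ℝ) : ℂ)) = 0 := by
  rw [Fin.sum_univ_two]
  simp only [uS, oddS_zero]
  push_cast
  simp
  ring

/-- A velocity given by `R^⊥` is divergence free. -/
lemma sum_integral_mul_pd {θ : Plane → ℝ} {u : Fin 2 → Plane → ℝ} (hθ : MemLp θ 2 volume) (hu : ∀ j, MemLp (u j) 2 volume)
    (h : ∀ j, MulRel (uS j) θ (u j)) {η : Plane → ℝ} (hη : IsTest η) : ∑ j, ∫ x, u j x * pd j η x = 0 := by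
  apply Complex.ofReal_injective
  rw [Complex.ofReal_sum]
  have e : ∀ j, ((∫ x, u j x * pd j η x : ℝ) : ℂ) = ∫ ξ, ft θ ξ * conj (uS j ξ * (I * ((2 * Real.pi * ξ j : ℝ) : ℂ)) * hat η ξ) := fun j => by
    rw [integral_ft_mul_hat (hu j) (hη.pd j)]
    apply integral_congr_ae
    filter_upwards [(h j).ft (isSymb_uS j) hθ (hu j)] with ξ h1
    rw [h1, hη.hat_pd]
    simp only [map_mul]
    ring
  simp_rw [e]
  rw [← integral_finsetSum]
  · simp only [← Finset.mul_sum, ← map_sum, ← Finset.sum_mul, sum_uS_mul]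
    simp
  · intro j _
    have h1 := integrable_ft_mul (f := θ) (isSymb_uS j) (hη.pd j)
    refine h1.congr (.of_forall fun ξ => ?_)
    simp only [hη.hat_pd]
    congr 2; ring

/-! ### Pairing with far away functions -/

lemma lintegral_enorm_le_of_supp {ζ : Plane → ℝ} (hζ : IsTest ζ) {a : Plane} {r : ℝ} (hs : ∀ x, ζ x ≠ 0 → ‖x - a‖ ≤ r) :
    ∫⁻ y, ‖ζ y‖ₑ ≤ ENNReal.ofReal (Real.sqrt (volume (Metric.closedBall (0 : Plane) r)).toReal * n2 ζ) := by
  have hB : MeasurableSet (Metric.closedBall a r) := Metric.isClosed_closedBall.measurableSet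
  have h := lintegral_mul_sq_le (μ := (volume : Measure Plane)) (k := (Metric.closedBall a r).indicator 1) (F := fun y => ‖ζ y‖ₑ)
    ((measurable_one.indicator hB).aemeasurable) hζ.continuous.measurable.enorm.aemeasurable
  have e1 : ∀ y, (Metric.closedBall a r).indicator (1 : Plane → ℝ≥0∞) y * ‖ζ y‖ₑ = ‖ζ y‖ₑ := fun y => by
    by_cases h0 : ζ y = 0
    · simp [h0]
    · rw [Set.indicator_of_mem (by simpa [dist_eq_norm] using hs y h0)]; simp
  have e2 : ∀ y, (Metric.closedBall a r).indicator (1 : Plane → ℝ≥0∞) y * ‖ζ y‖ₑ ^ 2 = ‖ζ y‖ₑ ^ 2 := fun y => by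
    rw [pow_two, ← mul_assoc, e1]
  simp_rw [e1, e2] at h
  rw [lintegral_indicator_one hB, Measure.addHaar_closedBall_center, lintegral_enorm_sq_eq (hζ.memLp 2),
    ← ENNReal.ofReal_toReal (measure_closedBall_lt_top (μ := (volume : Measure Plane)) (x := 0) (r := r)).ne, ← ENNReal.ofReal_mul (by positivity)] at h
  refine (le_ofReal_sqrt h).trans_eq ?_
  rw [Real.sqrt_mul (by positivity), Real.sqrt_sq (n2_nonneg _)]

lemma exists_far_pairing {σ : ℝ} (hσ : 0 < σ) (hσ1 : σ < 1) (r : ℝ) : ∃ C : ℝ, 0 ≤ C ∧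
    ∀ (a : Plane) (ζ : Plane → ℝ), IsTest ζ → (∀ x, ζ x ≠ 0 → ‖x - a‖ ≤ r) → ∀ (h : Plane → ℝ) (S : ℝ),
    AEStronglyMeasurable h volume → UB h S → 0 ≤ S → ∀ i,
    ∫⁻ x in {x | r + 1 ≤ ‖x - a‖}, ‖h x * multiplier (oddS σ i) ζ x‖ₑ ≤ ENNReal.ofReal (C * Real.sqrt S * n2 ζ) := by
  obtain ⟨C₁, hC₁, h₁⟩ := exists_abs_oddTest_le hσ hσ1
  obtain ⟨C₂, hC₂, h₂⟩ := UB.far hσ one_pos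
  set v := Real.sqrt (volume (Metric.closedBall (0 : Plane) r)).toReal
  refine ⟨C₁ * Real.sqrt C₂ * v, by positivity, fun a ζ hζ hs h S hm hS hS0 i => ?_⟩
  have hset : MeasurableSet {x : Plane | r + 1 ≤ ‖x - a‖} := measurableSet_le measurable_const (by fun_prop)
  have hk : Measurable fun p : Plane × Plane => ENNReal.ofReal (‖p.1 - p.2‖ ^ (-2 - σ)) := by fun_prop
  calc ∫⁻ x in {x | r + 1 ≤ ‖x - a‖}, ‖h x * multiplier (oddS σ i) ζ x‖ₑ
      ≤ ∫⁻ x in {x | r + 1 ≤ ‖x - a‖}, ENNReal.ofReal C₁ * ∫⁻ y, ‖ζ y‖ₑ * (ENNReal.ofReal (‖x - y‖ ^ (-2 - σ)) * ‖h x‖ₑ) := by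
        refine lintegral_mono fun x => ?_
        rw [enorm_mul]
        refine (mul_le_mul_right (h₁ i ζ hζ x) _).trans_eq ?_
        simp_rw [← mul_assoc]
        rw [lintegral_mul_const' _ _ enorm_ne_top]; ring
    _ = ENNReal.ofReal C₁ * ∫⁻ y, ‖ζ y‖ₑ * ∫⁻ x in {x | r + 1 ≤ ‖x - a‖}, ENNReal.ofReal (‖x - y‖ ^ (-2 - σ)) * ‖h x‖ₑ := by
        rw [lintegral_const_mul' _ _ ENNReal.ofReal_ne_top, lintegral_lintegral_swap]
        · congr 2 with y
          rw [lintegral_const_mul' _ _ enorm_ne_top]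
        · exact (hζ.continuous.comp continuous_snd).measurable.enorm.aemeasurable.mul
            (hk.aemeasurable.mul hm.restrict.comp_fst.enorm)
    _ ≤ ENNReal.ofReal C₁ * ∫⁻ y, ‖ζ y‖ₑ * ENNReal.ofReal (Real.sqrt (C₂ * S)) := by
        gcongr ENNReal.ofReal C₁ * ?_
        refine lintegral_mono fun y => ?_
        by_cases h0 : ζ y = 0
        · simp [h0]
        gcongr
        refine le_trans (lintegral_mono_set fun x hx => ?_) (h₂ h S hm hS y)
        have h3 := hs y h0
        have h4 : r + 1 ≤ ‖x - a‖ := hx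
        have h5 : ‖x - a‖ ≤ ‖x - y‖ + ‖y - a‖ := by
          simpa using norm_add_le (x - y) (y - a)
        show 1 ≤ ‖x - y‖
        linarith
    _ ≤ ENNReal.ofReal C₁ * (ENNReal.ofReal (v * n2 ζ) * ENNReal.ofReal (Real.sqrt (C₂ * S))) := by
        rw [lintegral_mul_const _ hζ.continuous.measurable.enorm]
        gcongr
        exact lintegral_enorm_le_of_supp hζ hs
    _ = _ := by
        have := n2_nonneg ζ
        rw [← ENNReal.ofReal_mul (by positivity), ← ENNReal.ofReal_mul (by positivity), Real.sqrt_mul hC₂]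
        congr 1; ring

/-! ### Local estimates at a fixed time -/

lemma n2_sq_le_of_lintegral {h : Plane → ℝ} (hh : MemLp h 2 volume) {D : ℝ} (hD : 0 ≤ D)
    (h1 : ∫⁻ x, ‖h x‖ₑ ^ 2 ≤ ENNReal.ofReal D) : n2 h ^ 2 ≤ D := by
  rwa [lintegral_enorm_sq_eq hh, ENNReal.ofReal_le_ofReal_iff hD] at h1

lemma le_mul_sqrt_of_sq_le {x C S : ℝ} (hC : 0 ≤ C) (h : x ^ 2 ≤ C * S) : x ≤ Real.sqrt C * Real.sqrt S := by
  rw [← Real.sqrt_mul hC]; exact Real.le_sqrt_of_sq_le h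

/-- `g = Λ^σ f` pointwise, by the singular integral. -/
def Pt (σ : ℝ) (f g : Plane → ℝ) : Prop := ∀ x, Integrable (fun z => d2 f z x * ‖z‖ ^ (-2 - σ)) ∧
  kcon σ * g x = ∫ z, d2 f z x * ‖z‖ ^ (-2 - σ)

lemma Loc.memLp_mul {ψ g : Plane → ℝ} {a : Plane} {r L : ℝ} (hψ : Loc ψ a r L) (hg : Continuous g) :
    MemLp (fun x => ψ x * g x) 2 volume :=
  (hψ.test.continuous.mul hg).memLp_of_hasCompactSupport hψ.test.2.mul_right

lemma exists_n2_mul_le (r L : ℝ) : ∃ C : ℝ, 0 ≤ C ∧ ∀ (ψ : Plane → ℝ) (a : Plane), Loc ψ a r L → ∀ (g : Plane → ℝ) (S : ℝ),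
    Continuous g → 0 ≤ S → UB g S → n2 (fun x => ψ x * g x) ^ 2 ≤ C * S := by
  obtain ⟨C, hC, h1⟩ := UB.lintegral_ball r
  refine ⟨L ^ 2 * C, by positivity, fun ψ a hψ g S hg hS0 hS => ?_⟩
  refine n2_sq_le_of_lintegral (hψ.memLp_mul hg) (by positivity) ?_
  have hB : MeasurableSet (Metric.closedBall a r) := Metric.isClosed_closedBall.measurableSet
  calc _ ≤ ∫⁻ x, ENNReal.ofReal (L ^ 2) * (Metric.closedBall a r).indicator (fun x => ‖g x‖ₑ ^ 2) x := by
        refine lintegral_mono fun x => ?_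
        by_cases h0 : ψ x = 0
        · simp [h0]
        rw [Set.indicator_of_mem (by simpa [dist_eq_norm] using hψ.supp x h0), enorm_mul, mul_pow]
        gcongr
        rw [← ofReal_norm, ← ENNReal.ofReal_pow (norm_nonneg _)]
        apply ENNReal.ofReal_le_ofReal
        gcongr
        exact hψ.bd x
    _ = ENNReal.ofReal (L ^ 2) * ∫⁻ x in Metric.closedBall a r, ‖g x‖ₑ ^ 2 := by
        rw [lintegral_const_mul' _ _ ENNReal.ofReal_ne_top, lintegral_indicator hB]
    _ ≤ ENNReal.ofReal (L ^ 2) * ENNReal.ofReal (C * S) := by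
        gcongr; exact h1 g S hg.aestronglyMeasurable hS a
    _ = _ := by rw [← ENNReal.ofReal_mul (by positivity)]; congr 1; ring

lemma Pt.fracLapTest_mul {σ : ℝ} (hσ : 0 < σ) (hσ2 : σ < 2) {f g ψ : Plane → ℝ} (h : Pt σ f g)
    (hψf : IsTest fun x => ψ x * f x) (x : Plane) :
    fracLapTest σ (fun x => ψ x * f x) x = ψ x * g x + (kcon σ)⁻¹ * comm σ ψ f x := by
  have h1 := SQG.fracLapTest_mul hσ hσ2 hψf x (h x).1
  rw [← (h x).2] at h1
  have := kcon_pos hσ hσ2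
  field_simp
  linarith

lemma exists_fracLap_uloc {σ : ℝ} (hσ : 0 < σ) (hσ1 : σ < 1) (r L : ℝ) : ∃ C : ℝ, 0 ≤ C ∧
    ∀ (ψ : Plane → ℝ) (a : Plane), Loc ψ a r L → ∀ (f g : Plane → ℝ) (S : ℝ),
    ContDiff ℝ ((⊤ : ℕ∞) : WithTop ℕ∞) f → Continuous g → Pt σ f g → 0 ≤ S → UB f S → UB g S →
    n2 (fracLapTest σ fun x => ψ x * f x) ^ 2 ≤ C * S := by
  obtain ⟨C₁, hC₁, h₁⟩ := exists_n2_mul_le r L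
  obtain ⟨C₂, hC₂, h₂⟩ := exists_comm_uloc hσ hσ1 r L
  refine ⟨2 * C₁ + 2 * ((kcon σ)⁻¹ ^ 2 * C₂), by positivity, fun ψ a hψ f g S hf hg hpt hS0 hSf hSg => ?_⟩
  have hc := h₂ ψ a hψ f S hf.continuous hS0 hSf
  have e : (fracLapTest σ fun x => ψ x * f x) = fun x => ψ x * g x + (kcon σ)⁻¹ * comm σ ψ f x := by
    ext x
    exact hpt.fracLapTest_mul hσ (by linarith) (hψ.test.mul_contDiff hf) x
  rw [e]
  refine (n2_add_sq_le (hψ.memLp_mul hg) (hc.1.const_mul _)).trans ?_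
  rw [n2_const_mul_sq]
  have := h₁ ψ a hψ g S hg hS0 hSg
  have h3 : (kcon σ)⁻¹ ^ 2 * n2 (comm σ ψ f) ^ 2 ≤ (kcon σ)⁻¹ ^ 2 * (C₂ * S) := by gcongr; exact hc.2
  linarith

/-- Smooth functions `f`, `g = Λ^s f` and `U = R^⊥ g`. -/
structure Snap (s : ℝ) (f g : Plane → ℝ) (U : Fin 2 → Plane → ℝ) : Prop where
  f_smooth : ContDiff ℝ ((⊤ : ℕ∞) : WithTop ℕ∞) f
  g_smooth : ContDiff ℝ ((⊤ : ℕ∞) : WithTop ℕ∞) g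
  u_smooth : ∀ j, ContDiff ℝ ((⊤ : ℕ∞) : WithTop ℕ∞) (U j)
  f2 : MemLp f 2 volume
  g2 : MemLp g 2 volume
  u2 : ∀ j, MemLp (U j) 2 volume
  frac : MulRel (lamS s) f g
  pt : Pt s f g
  vel : ∀ j, MulRel (uS j) g (U j)

lemma cv_contDiff_of_memLp {f ρ : Plane → ℝ} (hf : MemLp f 2 volume) (hρ : IsTest ρ) :
    ContDiff ℝ ((⊤ : ℕ∞) : WithTop ℕ∞) (cv f ρ) :=
  cv_contDiff (ULI.of_memLp hf).locallyIntegrable hρ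

lemma Snap.of_cv {s : ℝ} (hs : 0 < s) (hs2 : s < 2) {w θ : Plane → ℝ} {u : Fin 2 → Plane → ℝ} (hw : MemLp w 2 volume) (hθ : MemLp θ 2 volume)
    (hu : ∀ j, MemLp (u j) 2 volume) (hf : IsFracLap s w θ) (hr : ∀ j, MulRel (uS j) θ (u j)) {ρ : Plane → ℝ} (hρ : IsTest ρ) :
    Snap s (cv w ρ) (cv θ ρ) (fun j => cv (u j) ρ) where
  f_smooth := cv_contDiff_of_memLp hw hρ
  g_smooth := cv_contDiff_of_memLp hθ hρ
  u_smooth j := cv_contDiff_of_memLp (hu j) hρ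
  f2 := memLp_cv hw hρ.integrable
  g2 := memLp_cv hθ hρ.integrable
  u2 j := memLp_cv (hu j) hρ.integrable
  frac := MulRel.cv (isSymb_lamS hs.le (by linarith)) hf hw hθ hρ
  pt x := (ULI.of_memLp hw).cv_fracLap hs hs2 hf hρ x
  vel j := MulRel.cv (isSymb_uS j) (hr j) hθ (hu j) hρ

lemma uS_cases (j : Fin 2) : ∃ i, uS j = oddS 0 i ∨ uS j = fun ξ => -oddS 0 i ξ := by
  by_cases h : j = 0
  · exact ⟨1, .inl (by ext ξ; simp [uS, h])⟩
  · exact ⟨0, .inr (by ext ξ; simp [uS, h])⟩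

lemma oddS_eq_mul (σ : ℝ) (i : Fin 2) (ξ : Plane) : oddS σ i ξ = lamS σ ξ * oddS 0 i ξ := by
  rw [oddS_zero, oddS, lamS]; push_cast; ring

lemma Snap.abs_integral_vel {s : ℝ} (hs : 0 < s) (hs1 : s < 1) {f g : Plane → ℝ} {U : Fin 2 → Plane → ℝ} (h : Snap s f g U)
    (j : Fin 2) : ∃ i, ∀ η, IsTest η → |∫ x, U j x * η x| = |∫ x, f x * multiplier (oddS s i) η x| := by
  obtain ⟨i, hi⟩ := uS_cases j
  refine ⟨i, fun η hη => ?_⟩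
  have hso := isSymb_oddS le_rfl (by norm_num : (0 : ℝ) ≤ 4) i
  rw [← h.frac.integral_multiplier (isSymb_lamS hs.le (by linarith)) hso (isSymb_oddS hs.le (by linarith) i)
    (oddS_eq_mul s i) h.f2 h.g2 hη, h.vel j η hη]
  rcases hi with hi | hi
  · rw [hi]
  · simp only [hi, multiplier_neg, mul_neg, integral_neg, abs_neg]

/-- The velocity is locally controlled by `f` and `Λ^s f`. -/
lemma exists_vel_uloc {s : ℝ} (hs : 0 < s) (hs1 : s < 1) : ∃ C : ℝ, 0 ≤ C ∧
    ∀ (f g : Plane → ℝ) (U : Fin 2 → Plane → ℝ) (S : ℝ), Snap s f g U → 0 ≤ S → UB f S → UB g S →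
    ∀ j, UB (U j) (C * S) := by
  let b₁ : ContDiffBump (0 : Plane) := ⟨1, 2, by norm_num, by norm_num⟩
  let b₂ : ContDiffBump (0 : Plane) := ⟨3, 4, by norm_num, by norm_num⟩
  have hb₁ : IsTest b₁ := ⟨b₁.contDiff, b₁.hasCompactSupport⟩
  have hb₂ : IsTest b₂ := ⟨b₂.contDiff, b₂.hasCompactSupport⟩
  obtain ⟨r, L, -, -, hloc⟩ := exists_loc hb₂
  obtain ⟨C₁, hC₁, h₁⟩ := exists_fracLap_uloc hs hs1 r L
  obtain ⟨C₂, hC₂, h₂⟩ := exists_far_pairing hs hs1 2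
  refine ⟨(Real.sqrt C₁ + C₂) ^ 2, by positivity, fun f g U S h hS0 hSf hSg j a => ?_⟩
  set ψ : Plane → ℝ := fun x => b₂ (x - a)
  set ψ₁ : Plane → ℝ := fun x => b₁ (x - a)
  have hψ : Loc ψ a r L := hloc a
  have hψ₁ : IsTest ψ₁ := hb₁.comp_sub a
  set η : Plane → ℝ := fun x => ψ₁ x * U j x
  have hη : IsTest η := hψ₁.mul_contDiff (h.u_smooth j)
  have hs₁ : ∀ x, ψ₁ x ≠ 0 → ‖x - a‖ ≤ 2 := fun x hx => by
    have : x - a ∈ Function.support b₁ := hx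
    rw [b₁.support_eq] at this
    simpa using (Metric.mem_ball.mp this).le
  have hηs : ∀ x, η x ≠ 0 → ‖x - a‖ ≤ 2 := fun x hx => hs₁ x (left_ne_zero_of_mul hx)
  obtain ⟨i, hi⟩ := h.abs_integral_vel hs hs1 j
  have hψf : IsTest fun x => ψ x * f x := hψ.test.mul_contDiff h.f_smooth
  have hso := isSymb_oddS hs.le (by linarith : s ≤ 4) i
  have hso0 := isSymb_oddS le_rfl (by norm_num : (0 : ℝ) ≤ 4) i
  have hsl := isSymb_lamS hs.le (by linarith : s ≤ 4)
  have hf' : MemLp (fun x => (1 - ψ x) * f x) 2 volume := by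
    have := memLp_fun_sub h.f2 (hψf.memLp 2)
    refine this.ae_eq (.of_forall fun x => ?_)
    simp only; ring
  have hUB' : UB (fun x => (1 - ψ x) * f x) S := fun b => by
    refine le_trans (lintegral_mono fun x => ?_) (hSf b)
    rw [enorm_mul]
    have : ‖1 - ψ x‖ₑ ≤ 1 := by
      rw [← ofReal_norm, ← ENNReal.ofReal_one]
      apply ENNReal.ofReal_le_ofReal
      rw [Real.norm_eq_abs, abs_le]
      have h1 := b₂.nonneg (x := x - a)
      have h2 := b₂.le_one (x := x - a)
      constructor <;> linarith
    calc _ ≤ (1 * ‖f x‖ₑ) ^ 2 := by gcongr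
      _ = _ := by rw [one_mul]
  have hn := n2_nonneg η
  have near : |∫ x, (ψ x * f x) * multiplier (oddS s i) η x| ≤ Real.sqrt C₁ * Real.sqrt S * n2 η := by
    rw [← (mulRel_test hsl (conj_lamS s) hψf).integral_multiplier hsl hso0 hso (oddS_eq_mul s i) (hψf.memLp 2)
      (hsl.memLp_multiplier hψf) hη]
    refine (abs_integral_mul_le (hsl.memLp_multiplier hψf) (hso0.memLp_multiplier hη)).trans ?_
    gcongr
    · exact n2_nonneg _
    · exact le_mul_sqrt_of_sq_le hC₁ (h₁ ψ a hψ f g S h.f_smooth h.g_smooth.continuous h.pt hS0 hSf hSg)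
    · exact n2_multiplier_le hso0 (norm_oddS_zero_le i) hη
  have far : |∫ x, ((1 - ψ x) * f x) * multiplier (oddS s i) η x| ≤ C₂ * Real.sqrt S * n2 η := by
    have h3 := h₂ a η hη hηs _ S hf'.1 hUB' hS0 i
    rw [← ENNReal.ofReal_le_ofReal_iff (by positivity), ← Real.norm_eq_abs, ofReal_norm]
    refine (enorm_integral_le_lintegral_enorm _).trans (le_trans (le_of_eq ?_) h3)
    have hset : MeasurableSet {x : Plane | 2 + 1 ≤ ‖x - a‖} := measurableSet_le measurable_const (by fun_prop)
    rw [← lintegral_indicator hset]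
    congr 1 with x
    by_cases hx : 2 + 1 ≤ ‖x - a‖
    · rw [Set.indicator_of_mem (by exact hx)]
    · rw [Set.indicator_of_notMem (by exact hx)]
      have : ψ x = 1 := b₂.one_of_mem_closedBall (by simp only [Metric.mem_closedBall, dist_zero_right, b₂]; linarith)
      simp [this]
  set X := ∫ x, U j x * η x
  have hX : X ≤ (Real.sqrt C₁ + C₂) * Real.sqrt S * n2 η := by
    refine (le_abs_self _).trans ?_
    rw [hi η hη]
    have i1 := (hψf.memLp 2).integrable_mul (hso.memLp_multiplier hη)
    have i2 := hf'.integrable_mul (hso.memLp_multiplier hη)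
    have e : ∫ x, f x * multiplier (oddS s i) η x = (∫ x, (ψ x * f x) * multiplier (oddS s i) η x) +
        ∫ x, ((1 - ψ x) * f x) * multiplier (oddS s i) η x := by
      rw [← integral_add (by exact i1) (by exact i2)]
      congr 1 with x; ring
    rw [e]
    refine (abs_add_le _ _).trans ((add_le_add near far).trans_eq ?_)
    ring
  have hU : Integrable fun x => U j x * η x := (h.u2 j).integrable_mul (hη.memLp 2)
  have hnX : n2 η ^ 2 ≤ X := by
    rw [n2_sq]
    refine integral_mono (hη.memLp 2).integrable_sq hU fun x => ?_
    have h1 := b₁.nonneg (x := x - a)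
    have h2 := b₁.le_one (x := x - a)
    simp only [η, ψ₁]
    calc (b₁ (x - a) * U j x) ^ 2 = b₁ (x - a) * (b₁ (x - a) * U j x ^ 2) := by ring
      _ ≤ 1 * (b₁ (x - a) * U j x ^ 2) := by gcongr
      _ = _ := by ring
  have hX2 : X ≤ (Real.sqrt C₁ + C₂) ^ 2 * S := by
    have h0 : 0 ≤ Real.sqrt C₁ + C₂ := by positivity
    have h1 : n2 η ≤ (Real.sqrt C₁ + C₂) * Real.sqrt S := by
      by_contra hc
      push Not at hc
      have : 0 < n2 η := lt_of_le_of_lt (by positivity) hc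
      nlinarith
    calc X ≤ (Real.sqrt C₁ + C₂) * Real.sqrt S * ((Real.sqrt C₁ + C₂) * Real.sqrt S) := hX.trans (by gcongr)
      _ = (Real.sqrt C₁ + C₂) ^ 2 * (Real.sqrt S * Real.sqrt S) := by ring
      _ = _ := by rw [Real.mul_self_sqrt hS0]
  refine le_trans ?_ (ENNReal.ofReal_le_ofReal hX2)
  rw [ofReal_integral_eq_lintegral_ofReal hU (.of_forall fun x => by
    have h1 := b₁.nonneg (x := x - a)
    simp only [η, ψ₁, Pi.zero_apply]
    nlinarith [mul_nonneg h1 (sq_nonneg (U j x))])]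
  refine le_trans (lintegral_mono_ae ?_) (setLIntegral_le_lintegral (Metric.closedBall a 1) _)
  filter_upwards [ae_restrict_mem Metric.isClosed_closedBall.measurableSet] with x hx
  have : ψ₁ x = 1 := b₁.one_of_mem_closedBall (by simpa [dist_eq_norm, b₁] using hx)
  simp only [η, this, one_mul]
  rw [← ofReal_norm, ← ENNReal.ofReal_pow (norm_nonneg _), Real.norm_eq_abs, sq_abs, pow_two]

/-- Pairing of a uniformly local function with a multiplier of order `σ` of a localized function. -/
lemma exists_pairing {σ : ℝ} (hσ : 0 < σ) (hσ1 : σ < 1) (r : ℝ) : ∃ C : ℝ, 0 ≤ C ∧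
    ∀ (a : Plane) (ζ : Plane → ℝ), IsTest ζ → (∀ x, ζ x ≠ 0 → ‖x - a‖ ≤ r) → ∀ (h : Plane → ℝ) (S : ℝ),
    MemLp h 2 volume → UB h S → 0 ≤ S → ∀ i,
    |∫ x, h x * multiplier (oddS σ i) ζ x| ≤ C * Real.sqrt S * (n2 ζ + n2 (multiplier (oddS σ i) ζ)) := by
  obtain ⟨C₁, hC₁, h₁⟩ := UB.lintegral_ball (r + 1)
  obtain ⟨C₂, hC₂, h₂⟩ := exists_far_pairing hσ hσ1 r
  refine ⟨Real.sqrt C₁ + C₂, by positivity, fun a ζ hζ hs h S hh hS hS0 i => ?_⟩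
  have hso := isSymb_oddS hσ.le (by linarith : σ ≤ 4) i
  have hset : MeasurableSet {x : Plane | r + 1 ≤ ‖x - a‖} := measurableSet_le measurable_const (by fun_prop)
  set F := {x : Plane | r + 1 ≤ ‖x - a‖}
  have hi : Integrable fun x => h x * multiplier (oddS σ i) ζ x := hh.integrable_mul (hso.memLp_multiplier hζ)
  have hn := n2_nonneg ζ
  have hn' := n2_nonneg (multiplier (oddS σ i) ζ)
  rw [← integral_add_compl hset hi]
  have far : |∫ x in F, h x * multiplier (oddS σ i) ζ x| ≤ C₂ * Real.sqrt S * n2 ζ := by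
    rw [← ENNReal.ofReal_le_ofReal_iff (by positivity), ← Real.norm_eq_abs, ofReal_norm]
    exact (enorm_integral_le_lintegral_enorm _).trans (h₂ a ζ hζ hs h S hh.1 hS hS0 i)
  have hind : MemLp (Fᶜ.indicator h) 2 volume := hh.indicator hset.compl
  have near : |∫ x in Fᶜ, h x * multiplier (oddS σ i) ζ x| ≤ Real.sqrt C₁ * Real.sqrt S * n2 (multiplier (oddS σ i) ζ) := by
    rw [← integral_indicator hset.compl]
    have e : Fᶜ.indicator (fun x => h x * multiplier (oddS σ i) ζ x) = fun x => Fᶜ.indicator h x * multiplier (oddS σ i) ζ x := by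
      ext x
      by_cases hx : x ∈ Fᶜ <;> simp [Set.indicator, hx]
    rw [e]
    refine (abs_integral_mul_le hind (hso.memLp_multiplier hζ)).trans ?_
    gcongr
    refine le_mul_sqrt_of_sq_le hC₁ (n2_sq_le_of_lintegral hind (by positivity) (le_trans ?_ (h₁ h S hh.1 hS a)))
    rw [← lintegral_indicator Metric.isClosed_closedBall.measurableSet]
    refine lintegral_mono fun x => ?_
    by_cases hx : x ∈ Fᶜ
    · have hx' : x ∈ Metric.closedBall a (r + 1) := by
        simp only [F, Set.mem_compl_iff, Set.mem_ofPred_eq, not_le] at hx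
        simpa [dist_eq_norm] using hx.le
      simp [Set.indicator_of_mem hx, Set.indicator_of_mem hx']
    · simp [Set.indicator_of_notMem hx]
  refine (abs_add_le _ _).trans ((add_le_add far near).trans ?_)
  have h3 : 0 ≤ Real.sqrt C₁ * Real.sqrt S * n2 ζ := by positivity
  have h4 : 0 ≤ C₂ * Real.sqrt S * n2 (multiplier (oddS σ i) ζ) := by positivity
  nlinarith

/-- The nonlinear term in the energy equation of `f`. -/
lemma exists_nonlinear_le {s : ℝ} (hs : 1 / 2 < s) (hs1 : s < 1) (r L : ℝ) : ∃ C : ℝ, 0 ≤ C ∧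
    ∀ (ψ : Plane → ℝ) (a : Plane), Loc ψ a r L → ∀ (f g : Plane → ℝ) (S : ℝ), ContDiff ℝ ((⊤ : ℕ∞) : WithTop ℕ∞) f → Continuous g →
    Pt s f g → 0 ≤ S → UB f S → UB g S → ∀ (h : Plane → ℝ) (S' : ℝ), MemLp h 2 volume → UB h S' → 0 ≤ S' → ∀ j,
    |∫ x, h x * fracGradTest s j (fun x => ψ x * f x) x| ≤ C * Real.sqrt S' * Real.sqrt S := by
  obtain ⟨C₁, hC₁, h₁⟩ := exists_n2_mul_le r L
  obtain ⟨C₂, hC₂, h₂⟩ := exists_fracLap_uloc (by linarith : 0 < s) hs1 r L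
  obtain ⟨C₃, hC₃, h₃⟩ := exists_pairing (by linarith : 0 < 1 - s) (by linarith : 1 - s < 1) r
  refine ⟨C₃ * (Real.sqrt C₁ + Real.sqrt (2 * C₁ + 2 * C₂)), by positivity,
    fun ψ a hψ f g S hf hg hpt hS0 hSf hSg h S' hh hS' hS'0 j => ?_⟩
  have hζ : IsTest fun x => ψ x * f x := hψ.test.mul_contDiff hf
  rw [fracGradTest_eq]
  refine (h₃ a _ hζ (fun x hx => hψ.supp x (left_ne_zero_of_mul hx)) h S' hh hS' hS'0 j).trans ?_
  have b1 := h₁ ψ a hψ f S hf.continuous hS0 hSf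
  have b2 := h₂ ψ a hψ f g S hf hg hpt hS0 hSf hSg
  have hle : ∀ ξ, ‖oddS (1 - s) j ξ‖ ≤ 1 + ‖lamS s ξ‖ := fun ξ => by
    refine (norm_oddS_le _ _ _).trans ?_
    rw [lamS, lamS, norm_real, norm_real, Real.norm_of_nonneg (by positivity), Real.norm_of_nonneg (by positivity)]
    have hx : 0 ≤ 2 * Real.pi * ‖ξ‖ := by positivity
    rcases le_total (2 * Real.pi * ‖ξ‖) 1 with h | h
    · have := Real.rpow_le_one hx h (by linarith : 0 ≤ 1 - s)
      have : 0 ≤ (2 * Real.pi * ‖ξ‖) ^ s := by positivity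
      linarith
    · have := Real.rpow_le_rpow_of_exponent_le h (by linarith : 1 - s ≤ s)
      linarith
  have b3 := n2_multiplier_sq_le (isSymb_oddS (by linarith : 0 ≤ 1 - s) (by linarith) j)
    (isSymb_lamS (by linarith : 0 ≤ s) (by linarith)) hle hζ
  rw [← fracLapTest_eq] at b3
  have c1 := le_mul_sqrt_of_sq_le hC₁ b1
  have c2 := le_mul_sqrt_of_sq_le (C := 2 * C₁ + 2 * C₂) (S := S) (by positivity) (b3.trans (by linarith))
  calc _ ≤ C₃ * Real.sqrt S' * (Real.sqrt C₁ * Real.sqrt S + Real.sqrt (2 * C₁ + 2 * C₂) * Real.sqrt S) := by gcongr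
    _ = _ := by ring

/-! ### Dissipation -/

lemma abs_integral_mul_fracLap_le {σ : ℝ} (hσ : 0 < σ) (hσ2 : σ < 2) {h Φ : Plane → ℝ} {a : Plane} {r L D : ℝ}
    (hΦ : Loc Φ a r L) (hh : ULI h) (hD0 : 0 ≤ D) (hD : ∀ b, ∫⁻ x in Metric.closedBall b r, ‖h x‖ₑ ≤ ENNReal.ofReal D) :
    |∫ x, h x * fracLapTest σ Φ x| ≤ 3 * D * L * (∫ z, krn 2 σ z) / kcon σ := by
  have hk := kcon_pos hσ hσ2
  have hL := hΦ.L_nonneg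
  have e : |∫ x, h x * fracLapTest σ Φ x| * kcon σ = |kcon σ * ∫ x, h x * fracLapTest σ Φ x| := by
    rw [abs_mul, abs_of_pos hk, mul_comm]
  rw [le_div_iff₀ hk, e, hh.integral_mul_fracLap hΦ.test hσ hσ2,
    ← integral_const_mul]
  refine (abs_integral_le_integral_abs).trans ?_
  refine integral_mono (hh.integrable_fracLap hΦ.test hσ hσ2).abs ((integrable_krn hσ hσ2).const_mul _) fun z => ?_
  simp only
  rw [abs_mul, abs_of_nonneg (by positivity : (0 : ℝ) ≤ ‖z‖ ^ (-2 - σ)), krn_two, ← mul_assoc]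
  gcongr
  have h1 := lintegral_mul_d2_le hΦ (C := D.toNNReal) hh.meas hD z
  rw [Real.coe_toNNReal _ hD0] at h1
  rw [← ENNReal.ofReal_le_ofReal_iff (by positivity), ← Real.norm_eq_abs, ofReal_norm]
  exact (enorm_integral_le_lintegral_enorm _).trans h1

lemma ULI.integrable_diff {h ζ : Plane → ℝ} (hh : ULI h) (hζ : IsTest ζ) (z : Plane) :
    Integrable fun x => (h x - h (x + z)) * (ζ x - ζ (x + z)) := by
  have i1 : Integrable fun x => h x * ζ x := hh.integrable_mul hζ.continuous hζ.2
  have i2 : Integrable fun x => h x * ζ (x + z) := hh.integrable_mul (hζ.comp_add z).continuous (hζ.comp_add z).2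
  have i4 : Integrable fun x => h (x + z) * ζ x := (hh.comp_add z).integrable_mul hζ.continuous hζ.2
  have i5 : Integrable fun x => h (x + z) * ζ (x + z) :=
    (hh.comp_add z).integrable_mul (hζ.comp_add z).continuous (hζ.comp_add z).2
  refine ((i1.sub i2).sub (i4.sub i5)).congr (.of_forall fun x => ?_)
  simp only [Pi.sub_apply]; ring

lemma integral_mul_fracLap_mono {σ : ℝ} (hσ : 0 < σ) (hσ2 : σ < 2) {h₁ ζ₁ h₂ ζ₂ : Plane → ℝ} (hh₁ : ULI h₁) (hζ₁ : IsTest ζ₁)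
    (hh₂ : ULI h₂) (hζ₂ : IsTest ζ₂) (hle : ∀ x y, (h₁ x - h₁ y) * (ζ₁ x - ζ₁ y) ≤ (h₂ x - h₂ y) * (ζ₂ x - ζ₂ y)) :
    ∫ x, h₁ x * fracLapTest σ ζ₁ x ≤ ∫ x, h₂ x * fracLapTest σ ζ₂ x := by
  rw [← mul_le_mul_iff_right₀ (kcon_pos hσ hσ2), hh₁.integral_mul_fracLap hζ₁ hσ hσ2, hh₂.integral_mul_fracLap hζ₂ hσ hσ2]
  refine integral_mono (hh₁.integrable_fracLap hζ₁ hσ hσ2) (hh₂.integrable_fracLap hζ₂ hσ hσ2) fun z => ?_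
  simp only
  refine mul_le_mul_of_nonneg_right ?_ (by positivity)
  rw [hh₁.integral_mul_d2 hζ₁, hh₂.integral_mul_d2 hζ₂]
  exact integral_mono (hh₁.integrable_diff hζ₁ z) (hh₂.integrable_diff hζ₂ z) fun x => hle x (x + z)

lemma mul_pow_le_of_nonneg (n : ℕ) {a b : ℝ} (ha : 0 ≤ a) (hb : 0 ≤ b) :
    ((n : ℝ) + 1) * (a ^ n * b) ≤ n * a ^ (n + 1) + b ^ (n + 1) := by
  induction n with
  | zero => simp
  | succ k ih =>
    have h1 := mul_le_mul_of_nonneg_left ih hb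
    have h2 : 0 ≤ ((k : ℝ) + 1) * a ^ k * (a - b) ^ 2 := by positivity
    push_cast
    ring_nf at h1 h2 ⊢
    linarith

lemma mul_pow_le_of_odd {n : ℕ} (hn : Odd n) (a b : ℝ) :
    ((n : ℝ) + 1) * (a ^ n * b) ≤ n * a ^ (n + 1) + b ^ (n + 1) := by
  have h := mul_pow_le_of_nonneg n (abs_nonneg a) (abs_nonneg b)
  have he : Even (n + 1) := hn.add_one
  rw [he.pow_abs, he.pow_abs] at h
  refine le_trans ?_ h
  refine mul_le_mul_of_nonneg_left ?_ (by positivity)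
  rw [← abs_pow, ← abs_mul]
  exact le_abs_self _

lemma convex_pow_diff {n : ℕ} (hn : Odd n) {p q : ℝ} (hp : 0 ≤ p) (hq : 0 ≤ q) (a b : ℝ) :
    (a ^ (n + 1) / (n + 1) - b ^ (n + 1) / (n + 1)) * (p - q) ≤ (a - b) * (p * a ^ n - q * b ^ n) := by
  have h1 := mul_pow_le_of_odd hn a b
  have h2 := mul_pow_le_of_odd hn b a
  have h3 := mul_le_mul_of_nonneg_left h1 hp
  have h4 := mul_le_mul_of_nonneg_left h2 hq
  have hpos : (0 : ℝ) < n + 1 := by positivity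
  rw [← sub_div, div_mul_eq_mul_div, div_le_iff₀ hpos]
  ring_nf at h3 h4 ⊢
  linarith

lemma ULI.of_integrable {h : Plane → ℝ} (hh : Integrable h) : ULI h := by
  refine ⟨hh.1, fun r => ⟨(∫⁻ x, ‖h x‖ₑ).toNNReal, fun a => ?_⟩⟩
  rw [ENNReal.coe_toNNReal hh.2.ne]
  exact setLIntegral_le_lintegral _ _

lemma dissipation_le {σ : ℝ} (hσ : 0 < σ) (hσ2 : σ < 2) {n : ℕ} (hn : Odd n) {g Φ : Plane → ℝ}
    (hg : ContDiff ℝ ((⊤ : ℕ∞) : WithTop ℕ∞) g) (hg2 : MemLp g 2 volume) (hgn : Integrable fun x => g x ^ (n + 1))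
    (hΦ : IsTest Φ) (hΦ0 : ∀ x, 0 ≤ Φ x) :
    (∫ x, g x ^ (n + 1) / (n + 1) * fracLapTest σ Φ x) ≤ ∫ x, g x * fracLapTest σ (fun x => Φ x * g x ^ n) x := by
  refine integral_mul_fracLap_mono hσ hσ2 (ULI.of_integrable (hgn.div_const _)) hΦ (ULI.of_memLp hg2)
    (hΦ.mul_contDiff (hg.pow n)) fun x y => ?_
  exact convex_pow_diff hn (hΦ0 x) (hΦ0 y) _ _

lemma UB.lintegral_sq_ball (r : ℝ) : ∃ C : ℝ, 0 ≤ C ∧ ∀ (h : Plane → ℝ) (S : ℝ), AEStronglyMeasurable h volume →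
    UB h S → ∀ a, ∫⁻ x in Metric.closedBall a r, ‖h x ^ 2‖ₑ ≤ ENNReal.ofReal (C * S) := by
  obtain ⟨C, hC, h1⟩ := UB.lintegral_ball r
  refine ⟨C, hC, fun h S hm hS a => ?_⟩
  simpa [enorm_pow] using h1 h S hm hS a

lemma exists_dissipation_le (r L : ℝ) : ∃ C : ℝ, 0 ≤ C ∧
    ∀ (Φ : Plane → ℝ) (a : Plane), Loc Φ a r L → (∀ x, 0 ≤ Φ x) → ∀ (g : Plane → ℝ) (S : ℝ),
    ContDiff ℝ ((⊤ : ℕ∞) : WithTop ℕ∞) g → MemLp g 2 volume → 0 ≤ S → UB g S →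
    -(C * S) ≤ ∫ x, g x * fracLapTest 1 (fun x => Φ x * g x) x := by
  obtain ⟨C, hC, h1⟩ := UB.lintegral_sq_ball r
  refine ⟨3 * C * |L| * (∫ z, krn 2 1 z) / kcon 1, ?_, fun Φ a hΦ hΦ0 g S hg hg2 hS0 hS => ?_⟩
  · have := kcon_pos one_pos one_lt_two
    have : 0 ≤ ∫ z, krn 2 1 z := integral_nonneg fun z => krn_nonneg _ _ _
    positivity
  have h2 := dissipation_le one_pos one_lt_two odd_one hg hg2 hg2.integrable_sq hΦ.test hΦ0
  simp only [pow_one] at h2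
  refine le_trans ?_ h2
  have h3 := abs_integral_mul_fracLap_le one_pos one_lt_two hΦ (h := fun x => g x ^ (1 + 1) / (((1 : ℕ) : ℝ) + 1))
    (ULI.of_integrable (hg2.integrable_sq.div_const _)) (D := C * S) (by positivity) fun b => ?_
  · have h4 := neg_le_of_neg_le ((neg_le_abs _).trans h3)
    refine le_trans (le_of_eq ?_) h4
    rw [abs_of_nonneg hΦ.L_nonneg]; ring
  · refine le_trans (lintegral_mono fun x => ?_) (h1 g S hg.continuous.aestronglyMeasurable hS b)
    rw [← ofReal_norm, ← ofReal_norm]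
    apply ENNReal.ofReal_le_ofReal
    rw [norm_div]
    norm_num
    exact sq_nonneg _

lemma lamS_add {a b : ℝ} (ha : 0 ≤ a) (hb : 0 ≤ b) (ξ : Plane) : lamS (a + b) ξ = lamS a ξ * lamS b ξ := by
  rw [lamS, lamS, lamS, ← Complex.ofReal_mul, Real.rpow_add_of_nonneg (by positivity) ha hb]

lemma n2_fracLap_half {η : Plane → ℝ} (hη : IsTest η) :
    n2 (fracLapTest (1 / 2) η) ^ 2 = ∫ x, η x * fracLapTest 1 η x := by
  have hh := isSymb_lamS (by norm_num : (0 : ℝ) ≤ 1 / 2) (by norm_num)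
  have h1 := isSymb_lamS (by norm_num : (0 : ℝ) ≤ 1) (by norm_num)
  rw [fracLapTest_eq, fracLapTest_eq, n2_sq]
  rw [← (mulRel_test hh (conj_lamS _) hη).integral_multiplier hh hh h1
    (fun ξ => by rw [← lamS_add (by norm_num) (by norm_num)]; norm_num) (hη.memLp 2) (hh.memLp_multiplier hη) hη]
  congr 1 with x; ring

/-- The localized dissipation of `g` controls the localized `L²` norm of `Λ^(1/2) g`. -/
lemma exists_half_le (r L : ℝ) : ∃ C : ℝ, 0 ≤ C ∧
    ∀ (ψ : Plane → ℝ) (a : Plane), Loc ψ a r L → ∀ (g v : Plane → ℝ) (S : ℝ),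
    ContDiff ℝ ((⊤ : ℕ∞) : WithTop ℕ∞) g → MemLp g 2 volume → Continuous v → Pt (1 / 2) g v → 0 ≤ S → UB g S →
    n2 (fun x => ψ x * v x) ^ 2 ≤ 2 * (∫ x, g x * fracLapTest 1 (fun x => ψ x ^ 2 * g x) x) + C * S := by
  obtain ⟨C₁, hC₁, h₁⟩ := UB.lintegral_sq_ball r
  obtain ⟨C₂, hC₂, h₂⟩ := exists_comm_uloc (by norm_num : (0 : ℝ) < 1 / 2) (by norm_num) r L
  have hk1 := kcon_pos one_pos one_lt_two
  have hkr : 0 ≤ ∫ z, krn 2 1 z := integral_nonneg fun z => krn_nonneg _ _ _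
  refine ⟨2 * (4 * C₁ * L ^ 2 * (∫ z, krn 2 1 z) / kcon 1) + 2 * ((kcon (1 / 2))⁻¹ ^ 2 * C₂), by positivity,
    fun ψ a hψ g v S hg hg2 hv hpt hS0 hS => ?_⟩
  have hψg : IsTest fun x => ψ x * g x := hψ.test.mul_contDiff hg
  have hψψg : IsTest fun x => ψ x ^ 2 * g x := by
    have : (fun x => ψ x ^ 2 * g x) = fun x => ψ x * (ψ x * g x) := by ext x; ring
    rw [this]; exact hψ.test.mul_contDiff hψg.1
  have hgU := ULI.of_memLp hg2
  have hψU := ULI.of_memLp (hψg.memLp 2)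
  -- comparison of the two quadratic forms
  have key : (∫ x, ψ x * g x * fracLapTest 1 (fun x => ψ x * g x) x) ≤
      (∫ x, g x * fracLapTest 1 (fun x => ψ x ^ 2 * g x) x) + 4 * C₁ * L ^ 2 * (∫ z, krn 2 1 z) / kcon 1 * S := by
    rw [← mul_le_mul_iff_right₀ hk1, mul_add, hψU.integral_mul_fracLap hψg one_pos one_lt_two,
      hgU.integral_mul_fracLap hψψg one_pos one_lt_two]
    have e : kcon 1 * (4 * C₁ * L ^ 2 * (∫ z, krn 2 1 z) / kcon 1 * S) = ∫ z, (4 * C₁ * S * L ^ 2) * krn 2 1 z := by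
      rw [integral_const_mul]; field_simp
    have i1 := hψU.integrable_fracLap hψg one_pos one_lt_two
    have i2 := hgU.integrable_fracLap hψψg one_pos one_lt_two
    have i3 := (integrable_krn one_pos one_lt_two).const_mul (4 * C₁ * S * L ^ 2)
    rw [e, ← integral_add i2 i3]
    refine integral_mono i1 (i2.add i3) fun z => ?_
    simp only
    rw [krn_two, ← mul_assoc, ← add_mul]
    gcongr
    rw [hψU.integral_mul_d2 hψg, hgU.integral_mul_d2 hψψg, ← sub_le_iff_le_add',
      ← integral_sub (hψU.integrable_diff hψg z) (hgU.integrable_diff hψψg z)]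
    have hc : Continuous g := hg.continuous
    have hB : MeasurableSet (Metric.closedBall a r) := Metric.isClosed_closedBall.measurableSet
    set c := ENNReal.ofReal (L ^ 2 * (min 1 ‖z‖) ^ 2)
    have hb : ∀ x, ‖(ψ x * g x - ψ (x + z) * g (x + z)) * (ψ x * g x - ψ (x + z) * g (x + z)) -
        (g x - g (x + z)) * (ψ x ^ 2 * g x - ψ (x + z) ^ 2 * g (x + z))‖ₑ ≤
        c * ((Metric.closedBall a r).indicator (fun x => ‖g x ^ 2‖ₑ) x + (Metric.closedBall (a - z) r).indicator (fun x => ‖g x ^ 2‖ₑ) x) +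
        c * ((Metric.closedBall a r).indicator (fun x => ‖g (x + z) ^ 2‖ₑ) x + (Metric.closedBall a r).indicator (fun x => ‖g x ^ 2‖ₑ) (x + z)) := by
      intro x
      have e1 : (ψ x * g x - ψ (x + z) * g (x + z)) * (ψ x * g x - ψ (x + z) * g (x + z)) -
        (g x - g (x + z)) * (ψ x ^ 2 * g x - ψ (x + z) ^ 2 * g (x + z)) = (ψ x - ψ (x + z)) ^ 2 * (g x * g (x + z)) := by ring
      rw [e1]
      by_cases h0 : ψ x = ψ (x + z)
      · simp [h0]
      have h1 : ‖(ψ x - ψ (x + z)) ^ 2 * (g x * g (x + z))‖ₑ ≤ c * (‖g x ^ 2‖ₑ + ‖g (x + z) ^ 2‖ₑ) := by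
        rw [← ofReal_norm, ← ofReal_norm, ← ofReal_norm, ← ENNReal.ofReal_add (norm_nonneg _) (norm_nonneg _),
          ← ENNReal.ofReal_mul (by positivity)]
        apply ENNReal.ofReal_le_ofReal
        rw [norm_mul, ← mul_pow]
        have h2 := hψ.d1 x (x + z)
        simp only [sub_add_cancel_left, norm_neg] at h2
        have h3 : ‖(ψ x - ψ (x + z)) ^ 2‖ ≤ (L * min 1 ‖z‖) ^ 2 := by
          rw [norm_pow]; gcongr; exact h2
        have h4 : ‖g x * g (x + z)‖ ≤ ‖g x ^ 2‖ + ‖g (x + z) ^ 2‖ := by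
          rw [norm_mul, norm_pow, norm_pow]
          nlinarith [sq_nonneg (‖g x‖ - ‖g (x + z)‖), norm_nonneg (g x), norm_nonneg (g (x + z)), sq_nonneg (‖g x‖ + ‖g (x + z)‖)]
        gcongr
      refine h1.trans ?_
      have h2 : x ∈ Metric.closedBall a r ∨ x + z ∈ Metric.closedBall a r := by
        by_contra hcn
        push Not at hcn
        have e1 : ∀ y, y ∉ Metric.closedBall a r → ψ y = 0 := fun y hy => by
          by_contra h0; exact hy (by simpa [dist_eq_norm] using hψ.supp y h0)
        exact h0 (by rw [e1 _ hcn.1, e1 _ hcn.2])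
      rw [← mul_add]
      gcongr c * ?_
      rcases h2 with h2 | h2
      · rw [Set.indicator_of_mem h2, Set.indicator_of_mem h2]
        exact add_le_add le_self_add le_self_add
      · have h2' : x ∈ Metric.closedBall (a - z) r := by
          rw [Metric.mem_closedBall, dist_eq_norm] at h2 ⊢
          rwa [show x - (a - z) = x + z - a by abel]
        rw [Set.indicator_of_mem h2, Set.indicator_of_mem h2']
        exact add_le_add le_add_self le_add_self
    refine (le_abs_self _).trans ?_
    rw [← ENNReal.ofReal_le_ofReal_iff (by positivity), ← Real.norm_eq_abs, ofReal_norm]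
    refine (enorm_integral_le_lintegral_enorm _).trans ((lintegral_mono hb).trans ?_)
    have hm1 : Measurable fun x => ‖g x ^ 2‖ₑ := (by fun_prop : Continuous fun x => g x ^ 2).measurable.enorm
    have hm2 : Measurable fun x => ‖g (x + z) ^ 2‖ₑ := (by fun_prop : Continuous fun x => g (x + z) ^ 2).measurable.enorm
    have hi1 : ∀ b, Measurable ((Metric.closedBall b r).indicator fun x => ‖g x ^ 2‖ₑ) := fun b =>
      hm1.indicator Metric.isClosed_closedBall.measurableSet
    have hb1 : ∀ b, ∫⁻ x, (Metric.closedBall b r).indicator (fun x => ‖g x ^ 2‖ₑ) x ≤ ENNReal.ofReal (C₁ * S) := fun b => by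
      rw [lintegral_indicator Metric.isClosed_closedBall.measurableSet]
      exact h₁ g S hc.aestronglyMeasurable hS b
    have hb2 : ∫⁻ x, (Metric.closedBall a r).indicator (fun x => ‖g (x + z) ^ 2‖ₑ) x ≤ ENNReal.ofReal (C₁ * S) := by
      rw [lintegral_indicator hB, lintegral_closedBall_add (fun x => ‖g x ^ 2‖ₑ)]
      exact h₁ g S hc.aestronglyMeasurable hS _
    have hb3 : ∫⁻ x, (Metric.closedBall a r).indicator (fun x => ‖g x ^ 2‖ₑ) (x + z) ≤ ENNReal.ofReal (C₁ * S) := by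
      rw [lintegral_add_right_eq_self ((Metric.closedBall a r).indicator fun x => ‖g x ^ 2‖ₑ) z]
      exact hb1 a
    have hm : Measurable fun x => c * ((Metric.closedBall a r).indicator (fun x => ‖g x ^ 2‖ₑ) x +
        (Metric.closedBall (a - z) r).indicator (fun x => ‖g x ^ 2‖ₑ) x) := ((hi1 a).add (hi1 _)).const_mul c
    rw [lintegral_add_left hm, lintegral_const_mul' _ _ ENNReal.ofReal_ne_top, lintegral_const_mul' _ _ ENNReal.ofReal_ne_top,
      lintegral_add_left (hi1 a), lintegral_add_left (hm2.indicator hB)]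
    calc _ ≤ c * (ENNReal.ofReal (C₁ * S) + ENNReal.ofReal (C₁ * S)) + c * (ENNReal.ofReal (C₁ * S) + ENNReal.ofReal (C₁ * S)) := by
          gcongr
          · exact hb1 a
          · exact hb1 _
      _ = _ := by
          rw [← ENNReal.ofReal_add (by positivity) (by positivity), ← ENNReal.ofReal_mul (by positivity),
            ← ENNReal.ofReal_add (by positivity) (by positivity)]
          congr 1; ring
  have hc := h₂ ψ a hψ g S hg.continuous hS0 hS
  have hkh := kcon_pos (by norm_num : (0 : ℝ) < 1 / 2) (by norm_num)
  have e : (fun x => ψ x * v x) = fun x => fracLapTest (1 / 2) (fun x => ψ x * g x) x + -(kcon (1 / 2))⁻¹ * comm (1 / 2) ψ g x := by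
    ext x
    rw [hpt.fracLapTest_mul (by norm_num) (by norm_num) hψg x]; ring
  have hh := isSymb_lamS (by norm_num : (0 : ℝ) ≤ 1 / 2) (by norm_num)
  rw [e]
  refine (n2_add_sq_le (hh.memLp_multiplier hψg) (hc.1.const_mul _)).trans ?_
  rw [n2_const_mul_sq, ← fracLapTest_eq, n2_fracLap_half hψg, neg_sq]
  have h3 : (kcon (1 / 2))⁻¹ ^ 2 * n2 (comm (1 / 2) ψ g) ^ 2 ≤ (kcon (1 / 2))⁻¹ ^ 2 * (C₂ * S) := by gcongr; exact hc.2
  linarith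

/-! ### Bounds used for domination -/

lemma n2_mul_le_of_bdd {ψ f : Plane → ℝ} {L : ℝ} (hψ : ∀ x, |ψ x| ≤ L) (hf : MemLp f 2 volume)
    (hψf : MemLp (fun x => ψ x * f x) 2 volume) : n2 (fun x => ψ x * f x) ^ 2 ≤ L ^ 2 * n2 f ^ 2 := by
  rw [n2_sq, n2_sq, ← integral_const_mul]
  refine integral_mono hψf.integrable_sq (hf.integrable_sq.const_mul _) fun x => ?_
  simp only [mul_pow]
  gcongr ?_ * _
  exact sq_le_sq' (abs_le.mp (hψ x)).1 (abs_le.mp (hψ x)).2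

lemma exists_fracLap_mul_le {σ : ℝ} (hσ : 0 < σ) (hσ1 : σ < 1) (L : ℝ) : ∃ C : ℝ, 0 ≤ C ∧
    ∀ (ψ : Plane → ℝ) (a : Plane) (r : ℝ), Loc ψ a r L → ∀ (f g : Plane → ℝ),
    ContDiff ℝ ((⊤ : ℕ∞) : WithTop ℕ∞) f → Continuous g → MemLp f 2 volume → MemLp g 2 volume → Pt σ f g →
    n2 (fracLapTest σ fun x => ψ x * f x) ^ 2 ≤ C * (n2 f ^ 2 + n2 g ^ 2) := by
  set I := ∫ z, krn 1 σ z
  have hk := kcon_pos hσ (by linarith : σ < 2)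
  refine ⟨2 * L ^ 2 + 2 * ((kcon σ)⁻¹ ^ 2 * (2 * (L * I)) ^ 2), by positivity, fun ψ a r hψ f g hf hg hf2 hg2 hpt => ?_⟩
  have hc := memLp_comm hσ hσ1 hψ.L_nonneg hψ.test.continuous hf.continuous hψ.d1 hf2
  have e : (fracLapTest σ fun x => ψ x * f x) = fun x => ψ x * g x + (kcon σ)⁻¹ * comm σ ψ f x := by
    ext x
    exact hpt.fracLapTest_mul hσ (by linarith) (hψ.test.mul_contDiff hf) x
  rw [e]
  refine (n2_add_sq_le (hψ.memLp_mul hg) (hc.1.const_mul _)).trans ?_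
  rw [n2_const_mul_sq]
  have h1 := n2_mul_le_of_bdd hψ.bd hg2 (hψ.memLp_mul hg)
  have h2 : n2 (comm σ ψ f) ^ 2 ≤ (2 * (L * I)) ^ 2 * n2 f ^ 2 := by
    rw [← mul_pow]; gcongr
    · exact n2_nonneg _
    · exact hc.2
  have h3 : (kcon σ)⁻¹ ^ 2 * n2 (comm σ ψ f) ^ 2 ≤ (kcon σ)⁻¹ ^ 2 * ((2 * (L * I)) ^ 2 * n2 f ^ 2) := by gcongr
  have h4 : 0 ≤ L ^ 2 * n2 f ^ 2 := by positivity
  have h5 : 0 ≤ (kcon σ)⁻¹ ^ 2 * (2 * (L * I)) ^ 2 * n2 g ^ 2 := by positivity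
  nlinarith

lemma exists_abs_dissipation_half (L : ℝ) : ∃ C : ℝ, 0 ≤ C ∧
    ∀ (ψ : Plane → ℝ) (a : Plane) (r : ℝ), Loc ψ a r L → ∀ (g v : Plane → ℝ),
    ContDiff ℝ ((⊤ : ℕ∞) : WithTop ℕ∞) g → Continuous v → MemLp g 2 volume → MemLp v 2 volume → Pt (1 / 2) g v →
    MulRel (lamS (1 / 2)) g v →
    |∫ x, g x * fracLapTest 1 (fun x => ψ x * g x) x| ≤ C * (n2 g ^ 2 + n2 v ^ 2) := by
  obtain ⟨C, hC, h⟩ := exists_fracLap_mul_le (by norm_num : (0 : ℝ) < 1 / 2) (by norm_num) L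
  refine ⟨1 + C, by positivity, fun ψ a r hψ g v hg hv hg2 hv2 hpt hrel => ?_⟩
  have hζ : IsTest fun x => ψ x * g x := hψ.test.mul_contDiff hg
  have hh := isSymb_lamS (by norm_num : (0 : ℝ) ≤ 1 / 2) (by norm_num)
  have h1 := isSymb_lamS (by norm_num : (0 : ℝ) ≤ 1) (by norm_num)
  rw [fracLapTest_eq, ← hrel.integral_multiplier hh hh h1
    (fun ξ => by rw [← lamS_add (by norm_num) (by norm_num)]; norm_num) hg2 hv2 hζ]
  refine (abs_integral_mul_le hv2 (hh.memLp_multiplier hζ)).trans ?_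
  have h2 := h ψ a r hψ g v hg hv hg2 hv2 hpt
  rw [fracLapTest_eq] at h2
  nlinarith [sq_nonneg (n2 v - n2 (multiplier (lamS (1 / 2)) fun x => ψ x * g x)), sq_nonneg (n2 g), sq_nonneg (n2 v),
    sq_nonneg (n2 (multiplier (lamS (1 / 2)) fun x => ψ x * g x))]

lemma exists_abs_dissipation_of_frac {s : ℝ} (hs : 1 / 2 < s) (hs1 : s < 1) (L : ℝ) : ∃ C : ℝ, 0 ≤ C ∧
    ∀ (ψ : Plane → ℝ) (a : Plane) (r : ℝ), Loc ψ a r L → ∀ (f g : Plane → ℝ),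
    ContDiff ℝ ((⊤ : ℕ∞) : WithTop ℕ∞) f → Continuous g → MemLp f 2 volume → MemLp g 2 volume → Pt s f g →
    MulRel (lamS s) f g →
    |∫ x, f x * fracLapTest 1 (fun x => ψ x * f x) x| ≤ C * (n2 f ^ 2 + n2 g ^ 2) := by
  obtain ⟨C, hC, h⟩ := exists_fracLap_mul_le (by linarith : 0 < s) hs1 L
  refine ⟨1 + 2 * L ^ 2 + 2 * C, by positivity, fun ψ a r hψ f g hf hg hf2 hg2 hpt hrel => ?_⟩
  have hζ : IsTest fun x => ψ x * f x := hψ.test.mul_contDiff hf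
  have hs' := isSymb_lamS (by linarith : 0 ≤ s) (by linarith)
  have ht' := isSymb_lamS (by linarith : 0 ≤ 1 - s) (by linarith)
  have h1 := isSymb_lamS (by norm_num : (0 : ℝ) ≤ 1) (by norm_num)
  rw [fracLapTest_eq, ← hrel.integral_multiplier hs' ht' h1
    (fun ξ => by rw [← lamS_add (by linarith) (by linarith)]; congr 1; ring) hf2 hg2 hζ]
  refine (abs_integral_mul_le hg2 (ht'.memLp_multiplier hζ)).trans ?_
  have h2 := h ψ a r hψ f g hf hg hf2 hg2 hpt
  have h3 := n2_mul_le_of_bdd hψ.bd hf2 (hψ.memLp_mul hf.continuous)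
  have hle : ∀ ξ, ‖lamS (1 - s) ξ‖ ≤ 1 + ‖lamS s ξ‖ := fun ξ => by
    rw [lamS, lamS, norm_real, norm_real, Real.norm_of_nonneg (by positivity), Real.norm_of_nonneg (by positivity)]
    have hx : 0 ≤ 2 * Real.pi * ‖ξ‖ := by positivity
    rcases le_total (2 * Real.pi * ‖ξ‖) 1 with h | h
    · have := Real.rpow_le_one hx h (by linarith : 0 ≤ 1 - s)
      have : 0 ≤ (2 * Real.pi * ‖ξ‖) ^ s := by positivity
      linarith
    · have := Real.rpow_le_rpow_of_exponent_le h (by linarith : 1 - s ≤ s)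
      linarith
  have h4 := n2_multiplier_sq_le ht' hs' hle hζ
  rw [← fracLapTest_eq s] at h4
  have h5 := sq_nonneg (n2 g)
  have h6 : 0 ≤ L ^ 2 * n2 g ^ 2 := by positivity
  have h7 : 0 ≤ C * n2 g ^ 2 := by positivity
  have h8 := sq_nonneg (n2 f)
  nlinarith [sq_nonneg (n2 g - n2 (multiplier (lamS (1 - s)) fun x => ψ x * f x))]

/-! ### The transport term -/

lemma pd_mul_pow {Φ g : Plane → ℝ} (hΦ : Differentiable ℝ Φ) (hg : Differentiable ℝ g) (k : ℕ) (j : Fin 2) (x : Plane) :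
    pd j (fun x => Φ x * g x ^ (k + 1)) x = pd j Φ x * g x ^ (k + 1) + (k + 1) * (Φ x * (g x ^ k * pd j g x)) := by
  have h1 := (hΦ x).hasFDerivAt.mul ((hg x).hasFDerivAt.pow (k + 1))
  have h2 : HasFDerivAt (fun x => Φ x * g x ^ (k + 1)) _ x := h1
  unfold pd
  rw [h2.fderiv]
  simp
  ring

lemma continuous_pd {g : Plane → ℝ} (hg : ContDiff ℝ ((⊤ : ℕ∞) : WithTop ℕ∞) g) (j : Fin 2) : Continuous (pd j g) :=
  (hg.continuous_fderiv (by simp)).clm_apply continuous_const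

lemma transport_eq {g : Plane → ℝ} {U V : Fin 2 → Plane → ℝ} (hg : ContDiff ℝ ((⊤ : ℕ∞) : WithTop ℕ∞) g)
    (hU : ∀ j, Continuous (U j)) (hV : ∀ j, Continuous (V j)) (hg2 : MemLp g 2 volume) (hU2 : ∀ j, MemLp (U j) 2 volume)
    (hvel : ∀ j, MulRel (uS j) g (U j)) {Φ : Plane → ℝ} (hΦ : IsTest Φ) (k : ℕ) :
    ∑ j, ∫ x, V j x * pd j (fun x => Φ x * g x ^ (k + 1)) x =
      (∑ j, ∫ x, (V j x - U j x * g x) * pd j (fun x => Φ x * g x ^ (k + 1)) x) +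
      ((k : ℝ) + 2)⁻¹ * ∑ j, ∫ x, U j x * (pd j Φ x * g x ^ (k + 2)) := by
  have hgd := hg.differentiable (by simp)
  have hgc := hg.continuous
  have ht : ∀ m : ℕ, IsTest fun x => Φ x * g x ^ m := fun m => hΦ.mul_contDiff (hg.pow m)
  have hdiv := sum_integral_mul_pd hg2 hU2 hvel (ht (k + 2))
  have hint : ∀ {A B : Plane → ℝ}, Continuous A → IsTest B → Integrable fun x => A x * B x := fun hA hB =>
    (hA.mul hB.continuous).integrable_of_hasCompactSupport hB.2.mul_left
  have e : ∀ j x, V j x * pd j (fun x => Φ x * g x ^ (k + 1)) x =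
      (V j x - U j x * g x) * pd j (fun x => Φ x * g x ^ (k + 1)) x + (((k : ℝ) + 2)⁻¹ * (U j x * (pd j Φ x * g x ^ (k + 2))) +
      (((k : ℝ) + 1) / (k + 2)) * (U j x * pd j (fun x => Φ x * g x ^ (k + 2)) x)) := by
    intro j x
    rw [pd_mul_pow hΦ.differentiable hgd, pd_mul_pow hΦ.differentiable hgd (k + 1)]
    push_cast
    field_simp
    ring
  have hpdt : ∀ j, IsTest fun x => pd j Φ x * g x ^ (k + 2) := fun j => (hΦ.pd j).mul_contDiff (hg.pow _)
  simp_rw [e]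
  have i1 : ∀ j, Integrable fun x => (V j x - U j x * g x) * pd j (fun x => Φ x * g x ^ (k + 1)) x := fun j =>
    hint ((hV j).sub ((hU j).mul hgc)) ((ht _).pd j)
  have i2 : ∀ j, Integrable fun x => ((k : ℝ) + 2)⁻¹ * (U j x * (pd j Φ x * g x ^ (k + 2))) := fun j =>
    (hint (hU j) (hpdt j)).const_mul _
  have i3 : ∀ j, Integrable fun x => (((k : ℝ) + 1) / (k + 2)) * (U j x * pd j (fun x => Φ x * g x ^ (k + 2)) x) := fun j =>
    (hint (hU j) ((ht _).pd j)).const_mul _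
  have e2 : ∀ j, ∫ x, ((V j x - U j x * g x) * pd j (fun x => Φ x * g x ^ (k + 1)) x + (((k : ℝ) + 2)⁻¹ * (U j x * (pd j Φ x * g x ^ (k + 2))) +
      (((k : ℝ) + 1) / (k + 2)) * (U j x * pd j (fun x => Φ x * g x ^ (k + 2)) x))) =
      (∫ x, (V j x - U j x * g x) * pd j (fun x => Φ x * g x ^ (k + 1)) x) + (((k : ℝ) + 2)⁻¹ * ∫ x, U j x * (pd j Φ x * g x ^ (k + 2))) +
      (((k : ℝ) + 1) / (k + 2)) * ∫ x, U j x * pd j (fun x => Φ x * g x ^ (k + 2)) x := fun j => by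
    have i23 : Integrable fun x => ((k : ℝ) + 2)⁻¹ * (U j x * (pd j Φ x * g x ^ (k + 2))) +
      (((k : ℝ) + 1) / (k + 2)) * (U j x * pd j (fun x => Φ x * g x ^ (k + 2)) x) := (i2 j).add (i3 j)
    rw [integral_add (i1 j) i23, integral_add (i2 j) (i3 j), integral_const_mul, integral_const_mul, add_assoc]
  simp_rw [e2]
  rw [Finset.sum_add_distrib, Finset.sum_add_distrib, ← Finset.mul_sum, ← Finset.mul_sum, hdiv]
  ring

/-! ### The commutator of mollification and multiplication -/

lemma sq_mollified_sub_le {θ u ρ : Plane → ℝ} {K G δ : ℝ} (hρ : IsMoll G δ ρ) (hK : ∀ᵐ x, |θ x| ≤ K) (hθ : MemLp θ 2 volume)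
    (hu : MemLp u 2 volume) (x : Plane) :
    (cv (fun y => θ y * u y) ρ x - cv u ρ x * cv θ ρ x) ^ 2 ≤ (2 * K) ^ 2 * (cv (fun y => u y ^ 2) ρ x - cv u ρ x ^ 2) := by
  set k : Plane → ℝ := fun y => ρ (x - y)
  have hkt : IsTest k := hρ.test.sub_comp x
  have hk0 : ∀ y, 0 ≤ k y := fun y => hρ.nonneg _
  have hk1 : ∫ y, k y = 1 := by
    rw [← hρ.int]; exact integral_sub_left_eq_self (fun y => ρ y) volume x
  set g := cv θ ρ x
  set U := cv u ρ x
  have iθ : Integrable fun y => θ y * k y := (ULI.of_memLp hθ).integrable_mul hkt.continuous hkt.2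
  have iu : Integrable fun y => u y * k y := (ULI.of_memLp hu).integrable_mul hkt.continuous hkt.2
  have iu2 : Integrable fun y => u y ^ 2 * k y := (ULI.of_integrable hu.integrable_sq).integrable_mul hkt.continuous hkt.2
  have iθu : Integrable fun y => θ y * u y * k y :=
    (ULI.of_integrable (hθ.integrable_mul hu)).integrable_mul hkt.continuous hkt.2
  have ik := hkt.integrable
  have hg : |g| ≤ K := by
    have := abs_integral_mul_le_of_bdd hK ik
    rwa [show ∫ y, |k y| = 1 by rw [← hk1]; congr 1 with y; exact abs_of_nonneg (hk0 y), mul_one] at this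
  have hV : cv (fun y => θ y * u y) ρ x - U * g = ∫ y, (θ y - g) * ((u y - U) * k y) := by
    have e : ∀ y, (θ y - g) * ((u y - U) * k y) = (θ y * u y * k y - U * (θ y * k y)) - (g * (u y * k y) - g * U * k y) := fun y => by ring
    simp_rw [e]
    have j1 : Integrable fun y => θ y * u y * k y - U * (θ y * k y) := iθu.sub (iθ.const_mul U)
    have j2 : Integrable fun y => g * (u y * k y) - g * U * k y := (iu.const_mul g).sub (ik.const_mul (g * U))
    rw [integral_sub j1 j2, integral_sub iθu (iθ.const_mul U),
      integral_sub (iu.const_mul g) (ik.const_mul _), integral_const_mul, integral_const_mul, integral_const_mul, hk1]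
    show _ = cv (fun y => θ y * u y) ρ x - U * cv θ ρ x - (g * cv u ρ x - g * U * 1)
    ring
  have iB : Integrable fun y => (u y - U) * k y := by
    refine (iu.sub (ik.const_mul U)).congr (.of_forall fun y => ?_)
    simp only [Pi.sub_apply]; ring
  have iB2 : Integrable fun y => (u y - U) ^ 2 * k y := by
    refine ((iu2.sub (iu.const_mul (2 * U))).add (ik.const_mul (U ^ 2))).congr (.of_forall fun y => ?_)
    simp only [Pi.sub_apply, Pi.add_apply]; ring
  have hB2 : ∫ y, (u y - U) ^ 2 * k y = cv (fun y => u y ^ 2) ρ x - U ^ 2 := by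
    have e : ∀ y, (u y - U) ^ 2 * k y = u y ^ 2 * k y - (2 * U * (u y * k y) - U ^ 2 * k y) := fun y => by ring
    simp_rw [e]
    have j1 : Integrable fun y => 2 * U * (u y * k y) - U ^ 2 * k y := (iu.const_mul (2 * U)).sub (ik.const_mul (U ^ 2))
    rw [integral_sub iu2 j1, integral_sub (iu.const_mul (2 * U)) (ik.const_mul _),
      integral_const_mul, integral_const_mul, hk1]
    show cv (fun y => u y ^ 2) ρ x - (2 * U * cv u ρ x - U ^ 2 * 1) = _
    ring
  set c := ∫ y, |(u y - U) * k y|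
  have hc0 : 0 ≤ c := integral_nonneg fun _ => abs_nonneg _
  have hc : c ^ 2 ≤ ∫ y, (u y - U) ^ 2 * k y := by
    have h0 : 0 ≤ ∫ y, (|u y - U| - c) ^ 2 * k y := integral_nonneg fun y => mul_nonneg (sq_nonneg _) (hk0 y)
    have e : ∀ y, (|u y - U| - c) ^ 2 * k y = (u y - U) ^ 2 * k y - (2 * c * |(u y - U) * k y| - c ^ 2 * k y) := fun y => by
      rw [abs_mul, abs_of_nonneg (hk0 y)]
      have := sq_abs (u y - U)
      linear_combination k y * this
    simp_rw [e] at h0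
    have j1 : Integrable fun y => 2 * c * |(u y - U) * k y| - c ^ 2 * k y := (iB.abs.const_mul (2 * c)).sub (ik.const_mul (c ^ 2))
    rw [integral_sub iB2 j1, integral_sub (iB.abs.const_mul (2 * c)) (ik.const_mul _),
      integral_const_mul, integral_const_mul, hk1] at h0
    have : (2 * c * ∫ y, |(u y - U) * k y|) = 2 * c * c := rfl
    nlinarith
  have hA : |∫ y, (θ y - g) * ((u y - U) * k y)| ≤ 2 * K * c := by
    refine abs_integral_mul_le_of_bdd ?_ iB
    filter_upwards [hK] with y hy
    exact (abs_sub _ _).trans (by linarith)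
  rw [hV, ← hB2]
  calc _ ≤ (2 * K * c) ^ 2 := sq_le_sq' (abs_le.mp hA).1 (abs_le.mp hA).2
    _ = (2 * K) ^ 2 * c ^ 2 := by ring
    _ ≤ _ := by gcongr

lemma integral_cv {h ρ : Plane → ℝ} (hh : Integrable h) (hρ : Integrable ρ) :
    ∫ x, cv h ρ x = (∫ x, h x) * ∫ x, ρ x := by
  rw [cv_eq_convolution]
  have := integral_convolution (μ := (volume : Measure Plane)) (ν := volume) (ContinuousLinearMap.mul ℝ ℝ) hh hρ
  simpa using this

lemma integrable_cv {h ρ : Plane → ℝ} (hh : Integrable h) (hρ : IsTest ρ) : Integrable (cv h ρ) :=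
  (integral_abs_cv_le hh hρ).1

lemma norm_lamS_half_sq (ξ : Plane) : ‖lamS (1 / 2) ξ‖ ^ 2 = 2 * Real.pi * ‖ξ‖ := by
  rw [lamS, norm_real, Real.norm_of_nonneg (by positivity), ← Real.rpow_natCast, ← Real.rpow_mul (by positivity)]
  norm_num

/-- The mollification error of a product. -/
lemma n2_mollified_sub_le {θ u v ρ : Plane → ℝ} {K G δ : ℝ} (hρ : IsMoll G δ ρ) (hδ : 0 < δ) (hK : ∀ᵐ x, |θ x| ≤ K)
    (hθ : MemLp θ 2 volume) (hu : MemLp u 2 volume) (hv : MemLp v 2 volume) {j : Fin 2} (hr : MulRel (uS j) θ u)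
    (hh : MulRel (lamS (1 / 2)) θ v) :
    MemLp (fun x => cv (fun y => θ y * u y) ρ x - cv u ρ x * cv θ ρ x) 2 volume ∧
    n2 (fun x => cv (fun y => θ y * u y) ρ x - cv u ρ x * cv θ ρ x) ^ 2 ≤ 8 * K ^ 2 * δ * n2 v ^ 2 := by
  have hUc := memLp_cv hu hρ.test.integrable
  have i1 := (integrable_cv hu.integrable_sq hρ.test).sub hUc.integrable_sq
  have hp := sq_mollified_sub_le hρ hK hθ hu
  have hm : AEStronglyMeasurable (fun x => cv (fun y => θ y * u y) ρ x - cv u ρ x * cv θ ρ x) volume :=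
    (aestronglyMeasurable_cv (hθ.1.mul hu.1) hρ.test.continuous.aestronglyMeasurable).sub
      ((aestronglyMeasurable_cv hu.1 hρ.test.continuous.aestronglyMeasurable).mul
        (aestronglyMeasurable_cv hθ.1 hρ.test.continuous.aestronglyMeasurable))
  have hL : MemLp (fun x => cv (fun y => θ y * u y) ρ x - cv u ρ x * cv θ ρ x) 2 volume := by
    rw [memLp_two_iff_integrable_sq hm]
    refine (i1.const_mul ((2 * K) ^ 2)).mono' (hm.pow 2) (.of_forall fun x => ?_)
    rw [Real.norm_of_nonneg (sq_nonneg _)]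
    exact hp x
  refine ⟨hL, ?_⟩
  have i2 : Integrable fun ξ => ‖ft u ξ‖ ^ 2 := (memLp_ft u).integrable_norm_pow (p := 2) (by norm_num)
  have i3 : Integrable fun ξ => ‖ft (cv u ρ) ξ‖ ^ 2 := (memLp_ft _).integrable_norm_pow (p := 2) (by norm_num)
  have i4 : Integrable fun ξ => ‖ft v ξ‖ ^ 2 := (memLp_ft v).integrable_norm_pow (p := 2) (by norm_num)
  have key : n2 u ^ 2 - n2 (cv u ρ) ^ 2 ≤ 2 * δ * n2 v ^ 2 := by
    rw [n2_eq_ft hu, n2_eq_ft hUc, n2_eq_ft hv, ← integral_sub i2 i3, ← integral_const_mul]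
    refine integral_mono_ae (i2.sub i3) (i4.const_mul _) ?_
    filter_upwards [ft_cv hu hρ.test, hr.ft (isSymb_uS j) hθ hu,
      hh.ft (isSymb_lamS (by norm_num) (by norm_num)) hθ hv] with ξ h1 h2 h3
    rw [h1, h3, conj_lamS, norm_mul, norm_mul, mul_pow, mul_pow, norm_lamS_half_sq]
    have a1 := hρ.norm_hat_le ξ
    have a2 := hρ.norm_hat_sub_one_le ξ
    have a3 : 1 - ‖hat ρ ξ‖ ≤ 2 * Real.pi * δ * ‖ξ‖ := by
      have := norm_sub_norm_le (1 : ℂ) (hat ρ ξ)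
      rw [norm_one, norm_sub_rev] at this
      linarith
    have a4 : ‖ft u ξ‖ ^ 2 ≤ ‖ft θ ξ‖ ^ 2 := by
      rw [h2, norm_mul, RCLike.norm_conj]
      gcongr
      exact mul_le_of_le_one_left (norm_nonneg _) (norm_uS_le j ξ)
    have a5 : 1 - ‖hat ρ ξ‖ ^ 2 ≤ 2 * (2 * Real.pi * δ * ‖ξ‖) := by
      nlinarith [norm_nonneg (hat ρ ξ)]
    have a6 : 0 ≤ 2 * (2 * Real.pi * δ * ‖ξ‖) := by positivity
    calc ‖ft u ξ‖ ^ 2 - ‖hat ρ ξ‖ ^ 2 * ‖ft u ξ‖ ^ 2 = (1 - ‖hat ρ ξ‖ ^ 2) * ‖ft u ξ‖ ^ 2 := by ring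
      _ ≤ 2 * (2 * Real.pi * δ * ‖ξ‖) * ‖ft u ξ‖ ^ 2 := by gcongr
      _ ≤ 2 * (2 * Real.pi * δ * ‖ξ‖) * ‖ft θ ξ‖ ^ 2 := by gcongr
      _ = _ := by ring
  calc _ ≤ ∫ x, (2 * K) ^ 2 * (cv (fun y => u y ^ 2) ρ x - cv u ρ x ^ 2) := by
        rw [n2_sq]; exact integral_mono hL.integrable_sq (i1.const_mul _) hp
    _ = (2 * K) ^ 2 * (n2 u ^ 2 - n2 (cv u ρ) ^ 2) := by
        rw [integral_const_mul, integral_sub (integrable_cv hu.integrable_sq hρ.test) hUc.integrable_sq,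
          integral_cv hu.integrable_sq hρ.test.integrable, hρ.int, mul_one, n2_sq, n2_sq]
    _ ≤ (2 * K) ^ 2 * (2 * δ * n2 v ^ 2) := by gcongr
    _ = _ := by ring

lemma IsMoll.norm_mul_hat_le {G δ : ℝ} {ρ : Plane → ℝ} (h : IsMoll G δ ρ) (ξ : Plane) :
    2 * Real.pi * ‖ξ‖ * ‖hat ρ ξ‖ ≤ 2 * (G / δ) := by
  have h1 : ∀ j, 2 * Real.pi * |ξ j| * ‖hat ρ ξ‖ ≤ G / δ := fun j => by
    have h2 := h.test.hat_pd j ξ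
    have h3 : ‖hat (pd j ρ) ξ‖ ≤ ∫ x, |pd j ρ x| := by
      rw [hat, Real.fourier_eq']
      refine (norm_integral_le_integral_norm _).trans_eq ?_
      congr 1 with x
      rw [norm_smul, Complex.norm_exp_ofReal_mul_I, one_mul, norm_real, Real.norm_eq_abs]
    rw [h2, norm_mul, norm_mul, norm_I, one_mul, norm_real, norm_mul, Real.norm_eq_abs, Real.norm_eq_abs,
      abs_of_pos (by positivity : 0 < 2 * Real.pi)] at h3
    exact h3.trans (h.grad j)
  have h2 : ‖ξ‖ ≤ |ξ 0| + |ξ 1| := by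
    rw [EuclideanSpace.norm_eq, Fin.sum_univ_two]
    apply Real.sqrt_le_iff.mpr
    constructor
    · positivity
    · simp only [Real.norm_eq_abs]
      nlinarith [abs_nonneg (ξ 0), abs_nonneg (ξ 1)]
  have hp := Real.pi_pos
  calc _ ≤ 2 * Real.pi * (|ξ 0| + |ξ 1|) * ‖hat ρ ξ‖ := by gcongr
    _ = 2 * Real.pi * |ξ 0| * ‖hat ρ ξ‖ + 2 * Real.pi * |ξ 1| * ‖hat ρ ξ‖ := by ring
    _ ≤ _ := by linarith [h1 0, h1 1]

lemma n2_pd_cv_sq {θ ρ : Plane → ℝ} (hρ : IsTest ρ) (hθ : MemLp θ 2 volume)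
    (j : Fin 2) : MemLp (pd j (cv θ ρ)) 2 volume ∧
    n2 (pd j (cv θ ρ)) ^ 2 = ∫ ξ, ‖hat (pd j ρ) ξ‖ ^ 2 * ‖ft θ ξ‖ ^ 2 := by
  rw [pd_cv (ULI.of_memLp hθ).locallyIntegrable hρ]
  have hm := memLp_cv hθ (hρ.pd j).integrable
  refine ⟨hm, ?_⟩
  rw [n2_eq_ft hm]
  apply integral_congr_ae
  filter_upwards [ft_cv hθ (hρ.pd j)] with ξ h
  rw [h, norm_mul, mul_pow]

lemma IsMoll.grad_aux {G δ : ℝ} {ρ : Plane → ℝ} (h : IsMoll G δ ρ) (hδ : 0 < δ) (j : Fin 2) (ξ : Plane) (a b : ℂ)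
    (hab : b = conj (lamS (1 / 2) ξ) * a) :
    δ * (‖hat (pd j ρ) ξ‖ ^ 2 * ‖a‖ ^ 2) ≤ 2 * G * ‖b‖ ^ 2 ∧
    δ * (‖hat (pd j ρ) ξ‖ ^ 2 * ‖a‖ ^ 2) ≤ δ * (2 * Real.pi * ‖ξ‖ * ‖b‖ ^ 2) := by
  have h1 : ‖hat (pd j ρ) ξ‖ ≤ 2 * Real.pi * ‖ξ‖ * ‖hat ρ ξ‖ := by
    rw [h.test.hat_pd j ξ, norm_mul, norm_mul, norm_I, one_mul, norm_real, norm_mul, Real.norm_eq_abs, Real.norm_eq_abs,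
      abs_of_pos (by positivity : 0 < 2 * Real.pi)]
    have : |ξ j| ≤ ‖ξ‖ := by simpa using PiLp.norm_apply_le ξ j
    gcongr
  have h2 := h.norm_hat_le ξ
  have h3 := h.norm_mul_hat_le ξ
  have hx : 0 ≤ 2 * Real.pi * ‖ξ‖ := by positivity
  have hb : ‖b‖ ^ 2 = 2 * Real.pi * ‖ξ‖ * ‖a‖ ^ 2 := by
    rw [hab, conj_lamS, norm_mul, mul_pow, norm_lamS_half_sq]
  have h4 : δ * (2 * Real.pi * ‖ξ‖ * ‖hat ρ ξ‖) ≤ 2 * G := by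
    calc _ ≤ δ * (2 * (G / δ)) := by gcongr
      _ = 2 * G := by field_simp
  have hρ0 := norm_nonneg (hat ρ ξ)
  rw [hb]
  constructor
  · calc δ * (‖hat (pd j ρ) ξ‖ ^ 2 * ‖a‖ ^ 2) ≤ δ * ((2 * Real.pi * ‖ξ‖ * ‖hat ρ ξ‖) ^ 2 * ‖a‖ ^ 2) := by gcongr
      _ = (δ * (2 * Real.pi * ‖ξ‖ * ‖hat ρ ξ‖)) * (‖hat ρ ξ‖ * (2 * Real.pi * ‖ξ‖ * ‖a‖ ^ 2)) := by ring
      _ ≤ (2 * G) * (1 * (2 * Real.pi * ‖ξ‖ * ‖a‖ ^ 2)) := by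
        gcongr
        exact le_trans (by positivity) h4
      _ = _ := by ring
  · calc δ * (‖hat (pd j ρ) ξ‖ ^ 2 * ‖a‖ ^ 2) ≤ δ * ((2 * Real.pi * ‖ξ‖ * 1) ^ 2 * ‖a‖ ^ 2) := by
          gcongr
          exact h1.trans (by gcongr)
      _ = _ := by ring

lemma IsMoll.n2_grad_le {G δ : ℝ} {ρ θ v : Plane → ℝ} (h : IsMoll G δ ρ) (hδ : 0 < δ) (hθ : MemLp θ 2 volume) (hv : MemLp v 2 volume)
    (hh : MulRel (lamS (1 / 2)) θ v) (j : Fin 2) : δ * n2 (pd j (cv θ ρ)) ^ 2 ≤ 2 * G * n2 v ^ 2 := by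
  rw [(n2_pd_cv_sq h.test hθ j).2, n2_eq_ft hv, ← integral_const_mul, ← integral_const_mul]
  refine integral_mono_of_nonneg (.of_forall fun ξ => by positivity)
    (((memLp_ft v).integrable_norm_pow (p := 2) (by norm_num)).const_mul _) ?_
  filter_upwards [hh.ft (isSymb_lamS (by norm_num) (by norm_num)) hθ hv] with ξ h1
  exact (h.grad_aux hδ j ξ _ _ h1).1

lemma IsMollSeq.tendsto_grad {G : ℝ} {δ : ℕ → ℝ} {ρ : ℕ → Plane → ℝ} {θ v : Plane → ℝ} (h : IsMollSeq G δ ρ)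
    (hθ : MemLp θ 2 volume) (hv : MemLp v 2 volume) (hh : MulRel (lamS (1 / 2)) θ v) (j : Fin 2) :
    Tendsto (fun n => δ n * n2 (pd j (cv θ (ρ n))) ^ 2) atTop (𝓝 0) := by
  have hft := hh.ft (isSymb_lamS (by norm_num) (by norm_num)) hθ hv
  have e : ∀ n, δ n * n2 (pd j (cv θ (ρ n))) ^ 2 = ∫ ξ, δ n * (‖hat (pd j (ρ n)) ξ‖ ^ 2 * ‖ft θ ξ‖ ^ 2) := fun n => by
    rw [(n2_pd_cv_sq (h.moll n).test hθ j).2, integral_const_mul]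
  simp_rw [e]
  have h0 : (0 : ℝ) = ∫ ξ : Plane, (0 : ℝ) := by simp
  rw [h0]
  refine tendsto_integral_of_dominated_convergence (fun ξ => 2 * G * ‖ft v ξ‖ ^ 2) (fun n => ?_)
    (((memLp_ft v).integrable_norm_pow (p := 2) (by norm_num)).const_mul _) (fun n => ?_) ?_
  · exact ((((h.moll n).test.pd j).continuous_hat.norm.pow 2).aestronglyMeasurable.mul ((memLp_ft θ).1.norm.pow 2)).const_mul _
  · filter_upwards [hft] with ξ h1
    have := h.pos n
    rw [Real.norm_of_nonneg (by positivity)]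
    exact ((h.moll n).grad_aux (h.pos n) j ξ _ _ h1).1
  · filter_upwards [hft] with ξ h1
    have h2 : Tendsto (fun n => δ n * (2 * Real.pi * ‖ξ‖ * ‖ft v ξ‖ ^ 2)) atTop (𝓝 (0 * (2 * Real.pi * ‖ξ‖ * ‖ft v ξ‖ ^ 2))) :=
      h.lim.mul_const _
    rw [zero_mul] at h2
    refine squeeze_zero (fun n => ?_) (fun n => ((h.moll n).grad_aux (h.pos n) j ξ _ _ h1).2) h2
    have := h.pos n
    positivity

/-- The part of the transport term that vanishes with the mollification. -/
lemma exists_transport_error_le (K L G : ℝ) (k : ℕ) : ∃ C : ℝ, 0 ≤ C ∧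
    ∀ (Φ : Plane → ℝ) (a : Plane) (r : ℝ), Loc Φ a r L → ∀ (ρ : Plane → ℝ) (δ : ℝ), IsMoll G δ ρ → 0 < δ →
    ∀ (θ u v : Plane → ℝ) (j : Fin 2), (∀ᵐ x, |θ x| ≤ K) → MemLp θ 2 volume → MemLp u 2 volume → MemLp v 2 volume →
    MulRel (uS j) θ u → MulRel (lamS (1 / 2)) θ v →
    |∫ x, (cv (fun y => θ y * u y) ρ x - cv u ρ x * cv θ ρ x) * pd j (fun x => Φ x * cv θ ρ x ^ (k + 1)) x| ≤
      C * n2 v * Real.sqrt (δ * n2 θ ^ 2 + δ * n2 (pd j (cv θ ρ)) ^ 2) := by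
  set D : ℝ := 2 * (L * K ^ k) ^ 2 + 2 * (((k : ℝ) + 1) * (L * K ^ k)) ^ 2
  have hD : 0 ≤ D := by positivity
  refine ⟨Real.sqrt (8 * K ^ 2 * D), by positivity, fun Φ a r hΦ ρ δ hρ hδ θ u v j hK hθ hu hv hr hh => ?_⟩
  obtain ⟨e1, e2⟩ := n2_mollified_sub_le hρ hδ hK hθ hu hv hr hh
  obtain ⟨p1, -⟩ := n2_pd_cv_sq hρ.test hθ j
  have hg := cv_contDiff_of_memLp hθ hρ.test
  have hg2 := memLp_cv hθ hρ.test.integrable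
  have hgn : n2 (cv θ ρ) ≤ n2 θ := by
    have := n2_cv_le hθ hρ.test.integrable
    rwa [hρ.integral_abs, one_mul] at this
  have hgK : ∀ x, |cv θ ρ x| ≤ K := fun x => by
    refine (abs_integral_mul_le_of_bdd hK (hρ.test.sub_comp x).integrable).trans_eq ?_
    rw [integral_sub_left_eq_self (fun y => |ρ y|) volume x, hρ.integral_abs, mul_one]
  have ht : IsTest fun x => Φ x * cv θ ρ x ^ (k + 1) := hΦ.test.mul_contDiff (hg.pow _)
  have hL := hΦ.L_nonneg
  refine (abs_integral_mul_le e1 ((ht.pd j).memLp 2)).trans ?_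
  have hfun : pd j (fun x => Φ x * cv θ ρ x ^ (k + 1)) = fun x => (pd j Φ x * cv θ ρ x ^ k) * cv θ ρ x +
      (((k : ℝ) + 1) * (Φ x * cv θ ρ x ^ k)) * pd j (cv θ ρ) x := by
    ext x
    rw [pd_mul_pow hΦ.test.differentiable (hg.differentiable (by simp))]; ring
  have hgk : ∀ x, |cv θ ρ x ^ k| ≤ K ^ k := fun x => by
    rw [abs_pow]; exact pow_le_pow_left₀ (abs_nonneg _) (hgK x) k
  have b1 : ∀ x, |pd j Φ x * cv θ ρ x ^ k| ≤ L * K ^ k := fun x => by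
    rw [abs_mul]; exact mul_le_mul (hΦ.pd_le j x) (hgk x) (abs_nonneg _) hL
  have b2 : ∀ x, |((k : ℝ) + 1) * (Φ x * cv θ ρ x ^ k)| ≤ ((k : ℝ) + 1) * (L * K ^ k) := fun x => by
    rw [abs_mul, abs_mul, abs_of_pos (by positivity : (0 : ℝ) < k + 1)]
    gcongr
    · exact hΦ.bd x
    · exact hgk x
  have m1 : MemLp (fun x => (pd j Φ x * cv θ ρ x ^ k) * cv θ ρ x) 2 volume := by
    have : IsTest fun x => pd j Φ x * cv θ ρ x ^ (k + 1) := (hΦ.test.pd j).mul_contDiff (hg.pow _)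
    refine (this.memLp 2).ae_eq (.of_forall fun x => ?_)
    simp only; ring
  have m2 : MemLp (fun x => (((k : ℝ) + 1) * (Φ x * cv θ ρ x ^ k)) * pd j (cv θ ρ) x) 2 volume := by
    have hc := continuous_pd hg j
    have := hg.continuous
    have h1 : Continuous fun x => Φ x * (((k : ℝ) + 1) * (cv θ ρ x ^ k * pd j (cv θ ρ) x)) := by
      have := hΦ.test.continuous; fun_prop
    refine (h1.memLp_of_hasCompactSupport (p := 2) hΦ.test.2.mul_right).ae_eq (.of_forall fun x => ?_)
    simp only; ring
  have b3 : n2 (pd j fun x => Φ x * cv θ ρ x ^ (k + 1)) ^ 2 ≤ D * (n2 θ ^ 2 + n2 (pd j (cv θ ρ)) ^ 2) := by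
    rw [hfun]
    refine (n2_add_sq_le m1 m2).trans ?_
    have c1 := n2_mul_le_of_bdd b1 hg2 m1
    have c2 := n2_mul_le_of_bdd b2 p1 m2
    have c3 : n2 (cv θ ρ) ^ 2 ≤ n2 θ ^ 2 := by gcongr; exact n2_nonneg _
    have c4 : (L * K ^ k) ^ 2 * n2 (cv θ ρ) ^ 2 ≤ (L * K ^ k) ^ 2 * n2 θ ^ 2 := by gcongr
    have c5 : 0 ≤ (((k : ℝ) + 1) * (L * K ^ k)) ^ 2 * n2 θ ^ 2 := by positivity
    have c6 : 0 ≤ (L * K ^ k) ^ 2 * n2 (pd j (cv θ ρ)) ^ 2 := by positivity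
    simp only [D]
    linarith
  have hnv := n2_nonneg v
  have hX := n2_nonneg (fun x => cv (fun y => θ y * u y) ρ x - cv u ρ x * cv θ ρ x)
  have hY := n2_nonneg (pd j fun x => Φ x * cv θ ρ x ^ (k + 1))
  refine abs_le_of_sq_le_sq' (a := n2 (fun x => cv (fun y => θ y * u y) ρ x - cv u ρ x * cv θ ρ x) * n2 (pd j fun x => Φ x * cv θ ρ x ^ (k + 1))) ?_ (by positivity) |>.2
  rw [mul_pow, mul_pow, mul_pow, Real.sq_sqrt (by positivity), Real.sq_sqrt (by positivity)]
  calc _ ≤ (8 * K ^ 2 * δ * n2 v ^ 2) * (D * (n2 θ ^ 2 + n2 (pd j (cv θ ρ)) ^ 2)) := by gcongr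
    _ = _ := by ring

/-! ### Local bounds for the velocity -/

lemma eLpNorm_two_sq (h : Plane → ℝ) (μ : Measure Plane) : eLpNorm h 2 μ ^ 2 = ∫⁻ x, ‖h x‖ₑ ^ 2 ∂μ := by
  have := eLpNorm_nnreal_pow_eq_lintegral (f := h) (μ := μ) (p := 2) (by norm_num)
  simpa using this

lemma eLpNorm_two_eq {h : Plane → ℝ} (hh : MemLp h 2 volume) : eLpNorm h 2 volume = ENNReal.ofReal (n2 h) := by
  have h1 := eLpNorm_two_sq h volume
  rw [lintegral_enorm_sq_eq hh, ENNReal.ofReal_pow (n2_nonneg h)] at h1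
  exact (ENNReal.pow_right_strictMono two_ne_zero).injective h1

lemma UB.of_tendsto {h : Plane → ℝ} {H : ℕ → Plane → ℝ} {S : ℝ} (hm : MemLp h 2 volume) (hH : ∀ n, MemLp (H n) 2 volume)
    (hUB : ∀ n, UB (H n) S) (hl : Tendsto (fun n => n2 (fun x => H n x - h x)) atTop (𝓝 0)) : UB h S := by
  intro a
  set μ := (volume : Measure Plane).restrict (Metric.closedBall a 1)
  have key : eLpNorm h 2 μ ≤ ENNReal.ofReal (Real.sqrt S) := by
    have hle : ∀ n, eLpNorm h 2 μ ≤ ENNReal.ofReal (Real.sqrt S) + ENNReal.ofReal (n2 fun x => H n x - h x) := fun n => by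
      have hd := memLp_fun_sub (hH n) hm
      have e : h = H n - fun x => H n x - h x := by ext x; simp
      calc eLpNorm h 2 μ = eLpNorm (H n - fun x => H n x - h x) 2 μ := by rw [← e]
        _ ≤ eLpNorm (H n) 2 μ + eLpNorm (fun x => H n x - h x) 2 μ :=
          eLpNorm_sub_le (hH n).1.restrict hd.1.restrict (by norm_num)
        _ ≤ _ := by
          gcongr
          · exact le_ofReal_sqrt (by rw [eLpNorm_two_sq]; exact hUB n a)
          · rw [← eLpNorm_two_eq hd]; exact eLpNorm_mono_measure _ Measure.restrict_le_self
    have hlim : Tendsto (fun n => ENNReal.ofReal (Real.sqrt S) + ENNReal.ofReal (n2 fun x => H n x - h x)) atTop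
        (𝓝 (ENNReal.ofReal (Real.sqrt S) + ENNReal.ofReal 0)) := by
      exact tendsto_const_nhds.add (ENNReal.tendsto_ofReal hl)
    rw [ENNReal.ofReal_zero, add_zero] at hlim
    exact ge_of_tendsto' hlim hle
  rw [← eLpNorm_two_sq]
  rcases le_or_gt 0 S with hS | hS
  · calc _ ≤ ENNReal.ofReal (Real.sqrt S) ^ 2 := by gcongr
      _ = _ := by rw [← ENNReal.ofReal_pow (Real.sqrt_nonneg _), Real.sq_sqrt hS]
  · rw [Real.sqrt_eq_zero'.mpr hS.le, ENNReal.ofReal_zero] at key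
    rw [nonpos_iff_eq_zero.mp key]; simp

lemma n2_vel_le {θ u : Plane → ℝ} {j : Fin 2} (hθ : MemLp θ 2 volume) (hu : MemLp u 2 volume) (h : MulRel (uS j) θ u) :
    n2 u ≤ n2 θ := by
  refine (sq_le_sq₀ (n2_nonneg _) (n2_nonneg _)).mp ?_
  rw [n2_eq_ft hu, n2_eq_ft hθ]
  refine integral_mono_ae ((memLp_ft u).integrable_norm_pow (p := 2) (by norm_num))
    ((memLp_ft θ).integrable_norm_pow (p := 2) (by norm_num)) ?_
  filter_upwards [h.ft (isSymb_uS j) hθ hu] with ξ h1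
  rw [h1, norm_mul, RCLike.norm_conj]
  have := norm_uS_le j ξ
  gcongr
  exact mul_le_of_le_one_left (norm_nonneg _) this

/-- The unknowns at a fixed time: `θ = Λ^s w`, `u = R^⊥ θ`. -/
structure State (s : ℝ) (w θ : Plane → ℝ) (u : Fin 2 → Plane → ℝ) : Prop where
  w2 : MemLp w 2 volume
  θ2 : MemLp θ 2 volume
  u2 : ∀ j, MemLp (u j) 2 volume
  frac : MulRel (lamS s) w θ
  vel : ∀ j, MulRel (uS j) θ (u j)

lemma State.snap {s : ℝ} (hs : 0 < s) (hs2 : s < 2) {w θ : Plane → ℝ} {u : Fin 2 → Plane → ℝ} (h : State s w θ u)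
    {ρ : Plane → ℝ} (hρ : IsTest ρ) : Snap s (cv w ρ) (cv θ ρ) (fun j => cv (u j) ρ) :=
  Snap.of_cv hs hs2 h.w2 h.θ2 h.u2 h.frac h.vel hρ

lemma exists_velocity_uloc {s : ℝ} (hs : 0 < s) (hs1 : s < 1) : ∃ C : ℝ, 0 ≤ C ∧
    ∀ (w θ : Plane → ℝ) (u : Fin 2 → Plane → ℝ) (S : ℝ), State s w θ u → 0 ≤ S → UB w S → UB θ S →
    ∀ j, UB (u j) (C * S) := by
  obtain ⟨C, hC, h⟩ := exists_vel_uloc hs hs1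
  obtain ⟨G, δ, ρ, -, hρ⟩ := exists_isMollSeq
  refine ⟨C, hC, fun w θ u S hst hS hw hθ j => ?_⟩
  have hi : ∀ n, Integrable (ρ n) := fun n => (hρ.moll n).test.integrable
  exact UB.of_tendsto (hst.u2 j) (fun n => memLp_cv (hst.u2 j) (hi n))
    (fun n => h _ _ _ S (hst.snap hs (by linarith) (hρ.moll n).test) hS (hw.cv hst.w2.1 (hi n) (hρ.moll n).integral_abs)
      (hθ.cv hst.θ2.1 (hi n) (hρ.moll n).integral_abs) j) (hρ.tendsto_cv (hst.u2 j))

lemma memLp_mul_bdd {θ u : Plane → ℝ} {K : ℝ} (hK : ∀ᵐ x, |θ x| ≤ K) (hθ : AEStronglyMeasurable θ volume) (hu : MemLp u 2 volume) :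
    MemLp (fun x => θ x * u x) 2 volume := by
  refine MemLp.of_le_mul (c := K) hu (hθ.mul hu.1) ?_
  filter_upwards [hK] with x hx
  rw [norm_mul]
  gcongr
  exact hx

lemma n2_mul_bdd_le {θ u : Plane → ℝ} {K : ℝ} (hK : ∀ᵐ x, |θ x| ≤ K) (hθ : AEStronglyMeasurable θ volume) (hu : MemLp u 2 volume) :
    n2 (fun x => θ x * u x) ^ 2 ≤ K ^ 2 * n2 u ^ 2 := by
  rw [n2_sq, n2_sq, ← integral_const_mul]
  refine integral_mono_ae (memLp_mul_bdd hK hθ hu).integrable_sq (hu.integrable_sq.const_mul _) ?_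
  filter_upwards [hK] with x hx
  simp only [mul_pow]
  gcongr ?_ * _
  exact sq_le_sq' (abs_le.mp hx).1 (abs_le.mp hx).2

lemma UB.mul_bdd {θ u : Plane → ℝ} {K S : ℝ} (hK : ∀ᵐ x, |θ x| ≤ K) (hu : UB u S) : UB (fun x => θ x * u x) (K ^ 2 * S) := by
  intro a
  have hK2 : 0 ≤ K ^ 2 := sq_nonneg K
  rw [ENNReal.ofReal_mul hK2]
  calc ∫⁻ x in Metric.closedBall a 1, ‖θ x * u x‖ₑ ^ 2 ≤ ∫⁻ x in Metric.closedBall a 1, ENNReal.ofReal (K ^ 2) * ‖u x‖ₑ ^ 2 := by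
        refine lintegral_mono_ae (ae_restrict_of_ae ?_)
        filter_upwards [enorm_le_of_ae_abs_le hK] with x hx
        rw [enorm_mul, mul_pow]
        gcongr
        refine (pow_le_pow_left' hx 2).trans ?_
        rcases le_or_gt 0 K with h0 | h0
        · rw [ENNReal.ofReal_pow h0]
        · rw [ENNReal.ofReal_of_nonpos h0.le]; simp
    _ = ENNReal.ofReal (K ^ 2) * ∫⁻ x in Metric.closedBall a 1, ‖u x‖ₑ ^ 2 := lintegral_const_mul' _ _ ENNReal.ofReal_ne_top
    _ ≤ _ := by gcongr; exact hu a

lemma abs_cv_le {θ ρ : Plane → ℝ} {K G δ : ℝ} (hρ : IsMoll G δ ρ) (hK : ∀ᵐ x, |θ x| ≤ K) (x : Plane) : |cv θ ρ x| ≤ K := by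
  refine (abs_integral_mul_le_of_bdd hK (hρ.test.sub_comp x).integrable).trans_eq ?_
  rw [integral_sub_left_eq_self (fun y => |ρ y|) volume x, hρ.integral_abs, mul_one]

/-- The remaining part of the transport term is of lower order. -/
lemma exists_transport_le (r L K : ℝ) (hK : 0 ≤ K) : ∃ C : ℝ, 0 ≤ C ∧ ∀ (Φ : Plane → ℝ) (a : Plane), Loc Φ a r L →
    ∀ (g U : Plane → ℝ) (S S' : ℝ), Continuous g → Continuous U → (∀ x, |g x| ≤ K) → UB g S → UB U S' → 0 ≤ S → 0 ≤ S' → ∀ j,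
    |∫ x, U x * (pd j Φ x * g x ^ 2)| ≤ C * (S + S') := by
  obtain ⟨C, hC, h⟩ := UB.lintegral_ball r
  refine ⟨L ^ 0 * |L| * K * C, by positivity, fun Φ a hΦ g U S S' hg hU hgK hgS hUS hS hS' j => ?_⟩
  have hL := hΦ.L_nonneg
  have hs : ∀ x, pd j Φ x ≠ 0 → x ∈ Metric.closedBall a r := fun x hx => by
    by_contra hxa
    apply hx
    have hev : Φ =ᶠ[𝓝 x] fun _ => 0 := by
      filter_upwards [Metric.isClosed_closedBall.isOpen_compl.mem_nhds hxa] with y hy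
      by_contra h0
      exact hy (by simpa [dist_eq_norm] using hΦ.supp y h0)
    unfold pd
    rw [hev.fderiv_eq]; simp
  have hpt : ∀ x, ‖U x * (pd j Φ x * g x ^ 2)‖ₑ ≤
      (Metric.closedBall a r).indicator (fun x => ENNReal.ofReal (L * K) * (‖g x‖ₑ ^ 2 + ‖U x‖ₑ ^ 2)) x := fun x => by
    by_cases hx : x ∈ Metric.closedBall a r
    · rw [Set.indicator_of_mem hx]
      have e : ENNReal.ofReal (L * K) * (‖g x‖ₑ ^ 2 + ‖U x‖ₑ ^ 2) = ENNReal.ofReal (L * K * (|g x| ^ 2 + |U x| ^ 2)) := by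
        rw [ENNReal.ofReal_mul (by positivity : 0 ≤ L * K), ENNReal.ofReal_add (by positivity) (by positivity),
          ENNReal.ofReal_pow (abs_nonneg _), ENNReal.ofReal_pow (abs_nonneg _), ← Real.norm_eq_abs, ← Real.norm_eq_abs,
          ofReal_norm, ofReal_norm]
      rw [e, ← ofReal_norm]
      refine ENNReal.ofReal_le_ofReal ?_
      rw [Real.norm_eq_abs, abs_mul, abs_mul, abs_pow]
      have h1 := hΦ.pd_le j x
      calc |U x| * (|pd j Φ x| * |g x| ^ 2) ≤ |U x| * (L * (K * |g x|)) := by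
            gcongr
            rw [pow_two]; gcongr
            exact hgK x
        _ = L * K * (|U x| * |g x|) := by ring
        _ ≤ _ := by
          gcongr
          nlinarith [sq_nonneg (|U x| - |g x|), abs_nonneg (g x), abs_nonneg (U x)]
    · have : pd j Φ x = 0 := by by_contra h0; exact hx (hs x h0)
      simp [this]
  have hfin : ENNReal.ofReal |∫ x, U x * (pd j Φ x * g x ^ 2)| ≤ ENNReal.ofReal (L ^ 0 * |L| * K * C * (S + S')) := by
    rw [← Real.norm_eq_abs, ofReal_norm]
    refine (enorm_integral_le_lintegral_enorm _).trans ((lintegral_mono hpt).trans ?_)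
    rw [lintegral_indicator measurableSet_closedBall, lintegral_const_mul' _ _ ENNReal.ofReal_ne_top,
      lintegral_add_left (hg.enorm.measurable.pow_const 2)]
    refine (mul_le_mul_right (add_le_add (h g S hg.aestronglyMeasurable hgS a) (h U S' hU.aestronglyMeasurable hUS a)) _).trans_eq ?_
    rw [← ENNReal.ofReal_add (by positivity) (by positivity), ← ENNReal.ofReal_mul (by positivity), abs_of_nonneg hL]
    congr 1; ring
  exact (ENNReal.ofReal_le_ofReal_iff (by positivity)).mp hfin

/-! ### The rate of change of the mollified local energy -/

/-- The rate of change of the local energy of `w` and of `Λ^s w` mollified by `ρ`. -/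
def rate (s : ℝ) (Φ w θ : Plane → ℝ) (u : Fin 2 → Plane → ℝ) (ρ : Plane → ℝ) : ℝ :=
  ((∑ j, ∫ x, cv (fun y => θ y * u j y) ρ x * fracGradTest s j (fun x => Φ x * cv w ρ x) x) -
      ∫ x, cv w ρ x * fracLapTest 1 (fun x => Φ x * cv w ρ x) x) +
    ((∑ j, ∫ x, cv (fun y => θ y * u j y) ρ x * pd j (fun x => Φ x * cv θ ρ x) x) -
      ∫ x, cv θ ρ x * fracLapTest 1 (fun x => Φ x * cv θ ρ x) x)

lemma State.transport_eq {s : ℝ} (hs : 0 < s) (hs2 : s < 2) {w θ : Plane → ℝ} {u : Fin 2 → Plane → ℝ} (h : State s w θ u) {K G δ : ℝ}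
    (hK : ∀ᵐ x, |θ x| ≤ K) {ρ : Plane → ℝ} (hρ : IsMoll G δ ρ) {Φ : Plane → ℝ} (hΦ : IsTest Φ) (k : ℕ) :
    ∑ j, ∫ x, cv (fun y => θ y * u j y) ρ x * pd j (fun x => Φ x * cv θ ρ x ^ (k + 1)) x =
      (∑ j, ∫ x, (cv (fun y => θ y * u j y) ρ x - cv (u j) ρ x * cv θ ρ x) * pd j (fun x => Φ x * cv θ ρ x ^ (k + 1)) x) +
      ((k : ℝ) + 2)⁻¹ * ∑ j, ∫ x, cv (u j) ρ x * (pd j Φ x * cv θ ρ x ^ (k + 2)) := by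
  have hsn := h.snap hs hs2 hρ.test
  exact SQG.transport_eq (V := fun j => cv (fun y => θ y * u j y) ρ) hsn.g_smooth (fun j => (hsn.u_smooth j).continuous)
    (fun j => (cv_contDiff_of_memLp (memLp_mul_bdd hK h.θ2.1 (h.u2 j)) hρ.test).continuous) hsn.g2 hsn.u2 hsn.vel hΦ k

lemma exists_rate_le {s : ℝ} (hs : 1 / 2 < s) (hs1 : s < 1) (r L K : ℝ) (hK0 : 0 ≤ K) : ∃ C : ℝ, 0 ≤ C ∧
    ∀ (Φ : Plane → ℝ) (a : Plane), Loc Φ a r L → (∀ x, 0 ≤ Φ x) → ∀ (w θ : Plane → ℝ) (u : Fin 2 → Plane → ℝ) (S : ℝ),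
    State s w θ u → (∀ᵐ x, |θ x| ≤ K) → 0 ≤ S → UB w S → UB θ S → ∀ (ρ : Plane → ℝ) (G δ : ℝ), IsMoll G δ ρ →
    rate s Φ w θ u ρ ≤ C * S + (∑ j, |∫ x, (cv (fun y => θ y * u j y) ρ x - cv (u j) ρ x * cv θ ρ x) *
        pd j (fun x => Φ x * cv θ ρ x) x|) - ∫ x, cv θ ρ x * fracLapTest 1 (fun x => Φ x * cv θ ρ x) x := by
  have hs0 : 0 < s := by linarith
  obtain ⟨C1, hC1, h1⟩ := exists_nonlinear_le hs hs1 r L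
  obtain ⟨C2, hC2, h2⟩ := exists_dissipation_le r L
  obtain ⟨C3, hC3, h3⟩ := exists_velocity_uloc hs0 hs1
  obtain ⟨C4, hC4, h4⟩ := exists_transport_le r L K hK0
  refine ⟨2 * (C1 * Real.sqrt (K ^ 2 * C3)) + C2 + 2 * (C4 * (1 + C3)), by positivity,
    fun Φ a hΦ hΦ0 w θ u S hst hK hS hw hθ ρ G δ hρ => ?_⟩
  have hsn := hst.snap hs0 (by linarith) hρ.test
  have hρi := hρ.test.integrable
  have hf := hw.cv hst.w2.1 hρi hρ.integral_abs
  have hg := hθ.cv hst.θ2.1 hρi hρ.integral_abs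
  have hu := h3 w θ u S hst hS hw hθ
  have hh : ∀ j, MemLp (fun y => θ y * u j y) 2 volume := fun j => memLp_mul_bdd hK hst.θ2.1 (hst.u2 j)
  have hV : ∀ j, UB (cv (fun y => θ y * u j y) ρ) (K ^ 2 * C3 * S) := fun j => by
    rw [mul_assoc]
    exact (UB.mul_bdd hK (hu j)).cv (hh j).1 hρi hρ.integral_abs
  have b1 : ∀ j, ∫ x, cv (fun y => θ y * u j y) ρ x * fracGradTest s j (fun x => Φ x * cv w ρ x) x ≤
      C1 * Real.sqrt (K ^ 2 * C3) * S := fun j => by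
    refine (le_abs_self _).trans ((h1 Φ a hΦ _ _ S hsn.f_smooth hsn.g_smooth.continuous hsn.pt hS hf hg _ (K ^ 2 * C3 * S)
      (memLp_cv (hh j) hρi) (hV j) (by positivity) j).trans_eq ?_)
    rw [Real.sqrt_mul (by positivity)]
    have := Real.mul_self_sqrt hS
    linear_combination C1 * Real.sqrt (K ^ 2 * C3) * this
  have b2 := h2 Φ a hΦ hΦ0 _ S hsn.f_smooth hsn.f2 hS hf
  have b3 : ∀ j, ∫ x, cv (u j) ρ x * (pd j Φ x * cv θ ρ x ^ 2) ≤ C4 * (1 + C3) * S := fun j => by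
    refine (le_abs_self _).trans ((h4 Φ a hΦ _ _ S (C3 * S) hsn.g_smooth.continuous (hsn.u_smooth j).continuous
      (abs_cv_le hρ hK) hg ((hu j).cv (hst.u2 j).1 hρi hρ.integral_abs) hS (by positivity) j).trans_eq ?_)
    ring
  have e := hst.transport_eq hs0 (by linarith) hK hρ hΦ.test 0
  simp only [zero_add, pow_one, Nat.cast_zero] at e
  have b4 : ∑ j, ∫ x, (cv (fun y => θ y * u j y) ρ x - cv (u j) ρ x * cv θ ρ x) * pd j (fun x => Φ x * cv θ ρ x) x ≤
      ∑ j, |∫ x, (cv (fun y => θ y * u j y) ρ x - cv (u j) ρ x * cv θ ρ x) * pd j (fun x => Φ x * cv θ ρ x) x| :=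
    Finset.sum_le_sum fun j _ => le_abs_self _
  have b5 : ∑ j, ∫ x, cv (u j) ρ x * (pd j Φ x * cv θ ρ x ^ 2) ≤ 2 * (C4 * (1 + C3) * S) := by
    rw [Fin.sum_univ_two]; linarith [b3 0, b3 1]
  have b6 : ∑ j, ∫ x, cv (fun y => θ y * u j y) ρ x * fracGradTest s j (fun x => Φ x * cv w ρ x) x ≤
      2 * (C1 * Real.sqrt (K ^ 2 * C3) * S) := by
    rw [Fin.sum_univ_two]; linarith [b1 0, b1 1]
  have b7 : 0 ≤ C4 * (1 + C3) * S := by positivity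
  unfold rate
  rw [e]
  nlinarith

/-! ### Error terms and domination -/

/-- The part of the transport term, tested against a power, which is due to the mollification. -/
def transportErr (Φ θ : Plane → ℝ) (u : Fin 2 → Plane → ℝ) (ρ : Plane → ℝ) (k : ℕ) : ℝ :=
  ∑ j, |∫ x, (cv (fun y => θ y * u j y) ρ x - cv (u j) ρ x * cv θ ρ x) * pd j (fun x => Φ x * cv θ ρ x ^ (k + 1)) x|

lemma tendsto_transportErr {s K L G : ℝ} {w θ v : Plane → ℝ} {u : Fin 2 → Plane → ℝ} (hst : State s w θ u)
    (hK : ∀ᵐ x, |θ x| ≤ K) (hv : MemLp v 2 volume) (hh : MulRel (lamS (1 / 2)) θ v) {δ : ℕ → ℝ} {ρ : ℕ → Plane → ℝ}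
    (hρ : IsMollSeq G δ ρ) {Φ : ℕ → Plane → ℝ} (hΦ : ∀ n, ∃ a r, Loc (Φ n) a r L) (k : ℕ) :
    Tendsto (fun n => transportErr (Φ n) θ u (ρ n) k) atTop (𝓝 0) := by
  obtain ⟨C, hC, h⟩ := exists_transport_error_le K L G k
  have : ∀ j, Tendsto (fun n => |∫ x, (cv (fun y => θ y * u j y) (ρ n) x - cv (u j) (ρ n) x * cv θ (ρ n) x) *
      pd j (fun x => Φ n x * cv θ (ρ n) x ^ (k + 1)) x|) atTop (𝓝 0) := fun j => by
    refine squeeze_zero (fun _ => abs_nonneg _) (fun n => ?_)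
      (g := fun n => C * n2 v * Real.sqrt (δ n * n2 θ ^ 2 + δ n * n2 (pd j (cv θ (ρ n))) ^ 2)) ?_
    · obtain ⟨a, r, hl⟩ := hΦ n
      exact h _ a r hl _ _ (hρ.moll n) (hρ.pos n) θ (u j) v j hK hst.θ2 (hst.u2 j) hv (hst.vel j) hh
    · have h1 := ((hρ.lim.mul_const (n2 θ ^ 2)).add (hρ.tendsto_grad hst.θ2 hv hh j)).sqrt.const_mul (C * n2 v)
      simpa using h1
  have h2 := tendsto_finsetSum Finset.univ fun j _ => this j
  simpa [transportErr] using h2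

lemma exists_transportErr_le (K L G : ℝ) (hG : 0 ≤ G) (k : ℕ) : ∃ C : ℝ, 0 ≤ C ∧
    ∀ (Φ : Plane → ℝ) (a : Plane) (r : ℝ), Loc Φ a r L → ∀ (s : ℝ) (w θ v : Plane → ℝ) (u : Fin 2 → Plane → ℝ), State s w θ u →
    (∀ᵐ x, |θ x| ≤ K) → n2 θ ≤ K → MemLp v 2 volume → MulRel (lamS (1 / 2)) θ v →
    ∀ (ρ : Plane → ℝ) (δ : ℝ), IsMoll G δ ρ → 0 < δ → δ ≤ 1 → transportErr Φ θ u ρ k ≤ C * (1 + n2 v ^ 2) := by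
  obtain ⟨C, hC, h⟩ := exists_transport_error_le K L G k
  refine ⟨2 * (C * (K ^ 2 + 2 * G + 1)), by positivity, fun Φ a r hΦ s w θ v u hst hK hθK hv hh ρ δ hρ hδ hδ1 => ?_⟩
  have hb : ∀ j, |∫ x, (cv (fun y => θ y * u j y) ρ x - cv (u j) ρ x * cv θ ρ x) *
      pd j (fun x => Φ x * cv θ ρ x ^ (k + 1)) x| ≤ C * (K ^ 2 + 2 * G + 1) * (1 + n2 v ^ 2) := fun j => by
    refine (h Φ a r hΦ ρ δ hρ hδ θ (u j) v j hK hst.θ2 (hst.u2 j) hv (hst.vel j) hh).trans ?_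
    rw [mul_assoc, mul_assoc]
    refine mul_le_mul_of_nonneg_left ?_ hC
    have h1 := hρ.n2_grad_le hδ hst.θ2 hv hh j
    have hv0 := n2_nonneg v
    have hθ0 := n2_nonneg θ
    have h2 : δ * n2 θ ^ 2 ≤ K ^ 2 := by
      calc δ * n2 θ ^ 2 ≤ 1 * K ^ 2 := by gcongr
        _ = _ := one_mul _
    have hX : 0 ≤ δ * n2 θ ^ 2 + δ * n2 (pd j (cv θ ρ)) ^ 2 := by positivity
    have h3 := Real.sq_sqrt hX
    set X := δ * n2 θ ^ 2 + δ * n2 (pd j (cv θ ρ)) ^ 2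
    have h4 : X ≤ K ^ 2 + 2 * G * n2 v ^ 2 := by simp only [X]; linarith
    have h5 : 0 ≤ K ^ 2 * n2 v ^ 2 := by positivity
    nlinarith [sq_nonneg (n2 v - Real.sqrt X), sq_nonneg (n2 v), sq_nonneg K]
  unfold transportErr
  rw [Fin.sum_univ_two]
  linarith [hb 0, hb 1]

lemma exists_abs_rate_le {s : ℝ} (hs : 1 / 2 < s) (hs1 : s < 1) (r L K G : ℝ) (hK0 : 0 ≤ K) (hG : 0 ≤ G) : ∃ C : ℝ, 0 ≤ C ∧
    ∀ (Φ : Plane → ℝ) (a : Plane), Loc Φ a r L → ∀ (w θ v : Plane → ℝ) (u : Fin 2 → Plane → ℝ), State s w θ u →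
    (∀ᵐ x, |θ x| ≤ K) → n2 w ≤ K → n2 θ ≤ K → MemLp v 2 volume → MulRel (lamS (1 / 2)) θ v →
    ∀ (ρ : Plane → ℝ) (δ : ℝ), IsMoll G δ ρ → 0 < δ → δ ≤ 1 → |rate s Φ w θ u ρ| ≤ C * (1 + n2 v ^ 2) := by
  have hs0 : 0 < s := by linarith
  obtain ⟨C1, hC1, h1⟩ := exists_nonlinear_le hs hs1 r L
  obtain ⟨C2, hC2, h2⟩ := exists_abs_dissipation_of_frac hs hs1 L
  obtain ⟨C3, hC3, h3⟩ := exists_transportErr_le K L G hG 0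
  obtain ⟨C4, hC4, h4⟩ := exists_transport_le r L K hK0
  obtain ⟨C5, hC5, h5⟩ := exists_abs_dissipation_half L
  refine ⟨2 * (C1 * Real.sqrt ((K * K) ^ 2) * Real.sqrt (K ^ 2)) + C2 * (2 * K ^ 2) + C3 + 2 * (C4 * (2 * K ^ 2)) + C5 * (K ^ 2 + 1),
    by positivity, fun Φ a hΦ w θ v u hst hK hwK hθK hv hh ρ δ hρ hδ hδ1 => ?_⟩
  have hsn := hst.snap hs0 (by linarith) hρ.test
  have hρi := hρ.test.integrable
  have hcvle : ∀ {h : Plane → ℝ}, MemLp h 2 volume → n2 (cv h ρ) ≤ n2 h := fun {h} hh => by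
    have := n2_cv_le hh hρi
    rwa [hρ.integral_abs, one_mul] at this
  have hUBle : ∀ {h : Plane → ℝ} {B : ℝ}, MemLp h 2 volume → n2 h ≤ B → UB (cv h ρ) (B ^ 2) := fun {h B} hh hB =>
    (UB.of_memLp (memLp_cv hh hρi)).mono (by
      have := n2_nonneg (cv h ρ)
      have := (hcvle hh).trans hB
      gcongr)
  have hu : ∀ j, n2 (u j) ≤ K := fun j => (n2_vel_le hst.θ2 (hst.u2 j) (hst.vel j)).trans hθK
  have hm : ∀ j, MemLp (fun y => θ y * u j y) 2 volume := fun j => memLp_mul_bdd hK hst.θ2.1 (hst.u2 j)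
  have hmn : ∀ j, n2 (fun y => θ y * u j y) ≤ K * K := fun j => by
    refine (sq_le_sq₀ (n2_nonneg _) (by positivity)).mp ((n2_mul_bdd_le hK hst.θ2.1 (hst.u2 j)).trans ?_)
    have := n2_nonneg (u j)
    have := hu j
    rw [mul_pow]; gcongr
  have b1 : ∀ j, |∫ x, cv (fun y => θ y * u j y) ρ x * fracGradTest s j (fun x => Φ x * cv w ρ x) x| ≤
      C1 * Real.sqrt ((K * K) ^ 2) * Real.sqrt (K ^ 2) := fun j =>
    h1 Φ a hΦ _ _ (K ^ 2) hsn.f_smooth hsn.g_smooth.continuous hsn.pt (by positivity) (hUBle hst.w2 hwK) (hUBle hst.θ2 hθK) _ _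
      (memLp_cv (hm j) hρi) (hUBle (hm j) (hmn j)) (by positivity) j
  have b2 : |∫ x, cv w ρ x * fracLapTest 1 (fun x => Φ x * cv w ρ x) x| ≤ C2 * (2 * K ^ 2) := by
    refine (h2 Φ a r hΦ _ _ hsn.f_smooth hsn.g_smooth.continuous hsn.f2 hsn.g2 hsn.pt hsn.frac).trans ?_
    have a1 := (hcvle hst.w2).trans hwK
    have a2 := (hcvle hst.θ2).trans hθK
    have a3 := n2_nonneg (cv w ρ)
    have a4 := n2_nonneg (cv θ ρ)
    rw [two_mul]
    gcongr
  have b3 := h3 Φ a r hΦ s w θ v u hst hK hθK hv hh ρ δ hρ hδ hδ1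
  have b4 : ∀ j, |∫ x, cv (u j) ρ x * (pd j Φ x * cv θ ρ x ^ 2)| ≤ C4 * (2 * K ^ 2) := fun j => by
    rw [two_mul]
    exact h4 Φ a hΦ _ _ _ _ hsn.g_smooth.continuous (hsn.u_smooth j).continuous (abs_cv_le hρ hK) (hUBle hst.θ2 hθK)
      (hUBle (hst.u2 j) (hu j)) (by positivity) (by positivity) j
  have b5 : |∫ x, cv θ ρ x * fracLapTest 1 (fun x => Φ x * cv θ ρ x) x| ≤ C5 * (K ^ 2 + n2 v ^ 2) := by
    refine (h5 Φ a r hΦ _ (cv v ρ) hsn.g_smooth (cv_contDiff_of_memLp hv hρ.test).continuous hsn.g2 (memLp_cv hv hρi)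
      (fun x => (ULI.of_memLp hst.θ2).cv_fracLap (by norm_num) (by norm_num) hh hρ.test x)
      (hh.cv (isSymb_lamS (by norm_num) (by norm_num)) hst.θ2 hv hρ.test)).trans ?_
    have a2 := (hcvle hst.θ2).trans hθK
    have a3 := n2_nonneg (cv v ρ)
    have a4 := n2_nonneg (cv θ ρ)
    have a5 := hcvle hv
    gcongr
  have e := hst.transport_eq hs0 (by linarith) hK hρ hΦ.test 0
  simp only [zero_add, pow_one, Nat.cast_zero] at e
  have b3' : |∑ j, ∫ x, (cv (fun y => θ y * u j y) ρ x - cv (u j) ρ x * cv θ ρ x) * pd j (fun x => Φ x * cv θ ρ x) x| ≤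
      transportErr Φ θ u ρ 0 := by
    simpa [transportErr] using Finset.abs_sum_le_sum_abs (fun j : Fin 2 =>
      ∫ x, (cv (fun y => θ y * u j y) ρ x - cv (u j) ρ x * cv θ ρ x) * pd j (fun x => Φ x * cv θ ρ x) x) Finset.univ
  have b4' : |(2 : ℝ)⁻¹ * ∑ j, ∫ x, cv (u j) ρ x * (pd j Φ x * cv θ ρ x ^ 2)| ≤ 2 * (C4 * (2 * K ^ 2)) := by
    rw [abs_mul, Fin.sum_univ_two, abs_of_pos (by norm_num : (0 : ℝ) < 2⁻¹)]
    have := abs_add_le (∫ x, cv (u 0) ρ x * (pd 0 Φ x * cv θ ρ x ^ 2)) (∫ x, cv (u 1) ρ x * (pd 1 Φ x * cv θ ρ x ^ 2))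
    have := abs_nonneg (∫ x, cv (u 0) ρ x * (pd 0 Φ x * cv θ ρ x ^ 2))
    linarith [b4 0, b4 1]
  have b1' : |∑ j, ∫ x, cv (fun y => θ y * u j y) ρ x * fracGradTest s j (fun x => Φ x * cv w ρ x) x| ≤
      2 * (C1 * Real.sqrt ((K * K) ^ 2) * Real.sqrt (K ^ 2)) := by
    rw [Fin.sum_univ_two]
    exact (abs_add_le _ _).trans (by linarith [b1 0, b1 1])
  have hv2 := sq_nonneg (n2 v)
  have p1 : 0 ≤ C1 * Real.sqrt ((K * K) ^ 2) * Real.sqrt (K ^ 2) * n2 v ^ 2 := by positivity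
  have p2 : 0 ≤ C2 * (2 * K ^ 2) * n2 v ^ 2 := by positivity
  have p3 : 0 ≤ C4 * (2 * K ^ 2) * n2 v ^ 2 := by positivity
  have p4 : 0 ≤ C5 * K ^ 2 * n2 v ^ 2 := by positivity
  unfold rate
  rw [e]
  rw [abs_le] at *
  constructor <;> nlinarith

/-! ### Large cutoffs and the maximum principle -/

lemma Loc.scale {Φ : Plane → ℝ} {r L R : ℝ} (h : Loc Φ 0 r L) (hR : 1 ≤ R) : Loc (fun x => Φ (R⁻¹ • x)) 0 (R * r) L ∧
    ∀ j x, |pd j (fun x => Φ (R⁻¹ • x)) x| ≤ L / R := by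
  have hR0 : 0 < R := by linarith
  have hL := h.L_nonneg
  have ht : IsTest fun x => Φ (R⁻¹ • x) :=
    ⟨h.test.1.comp (contDiff_const_smul _), h.test.2.comp_homeomorph (Homeomorph.smulOfNeZero R⁻¹ (by positivity))⟩
  have hle : ∀ x : Plane, ‖R⁻¹ • x‖ ≤ ‖x‖ := fun x => by
    rw [norm_smul, norm_inv, Real.norm_of_nonneg hR0.le]
    exact mul_le_of_le_one_left (norm_nonneg _) (inv_le_one_of_one_le₀ hR)
  have hpd : ∀ j x, |pd j (fun x => Φ (R⁻¹ • x)) x| ≤ L / R := fun j x => by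
    have e : pd j (fun x => Φ (R⁻¹ • x)) x = R⁻¹ * pd j Φ (R⁻¹ • x) := by
      unfold pd
      rw [fderiv_comp_smul]; simp
    rw [e, abs_mul, abs_of_pos (by positivity : 0 < R⁻¹), div_eq_inv_mul]
    have := h.pd_le j (R⁻¹ • x)
    gcongr
  refine ⟨⟨ht, fun x hx => ?_, by have := h.r_pos; positivity, fun x => h.bd _, fun x y => ?_, fun z x => ?_, fun j x => ?_⟩, hpd⟩
  · have := h.supp _ hx
    rw [sub_zero, norm_smul, norm_inv, Real.norm_of_nonneg hR0.le, inv_mul_le_iff₀ hR0] at this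
    simpa using this
  · refine (h.d1 _ _).trans ?_
    rw [← smul_sub]
    gcongr
    exact hle _
  · have := h.dd2 (R⁻¹ • z) (R⁻¹ • x)
    simp only [d2, smul_add, smul_sub] at this ⊢
    refine this.trans ?_
    gcongr
    exact hle _
  · exact (hpd j x).trans (div_le_self hL hR)

lemma Loc.abs_fracLap_le {Φ : Plane → ℝ} {a : Plane} {r L σ : ℝ} (h : Loc Φ a r L) (hσ : 0 < σ) (hσ2 : σ < 2) (x : Plane) :
    |fracLapTest σ Φ x| ≤ (kcon σ)⁻¹ * (L * ∫ z, krn 2 σ z) := by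
  have hk := kcon_pos hσ hσ2
  rw [le_inv_mul_iff₀ hk, ← abs_of_pos hk, ← abs_mul, fracLapTest_eq_integral hσ hσ2 h.test, ← integral_const_mul,
    ← Real.norm_eq_abs]
  refine norm_integral_le_of_norm_le ((integrable_krn hσ hσ2).const_mul L) (.of_forall fun z => ?_)
  rw [Real.norm_eq_abs, abs_mul, abs_of_nonneg (by positivity : 0 ≤ ‖z‖ ^ (-2 - σ)), krn_two, ← mul_assoc]
  have := h.dd2 z x
  gcongr

lemma fracLapTest_scale {η : Plane → ℝ} (h : IsTest η) {R : ℝ} (hR : 0 < R) (x : Plane) :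
    fracLapTest 1 (fun x => η (R⁻¹ • x)) x = R⁻¹ * fracLapTest 1 η (R⁻¹ • x) := by
  have hk := kcon_pos (by norm_num : (0 : ℝ) < 1) (by norm_num)
  have ht : IsTest fun x => η (R⁻¹ • x) :=
    ⟨h.1.comp (contDiff_const_smul _), h.2.comp_homeomorph (Homeomorph.smulOfNeZero R⁻¹ (by positivity))⟩
  refine mul_left_cancel₀ hk.ne' ?_
  rw [fracLapTest_eq_integral (by norm_num) (by norm_num) ht, mul_left_comm, fracLapTest_eq_integral (by norm_num) (by norm_num) h]
  have e : ∀ z, d2 (fun x => η (R⁻¹ • x)) z x * ‖z‖ ^ (-2 - 1 : ℝ) =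
      (R ^ 3)⁻¹ * (fun z => d2 η z (R⁻¹ • x) * ‖z‖ ^ (-2 - 1 : ℝ)) (R⁻¹ • z) := fun z => by
    have e1 : ‖z‖ ^ (-2 - 1 : ℝ) = (R ^ 3)⁻¹ * ‖R⁻¹ • z‖ ^ (-2 - 1 : ℝ) := by
      have hR3 : R⁻¹ ^ (-2 - 1 : ℝ) = R ^ 3 := by
        rw [show (-2 - 1 : ℝ) = -(3 : ℕ) by norm_num, Real.rpow_neg (by positivity), Real.rpow_natCast, inv_pow, inv_inv]
      rw [norm_smul, norm_inv, Real.norm_of_nonneg hR.le, Real.mul_rpow (by positivity) (norm_nonneg _), ← mul_assoc, hR3,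
        inv_mul_cancel₀ (by positivity), one_mul]
    simp only [d2, smul_add, smul_sub, e1]
    ring
  rw [integral_congr_ae (.of_forall e), integral_const_mul,
    Measure.integral_comp_inv_smul volume (fun z => d2 η z (R⁻¹ • x) * ‖z‖ ^ (-2 - 1 : ℝ)) R]
  simp only [finrank_euclideanSpace, Fintype.card_fin, abs_of_pos (pow_pos hR 2), smul_eq_mul]
  rw [← mul_assoc]
  congr 1
  field_simp

lemma integrable_pow_of_bdd {g : Plane → ℝ} {K : ℝ} (hg : MemLp g 2 volume) (hK : ∀ᵐ x, |g x| ≤ K) (k : ℕ) :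
    Integrable (fun x => g x ^ (k + 2)) ∧ ∫ x, |g x ^ (k + 2)| ≤ K ^ k * n2 g ^ 2 := by
  have hp : ∀ᵐ x, ‖g x ^ (k + 2)‖ ≤ K ^ k * g x ^ 2 := by
    filter_upwards [hK] with x hx
    rw [Real.norm_eq_abs, pow_add, abs_mul, abs_pow, abs_of_nonneg (sq_nonneg (g x))]
    gcongr
  have hi : Integrable fun x => g x ^ (k + 2) := (hg.integrable_sq.const_mul _).mono' (hg.1.pow _) hp
  refine ⟨hi, ?_⟩
  rw [n2_sq, ← integral_const_mul]
  exact integral_mono_ae hi.abs (hg.integrable_sq.const_mul _) hp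

/-- The rate of change of `∫ Φ θ ^ (k + 2) / (k + 2)` after mollification. -/
def powRate (Φ θ : Plane → ℝ) (u : Fin 2 → Plane → ℝ) (ρ : Plane → ℝ) (k : ℕ) : ℝ :=
  (∑ j, ∫ x, cv (fun y => θ y * u j y) ρ x * pd j (fun x => Φ x * cv θ ρ x ^ (k + 1)) x) -
    ∫ x, cv θ ρ x * fracLapTest 1 (fun x => Φ x * cv θ ρ x ^ (k + 1)) x

lemma exists_powRate_le {φ : Plane → ℝ} {r L K : ℝ} (hφ : Loc φ 0 r L) (hφ0 : ∀ x, 0 ≤ φ x) (hK0 : 0 ≤ K) {k : ℕ} (hk : Odd (k + 1)) :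
    ∃ C : ℝ, 0 ≤ C ∧ ∀ (s : ℝ) (w θ : Plane → ℝ) (u : Fin 2 → Plane → ℝ), 0 < s → s < 2 → State s w θ u →
    (∀ᵐ x, |θ x| ≤ K) → n2 θ ≤ K → ∀ (ρ : Plane → ℝ) (G δ : ℝ), IsMoll G δ ρ → ∀ R, 1 ≤ R →
    powRate (fun x => φ (R⁻¹ • x)) θ u ρ k ≤ transportErr (fun x => φ (R⁻¹ • x)) θ u ρ k + C / R := by
  have hL := hφ.L_nonneg
  set D := (kcon 1)⁻¹ * (L * ∫ z, krn 2 1 z)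
  have hD : 0 ≤ D := (abs_nonneg _).trans (hφ.abs_fracLap_le (by norm_num) (by norm_num) 0)
  refine ⟨2 * (L * K ^ (k + 1) * (K * K)) + D * (K ^ k * K ^ 2), by positivity,
    fun s w θ u hs hs2 hst hK hθK ρ G δ hρ R hR => ?_⟩
  have hR0 : 0 < R := by linarith
  obtain ⟨hΦ, hpd⟩ := hφ.scale hR
  set Φ := fun x => φ (R⁻¹ • x)
  have hsn := hst.snap hs hs2 hρ.test
  have hρi := hρ.test.integrable
  have hcvle : ∀ {h : Plane → ℝ}, MemLp h 2 volume → n2 (cv h ρ) ≤ n2 h := fun {h} hh => by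
    have := n2_cv_le hh hρi
    rwa [hρ.integral_abs, one_mul] at this
  have hgK := abs_cv_le hρ hK
  have hgn := (hcvle hst.θ2).trans hθK
  have hUn : ∀ j, n2 (cv (u j) ρ) ≤ K := fun j => (hcvle (hst.u2 j)).trans ((n2_vel_le hst.θ2 (hst.u2 j) (hst.vel j)).trans hθK)
  obtain ⟨hi, hib⟩ := integrable_pow_of_bdd hsn.g2 (.of_forall hgK) k
  have h1 := dissipation_le (σ := 1) (by norm_num) (by norm_num) hk hsn.g_smooth hsn.g2 hi hΦ.test (fun x => hφ0 _)
  have hDR : ∀ x, |fracLapTest 1 Φ x| ≤ D / R := fun x => by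
    rw [fracLapTest_scale hφ.test hR0, abs_mul, abs_of_pos (by positivity : 0 < R⁻¹), div_eq_inv_mul]
    have := hφ.abs_fracLap_le (σ := 1) (by norm_num) (by norm_num) (R⁻¹ • x)
    gcongr
  have h2 : |∫ x, cv θ ρ x ^ (k + 1 + 1) / ((k + 1 : ℕ) + 1) * fracLapTest 1 Φ x| ≤ D / R * (K ^ k * K ^ 2) := by
    have e : ∀ x, cv θ ρ x ^ (k + 1 + 1) / ((k + 1 : ℕ) + 1) * fracLapTest 1 Φ x =
        fracLapTest 1 Φ x * (cv θ ρ x ^ (k + 2) / ((k + 1 : ℕ) + 1)) := fun x => by ring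
    simp_rw [e]
    refine (abs_integral_mul_le_of_bdd (.of_forall hDR) (hi.div_const _)).trans ?_
    have hDR0 : 0 ≤ D / R := by positivity
    gcongr
    calc _ ≤ ∫ x, |cv θ ρ x ^ (k + 2)| := by
          refine integral_mono (hi.div_const _).abs hi.abs fun x => ?_
          simp only [abs_div]
          refine div_le_self (abs_nonneg _) ?_
          rw [abs_of_nonneg (by positivity)]
          linarith [(Nat.cast_nonneg (k + 1) : (0 : ℝ) ≤ (k + 1 : ℕ))]
      _ ≤ K ^ k * n2 (cv θ ρ) ^ 2 := hib
      _ ≤ _ := by have := n2_nonneg (cv θ ρ); gcongr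
  have h3 : ∀ j, |∫ x, cv (u j) ρ x * (pd j Φ x * cv θ ρ x ^ (k + 2))| ≤ L / R * K ^ (k + 1) * (K * K) := fun j => by
    have e : ∀ x, cv (u j) ρ x * (pd j Φ x * cv θ ρ x ^ (k + 2)) =
        (pd j Φ x * cv θ ρ x ^ (k + 1)) * (cv (u j) ρ x * cv θ ρ x) := fun x => by ring
    simp_rw [e]
    refine (abs_integral_mul_le_of_bdd (M := L / R * K ^ (k + 1)) (.of_forall fun x => ?_) ((hsn.u2 j).integrable_mul hsn.g2)).trans ?_
    · rw [abs_mul, abs_pow]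
      have := hpd j x
      have := hgK x
      have : 0 ≤ L / R := by positivity
      gcongr
    · have : 0 ≤ L / R := by positivity
      have := n2_nonneg (cv θ ρ)
      gcongr
      calc _ = ∫ x, |cv (u j) ρ x| * |cv θ ρ x| := by congr 1 with x; exact abs_mul _ _
        _ ≤ n2 (cv (u j) ρ) * n2 (cv θ ρ) := integral_abs_mul_le (hsn.u2 j) hsn.g2
        _ ≤ _ := by gcongr; exact hUn j
  have h4 : ((k : ℝ) + 2)⁻¹ * ∑ j, ∫ x, cv (u j) ρ x * (pd j Φ x * cv θ ρ x ^ (k + 2)) ≤ 2 * (L / R * K ^ (k + 1) * (K * K)) := by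
    have hp : 0 ≤ L / R * K ^ (k + 1) * (K * K) := by positivity
    have hs2 : ∑ j, ∫ x, cv (u j) ρ x * (pd j Φ x * cv θ ρ x ^ (k + 2)) ≤ 2 * (L / R * K ^ (k + 1) * (K * K)) := by
      rw [Fin.sum_univ_two]
      linarith [(abs_le.mp (h3 0)).2, (abs_le.mp (h3 1)).2]
    calc _ ≤ ((k : ℝ) + 2)⁻¹ * (2 * (L / R * K ^ (k + 1) * (K * K))) := by gcongr
      _ ≤ 1 * (2 * (L / R * K ^ (k + 1) * (K * K))) := by
        gcongr
        exact inv_le_one_of_one_le₀ (by linarith [(Nat.cast_nonneg k : (0 : ℝ) ≤ k)])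
      _ = _ := one_mul _
  have h5 : ∑ j, ∫ x, (cv (fun y => θ y * u j y) ρ x - cv (u j) ρ x * cv θ ρ x) * pd j (fun x => Φ x * cv θ ρ x ^ (k + 1)) x ≤
      transportErr Φ θ u ρ k := Finset.sum_le_sum fun j _ => le_abs_self _
  have e := hst.transport_eq hs hs2 hK hρ hΦ.test k
  have e2 : (2 * (L * K ^ (k + 1) * (K * K)) + D * (K ^ k * K ^ 2)) / R =
      2 * (L / R * K ^ (k + 1) * (K * K)) + D / R * (K ^ k * K ^ 2) := by field_simp
  rw [e2]
  unfold powRate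
  rw [e]
  linarith [(abs_le.mp h2).1]

/-! ### Iterated mollifiers -/

lemma IsMoll.self_cv {G δ : ℝ} {ρ : Plane → ℝ} (h : IsMoll G δ ρ) : IsMoll (2 * G) (2 * δ) (cv ρ ρ) := by
  have hi := h.test.integrable
  refine ⟨h.test.cv h.test, fun x => integral_nonneg fun y => mul_nonneg (h.nonneg _) (h.nonneg _), fun x => ?_, fun x hx => ?_, ?_,
    fun j => ?_⟩
  · unfold cv
    rw [← integral_neg_eq_self]
    congr 1 with y
    rw [h.even, ← h.even (x - y)]
    congr 2; abel
  · obtain ⟨y, hy⟩ : ∃ y, ρ y * ρ (x - y) ≠ 0 := by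
      by_contra! h0
      exact hx (by simp [cv, h0])
    have h1 := h.supp _ (left_ne_zero_of_mul hy)
    have h2 := h.supp _ (right_ne_zero_of_mul hy)
    calc ‖x‖ = ‖y + (x - y)‖ := by congr 1; abel
      _ ≤ 2 * δ := (norm_add_le _ _).trans (by linarith)
  · rw [integral_cv hi hi, h.int, one_mul]
  · rw [pd_cv hi.locallyIntegrable h.test]
    refine (integral_abs_cv_le hi (h.test.pd j)).2.trans ?_
    rw [h.integral_abs, one_mul, mul_div_mul_left _ _ (by norm_num : (2 : ℝ) ≠ 0)]
    exact h.grad j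

lemma exists_isMollSeq_cv : ∃ (G : ℝ) (δ : ℕ → ℝ) (ρ : ℕ → Plane → ℝ), 0 ≤ G ∧ IsMollSeq G δ (fun n => cv (ρ n) (ρ n)) ∧
    ∀ n, IsTest (ρ n) ∧ ∀ x, ρ n (-x) = ρ n x := by
  obtain ⟨G, hG0, hG⟩ := exists_isMoll
  choose ρ hρ using fun n : ℕ => hG (1 / ((n : ℝ) + 1) / 2) (by positivity)
  refine ⟨2 * G, _, ρ, by positivity, ⟨fun n => ?_, fun n => ?_, fun n => (hρ n).self_cv, ?_⟩, fun n => ⟨(hρ n).test, (hρ n).even⟩⟩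
  · positivity
  · rw [mul_div_cancel₀ _ (by norm_num : (2 : ℝ) ≠ 0), div_le_one (by positivity)]; linarith [(Nat.cast_nonneg n : (0 : ℝ) ≤ n)]
  · simp_rw [mul_div_cancel₀ _ (by norm_num : (2 : ℝ) ≠ 0)]
    exact tendsto_one_div_add_atTop_nhds_zero_nat

/-! ### Integration in time -/

lemma integral_pow_mul {ψ : ℝ → ℝ} {t : ℝ} (h : IntervalIntegrable ψ volume 0 t) (c : ℝ) (n : ℕ) :
    (c + ∫ v in (0 : ℝ)..t, ψ v) ^ (n + 1) / (n + 1) - c ^ (n + 1) / (n + 1) =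
      ∫ τ in (0 : ℝ)..t, (c + ∫ v in (0 : ℝ)..τ, ψ v) ^ n * ψ τ := by
  set φ : ℝ → ℝ := fun τ => c + ∫ v in (0 : ℝ)..τ, ψ v
  have h0 : AbsolutelyContinuousOnInterval (fun _ : ℝ => c) 0 t :=
    (contDiff_const (n := 1)).contDiffOn.absolutelyContinuousOnInterval
  have h1 : AbsolutelyContinuousOnInterval φ 0 t :=
    h0.add (h.absolutelyContinuousOnInterval_intervalIntegral (c := 0) Set.left_mem_uIcc)
  have h2 : ∀ m : ℕ, AbsolutelyContinuousOnInterval (fun τ => φ τ ^ (m + 1)) 0 t := fun m => by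
    induction m with
    | zero => simpa using h1
    | succ m ih =>
      have := ih.mul h1
      refine (congrArg (fun F => AbsolutelyContinuousOnInterval F 0 t) ?_).mp this
      ext τ; simp only [Pi.mul_apply]; ring
  have h3 := (h2 n).integral_deriv_eq_sub
  have h4 : ∫ τ in (0 : ℝ)..t, deriv (fun τ => φ τ ^ (n + 1)) τ = ∫ τ in (0 : ℝ)..t, ((n : ℝ) + 1) * (φ τ ^ n * ψ τ) := by
    apply intervalIntegral.integral_congr_ae
    filter_upwards [h.ae_hasDerivAt_integral] with τ hτ hm
    have h5 := ((hτ (Set.uIoc_subset_uIcc hm) 0 Set.left_mem_uIcc).const_add c).pow (n + 1)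
    have h6 : HasDerivAt (fun τ => φ τ ^ (n + 1)) _ τ := h5
    rw [h6.deriv]
    simp [φ]; ring
  rw [h4, intervalIntegral.integral_const_mul] at h3
  have h7 : φ 0 = c := by simp [φ]
  rw [h7] at h3
  have hn : (n : ℝ) + 1 ≠ 0 := by positivity
  field_simp
  rw [← h3]

/-- The product of the time interval and the plane. -/
abbrev slab (T : ℝ) : Measure (ℝ × Plane) := (volume.restrict (Set.Ioo 0 T)).prod volume

lemma restrict_Ioc_le {t T : ℝ} (ht : t ≤ T) : (volume : Measure ℝ).restrict (Set.Ioc 0 t) ≤ volume.restrict (Set.Ioo 0 T) := by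
  rw [← restrict_Ioo_eq_restrict_Ioc]
  exact Measure.restrict_mono (Set.Ioo_subset_Ioo_right ht) le_rfl

lemma aestronglyMeasurable_pairing {T : ℝ} {h : ℝ → Plane → ℝ} (hh : AEStronglyMeasurable (Function.uncurry h) (slab T))
    {k : Plane → ℝ} (hk : Continuous k) :
    AEStronglyMeasurable (Function.uncurry fun τ x => ∫ y, h τ y * k (y - x)) (slab T) := by
  set h' := hh.mk _
  have hm : StronglyMeasurable fun q : (ℝ × Plane) × Plane => h' (q.1.1, q.2) * k (q.2 - q.1.2) :=
    (hh.stronglyMeasurable_mk.comp_measurable (by fun_prop)).mul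
      (hk.comp (by fun_prop : Continuous fun q : (ℝ × Plane) × Plane => q.2 - q.1.2)).stronglyMeasurable
  refine ⟨_, hm.integral_prod_right' (ν := (volume : Measure Plane)), ?_⟩
  have h1 : ∀ᵐ τ ∂(volume.restrict (Set.Ioo 0 T)), ∀ᵐ y, h τ y = h' (τ, y) := Measure.ae_ae_of_ae_prod hh.ae_eq_mk
  filter_upwards [(Measure.quasiMeasurePreserving_fst (ν := (volume : Measure Plane))).ae h1] with p hp
  refine integral_congr_ae ?_
  filter_upwards [hp] with y hy
  simp only [hy]

lemma integral_swap_time {T t K : ℝ} (ht : t ∈ Set.Icc 0 T) {Q : ℝ → Plane → ℝ} (hQ : AEStronglyMeasurable (Function.uncurry Q) (slab T))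
    (hb : ∀ τ ∈ Set.Icc 0 T, ∀ x, |Q τ x| ≤ K) {P A : Plane → ℝ} (hP : Integrable P)
    (hA : ∀ᵐ x, A x = ∫ τ in (0 : ℝ)..t, Q τ x) :
    (∫ x, A x * P x = ∫ τ in (0 : ℝ)..t, ∫ x, Q τ x * P x) ∧ IntervalIntegrable (fun τ => ∫ x, Q τ x * P x) volume 0 t := by
  have hac : ((volume : Measure ℝ).restrict (Set.Ioc 0 t)).prod (volume : Measure Plane) ≪ slab T :=
    (Measure.absolutelyContinuous_of_le (restrict_Ioc_le ht.2)).prod Measure.AbsolutelyContinuous.rfl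
  have hi : Integrable (Function.uncurry fun τ x => Q τ x * P x) (((volume : Measure ℝ).restrict (Set.Ioc 0 t)).prod volume) := by
    have h1 : Integrable (fun z : ℝ × Plane => K * |P z.2|) (((volume : Measure ℝ).restrict (Set.Ioc 0 t)).prod volume) :=
      (integrable_const K).mul_prod hP.abs
    refine h1.mono' ((hQ.mono_ac hac).mul hP.1.comp_snd) ?_
    have h2 : ∀ᵐ τ ∂((volume : Measure ℝ).restrict (Set.Ioc 0 t)), τ ∈ Set.Icc 0 T := by
      filter_upwards [ae_restrict_mem measurableSet_Ioc] with τ hτ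
      exact ⟨hτ.1.le, hτ.2.trans ht.2⟩
    filter_upwards [(Measure.quasiMeasurePreserving_fst (ν := (volume : Measure Plane))).ae h2] with p hp
    simp only [Function.uncurry, norm_mul, Real.norm_eq_abs]
    gcongr
    exact hb _ hp _
  refine ⟨?_, ?_⟩
  · simp_rw [intervalIntegral.integral_of_le ht.1] at hA ⊢
    rw [integral_integral_swap hi]
    refine integral_congr_ae ?_
    filter_upwards [hA] with x hx
    rw [hx, integral_mul_const]
  · rw [intervalIntegrable_iff_integrableOn_Ioc_of_le ht.1]
    exact hi.integral_prod_left

/-! ### Drifts given by Fourier multipliers -/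

/-- The time derivative of `f` mollified by `κ` and evaluated at `x`, for `∂ₜ f = ∑ mⱼ(D)ᵀ hⱼ - Λ f`. -/
def drift (m : Fin 2 → Plane → ℂ) (h : Fin 2 → Plane → ℝ) (f κ : Plane → ℝ) (x : Plane) : ℝ :=
  (∑ j, ∫ y, h j y * multiplier (m j) κ (y - x)) - ∫ y, f y * multiplier (lamS 1) κ (y - x)

lemma isSymb_lamS_one : IsSymb (lamS 1) := isSymb_lamS (by norm_num) (by norm_num)

lemma memLp_comp_sub {k : Plane → ℝ} (hk : MemLp k 2 volume) (x : Plane) : MemLp (fun y => k (y - x)) 2 volume :=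
  hk.comp_measurePreserving (measurePreserving_sub_right volume x)

lemma n2_comp_sub (k : Plane → ℝ) (x : Plane) : n2 (fun y => k (y - x)) = n2 k := by
  unfold n2
  rw [integral_sub_right_eq_self (fun y => k y ^ 2) x]

lemma abs_pairing_le {h k : Plane → ℝ} {K : ℝ} (hh : MemLp h 2 volume) (hK : n2 h ≤ K) (hk : MemLp k 2 volume) (x : Plane) :
    |∫ y, h y * k (y - x)| ≤ K * n2 k := by
  refine (abs_integral_mul_le hh (memLp_comp_sub hk x)).trans ?_
  rw [n2_comp_sub]
  have := n2_nonneg k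
  gcongr

lemma abs_drift_le {m : Fin 2 → Plane → ℂ} (hm : ∀ j, IsSymb (m j)) {h : Fin 2 → Plane → ℝ} {f κ : Plane → ℝ} {K : ℝ}
    (hκ : IsTest κ) (hh : ∀ j, MemLp (h j) 2 volume) (hhK : ∀ j, n2 (h j) ≤ K) (hf : MemLp f 2 volume) (hfK : n2 f ≤ K) (x : Plane) :
    |drift m h f κ x| ≤ K * ((∑ j, n2 (multiplier (m j) κ)) + n2 (multiplier (lamS 1) κ)) := by
  unfold drift
  refine (abs_sub _ _).trans ?_
  rw [mul_add, Finset.mul_sum]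
  refine add_le_add ((Finset.abs_sum_le_sum_abs _ _).trans (Finset.sum_le_sum fun j _ => ?_)) ?_
  · exact abs_pairing_le (hh j) (hhK j) ((hm j).memLp_multiplier hκ) x
  · exact abs_pairing_le hf hfK (isSymb_lamS_one.memLp_multiplier hκ) x

lemma integral_mul_pairing {m : Plane → ℂ} (hm : IsSymb m) {h κ ζ : Plane → ℝ} (hh : MemLp h 2 volume) (hκ : IsTest κ)
    (he : ∀ x, κ (-x) = κ x) (hζ : IsTest ζ) :
    ∫ x, ζ x * ∫ y, h y * multiplier m κ (y - x) = ∫ x, cv h κ x * multiplier m ζ x := by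
  rw [← integral_mul_cv hh hζ.integrable (hm.continuous_multiplier hκ) (hm.memLp_multiplier hκ), ← multiplier_cv hm hζ hκ, cv_comm,
    multiplier_cv hm hκ hζ, cv_comm, integral_cv_mul_two hh (hm.memLp_multiplier hζ) hκ]
  simp_rw [he]

lemma integrable_mul_pairing {h k P : Plane → ℝ} (hh : MemLp h 2 volume) (hk : Continuous k) (hk2 : MemLp k 2 volume) (hP : Integrable P) :
    Integrable fun x => P x * ∫ y, h y * k (y - x) := by
  refine (hP.abs.mul_const (n2 h * n2 k)).mono' (hP.1.mul ?_) (.of_forall fun x => ?_)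
  · have : AEStronglyMeasurable (fun p : Plane × Plane => h p.2 * k (p.2 - p.1)) (volume.prod volume) :=
      hh.1.comp_snd.mul (hk.comp (by fun_prop)).aestronglyMeasurable
    exact this.integral_prod_right'
  · rw [norm_mul, Real.norm_eq_abs, Real.norm_eq_abs]
    gcongr
    exact abs_pairing_le hh le_rfl hk2 x

lemma integral_drift_mul {m : Fin 2 → Plane → ℂ} (hm : ∀ j, IsSymb (m j)) {h : Fin 2 → Plane → ℝ} {f κ P : Plane → ℝ}
    (hκ : IsTest κ) (hh : ∀ j, MemLp (h j) 2 volume) (hf : MemLp f 2 volume) (hP : Integrable P) :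
    ∫ x, drift m h f κ x * P x = (∑ j, ∫ x, P x * ∫ y, h j y * multiplier (m j) κ (y - x)) -
      ∫ x, P x * ∫ y, f y * multiplier (lamS 1) κ (y - x) := by
  have i1 : ∀ j, Integrable fun x => P x * ∫ y, h j y * multiplier (m j) κ (y - x) := fun j =>
    integrable_mul_pairing (hh j) ((hm j).continuous_multiplier hκ) ((hm j).memLp_multiplier hκ) hP
  have i2 : Integrable fun x => P x * ∫ y, f y * multiplier (lamS 1) κ (y - x) :=
    integrable_mul_pairing hf (isSymb_lamS_one.continuous_multiplier hκ) (isSymb_lamS_one.memLp_multiplier hκ) hP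
  have e : ∀ x, drift m h f κ x * P x = (∑ j, P x * ∫ y, h j y * multiplier (m j) κ (y - x)) -
      P x * ∫ y, f y * multiplier (lamS 1) κ (y - x) := fun x => by
    rw [drift, ← Finset.mul_sum]; ring
  simp_rw [e]
  rw [integral_sub (integrable_finsetSum _ fun j _ => i1 j) i2, integral_finsetSum _ fun j _ => i1 j]

lemma integral_drift_mul_test {m : Fin 2 → Plane → ℂ} (hm : ∀ j, IsSymb (m j)) {h : Fin 2 → Plane → ℝ} {f κ ζ : Plane → ℝ}
    (hκ : IsTest κ) (he : ∀ x, κ (-x) = κ x) (hh : ∀ j, MemLp (h j) 2 volume) (hf : MemLp f 2 volume) (hζ : IsTest ζ) :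
    ∫ x, drift m h f κ x * ζ x = (∑ j, ∫ x, cv (h j) κ x * multiplier (m j) ζ x) - ∫ x, cv f κ x * fracLapTest 1 ζ x := by
  rw [integral_drift_mul hm hκ hh hf hζ.integrable, integral_mul_pairing isSymb_lamS_one hf hκ he hζ, fracLapTest_eq]
  congr 1
  exact Finset.sum_congr rfl fun j _ => integral_mul_pairing (hm j) (hh j) hκ he hζ

/-- Uniform square integrability in time of the data of an evolution equation. -/
structure TimeData (T K : ℝ) (h : Fin 2 → ℝ → Plane → ℝ) (f : ℝ → Plane → ℝ) : Prop where
  meas_h : ∀ j, AEStronglyMeasurable (Function.uncurry (h j)) (slab T)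
  meas_f : AEStronglyMeasurable (Function.uncurry f) (slab T)
  h2 : ∀ j, ∀ t ∈ Set.Icc 0 T, MemLp (h j t) 2 volume ∧ n2 (h j t) ≤ K
  f2 : ∀ t ∈ Set.Icc 0 T, MemLp (f t) 2 volume ∧ n2 (f t) ≤ K

lemma TimeData.aestronglyMeasurable_drift {T K : ℝ} {h : Fin 2 → ℝ → Plane → ℝ} {f : ℝ → Plane → ℝ} (hd : TimeData T K h f)
    {m : Fin 2 → Plane → ℂ} (hm : ∀ j, IsSymb (m j)) {κ : Plane → ℝ} (hκ : IsTest κ) :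
    AEStronglyMeasurable (Function.uncurry fun τ x => drift m (fun j => h j τ) (f τ) κ x) (slab T) := by
  have h1 : ∀ j, AEStronglyMeasurable (Function.uncurry fun τ x => ∫ y, h j τ y * multiplier (m j) κ (y - x)) (slab T) :=
    fun j => aestronglyMeasurable_pairing (hd.meas_h j) ((hm j).continuous_multiplier hκ)
  have h2 := aestronglyMeasurable_pairing hd.meas_f (isSymb_lamS_one.continuous_multiplier hκ)
  exact (Finset.aestronglyMeasurable_fun_sum _ fun j _ => h1 j).sub h2

lemma TimeData.abs_drift_le {T K : ℝ} {h : Fin 2 → ℝ → Plane → ℝ} {f : ℝ → Plane → ℝ} (hd : TimeData T K h f)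
    {m : Fin 2 → Plane → ℂ} (hm : ∀ j, IsSymb (m j)) {κ : Plane → ℝ} (hκ : IsTest κ) : ∀ τ ∈ Set.Icc 0 T, ∀ x,
    |drift m (fun j => h j τ) (f τ) κ x| ≤ K * ((∑ j, n2 (multiplier (m j) κ)) + n2 (multiplier (lamS 1) κ)) := fun τ hτ x =>
  SQG.abs_drift_le hm hκ (fun j => (hd.h2 j τ hτ).1) (fun j => (hd.h2 j τ hτ).2) (hd.f2 τ hτ).1 (hd.f2 τ hτ).2 x

/-- The balance law for integrals of powers of the mollified solution. -/
lemma TimeData.integral_pow {T K : ℝ} {h : Fin 2 → ℝ → Plane → ℝ} {f : ℝ → Plane → ℝ} (hd : TimeData T K h f)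
    {m : Fin 2 → Plane → ℂ} (hm : ∀ j, IsSymb (m j)) {κ : Plane → ℝ} (hκ : IsTest κ) (he : ∀ x, κ (-x) = κ x)
    (hev : ∀ t ∈ Set.Icc 0 T, ∀ x, cv (f t) κ x = cv (f 0) κ x + ∫ τ in (0 : ℝ)..t, drift m (fun j => h j τ) (f τ) κ x)
    {Φ : Plane → ℝ} (hΦ : IsTest Φ) (n : ℕ) {t : ℝ} (ht : t ∈ Set.Icc 0 T) :
    (∫ x, cv (f t) κ x ^ (n + 1) / (n + 1) * Φ x) - (∫ x, cv (f 0) κ x ^ (n + 1) / (n + 1) * Φ x) =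
      (∫ τ in (0 : ℝ)..t, ((∑ j, ∫ x, cv (h j τ) κ x * multiplier (m j) (fun x => Φ x * cv (f τ) κ x ^ n) x) -
        ∫ x, cv (f τ) κ x * fracLapTest 1 (fun x => Φ x * cv (f τ) κ x ^ n) x)) ∧
    IntervalIntegrable (fun τ => (∑ j, ∫ x, cv (h j τ) κ x * multiplier (m j) (fun x => Φ x * cv (f τ) κ x ^ n) x) -
        ∫ x, cv (f τ) κ x * fracLapTest 1 (fun x => Φ x * cv (f τ) κ x ^ n) x) volume 0 t := by
  set F := fun τ x => drift m (fun j => h j τ) (f τ) κ x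
  set D := K * ((∑ j, n2 (multiplier (m j) κ)) + n2 (multiplier (lamS 1) κ))
  have hF := hd.aestronglyMeasurable_drift hm hκ
  have hFb := hd.abs_drift_le hm hκ
  have hcv : ∀ τ x, cv (f τ) κ x = ∫ y, f τ y * κ (y - x) := fun τ x => by
    unfold cv
    congr 1 with y
    rw [← he (y - x), neg_sub]
  have hgm : AEStronglyMeasurable (Function.uncurry fun τ x => cv (f τ) κ x) (slab T) := by
    simp_rw [hcv]
    exact aestronglyMeasurable_pairing hd.meas_f hκ.continuous
  have hgb : ∀ τ ∈ Set.Icc 0 T, ∀ x, |cv (f τ) κ x| ≤ K * n2 κ := fun τ hτ x => by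
    rw [hcv]
    exact abs_pairing_le (hd.f2 τ hτ).1 (hd.f2 τ hτ).2 (hκ.memLp 2) x
  have hQm : AEStronglyMeasurable (Function.uncurry fun τ x => cv (f τ) κ x ^ n * F τ x) (slab T) := (hgm.pow n).mul hF
  have hQb : ∀ τ ∈ Set.Icc 0 T, ∀ x, |cv (f τ) κ x ^ n * F τ x| ≤ (K * n2 κ) ^ n * D := fun τ hτ x => by
    rw [abs_mul, abs_pow]
    have h1 := hgb τ hτ x
    have h2 := hFb τ hτ x
    exact mul_le_mul (pow_le_pow_left₀ (abs_nonneg _) h1 n) h2 (abs_nonneg _) (pow_nonneg ((abs_nonneg _).trans h1) n)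
  have hA : ∀ᵐ x, cv (f t) κ x ^ (n + 1) / (n + 1) - cv (f 0) κ x ^ (n + 1) / (n + 1) =
      ∫ τ in (0 : ℝ)..t, cv (f τ) κ x ^ n * F τ x := by
    filter_upwards [hF.prod_swap.prodMk_left] with x hx
    have hint : IntervalIntegrable (fun τ => F τ x) volume 0 t := by
      rw [intervalIntegrable_iff_integrableOn_Ioc_of_le ht.1]
      have hx' : AEStronglyMeasurable (fun τ => F τ x) (volume.restrict (Set.Ioc 0 t)) := hx.mono_measure (restrict_Ioc_le ht.2)
      refine ⟨hx', HasFiniteIntegral.of_bounded (C := D) ?_⟩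
      filter_upwards [ae_restrict_mem measurableSet_Ioc] with τ hτ
      exact hFb τ ⟨hτ.1.le, hτ.2.trans ht.2⟩ x
    have h1 := integral_pow_mul hint (cv (f 0) κ x) n
    rw [← hev t ht x] at h1
    rw [h1]
    refine intervalIntegral.integral_congr fun τ hτ => ?_
    rw [Set.uIcc_of_le ht.1] at hτ
    rw [← hev τ ⟨hτ.1, hτ.2.trans ht.2⟩ x]
  obtain ⟨e1, e2⟩ := integral_swap_time ht hQm hQb hΦ.integrable hA
  have hsm : ∀ τ ∈ Set.Icc 0 T, ContDiff ℝ ((⊤ : ℕ∞) : WithTop ℕ∞) (cv (f τ) κ) := fun τ hτ => cv_contDiff_of_memLp (hd.f2 τ hτ).1 hκ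
  have e3 : ∀ τ ∈ Set.Icc 0 T, ∫ x, cv (f τ) κ x ^ n * F τ x * Φ x =
      (∑ j, ∫ x, cv (h j τ) κ x * multiplier (m j) (fun x => Φ x * cv (f τ) κ x ^ n) x) -
        ∫ x, cv (f τ) κ x * fracLapTest 1 (fun x => Φ x * cv (f τ) κ x ^ n) x := fun τ hτ => by
    rw [← integral_drift_mul_test hm hκ he (fun j => (hd.h2 j τ hτ).1) (hd.f2 τ hτ).1 (hΦ.mul_contDiff ((hsm τ hτ).pow n))]
    congr 1 with x
    ring
  have hsub : ∀ τ ∈ Set.uIcc 0 t, τ ∈ Set.Icc 0 T := fun τ hτ => by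
    rw [Set.uIcc_of_le ht.1] at hτ
    exact ⟨hτ.1, hτ.2.trans ht.2⟩
  refine ⟨?_, e2.congr fun τ hτ => e3 τ (hsub τ (Set.uIoc_subset_uIcc hτ))⟩
  rw [← intervalIntegral.integral_congr fun τ hτ => e3 τ (hsub τ hτ), ← e1]
  have hi : ∀ τ ∈ Set.Icc 0 T, Integrable fun x => cv (f τ) κ x ^ (n + 1) / (n + 1) * Φ x := fun τ hτ => by
    refine Continuous.integrable_of_hasCompactSupport ?_ hΦ.2.mul_left
    exact (((hsm τ hτ).continuous.pow _).div_const _).mul hΦ.continuous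
  rw [← integral_sub (hi t ht) (hi 0 ⟨le_rfl, ht.1.trans ht.2⟩)]
  congr 1 with x
  ring

/-! ### The evolution of `w` and of `Λ^s w` -/

lemma hat_multiplier {m : Plane → ℂ} (hm : IsSymb m) (hmc : Continuous m) {η : Plane → ℝ} (hη : IsTest η)
    (hP : Integrable (multiplier m η)) : hat (multiplier m η) = fun ξ => m ξ * hat η ξ := by
  have e : (fun y => (multiplier m η y : ℂ)) = 𝓕⁻ fun ξ => m ξ * hat η ξ := by
    ext y; exact hm.coe_multiplier η y
  have hi : Integrable (𝓕 fun ξ => m ξ * hat η ξ) := by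
    have h1 : Integrable (𝓕⁻ fun ξ => m ξ * hat η ξ) := by
      rw [← e]; exact hP.ofReal
    refine h1.comp_neg.congr (.of_forall fun x => ?_)
    simp only [Real.fourierInv_eq_fourier_neg, neg_neg]
  unfold hat at *
  rw [e]
  exact Continuous.fourier_fourierInv_eq (hmc.mul hη.continuous_hat) (hm.integrable hη) hi

lemma cv_multiplier_multiplier {m m' m'' : Plane → ℂ} (hm : IsSymb m) (hm' : IsSymb m') (hmc : Continuous m') (hm'' : IsSymb m'')
    (e : ∀ ξ, m'' ξ = m' ξ * m ξ) {η ρ : Plane → ℝ} (hη : IsTest η) (hρ : IsTest ρ) (hP : Integrable (multiplier m' η)) :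
    cv (multiplier m' η) (multiplier m ρ) = multiplier m'' (cv η ρ) := by
  ext y
  have h1 := cv_multiplier_eq hP hm hρ y
  have h2 := hm''.coe_multiplier (cv η ρ) y
  rw [hat_multiplier hm' hmc hη hP] at h1
  have h3 : (fun ξ => m'' ξ * hat (cv η ρ) ξ) = fun ξ => m' ξ * hat η ξ * (m ξ * hat ρ ξ) := by
    ext ξ
    rw [IsTest.hat_cv hη.integrable hρ.integrable, e]; ring
  rw [h3, ← h1] at h2
  exact_mod_cast h2.symm

lemma cv_comp_sub (η ρ : Plane → ℝ) (a y : Plane) : cv (fun y => η (y - a)) ρ y = cv η ρ (y - a) := by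
  unfold cv
  rw [← integral_add_right_eq_self _ a]
  congr 1 with z
  simp only [add_sub_cancel_right]
  congr 2; abel

lemma continuous_lamS {σ : ℝ} (hσ : 0 ≤ σ) : Continuous (lamS σ) := by
  unfold lamS
  refine Complex.continuous_ofReal.comp (Continuous.rpow_const (by fun_prop) fun _ => .inr hσ)

lemma oddS_mul_lamS (s : ℝ) (j : Fin 2) (ξ : Plane) :
    I * ((2 * Real.pi * ξ j : ℝ) : ℂ) = lamS s ξ * oddS (1 - s) j ξ := by
  rcases eq_or_ne ξ 0 with h | h
  · simp [h, oddS]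
  · have hx : 0 < 2 * Real.pi * ‖ξ‖ := by have := Real.pi_pos; have := norm_pos_iff.mpr h; positivity
    have e : (2 * Real.pi * ‖ξ‖) ^ s * (2 * Real.pi * ‖ξ‖) ^ (1 - s) = 2 * Real.pi * ‖ξ‖ := by
      rw [← Real.rpow_add hx]; simp
    have hn : ‖ξ‖ ≠ 0 := norm_ne_zero_iff.mpr h
    rw [lamS, oddS, mul_left_comm, ← ofReal_mul]
    congr 2
    rw [mul_left_comm, e]
    field_simp

section
variable {s T : ℝ} {wI : Plane → ℝ} {w θ : ℝ → Plane → ℝ} {u : ℝ → Plane → Plane} {v : ℝ → Plane → ℝ}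

lemma IsWeakSolution.state (h : IsWeakSolution s T wI w θ u v) {t : ℝ} (ht : t ∈ Set.Icc 0 T) :
    State s (w t) (θ t) (fun j x => u t x j) where
  w2 := h.memLp_w t ht
  θ2 := h.memLp_θ t ht
  u2 j := (EuclideanSpace.proj (𝕜 := ℝ) j : Plane →L[ℝ] ℝ).comp_memLp' (h.memLp_u t ht)
  frac := h.frac t ht
  vel := (h.riesz t ht).mulRel

lemma ae_abs_le_of_eLpNorm_top {f : Plane → ℝ} {K : ℝ≥0} (h : eLpNorm f ⊤ volume ≤ K) : ∀ᵐ x, |f x| ≤ K := by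
  filter_upwards [ae_le_eLpNormEssSup (f := f) (μ := volume)] with x hx
  rw [eLpNorm_exponent_top] at h
  have := hx.trans h
  rw [← Real.norm_eq_abs]
  simpa [enorm_eq_nnnorm, ← NNReal.coe_le_coe] using this

lemma IsWeakSolution.exists_bound (h : IsWeakSolution s T wI w θ u v) : ∃ K : ℝ, 0 ≤ K ∧ ∀ t ∈ Set.Icc 0 T,
    n2 (w t) ≤ K ∧ n2 (θ t) ≤ K ∧ ∀ᵐ x, |θ t x| ≤ K := by
  obtain ⟨K, hK⟩ := h.bound
  refine ⟨K, K.2, fun t ht => ?_⟩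
  obtain ⟨h1, h2, h3⟩ := hK t ht
  rw [eLpNorm_two_eq (h.memLp_w t ht), ← ENNReal.ofReal_coe_nnreal, ENNReal.ofReal_le_ofReal_iff K.coe_nonneg] at h1
  rw [eLpNorm_two_eq (h.memLp_θ t ht), ← ENNReal.ofReal_coe_nnreal, ENNReal.ofReal_le_ofReal_iff K.coe_nonneg] at h2
  exact ⟨h1, h2, ae_abs_le_of_eLpNorm_top h3⟩

/-- The components of the flux `θ u`. -/
def flux (θ : ℝ → Plane → ℝ) (u : ℝ → Plane → Plane) (j : Fin 2) (t : ℝ) (x : Plane) : ℝ := θ t x * u t x j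

lemma IsWeakSolution.timeData (h : IsWeakSolution s T wI w θ u v) {K : ℝ} (hK0 : 0 ≤ K) (hK : ∀ t ∈ Set.Icc 0 T,
    n2 (w t) ≤ K ∧ n2 (θ t) ≤ K ∧ ∀ᵐ x, |θ t x| ≤ K) :
    TimeData T (K * K + K) (flux θ u) w ∧ TimeData T (K * K + K) (flux θ u) θ := by
  have hm : ∀ j, AEStronglyMeasurable (Function.uncurry (flux θ u j)) (slab T) := fun j =>
    h.meas_θ.mul ((EuclideanSpace.proj (𝕜 := ℝ) j : Plane →L[ℝ] ℝ).continuous.comp_aestronglyMeasurable h.meas_u)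
  have h2 : ∀ j, ∀ t ∈ Set.Icc 0 T, MemLp (flux θ u j t) 2 volume ∧ n2 (flux θ u j t) ≤ K * K + K := fun j t ht => by
    have hst := h.state ht
    obtain ⟨-, k2, k3⟩ := hK t ht
    refine ⟨memLp_mul_bdd k3 hst.θ2.1 (hst.u2 j), ?_⟩
    have h1 := n2_mul_bdd_le k3 hst.θ2.1 (hst.u2 j)
    have h2 := (n2_vel_le hst.θ2 (hst.u2 j) (hst.vel j)).trans k2
    have h3 := n2_nonneg (fun x => u t x j)
    have h4 : n2 (flux θ u j t) ≤ K * K := by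
      refine (sq_le_sq₀ (n2_nonneg _) (by positivity)).mp (h1.trans ?_)
      rw [mul_pow]; gcongr
    linarith
  have hKK : 0 ≤ K * K := by positivity
  exact ⟨⟨hm, h.meas_w, h2, fun t ht => ⟨h.memLp_w t ht, by linarith [(hK t ht).1]⟩⟩,
    ⟨hm, h.meas_θ, h2, fun t ht => ⟨h.memLp_θ t ht, by linarith [(hK t ht).2.1]⟩⟩⟩

lemma cv_eq_of_even {κ : Plane → ℝ} (he : ∀ x, κ (-x) = κ x) (f : Plane → ℝ) (x : Plane) : cv f κ x = ∫ y, f y * κ (y - x) := by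
  unfold cv
  congr 1 with y
  rw [← he (y - x), neg_sub]

lemma IsWeakSolution.evolution_w (hs : 0 < s) (hs1 : s < 1) (hT : 0 < T) (h : IsWeakSolution s T wI w θ u v) {K : ℝ}
    (hd : TimeData T K (flux θ u) w) {κ : Plane → ℝ} (hκ : IsTest κ) (he : ∀ x, κ (-x) = κ x) : ∀ t ∈ Set.Icc 0 T, ∀ x,
    cv (w t) κ x = cv (w 0) κ x + ∫ τ in (0 : ℝ)..t, drift (oddS (1 - s)) (fun j => flux θ u j τ) (w τ) κ x := by
  intro t ht x
  have hη := hκ.comp_sub x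
  have h0 := h.equation _ hη 0 ⟨le_rfl, hT.le⟩
  rw [intervalIntegral.integral_same, add_zero] at h0
  rw [cv_eq_of_even he, cv_eq_of_even he, h.equation _ hη t ht, h0]
  congr 1
  refine intervalIntegral.integral_congr fun τ hτ => ?_
  rw [Set.uIcc_of_le ht.1] at hτ
  have hτ' : τ ∈ Set.Icc 0 T := ⟨hτ.1, hτ.2.trans ht.2⟩
  have hsy : ∀ j, IsSymb (oddS (1 - s) j) := fun j => isSymb_oddS (by linarith) (by linarith) j
  simp only [drift, fracLapTest_eq, fracGradTest_eq, multiplier_comp_sub]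
  congr 1
  have hi : ∀ j, Integrable fun y => flux θ u j τ y * multiplier (oddS (1 - s) j) κ (y - x) := fun j =>
    (hd.h2 j τ hτ').1.integrable_mul (memLp_comp_sub ((hsy j).memLp_multiplier hκ) x)
  rw [← integral_finsetSum _ fun j _ => hi j]
  congr 1 with y
  rw [Finset.mul_sum]
  refine Finset.sum_congr rfl fun j _ => ?_
  simp only [flux]; ring

lemma IsWeakSolution.evolution_frac (hs : 0 < s) (hs1 : s < 1) (hT : 0 < T) (h : IsWeakSolution s T wI w θ u v) {K : ℝ}
    (hd : TimeData T K (flux θ u) w) {ρ : Plane → ℝ} (hρ : IsTest ρ) (he : ∀ x, ρ (-x) = ρ x)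
    (hee : ∀ x, cv ρ ρ (-x) = cv ρ ρ x) : ∀ t ∈ Set.Icc 0 T, ∀ x,
    cv (θ t) (cv ρ ρ) x = cv (θ 0) (cv ρ ρ) x +
      ∫ τ in (0 : ℝ)..t, drift (fun j ξ => I * ((2 * Real.pi * ξ j : ℝ) : ℂ)) (fun j => flux θ u j τ) (θ τ) (cv ρ ρ) x := by
  intro t ht a
  have hη := hρ.comp_sub a
  set η : Plane → ℝ := fun y => ρ (y - a)
  have hκη : IsTest (cv η ρ) := hη.cv hρ
  have hκ : ∀ y, cv ρ ρ (y - a) = cv η ρ y := fun y => (cv_comp_sub ρ ρ a y).symm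
  have hsy := isSymb_lamS hs.le (by linarith : s ≤ 4)
  have hP : Integrable (multiplier (lamS s) η) := by
    have := hη.integrable_fracLap hs (by linarith); rwa [fracLapTest_eq] at this
  have hP2 := hsy.memLp_multiplier hη
  have hodd : ∀ j, IsSymb (oddS (1 - s) j) := fun j => isSymb_oddS (by linarith) (by linarith) j
  have e1 : ∀ τ ∈ Set.Icc 0 T, cv (θ τ) (cv ρ ρ) a = ∫ x, cv (w τ) ρ x * multiplier (lamS s) η x := fun τ hτ => by
    rw [cv_eq_of_even hee]
    simp_rw [hκ]
    rw [h.frac τ hτ _ hκη, fracLapTest_eq, cv_comm, multiplier_cv hsy hρ hη, cv_comm, integral_cv_mul_two (h.memLp_w τ hτ) hP2 hρ]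
    simp_rw [he]
  have hev := h.evolution_w hs hs1 hT hd hρ he
  have h0 : (0 : ℝ) ∈ Set.Icc 0 T := ⟨le_rfl, hT.le⟩
  have hcw : ∀ τ ∈ Set.Icc 0 T, Integrable fun x => cv (w τ) ρ x * multiplier (lamS s) η x := fun τ hτ =>
    (memLp_cv (h.memLp_w τ hτ) hρ.integrable).integrable_mul hP2
  have e2 := (integral_swap_time ht (hd.aestronglyMeasurable_drift hodd hρ) (hd.abs_drift_le hodd hρ) hP
    (A := fun x => cv (w t) ρ x - cv (w 0) ρ x) (.of_forall fun x => by rw [hev t ht x]; ring)).1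
  simp_rw [sub_mul] at e2
  rw [integral_sub (hcw t ht) (hcw 0 h0), ← e1 t ht, ← e1 0 h0] at e2
  rw [← sub_eq_iff_eq_add', e2]
  refine intervalIntegral.integral_congr fun τ hτ => ?_
  rw [Set.uIcc_of_le ht.1] at hτ
  have hτ' : τ ∈ Set.Icc 0 T := ⟨hτ.1, hτ.2.trans ht.2⟩
  simp only
  rw [integral_drift_mul hodd hρ (fun j => (hd.h2 j τ hτ').1) (hd.f2 τ hτ').1 hP]
  unfold drift
  have hl1 := isSymb_lamS_one
  have hl : IsSymb (lamS (s + 1)) := isSymb_lamS (by linarith) (by linarith)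
  congr 1
  · refine Finset.sum_congr rfl fun j _ => ?_
    rw [← integral_mul_cv (hd.h2 j τ hτ').1 hP ((hodd j).continuous_multiplier hρ) ((hodd j).memLp_multiplier hρ),
      cv_multiplier_multiplier (hodd j) hsy (continuous_lamS hs.le) (isSymb_pd j) (oddS_mul_lamS s j) hη hρ hP]
    congr 1 with y
    rw [← multiplier_comp_sub]
    simp_rw [hκ]
  · rw [← integral_mul_cv (hd.f2 τ hτ').1 hP (hl1.continuous_multiplier hρ) (hl1.memLp_multiplier hρ),
      cv_multiplier_multiplier hl1 hsy (continuous_lamS hs.le) hl (lamS_add hs.le (by norm_num)) hη hρ hP,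
      ← MulRel.integral_multiplier hsy hl1 hl (lamS_add hs.le (by norm_num)) (h.frac τ hτ') (h.memLp_w τ hτ') (h.memLp_θ τ hτ') hκη]
    congr 1 with y
    rw [← multiplier_comp_sub]
    simp_rw [hκ]

end

/-! ### Passage to the limit in balance laws -/

lemma restrict_Ioc_le_Ioo {r t T : ℝ} (hr : 0 ≤ r) (ht : t ≤ T) :
    (volume : Measure ℝ).restrict (Set.Ioc r t) ≤ volume.restrict (Set.Ioo 0 T) := by
  rw [← restrict_Ioo_eq_restrict_Ioc]
  exact Measure.restrict_mono (Set.Ioo_subset_Ioo hr ht) le_rfl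

lemma intervalIntegrable_of_Ioo {r t T : ℝ} (hr : 0 ≤ r) (hrt : r ≤ t) (ht : t ≤ T) {g : ℝ → ℝ}
    (hg : IntegrableOn g (Set.Ioo 0 T)) : IntervalIntegrable g volume r t := by
  rw [intervalIntegrable_iff_integrableOn_Ioc_of_le hrt]
  exact Integrable.mono_measure hg (restrict_Ioc_le_Ioo hr ht)

section
variable {T : ℝ} {A : ℝ → ℝ} {An Bn : ℕ → ℝ → ℝ} {g H : ℝ → ℝ}

lemma sub_eq_integral_of_balance (hAB : ∀ n, ∀ t ∈ Set.Icc 0 T, An n t - An n 0 = ∫ τ in (0 : ℝ)..t, Bn n τ)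
    (hB : ∀ n, ∀ t ∈ Set.Icc 0 T, IntervalIntegrable (Bn n) volume 0 t) {r t : ℝ} (hr : 0 ≤ r) (hrt : r ≤ t) (ht : t ≤ T) (n : ℕ) :
    An n t - An n r = ∫ τ in r..t, Bn n τ := by
  have mt : t ∈ Set.Icc 0 T := ⟨hr.trans hrt, ht⟩
  have mr : r ∈ Set.Icc 0 T := ⟨hr, hrt.trans ht⟩
  rw [← intervalIntegral.integral_interval_sub_left (hB n t mt) (hB n r mr), ← hAB n t mt, ← hAB n r mr]
  ring

lemma abs_sub_le_integral_of_tendsto (hg : IntegrableOn g (Set.Ioo 0 T))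
    (hA : ∀ t ∈ Set.Icc 0 T, Tendsto (fun n => An n t) atTop (𝓝 (A t)))
    (hAB : ∀ n, ∀ t ∈ Set.Icc 0 T, An n t - An n 0 = ∫ τ in (0 : ℝ)..t, Bn n τ)
    (hB : ∀ n, ∀ t ∈ Set.Icc 0 T, IntervalIntegrable (Bn n) volume 0 t)
    (hb : ∀ n, ∀ᵐ τ ∂(volume.restrict (Set.Ioo 0 T)), |Bn n τ| ≤ g τ) {r t : ℝ} (hr : 0 ≤ r) (hrt : r ≤ t) (ht : t ≤ T) :
    |A t - A r| ≤ ∫ τ in r..t, g τ := by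
  have hl := ((hA t ⟨hr.trans hrt, ht⟩).sub (hA r ⟨hr, hrt.trans ht⟩)).abs
  refine le_of_tendsto' hl fun n => ?_
  rw [sub_eq_integral_of_balance hAB hB hr hrt ht, ← Real.norm_eq_abs]
  refine intervalIntegral.norm_integral_le_of_norm_le hrt ?_ (intervalIntegrable_of_Ioo hr hrt ht hg)
  rw [← ae_restrict_iff' measurableSet_Ioc]
  exact ae_mono (restrict_Ioc_le_Ioo hr ht) (hb n)

lemma sub_le_integral_of_tendsto (hg : IntegrableOn g (Set.Ioo 0 T)) (hH : IntegrableOn H (Set.Ioo 0 T))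
    (hA : ∀ t ∈ Set.Icc 0 T, Tendsto (fun n => An n t) atTop (𝓝 (A t)))
    (hAB : ∀ n, ∀ t ∈ Set.Icc 0 T, An n t - An n 0 = ∫ τ in (0 : ℝ)..t, Bn n τ)
    (hB : ∀ n, ∀ t ∈ Set.Icc 0 T, IntervalIntegrable (Bn n) volume 0 t)
    (hb : ∀ n, ∀ᵐ τ ∂(volume.restrict (Set.Ioo 0 T)), Bn n τ ≤ g τ)
    (he : ∀ᵐ τ ∂(volume.restrict (Set.Ioo 0 T)), ∃ e : ℕ → ℝ, Tendsto e atTop (𝓝 0) ∧ ∀ n, Bn n τ ≤ H τ + e n)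
    {r t : ℝ} (hr : 0 ≤ r) (hrt : r ≤ t) (ht : t ≤ T) : A t - A r ≤ ∫ τ in r..t, H τ := by
  have hle := restrict_Ioc_le_Ioo hr ht
  have hHi := intervalIntegrable_of_Ioo hr hrt ht hH
  have hgi := intervalIntegrable_of_Ioo hr hrt ht hg
  have hBi : ∀ n, IntervalIntegrable (Bn n) volume r t := fun n =>
    (hB n r ⟨hr, hrt.trans ht⟩).symm.trans (hB n t ⟨hr.trans hrt, ht⟩)
  have hmi : ∀ n, IntervalIntegrable (fun τ => max (Bn n τ) (H τ)) volume r t := fun n => by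
    rw [intervalIntegrable_iff_integrableOn_Ioc_of_le hrt] at *
    exact ((intervalIntegrable_iff_integrableOn_Ioc_of_le hrt).mp (hBi n)).sup hHi
  have hlim : Tendsto (fun n => ∫ τ in r..t, max (Bn n τ) (H τ)) atTop (𝓝 (∫ τ in r..t, H τ)) := by
    refine intervalIntegral.tendsto_integral_filter_of_dominated_convergence (fun τ => |g τ| + |H τ|) (.of_forall fun n => ?_)
      (.of_forall fun n => ?_) (hgi.abs.add hHi.abs) ?_
    · rw [Set.uIoc_of_le hrt]
      exact (hmi n).aestronglyMeasurable
    · rw [← ae_restrict_iff' measurableSet_uIoc, Set.uIoc_of_le hrt]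
      filter_upwards [ae_mono hle (hb n)] with τ hτ
      rw [Real.norm_eq_abs, abs_le]
      constructor
      · have := le_max_right (Bn n τ) (H τ)
        have := neg_abs_le (H τ)
        have := abs_nonneg (g τ)
        linarith
      · have := le_abs_self (g τ)
        have := le_abs_self (H τ)
        have := abs_nonneg (g τ)
        have := abs_nonneg (H τ)
        exact max_le (by linarith) (by linarith)
    · rw [← ae_restrict_iff' measurableSet_uIoc, Set.uIoc_of_le hrt]
      filter_upwards [ae_mono hle he] with τ ⟨e, he1, he2⟩
      have h1 : Tendsto (fun n => max (H τ + e n) (H τ)) atTop (𝓝 (max (H τ + 0) (H τ))) :=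
        (he1.const_add _).max tendsto_const_nhds
      rw [add_zero, max_self] at h1
      exact tendsto_of_tendsto_of_tendsto_of_le_of_le tendsto_const_nhds h1 (fun n => le_max_right _ _)
        fun n => max_le_max_right _ (he2 n)
  refine le_of_tendsto_of_tendsto' ((hA t ⟨hr.trans hrt, ht⟩).sub (hA r ⟨hr, hrt.trans ht⟩)) hlim fun n => ?_
  rw [sub_eq_integral_of_balance hAB hB hr hrt ht]
  exact intervalIntegral.integral_mono_on hrt (hBi n) (hmi n) fun τ _ => le_max_left _ _

lemma absolutelyContinuousOnInterval_of_abs_sub_le (hT : 0 ≤ T) (hg : IntegrableOn g (Set.Ioo 0 T))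
    (h : ∀ r t, 0 ≤ r → r ≤ t → t ≤ T → |A t - A r| ≤ ∫ τ in r..t, g τ) : AbsolutelyContinuousOnInterval A 0 T := by
  have h0 := intervalIntegrable_of_Ioo le_rfl hT le_rfl hg
  have hG := h0.absolutelyContinuousOnInterval_intervalIntegral (c := 0) Set.left_mem_uIcc
  have hi : ∀ t ∈ Set.Icc 0 T, IntervalIntegrable g volume 0 t := fun t ht => intervalIntegrable_of_Ioo le_rfl ht.1 ht.2 hg
  have hd : ∀ r t, r ∈ Set.Icc 0 T → t ∈ Set.Icc 0 T →
      dist (A r) (A t) ≤ dist (∫ τ in (0 : ℝ)..r, g τ) (∫ τ in (0 : ℝ)..t, g τ) := by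
    intro r t hr ht
    wlog hrt : r ≤ t generalizing r t
    · rw [dist_comm, dist_comm (∫ τ in (0 : ℝ)..r, g τ)]
      exact this t r ht hr (le_of_not_ge hrt)
    rw [dist_comm, dist_comm (∫ τ in (0 : ℝ)..r, g τ), Real.dist_eq, Real.dist_eq,
      intervalIntegral.integral_interval_sub_left (hi t ht) (hi r hr)]
    exact (h r t hr.1 hrt ht.2).trans (le_abs_self _)
  rw [absolutelyContinuousOnInterval_iff] at hG ⊢
  intro ε hε
  obtain ⟨δ, hδ, hG⟩ := hG ε hε
  refine ⟨δ, hδ, fun E hE hEδ => (Finset.sum_le_sum fun i hi' => ?_).trans_lt (hG E hE hEδ)⟩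
  have := hE.1 i hi'
  rw [Set.uIcc_of_le hT] at this
  exact hd _ _ this.1 this.2

lemma ae_deriv_le_of_sub_le (hT : 0 < T) (hH : IntegrableOn H (Set.Ioo 0 T)) (hA : AbsolutelyContinuousOnInterval A 0 T)
    (h : ∀ r t, 0 ≤ r → r ≤ t → t ≤ T → A t - A r ≤ ∫ τ in r..t, H τ) :
    ∀ᵐ t, t ∈ Set.Ioo 0 T → ∃ d : ℝ, HasDerivAt A d t ∧ d ≤ H t := by
  have h0 := intervalIntegrable_of_Ioo le_rfl hT.le le_rfl hH
  have hi : ∀ t ∈ Set.Icc 0 T, IntervalIntegrable H volume 0 t := fun t ht => intervalIntegrable_of_Ioo le_rfl ht.1 ht.2 hH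
  have hmono : MonotoneOn (fun t => (∫ τ in (0 : ℝ)..t, H τ) - A t) (Set.Icc 0 T) := fun r hr t ht hrt => by
    have h1 := h r t hr.1 hrt ht.2
    rw [← intervalIntegral.integral_interval_sub_left (hi t ht) (hi r hr)] at h1
    simp only
    linarith
  filter_upwards [h0.ae_hasDerivAt_integral, hA.ae_differentiableAt] with t h1 h2 ht
  have htI : t ∈ Set.Icc 0 T := Set.Ioo_subset_Icc_self ht
  rw [Set.uIcc_of_le hT.le] at h1 h2
  have h3 := h1 htI 0 ⟨le_rfl, hT.le⟩
  have h4 := (h2 htI).hasDerivAt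
  refine ⟨_, h4, ?_⟩
  have h5 := (h3.sub h4).hasDerivWithinAt (s := Set.Icc 0 T)
  have h6 := h5.derivWithin (uniqueDiffOn_Icc hT t htI)
  have h7 := hmono.derivWithin_nonneg (x := t)
  have h8 : derivWithin (fun t => (∫ τ in (0 : ℝ)..t, H τ) - A t) (Set.Icc 0 T) t = H t - deriv A t := h6
  rw [h8] at h7
  linarith

lemma le_mul_exp_of_le_integral {U : ℝ → ℝ} {C a : ℝ} (hC : 0 ≤ C) (hU : IntegrableOn U (Set.Ioo 0 T))
    (h : ∀ t ∈ Set.Icc 0 T, U t ≤ a + C * ∫ τ in (0 : ℝ)..t, U τ) : ∀ t ∈ Set.Icc 0 T, a + C * ∫ τ in (0 : ℝ)..t, U τ ≤ a * Real.exp (C * t) := by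
  intro t ht
  have h0 := intervalIntegrable_of_Ioo le_rfl ht.1 ht.2 hU
  have hc : AbsolutelyContinuousOnInterval (fun _ : ℝ => a) 0 t :=
    (contDiff_const (n := 1)).contDiffOn.absolutelyContinuousOnInterval
  have hE : AbsolutelyContinuousOnInterval (fun τ => Real.exp (-(C * τ))) 0 t :=
    ContDiffOn.absolutelyContinuousOnInterval (by fun_prop)
  have hW := (hc.add ((h0.absolutelyContinuousOnInterval_intervalIntegral (c := 0) Set.left_mem_uIcc).const_mul C)).mul hE
  have h1 := hW.integral_deriv_eq_sub
  have h2 : ∫ τ in (0 : ℝ)..t, deriv (((fun _ : ℝ => a) + fun x => C * ∫ v in (0 : ℝ)..x, U v) * fun τ => Real.exp (-(C * τ))) τ ≤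
      ∫ τ in (0 : ℝ)..t, (0 : ℝ) := by
    refine intervalIntegral.integral_mono_ae_restrict ht.1 hW.intervalIntegrable_deriv (by simp) ?_
    rw [EventuallyLE, ae_restrict_iff' measurableSet_Icc]
    filter_upwards [h0.ae_hasDerivAt_integral] with τ hτ hm
    rw [Set.uIcc_of_le ht.1] at hτ
    have d1 := ((hτ hm 0 ⟨le_rfl, ht.1⟩).const_mul C).const_add a
    have d2 : HasDerivAt (fun τ => Real.exp (-(C * τ))) (Real.exp (-(C * τ)) * -(C * 1)) τ :=
      (((hasDerivAt_id τ).const_mul C).neg).exp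
    have d3 := d1.mul d2
    have d4 : HasDerivAt (((fun _ : ℝ => a) + fun x => C * ∫ v in (0 : ℝ)..x, U v) * fun τ => Real.exp (-(C * τ))) _ τ := d3
    rw [d4.deriv]
    have h3 := h τ ⟨hm.1, hm.2.trans ht.2⟩
    have h4 := Real.exp_pos (-(C * τ))
    have h5 : 0 ≤ C * Real.exp (-(C * τ)) * (a + C * (∫ v in (0 : ℝ)..τ, U v) - U τ) := by
      have : 0 ≤ a + C * (∫ v in (0 : ℝ)..τ, U v) - U τ := by linarith
      positivity
    nlinarith
  rw [intervalIntegral.integral_zero, h1] at h2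
  simp only [Pi.mul_apply, Pi.add_apply, intervalIntegral.integral_same, mul_zero, add_zero, neg_zero, Real.exp_zero, mul_one] at h2
  rw [Real.exp_neg] at h2
  have h3 := Real.exp_pos (C * t)
  have h4 : (a + C * ∫ v in (0 : ℝ)..t, U v) * (Real.exp (C * t))⁻¹ ≤ a := by linarith
  rwa [mul_inv_le_iff₀ h3] at h4

end

lemma tendsto_integral_comp_mul {G : ℕ → Plane → ℝ} {θ Φ : Plane → ℝ} {Φn : ℕ → Plane → ℝ} {q : ℝ → ℝ} {D L K : ℝ} (hD : 0 ≤ D)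
    (hG : ∀ n, MemLp (G n) 2 volume) (hGK : ∀ n, n2 (G n) ≤ K) (hθ : MemLp θ 2 volume) (hθK : n2 θ ≤ K)
    (hl : Tendsto (fun n => n2 fun x => G n x - θ x) atTop (𝓝 0))
    (hqG : ∀ n, Integrable fun x => q (G n x)) (hqθ : Integrable fun x => q (θ x))
    (hq : ∀ n, ∀ᵐ x, |q (G n x) - q (θ x)| ≤ D * (|G n x - θ x| * (|G n x| + |θ x|)))
    (hc : ∀ n, Continuous (Φn n)) (hL : ∀ n x, |Φn n x| ≤ L) (hΦ : ∀ x, Tendsto (fun n => Φn n x) atTop (𝓝 (Φ x))) :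
    Tendsto (fun n => ∫ x, q (G n x) * Φn n x) atTop (𝓝 (∫ x, q (θ x) * Φ x)) := by
  have hL0 : 0 ≤ L := (abs_nonneg _).trans (hL 0 0)
  have hi : ∀ (f : Plane → ℝ) n, Integrable f → Integrable fun x => f x * Φn n x := fun f n hf =>
    hf.mul_bdd (c := L) (hc n).aestronglyMeasurable (.of_forall fun x => by rw [Real.norm_eq_abs]; exact hL n x)
  have h1 : Tendsto (fun n => ∫ x, q (θ x) * Φn n x) atTop (𝓝 (∫ x, q (θ x) * Φ x)) := by
    refine tendsto_integral_of_dominated_convergence (fun x => |q (θ x)| * L) (fun n => (hi _ n hqθ).1) (hqθ.abs.mul_const L)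
      (fun n => .of_forall fun x => ?_) (.of_forall fun x => (hΦ x).const_mul _)
    rw [norm_mul, Real.norm_eq_abs, Real.norm_eq_abs]
    gcongr
    exact hL n x
  have h2 : Tendsto (fun n => ∫ x, (q (G n x) - q (θ x)) * Φn n x) atTop (𝓝 0) := by
    refine squeeze_zero_norm (a := fun n => L * (D * (n2 (fun x => G n x - θ x) * (K + K)))) (fun n => ?_) ?_
    · have hd := memLp_fun_sub (hG n) hθ
      have j1 : Integrable fun x => |G n x - θ x| * |G n x| := hd.norm.integrable_mul (hG n).norm
      have j2 : Integrable fun x => |G n x - θ x| * |θ x| := hd.norm.integrable_mul hθ.norm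
      have i1 : Integrable fun x => L * (D * (|G n x - θ x| * |G n x| + |G n x - θ x| * |θ x|)) :=
        ((j1.add j2).const_mul D).const_mul L
      refine (norm_integral_le_of_norm_le i1 ?_).trans ?_
      · filter_upwards [hq n] with x hx
        rw [norm_mul, Real.norm_eq_abs, Real.norm_eq_abs, ← mul_add, mul_comm]
        exact mul_le_mul (hL n x) hx (abs_nonneg _) hL0
      · rw [integral_const_mul, integral_const_mul, integral_add j1 j2]
        have h0 := n2_nonneg fun x => G n x - θ x
        have k1 := (integral_abs_mul_le hd (hG n)).trans (mul_le_mul_of_nonneg_left (hGK n) h0)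
        have k2 := (integral_abs_mul_le hd hθ).trans (mul_le_mul_of_nonneg_left hθK h0)
        gcongr
        linarith
    · have := ((hl.mul_const (K + K)).const_mul D).const_mul L
      simpa using this
  have h3 := h2.add h1
  rw [zero_add] at h3
  refine h3.congr fun n => ?_
  simp_rw [sub_mul]
  rw [integral_sub (hi _ n (hqG n)) (hi _ n hqθ)]
  ring

/-! ### The maximum principle -/

section
variable {s T : ℝ} {wI : Plane → ℝ} {w θ : ℝ → Plane → ℝ} {u : ℝ → Plane → Plane} {v : ℝ → Plane → ℝ}

lemma n2_sq_eq_toReal {f : Plane → ℝ} (hf : AEStronglyMeasurable f volume) :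
    n2 f ^ 2 = (∫⁻ x, ENNReal.ofReal (f x ^ 2)).toReal := by
  rw [n2_sq, integral_eq_lintegral_of_nonneg_ae (.of_forall fun x => sq_nonneg _) (hf.pow 2)]

lemma IsWeakSolution.integrableOn_half (h : IsWeakSolution s T wI w θ u v) :
    IntegrableOn (fun τ => n2 (v τ) ^ 2) (Set.Ioo 0 T) := by
  have hm : AEMeasurable (fun p : ℝ × Plane => ENNReal.ofReal (v p.1 p.2 ^ 2)) (slab T) :=
    (h.meas_v.aemeasurable.pow_const 2).ennreal_ofReal
  refine (integrable_toReal_of_lintegral_ne_top hm.lintegral_prod_right' h.half_bound.ne).congr ?_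
  rw [EventuallyEq, ae_restrict_iff' measurableSet_Ioo]
  filter_upwards [h.half] with τ hτ hm
  exact (n2_sq_eq_toReal (hτ hm).1.1).symm

lemma IsWeakSolution.ae_half (h : IsWeakSolution s T wI w θ u v) :
    ∀ᵐ τ ∂(volume.restrict (Set.Ioo 0 T)), τ ∈ Set.Icc 0 T ∧ MemLp (v τ) 2 volume ∧ MulRel (lamS (1 / 2)) (θ τ) (v τ) := by
  rw [ae_restrict_iff' measurableSet_Ioo]
  filter_upwards [h.half] with τ hτ hm
  exact ⟨Set.Ioo_subset_Icc_self hm, hτ hm⟩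

lemma abs_pow_div_sub_le (k : ℕ) {a b K : ℝ} (ha : |a| ≤ K) (hb : |b| ≤ K) :
    |a ^ (k + 1 + 1) / ((k + 1 : ℕ) + 1) - b ^ (k + 1 + 1) / ((k + 1 : ℕ) + 1)| ≤ K ^ k * (|a - b| * (|a| + |b|)) := by
  have h1 := abs_pow_sub_pow_le a b (k + 1 + 1)
  have hk : (0 : ℝ) < (k + 1 : ℕ) + 1 := by positivity
  rw [← sub_div, abs_div, abs_of_pos hk, div_le_iff₀ hk]
  refine h1.trans ?_
  have h2 : max |a| |b| ^ (k + 1) ≤ K ^ k * (|a| + |b|) := by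
    rw [pow_succ]
    refine mul_le_mul (pow_le_pow_left₀ (le_max_of_le_left (abs_nonneg _)) (max_le ha hb) k) ?_
      (le_max_of_le_left (abs_nonneg _)) (pow_nonneg ((abs_nonneg _).trans ha) k)
    exact max_le (by linarith [abs_nonneg b]) (by linarith [abs_nonneg a])
  simp only [Nat.add_sub_cancel]
  push_cast
  calc _ ≤ |a - b| * ((k : ℝ) + 1 + 1) * (K ^ k * (|a| + |b|)) := by gcongr
    _ = _ := by ring

lemma IsMollSeq.n2_cv_le {G : ℝ} {δ : ℕ → ℝ} {ρ : ℕ → Plane → ℝ} (h : IsMollSeq G δ ρ) {f : Plane → ℝ} (hf : MemLp f 2 volume) (n : ℕ) :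
    n2 (cv f (ρ n)) ≤ n2 f := by
  have := SQG.n2_cv_le hf (h.moll n).test.integrable
  rwa [(h.moll n).integral_abs, one_mul] at this

/-- Even powers of `θ` have nonincreasing integrals. -/
lemma IsWeakSolution.integral_pow_le (hs : 0 < s) (hs1 : s < 1) (hT : 0 < T) (h : IsWeakSolution s T wI w θ u v) {φ₀ : Plane → ℝ}
    (hφ₀ : IsLocalizer φ₀) {k : ℕ} (hk : Odd (k + 1)) {t : ℝ} (ht : t ∈ Set.Icc 0 T) :
    ∫ x, θ t x ^ (k + 2) ≤ ∫ x, θ 0 x ^ (k + 2) := by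
  obtain ⟨K, hK0, hK⟩ := h.exists_bound
  obtain ⟨hdw, hdθ⟩ := h.timeData hK0 hK
  obtain ⟨G, δ, ρ, hG, hκ, hρ⟩ := exists_isMollSeq_cv
  obtain ⟨r, L, hr, hL, hloc⟩ := exists_loc hφ₀.test
  have hφ : Loc φ₀ 0 r L := by simpa using hloc 0
  set R : ℕ → ℝ := fun n => (n : ℝ) + 1
  have hR : ∀ n, 1 ≤ R n := fun n => by simp [R]
  set Φ : ℕ → Plane → ℝ := fun n x => φ₀ ((R n)⁻¹ • x)
  have hΦ : ∀ n, Loc (Φ n) 0 (R n * r) L := fun n => (hφ.scale (hR n)).1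
  have hΦ1 : ∀ x, Tendsto (fun n => Φ n x) atTop (𝓝 1) := fun x => by
    refine tendsto_const_nhds.congr' ?_
    obtain ⟨N, hN⟩ := exists_nat_ge ‖x‖
    filter_upwards [eventually_ge_atTop N] with n hn
    refine (hφ₀.eq_one _ ?_).symm
    have hR0 : 0 < R n := by linarith [hR n]
    rw [norm_smul, norm_inv, Real.norm_of_nonneg hR0.le, inv_mul_le_iff₀ hR0]
    have : (N : ℝ) ≤ n := by exact_mod_cast hn
    simp only [R]
    linarith [norm_nonneg x]
  obtain ⟨C1, hC1, h1⟩ := exists_transportErr_le K L G hG k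
  obtain ⟨C2, hC2, h2⟩ := exists_powRate_le hφ hφ₀.nonneg hK0 hk
  have hev := fun n => h.evolution_frac hs hs1 hT hdw (hρ n).1 (hρ n).2 (hκ.moll n).even
  have hbal := fun n t ht => hdθ.integral_pow (fun j => isSymb_pd j) (hκ.moll n).test (hκ.moll n).even (hev n) (hΦ n).test (k + 1) (t := t) ht
  have hrate : ∀ n, ∀ τ ∈ Set.Icc 0 T,
      (∑ j, ∫ x, cv (flux θ u j τ) (cv (ρ n) (ρ n)) x * multiplier (fun ξ => I * ((2 * Real.pi * ξ j : ℝ) : ℂ))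
        (fun x => Φ n x * cv (θ τ) (cv (ρ n) (ρ n)) x ^ (k + 1)) x) -
        ∫ x, cv (θ τ) (cv (ρ n) (ρ n)) x * fracLapTest 1 (fun x => Φ n x * cv (θ τ) (cv (ρ n) (ρ n)) x ^ (k + 1)) x =
      powRate (Φ n) (θ τ) (fun j x => u τ x j) (cv (ρ n) (ρ n)) k := fun n τ hτ => by
    have ht : IsTest (fun x => Φ n x * cv (θ τ) (cv (ρ n) (ρ n)) x ^ (k + 1)) :=
      (hΦ n).test.mul_contDiff ((cv_contDiff_of_memLp (h.memLp_θ τ hτ) (hκ.moll n).test).pow _)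
    unfold powRate
    simp_rw [ht.pd_eq_multiplier]
    rfl
  have key := sub_le_integral_of_tendsto (T := T) (g := fun τ => C1 * (1 + n2 (v τ) ^ 2) + C2) (H := fun _ => 0)
    (A := fun t => ∫ x, θ t x ^ (k + 1 + 1) / ((k + 1 : ℕ) + 1) * 1)
    (An := fun n t => ∫ x, cv (θ t) (cv (ρ n) (ρ n)) x ^ (k + 1 + 1) / ((k + 1 : ℕ) + 1) * Φ n x)
    (Bn := fun n τ => (∑ j, ∫ x, cv (flux θ u j τ) (cv (ρ n) (ρ n)) x * multiplier (fun ξ => I * ((2 * Real.pi * ξ j : ℝ) : ℂ))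
        (fun x => Φ n x * cv (θ τ) (cv (ρ n) (ρ n)) x ^ (k + 1)) x) -
        ∫ x, cv (θ τ) (cv (ρ n) (ρ n)) x * fracLapTest 1 (fun x => Φ n x * cv (θ τ) (cv (ρ n) (ρ n)) x ^ (k + 1)) x)
    ?_ (by simp) ?_ (fun n t ht => (hbal n t ht).1) (fun n t ht => (hbal n t ht).2) (fun n => ?_) ?_ le_rfl ht.1 ht.2
  · simp only [intervalIntegral.integral_zero, mul_one] at key
    rw [integral_div, integral_div, ← sub_div] at key
    have hp : (0 : ℝ) < (k + 1 : ℕ) + 1 := by positivity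
    have := (div_le_iff₀ hp).mp key
    rw [zero_mul] at this
    linarith
  · have hc : IntegrableOn (fun _ : ℝ => (1 : ℝ)) (Set.Ioo 0 T) := by simp
    have hc2 : IntegrableOn (fun _ : ℝ => C2) (Set.Ioo 0 T) := by simp
    exact ((Integrable.add hc h.integrableOn_half).const_mul C1).add hc2
  · intro t ht
    obtain ⟨-, k2, k3⟩ := hK t ht
    have hb := fun n => abs_cv_le (hκ.moll n) k3
    refine tendsto_integral_comp_mul (q := fun y => y ^ (k + 1 + 1) / ((k + 1 : ℕ) + 1)) (D := K ^ k) (K := K) (by positivity)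
      (fun n => memLp_cv (h.memLp_θ t ht) (hκ.moll n).test.integrable)
      (fun n => (hκ.n2_cv_le (h.memLp_θ t ht) n).trans k2) (h.memLp_θ t ht) k2 (hκ.tendsto_cv (h.memLp_θ t ht)) (fun n => ?_) ?_
      (fun n => ?_) (fun n => (hΦ n).test.continuous) (fun n => (hΦ n).bd) hΦ1
    · exact (integrable_pow_of_bdd (memLp_cv (h.memLp_θ t ht) (hκ.moll n).test.integrable) (.of_forall (hb n)) k).1.div_const _
    · exact (integrable_pow_of_bdd (h.memLp_θ t ht) k3 k).1.div_const _
    · filter_upwards [k3] with x hx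
      exact abs_pow_div_sub_le k (hb n x) hx
  · filter_upwards [h.ae_half] with τ ⟨hτ, hv, hvr⟩
    obtain ⟨-, k2, k3⟩ := hK τ hτ
    rw [hrate n τ hτ]
    have a1 := h1 _ _ _ (hΦ n) s _ _ _ _ (h.state hτ) k3 k2 hv hvr _ _ (hκ.moll n) (hκ.pos n) (hκ.le_one n)
    have a2 := h2 s _ _ _ hs (by linarith) (h.state hτ) k3 k2 _ _ _ (hκ.moll n) (R n) (hR n)
    have a3 : C2 / R n ≤ C2 := div_le_self hC2 (hR n)
    exact a2.trans (add_le_add a1 a3)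
  · filter_upwards [h.ae_half] with τ ⟨hτ, hv, hvr⟩
    obtain ⟨-, k2, k3⟩ := hK τ hτ
    refine ⟨fun n => transportErr (Φ n) (θ τ) (fun j x => u τ x j) (cv (ρ n) (ρ n)) k + C2 / R n, ?_, fun n => ?_⟩
    · have t1 := tendsto_transportErr (h.state hτ) k3 hv hvr hκ (fun n => ⟨_, _, hΦ n⟩) k
      have t2 : Tendsto (fun n => C2 / R n) atTop (𝓝 0) :=
        tendsto_const_nhds.div_atTop (tendsto_natCast_atTop_atTop.atTop_add tendsto_const_nhds)
      simpa using t1.add t2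
    · rw [hrate n τ hτ, zero_add]
      exact h2 s _ _ _ hs (by linarith) (h.state hτ) k3 k2 _ _ _ (hκ.moll n) (R n) (hR n)

lemma IsWeakSolution.maximum_principle (hs : 0 < s) (hs1 : s < 1) (hT : 0 < T) (h : IsWeakSolution s T wI w θ u v) {φ₀ : Plane → ℝ}
    (hφ₀ : IsLocalizer φ₀) {B : ℝ} (hB0 : 0 ≤ B) (hB : ∀ᵐ x, |θ 0 x| ≤ B) {t : ℝ} (ht : t ∈ Set.Icc 0 T) : ∀ᵐ x, |θ t x| ≤ B := by
  obtain ⟨K, hK0, hK⟩ := h.exists_bound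
  have h0 : (0 : ℝ) ∈ Set.Icc 0 T := ⟨le_rfl, hT.le⟩
  have key : ∀ B', B < B' → volume {x | B' ≤ |θ t x|} = 0 := fun B' hB' => by
    have hB'0 : 0 < B' := hB0.trans_lt hB'
    have hle : ∀ i : ℕ, volume {x | B' ≤ |θ t x|} ≤ ENNReal.ofReal ((B / B') ^ (2 * i) * (n2 (θ 0) ^ 2 / B' ^ 2)) := fun i => by
      have h1 := h.integral_pow_le hs hs1 hT hφ₀ (k := 2 * i) ⟨i, rfl⟩ ht
      obtain ⟨i1, -⟩ := integrable_pow_of_bdd (h.memLp_θ t ht) (hK t ht).2.2 (2 * i)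
      obtain ⟨i2, i3⟩ := integrable_pow_of_bdd (h.memLp_θ 0 h0) hB (2 * i)
      have h2 : ∫ x, θ t x ^ (2 * i + 2) ≤ B ^ (2 * i) * n2 (θ 0) ^ 2 :=
        h1.trans ((integral_mono i2 i2.abs fun x => le_abs_self _).trans i3)
      have hev : Even (2 * i + 2) := ⟨i + 1, by ring⟩
      have h3 := mul_meas_ge_le_lintegral₀ (i1.1.aemeasurable.ennreal_ofReal) (ENNReal.ofReal (B' ^ (2 * i + 2)))
      rw [← ofReal_integral_eq_lintegral_ofReal i1 (.of_forall fun x => hev.pow_nonneg _)] at h3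
      have h4 : volume {x | B' ≤ |θ t x|} ≤ volume {x | ENNReal.ofReal (B' ^ (2 * i + 2)) ≤ ENNReal.ofReal (θ t x ^ (2 * i + 2))} := by
        refine measure_mono fun x hx => ENNReal.ofReal_le_ofReal ?_
        rw [← hev.pow_abs (θ t x)]
        exact pow_le_pow_left₀ hB'0.le hx _
      have h5 : ENNReal.ofReal (B' ^ (2 * i + 2)) ≠ 0 := by
        rw [Ne, ENNReal.ofReal_eq_zero, not_le]; positivity
      have h6 := (mul_le_mul_right h4 (ENNReal.ofReal (B' ^ (2 * i + 2)))).trans (h3.trans (ENNReal.ofReal_le_ofReal h2))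
      rw [mul_comm, ← ENNReal.le_div_iff_mul_le (.inl h5) (.inl ENNReal.ofReal_ne_top), ← ENNReal.ofReal_div_of_pos (by positivity)] at h6
      refine h6.trans_eq ?_
      congr 1
      rw [div_pow, pow_add]
      field_simp
    have hlim : Tendsto (fun i : ℕ => ENNReal.ofReal ((B / B') ^ (2 * i) * (n2 (θ 0) ^ 2 / B' ^ 2))) atTop (𝓝 0) := by
      have hq : (B / B') ^ 2 < 1 := by
        have : B / B' < 1 := (div_lt_one hB'0).mpr hB'
        have h0 : 0 ≤ B / B' := by positivity
        nlinarith
      have h7 := ENNReal.tendsto_ofReal ((tendsto_pow_atTop_nhds_zero_of_lt_one (by positivity) hq).mul_const (n2 (θ 0) ^ 2 / B' ^ 2))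
      simp_rw [pow_mul]
      simpa using h7
    exact nonpos_iff_eq_zero.mp (ge_of_tendsto' hlim hle)
  have hall : ∀ᵐ x, ∀ m : ℕ, |θ t x| < B + 1 / ((m : ℝ) + 1) := by
    rw [ae_all_iff]
    intro m
    have := key (B + 1 / ((m : ℝ) + 1)) (by linarith [(by positivity : (0 : ℝ) < 1 / ((m : ℝ) + 1))])
    rw [ae_iff]
    simpa only [not_lt] using this
  filter_upwards [hall] with x hx
  refine le_of_tendsto_of_tendsto' tendsto_const_nhds (b := atTop) (f := fun _ : ℕ => |θ t x|) ?_ fun m => (hx m).le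
  simpa using (tendsto_one_div_add_atTop_nhds_zero_nat (𝕜 := ℝ)).const_add B

/-! ### The local energy -/

/-- The local energy as a real integral. -/
def energy (Φ w θ : Plane → ℝ) : ℝ := (∫ x, w x ^ (1 + 1) / ((1 : ℕ) + 1) * Φ x) + ∫ x, θ x ^ (1 + 1) / ((1 : ℕ) + 1) * Φ x

lemma IsWeakSolution.energy_balance (hs : 0 < s) (hs1 : s < 1) (hT : 0 < T) (h : IsWeakSolution s T wI w θ u v) {ρ : Plane → ℝ}
    (hρ : IsTest ρ) (he : ∀ x, ρ (-x) = ρ x) (hκ : IsTest (cv ρ ρ)) (hee : ∀ x, cv ρ ρ (-x) = cv ρ ρ x) {Φ : Plane → ℝ} (hΦ : IsTest Φ)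
    {t : ℝ} (ht : t ∈ Set.Icc 0 T) :
    energy Φ (cv (w t) (cv ρ ρ)) (cv (θ t) (cv ρ ρ)) - energy Φ (cv (w 0) (cv ρ ρ)) (cv (θ 0) (cv ρ ρ)) =
      (∫ τ in (0 : ℝ)..t, rate s Φ (w τ) (θ τ) (fun j x => u τ x j) (cv ρ ρ)) ∧
    IntervalIntegrable (fun τ => rate s Φ (w τ) (θ τ) (fun j x => u τ x j) (cv ρ ρ)) volume 0 t := by
  obtain ⟨K, hK0, hK⟩ := h.exists_bound
  obtain ⟨hdw, hdθ⟩ := h.timeData hK0 hK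
  obtain ⟨e1, i1⟩ := hdw.integral_pow (fun j => isSymb_oddS (by linarith) (by linarith) j) hκ hee
    (h.evolution_w hs hs1 hT hdw hκ hee) hΦ 1 ht
  obtain ⟨e2, i2⟩ := hdθ.integral_pow (fun j => isSymb_pd j) hκ hee (h.evolution_frac hs hs1 hT hdw hρ he hee) hΦ 1 ht
  have hr : ∀ τ ∈ Set.Icc 0 T, rate s Φ (w τ) (θ τ) (fun j x => u τ x j) (cv ρ ρ) =
      ((∑ j, ∫ x, cv (flux θ u j τ) (cv ρ ρ) x * multiplier (oddS (1 - s) j) (fun x => Φ x * cv (w τ) (cv ρ ρ) x ^ 1) x) -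
        ∫ x, cv (w τ) (cv ρ ρ) x * fracLapTest 1 (fun x => Φ x * cv (w τ) (cv ρ ρ) x ^ 1) x) +
      ((∑ j, ∫ x, cv (flux θ u j τ) (cv ρ ρ) x * multiplier (fun ξ => I * ((2 * Real.pi * ξ j : ℝ) : ℂ))
        (fun x => Φ x * cv (θ τ) (cv ρ ρ) x ^ 1) x) -
        ∫ x, cv (θ τ) (cv ρ ρ) x * fracLapTest 1 (fun x => Φ x * cv (θ τ) (cv ρ ρ) x ^ 1) x) := fun τ hτ => by
    have ht : IsTest (fun x => Φ x * cv (θ τ) (cv ρ ρ) x) := hΦ.mul_contDiff (cv_contDiff_of_memLp (h.memLp_θ τ hτ) hκ)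
    unfold rate
    simp_rw [pow_one, ht.pd_eq_multiplier, fracGradTest_eq]
    rfl
  have hsub : ∀ τ ∈ Set.uIcc 0 t, τ ∈ Set.Icc 0 T := fun τ hτ => by
    rw [Set.uIcc_of_le ht.1] at hτ
    exact ⟨hτ.1, hτ.2.trans ht.2⟩
  refine ⟨?_, (i1.add i2).congr fun τ hτ => (hr τ (hsub τ (Set.uIoc_subset_uIcc hτ))).symm⟩
  rw [intervalIntegral.integral_congr fun τ hτ => hr τ (hsub τ hτ), intervalIntegral.integral_add i1 i2, ← e1, ← e2]
  unfold energy
  ring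

lemma IsMollSeq.tendsto_integral_sq {G : ℝ} {δ : ℕ → ℝ} {κ : ℕ → Plane → ℝ} (hκ : IsMollSeq G δ κ) {f Φ : Plane → ℝ}
    (hf : MemLp f 2 volume) {a : Plane} {r L : ℝ} (hΦ : Loc Φ a r L) :
    Tendsto (fun n => ∫ x, cv f (κ n) x ^ (1 + 1) / ((1 : ℕ) + 1) * Φ x) atTop
      (𝓝 (∫ x, f x ^ (1 + 1) / ((1 : ℕ) + 1) * Φ x)) := by
  refine tendsto_integral_comp_mul (q := fun y => y ^ (1 + 1) / ((1 : ℕ) + 1)) (D := 1) (K := n2 f) (Φn := fun _ => Φ) (by norm_num)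
    (fun n => memLp_cv hf (hκ.moll n).test.integrable) (fun n => hκ.n2_cv_le hf n) hf le_rfl (hκ.tendsto_cv hf)
    (fun n => (memLp_cv hf (hκ.moll n).test.integrable).integrable_sq.div_const _) (hf.integrable_sq.div_const _)
    (fun n => .of_forall fun x => ?_) (fun _ => hΦ.test.continuous) (fun _ => hΦ.bd) (fun x => tendsto_const_nhds)
  have := abs_pow_div_sub_le 0 (a := cv f (κ n) x) (b := f x) (le_max_left _ _) (le_max_right _ _)
  simpa using this

lemma tendsto_energy {G : ℝ} {δ : ℕ → ℝ} {κ : ℕ → Plane → ℝ} (hκ : IsMollSeq G δ κ) {w θ Φ : Plane → ℝ} (hw : MemLp w 2 volume)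
    (hθ : MemLp θ 2 volume) {a : Plane} {r L : ℝ} (hΦ : Loc Φ a r L) :
    Tendsto (fun n => energy Φ (cv w (κ n)) (cv θ (κ n))) atTop (𝓝 (energy Φ w θ)) :=
  (hκ.tendsto_integral_sq hw hΦ).add (hκ.tendsto_integral_sq hθ hΦ)

lemma IsWeakSolution.integrableOn_one_add_half (h : IsWeakSolution s T wI w θ u v) (C : ℝ) :
    IntegrableOn (fun τ => C * (1 + n2 (v τ) ^ 2)) (Set.Ioo 0 T) := by
  have hc : IntegrableOn (fun _ : ℝ => (1 : ℝ)) (Set.Ioo 0 T) := by simp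
  exact (Integrable.add hc h.integrableOn_half).const_mul C

lemma IsWeakSolution.absolutelyContinuous_energy (hs : 1 / 2 < s) (hs1 : s < 1) (hT : 0 < T) (h : IsWeakSolution s T wI w θ u v)
    {Φ : Plane → ℝ} {a : Plane} {r L : ℝ} (hΦ : Loc Φ a r L) :
    AbsolutelyContinuousOnInterval (fun t => energy Φ (w t) (θ t)) 0 T := by
  obtain ⟨K, hK0, hK⟩ := h.exists_bound
  obtain ⟨G, δ, ρ, hG, hκ, hρ⟩ := exists_isMollSeq_cv
  obtain ⟨C, hC, hrate⟩ := exists_abs_rate_le hs hs1 r L K G hK0 hG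
  have hbal := fun n t ht => h.energy_balance (by linarith) hs1 hT (hρ n).1 (hρ n).2 (hκ.moll n).test (hκ.moll n).even hΦ.test (t := t) ht
  refine absolutelyContinuousOnInterval_of_abs_sub_le hT.le (h.integrableOn_one_add_half C) fun q t hq hqt ht =>
    abs_sub_le_integral_of_tendsto (h.integrableOn_one_add_half C)
      (fun t ht => tendsto_energy hκ (h.memLp_w t ht) (h.memLp_θ t ht) hΦ) (fun n t ht => (hbal n t ht).1)
      (fun n t ht => (hbal n t ht).2) (fun n => ?_) hq hqt ht
  filter_upwards [h.ae_half] with τ ⟨hτ, hv, hvr⟩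
  obtain ⟨k1, k2, k3⟩ := hK τ hτ
  exact hrate Φ a hΦ _ _ _ _ (h.state hτ) k3 k1 k2 hv hvr _ _ (hκ.moll n) (hκ.pos n) (hκ.le_one n)

end

lemma exists_energy_le {s : ℝ} (hs : 1 / 2 < s) (hs1 : s < 1) (r L B : ℝ) (hB0 : 0 ≤ B) : ∃ C : ℝ, 0 ≤ C ∧
    ∀ (T : ℝ) (wI : Plane → ℝ) (w θ : ℝ → Plane → ℝ) (u : ℝ → Plane → Plane) (v : ℝ → Plane → ℝ), 0 < T →
    IsWeakSolution s T wI w θ u v → (∀ t ∈ Set.Icc 0 T, ∀ᵐ x, |θ t x| ≤ B) → ∀ S : ℝ → ℝ, IntegrableOn S (Set.Ioo 0 T) →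
    (∀ t ∈ Set.Icc 0 T, 0 ≤ S t ∧ UB (w t) (S t) ∧ UB (θ t) (S t)) → ∀ (Φ : Plane → ℝ) (a : Plane), Loc Φ a r L → (∀ x, 0 ≤ Φ x) →
    ∀ (C' : ℝ) (D : ℝ → ℝ), IntegrableOn D (Set.Ioo 0 T) →
    (∀ᵐ τ ∂(volume.restrict (Set.Ioo 0 T)), ∀ (G : ℝ) (δ : ℕ → ℝ) (κ : ℕ → Plane → ℝ), IsMollSeq G δ κ → ∃ e : ℕ → ℝ,
      Tendsto e atTop (𝓝 0) ∧ ∀ n, -∫ x, cv (θ τ) (κ n) x * fracLapTest 1 (fun x => Φ x * cv (θ τ) (κ n) x) x ≤ C' * S τ - D τ + e n) →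
    ∀ q t, 0 ≤ q → q ≤ t → t ≤ T → energy Φ (w t) (θ t) - energy Φ (w q) (θ q) ≤ ∫ τ in q..t, ((C + C') * S τ - D τ) := by
  obtain ⟨C, hC, hrate⟩ := exists_rate_le hs hs1 r L B hB0
  refine ⟨C, hC, fun T wI w θ u v hT h hθ S hS hUB Φ a hΦ hΦ0 C' D hD hdis q t hq hqt ht => ?_⟩
  obtain ⟨K, hK0, hK⟩ := h.exists_bound
  obtain ⟨G, δ, ρ, hG, hκ, hρ⟩ := exists_isMollSeq_cv
  obtain ⟨C1, hC1, habs⟩ := exists_abs_rate_le hs hs1 r L K G hK0 hG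
  have hbal := fun n t ht => h.energy_balance (by linarith) hs1 hT (hρ n).1 (hρ n).2 (hκ.moll n).test (hκ.moll n).even hΦ.test (t := t) ht
  refine sub_le_integral_of_tendsto (h.integrableOn_one_add_half C1) ((hS.const_mul (C + C')).sub hD)
      (fun t ht => tendsto_energy hκ (h.memLp_w t ht) (h.memLp_θ t ht) hΦ) (fun n t ht => (hbal n t ht).1)
      (fun n t ht => (hbal n t ht).2) (fun n => ?_) ?_ hq hqt ht
  · filter_upwards [h.ae_half] with τ ⟨hτ, hv, hvr⟩
    obtain ⟨k1, k2, k3⟩ := hK τ hτ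
    exact (le_abs_self _).trans (habs Φ a hΦ _ _ _ _ (h.state hτ) k3 k1 k2 hv hvr _ _ (hκ.moll n) (hκ.pos n) (hκ.le_one n))
  · filter_upwards [h.ae_half, hdis] with τ ⟨hτ, hv, hvr⟩ hdτ
    obtain ⟨e, he, hle⟩ := hdτ G δ _ hκ
    obtain ⟨hS0, hUw, hUθ⟩ := hUB τ hτ
    refine ⟨fun n => e n + transportErr Φ (θ τ) (fun j x => u τ x j) (cv (ρ n) (ρ n)) 0, ?_, fun n => ?_⟩
    · have t1 := tendsto_transportErr (h.state hτ) (hK τ hτ).2.2 hv hvr hκ (fun _ => ⟨_, _, hΦ⟩) 0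
      simpa using he.add t1
    · have a1 := hrate Φ a hΦ hΦ0 _ _ _ _ (h.state hτ) (hθ τ hτ) hS0 hUw hUθ _ _ _ (hκ.moll n)
      have a2 : transportErr Φ (θ τ) (fun j x => u τ x j) (cv (ρ n) (ρ n)) 0 =
          ∑ j, |∫ x, (cv (fun y => θ τ y * u τ y j) (cv (ρ n) (ρ n)) x - cv (fun x => u τ x j) (cv (ρ n) (ρ n)) x *
            cv (θ τ) (cv (ρ n) (ρ n)) x) * pd j (fun x => Φ x * cv (θ τ) (cv (ρ n) (ρ n)) x) x| := by
        simp [transportErr]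
      rw [← a2] at a1
      have a3 := hle n
      simp only [Pi.sub_apply]
      linarith

/-! ### Localized energies -/

lemma Loc.integrable_sq_mul {Φ : Plane → ℝ} {a : Plane} {r L : ℝ} (hΦ : Loc Φ a r L) {f : Plane → ℝ} (hf : MemLp f 2 volume) :
    Integrable fun x => f x ^ (1 + 1) / ((1 : ℕ) + 1) * Φ x :=
  (hf.integrable_sq.div_const _).mul_bdd (c := L) hΦ.test.continuous.aestronglyMeasurable (.of_forall hΦ.bd)

lemma locEnergy_eq {Φ : Plane → ℝ} {a : Plane} {r L : ℝ} (hΦ : Loc Φ a r L) (hΦ0 : ∀ x, 0 ≤ Φ x) {w θ : Plane → ℝ}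
    (hw : MemLp w 2 volume) (hθ : MemLp θ 2 volume) : locEnergy Φ w θ = ENNReal.ofReal (energy Φ w θ) := by
  have hi := (hΦ.integrable_sq_mul hw).add (hΦ.integrable_sq_mul hθ)
  rw [energy, ← integral_add (hΦ.integrable_sq_mul hw) (hΦ.integrable_sq_mul hθ), locEnergy]
  refine Eq.trans ?_ (ofReal_integral_eq_lintegral_ofReal hi (.of_forall fun x => ?_)).symm
  · refine lintegral_congr fun x => ?_
    congr 1
    simp only [Pi.add_apply]
    norm_num
  · have := hΦ0 x
    simp only [Pi.zero_apply, Pi.add_apply]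
    norm_num
    positivity

lemma energy_nonneg {Φ : Plane → ℝ} (hΦ0 : ∀ x, 0 ≤ Φ x) (w θ : Plane → ℝ) : 0 ≤ energy Φ w θ := by
  refine add_nonneg (integral_nonneg fun x => ?_) (integral_nonneg fun x => ?_) <;>
  · have := hΦ0 x
    simp only [Pi.zero_apply]
    norm_num
    positivity

lemma Loc.integral_sq_mul_le {Φ : Plane → ℝ} {a : Plane} {r L : ℝ} (hΦ : Loc Φ a r L) {f : Plane → ℝ} (hf : MemLp f 2 volume) :
    ∫ x, f x ^ (1 + 1) / ((1 : ℕ) + 1) * Φ x ≤ L * n2 f ^ 2 := by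
  rw [n2_sq, ← integral_const_mul]
  refine integral_mono (hΦ.integrable_sq_mul hf) (hf.integrable_sq.const_mul L) fun x => ?_
  have h1 := (le_abs_self _).trans (hΦ.bd x)
  have h2 := sq_nonneg (f x)
  have h3 := hΦ.L_nonneg
  norm_num
  nlinarith [mul_le_mul_of_nonneg_left h1 h2, mul_nonneg h2 h3]

lemma energy_le_of_bdd {Φ : Plane → ℝ} {a : Plane} {r L : ℝ} (hΦ : Loc Φ a r L) (hΦ0 : ∀ x, 0 ≤ Φ x) {w θ : Plane → ℝ}
    (hw : MemLp w 2 volume) (hθ : MemLp θ 2 volume) {B : ℝ} (hwB : ∀ᵐ x, |w x| ≤ B) (hθB : ∀ᵐ x, |θ x| ≤ B) :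
    energy Φ w θ ≤ B ^ 2 * ∫ x, Φ x := by
  rw [energy, ← integral_add (hΦ.integrable_sq_mul hw) (hΦ.integrable_sq_mul hθ), ← integral_const_mul]
  refine integral_mono_ae ((hΦ.integrable_sq_mul hw).add (hΦ.integrable_sq_mul hθ)) (hΦ.test.integrable.const_mul _) ?_
  filter_upwards [hwB, hθB] with x h1 h2
  have h3 := sq_le_sq' (abs_le.mp h1).1 (abs_le.mp h1).2
  have h4 := sq_le_sq' (abs_le.mp h2).1 (abs_le.mp h2).2
  have h5 := hΦ0 x
  norm_num
  nlinarith [mul_le_mul_of_nonneg_right h3 h5, mul_le_mul_of_nonneg_right h4 h5]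

lemma exists_energy_growth {s : ℝ} (hs : 1 / 2 < s) (hs1 : s < 1) (r L B : ℝ) (hB0 : 0 ≤ B) : ∃ C : ℝ, 0 ≤ C ∧
    ∀ (T : ℝ) (wI : Plane → ℝ) (w θ : ℝ → Plane → ℝ) (u : ℝ → Plane → Plane) (v : ℝ → Plane → ℝ), 0 < T →
    IsWeakSolution s T wI w θ u v → (∀ t ∈ Set.Icc 0 T, ∀ᵐ x, |θ t x| ≤ B) → ∀ S : ℝ → ℝ, IntegrableOn S (Set.Ioo 0 T) →
    (∀ t ∈ Set.Icc 0 T, 0 ≤ S t ∧ UB (w t) (S t) ∧ UB (θ t) (S t)) → ∀ (Φ : Plane → ℝ) (a : Plane), Loc Φ a r L → (∀ x, 0 ≤ Φ x) →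
    ∀ q t, 0 ≤ q → q ≤ t → t ≤ T → energy Φ (w t) (θ t) - energy Φ (w q) (θ q) ≤ ∫ τ in q..t, C * S τ := by
  obtain ⟨C₁, hC₁, h₁⟩ := exists_energy_le hs hs1 r L B hB0
  obtain ⟨C₂, hC₂, h₂⟩ := exists_dissipation_le r L
  refine ⟨C₁ + C₂, by positivity, fun T wI w θ u v hT h hB S hS hUB Φ a hΦ hΦ0 q t hq hqt ht => ?_⟩
  have := h₁ T wI w θ u v hT h hB S hS hUB Φ a hΦ hΦ0 C₂ (fun _ => 0) integrableOn_zero ?_ q t hq hqt ht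
  · simpa using this
  · filter_upwards [h.ae_half] with τ ⟨hτ, _, _⟩ G δ κ hκ
    refine ⟨fun _ => 0, tendsto_const_nhds, fun n => ?_⟩
    have hθ := h.memLp_θ τ hτ
    have := h₂ Φ a hΦ hΦ0 (cv (θ τ) (κ n)) (S τ) (cv_contDiff_of_memLp hθ (hκ.moll n).test) (memLp_cv hθ (hκ.moll n).test.integrable)
      (hUB τ hτ).1 ((hUB τ hτ).2.2.cv hθ.1 (hκ.moll n).test.integrable (hκ.moll n).integral_abs)
    linarith

section
variable {s T : ℝ} {wI : Plane → ℝ} {w θ : ℝ → Plane → ℝ} {u : ℝ → Plane → Plane} {v : ℝ → Plane → ℝ}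

lemma IsWeakSolution.integrableOn_mul_half (h : IsWeakSolution s T wI w θ u v) {ψ : Plane → ℝ} {a : Plane} {r L : ℝ} (hψ : Loc ψ a r L) :
    IntegrableOn (fun τ => n2 (fun x => ψ x * v τ x) ^ 2) (Set.Ioo 0 T) := by
  have hm : AEMeasurable (fun p : ℝ × Plane => ENNReal.ofReal ((ψ p.2 * v p.1 p.2) ^ 2)) (slab T) :=
    (((hψ.test.continuous.comp continuous_snd).measurable.aemeasurable.mul h.meas_v.aemeasurable).pow_const 2).ennreal_ofReal
  have hle : ∀ τ, ∫⁻ x, ENNReal.ofReal ((ψ x * v τ x) ^ 2) ≤ ENNReal.ofReal (L ^ 2) * ∫⁻ x, ENNReal.ofReal (v τ x ^ 2) := fun τ => by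
    rw [← lintegral_const_mul' _ _ ENNReal.ofReal_ne_top]
    refine lintegral_mono fun x => ?_
    rw [← ENNReal.ofReal_mul (sq_nonneg L), mul_pow]
    refine ENNReal.ofReal_le_ofReal (mul_le_mul_of_nonneg_right ?_ (sq_nonneg _))
    exact sq_le_sq' (abs_le.mp (hψ.bd x)).1 (abs_le.mp (hψ.bd x)).2
  have hfin : ∫⁻ τ in Set.Ioo 0 T, ∫⁻ x, ENNReal.ofReal ((ψ x * v τ x) ^ 2) ≠ ⊤ := by
    refine ((lintegral_mono hle).trans_lt ?_).ne
    rw [lintegral_const_mul' _ _ ENNReal.ofReal_ne_top]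
    exact ENNReal.mul_lt_top ENNReal.ofReal_lt_top h.half_bound
  refine (integrable_toReal_of_lintegral_ne_top hm.lintegral_prod_right' hfin).congr ?_
  filter_upwards [h.ae_half] with τ hτ
  exact (n2_sq_eq_toReal (hψ.test.continuous.aestronglyMeasurable.mul hτ.2.1.1)).symm

end

lemma exists_energy_dissipation {s : ℝ} (hs : 1 / 2 < s) (hs1 : s < 1) (r L r' L' B : ℝ) (hB0 : 0 ≤ B) : ∃ C : ℝ, 0 ≤ C ∧
    ∀ (T : ℝ) (wI : Plane → ℝ) (w θ : ℝ → Plane → ℝ) (u : ℝ → Plane → Plane) (v : ℝ → Plane → ℝ), 0 < T →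
    IsWeakSolution s T wI w θ u v → (∀ t ∈ Set.Icc 0 T, ∀ᵐ x, |θ t x| ≤ B) → ∀ S : ℝ → ℝ, IntegrableOn S (Set.Ioo 0 T) →
    (∀ t ∈ Set.Icc 0 T, 0 ≤ S t ∧ UB (w t) (S t) ∧ UB (θ t) (S t)) → ∀ (ψ : Plane → ℝ) (a : Plane), Loc ψ a r L →
    Loc (fun x => ψ x ^ 2) a r' L' →
    energy (fun x => ψ x ^ 2) (w T) (θ T) - energy (fun x => ψ x ^ 2) (w 0) (θ 0) ≤
      ∫ τ in (0 : ℝ)..T, (C * S τ - n2 (fun x => ψ x * v τ x) ^ 2 / 2) := by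
  obtain ⟨C₁, hC₁, h₁⟩ := exists_energy_le hs hs1 r' L' B hB0
  obtain ⟨C₂, hC₂, h₂⟩ := exists_half_le r L
  refine ⟨C₁ + C₂ / 2, by positivity, fun T wI w θ u v hT h hB S hS hUB ψ a hψ hψ2 => ?_⟩
  refine h₁ T wI w θ u v hT h hB S hS hUB _ a hψ2 (fun x => sq_nonneg _) (C₂ / 2) _ ((h.integrableOn_mul_half hψ).div_const 2) ?_
    0 T le_rfl hT.le le_rfl
  filter_upwards [h.ae_half] with τ ⟨hτ, hv, hvr⟩ G δ κ hκ
  have hθ := h.memLp_θ τ hτ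
  have hn : ∀ f : Plane → ℝ, ∫ x, f x ^ (1 + 1) / ((1 : ℕ) + 1) * ψ x ^ 2 = n2 (fun x => ψ x * f x) ^ 2 / 2 := fun f => by
    rw [n2_sq, ← integral_div]
    refine integral_congr_ae (.of_forall fun x => ?_)
    simp only
    push_cast
    ring
  refine ⟨fun n => n2 (fun x => ψ x * v τ x) ^ 2 / 2 - n2 (fun x => ψ x * cv (v τ) (κ n) x) ^ 2 / 2, ?_, fun n => ?_⟩
  · have := hκ.tendsto_integral_sq hv hψ2
    simp only [hn] at this
    rw [← _root_.sub_self (n2 (fun x => ψ x * v τ x) ^ 2 / 2)]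
    exact this.const_sub _
  · have hρ := hκ.moll n
    have := h₂ ψ a hψ (cv (θ τ) (κ n)) (cv (v τ) (κ n)) (S τ) (cv_contDiff_of_memLp hθ hρ.test) (memLp_cv hθ hρ.test.integrable)
      (cv_contDiff_of_memLp hv hρ.test).continuous (fun x => (ULI.of_memLp hθ).cv_fracLap (by norm_num) (by norm_num) hvr hρ.test x)
      (hUB τ hτ).1 ((hUB τ hτ).2.2.cv hθ.1 hρ.test.integrable hρ.integral_abs)
    linarith

section
variable {s T : ℝ} {wI : Plane → ℝ} {w θ : ℝ → Plane → ℝ} {u : ℝ → Plane → Plane} {v : ℝ → Plane → ℝ}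

/-- The squared norm in `H^s_uloc` at each time, as a real number. -/
def ulocReal (φ₀ : Plane → ℝ) (w θ : ℝ → Plane → ℝ) (t : ℝ) : ℝ := (ulocNormSq φ₀ (w t) (θ t)).toReal

lemma IsWeakSolution.locEnergy_translate (h : IsWeakSolution s T wI w θ u v) {φ₀ : Plane → ℝ} (hφ₀ : IsLocalizer φ₀) (k : Fin 2 → ℤ)
    {t : ℝ} (ht : t ∈ Set.Icc 0 T) :
    locEnergy (translate φ₀ k) (w t) (θ t) = ENNReal.ofReal (energy (translate φ₀ k) (w t) (θ t)) := by
  obtain ⟨r, L, hr, hL, hloc⟩ := exists_loc hφ₀.test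
  exact locEnergy_eq (hloc _) (fun x => hφ₀.nonneg _) (h.memLp_w t ht) (h.memLp_θ t ht)

lemma IsWeakSolution.exists_ulocNormSq_le (h : IsWeakSolution s T wI w θ u v) {φ₀ : Plane → ℝ} (hφ₀ : IsLocalizer φ₀) :
    ∃ K : ℝ, 0 ≤ K ∧ ∀ t ∈ Set.Icc 0 T, ulocNormSq φ₀ (w t) (θ t) ≤ ENNReal.ofReal K := by
  obtain ⟨K, hK0, hK⟩ := h.exists_bound
  obtain ⟨r, L, hr, hL, hloc⟩ := exists_loc hφ₀.test
  refine ⟨L * K ^ 2 + L * K ^ 2, by positivity, fun t ht => iSup_le fun k => ?_⟩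
  rw [h.locEnergy_translate hφ₀ k ht]
  refine ENNReal.ofReal_le_ofReal (add_le_add (((hloc _).integral_sq_mul_le (h.memLp_w t ht)).trans ?_)
    (((hloc _).integral_sq_mul_le (h.memLp_θ t ht)).trans ?_))
  · have := pow_le_pow_left₀ (n2_nonneg _) (hK t ht).1 2
    gcongr
  · have := pow_le_pow_left₀ (n2_nonneg _) (hK t ht).2.1 2
    gcongr

lemma IsWeakSolution.ulocNormSq_eq (h : IsWeakSolution s T wI w θ u v) {φ₀ : Plane → ℝ} (hφ₀ : IsLocalizer φ₀)
    {t : ℝ} (ht : t ∈ Set.Icc 0 T) : ulocNormSq φ₀ (w t) (θ t) = ENNReal.ofReal (ulocReal φ₀ w θ t) := by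
  obtain ⟨K, -, hK⟩ := h.exists_ulocNormSq_le hφ₀
  exact (ENNReal.ofReal_toReal ((hK t ht).trans_lt ENNReal.ofReal_lt_top).ne).symm

lemma IsWeakSolution.energy_le_ulocReal (h : IsWeakSolution s T wI w θ u v) {φ₀ : Plane → ℝ} (hφ₀ : IsLocalizer φ₀) (k : Fin 2 → ℤ)
    {t : ℝ} (ht : t ∈ Set.Icc 0 T) : energy (translate φ₀ k) (w t) (θ t) ≤ ulocReal φ₀ w θ t := by
  have h1 := le_iSup (fun k => locEnergy (translate φ₀ k) (w t) (θ t)) k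
  change _ ≤ ulocNormSq φ₀ (w t) (θ t) at h1
  rw [h.locEnergy_translate hφ₀ k ht, h.ulocNormSq_eq hφ₀ ht] at h1
  exact (ENNReal.ofReal_le_ofReal_iff ENNReal.toReal_nonneg).mp h1

lemma IsWeakSolution.ulocReal_le (h : IsWeakSolution s T wI w θ u v) {φ₀ : Plane → ℝ} (hφ₀ : IsLocalizer φ₀) {A : ℝ} (hA : 0 ≤ A)
    {t : ℝ} (ht : t ∈ Set.Icc 0 T) (hk : ∀ k, energy (translate φ₀ k) (w t) (θ t) ≤ A) : ulocReal φ₀ w θ t ≤ A := by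
  refine ENNReal.toReal_le_of_le_ofReal hA (iSup_le fun k => ?_)
  rw [h.locEnergy_translate hφ₀ k ht]
  exact ENNReal.ofReal_le_ofReal (hk k)

lemma IsWeakSolution.integrableOn_ulocReal (hs : 1 / 2 < s) (hs1 : s < 1) (hT : 0 < T) (h : IsWeakSolution s T wI w θ u v)
    {φ₀ : Plane → ℝ} (hφ₀ : IsLocalizer φ₀) : IntegrableOn (ulocReal φ₀ w θ) (Set.Ioo 0 T) := by
  obtain ⟨r, L, hr, hL, hloc⟩ := exists_loc hφ₀.test
  obtain ⟨K, hK0, hK⟩ := h.exists_ulocNormSq_le hφ₀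
  have hm : AEMeasurable (ulocReal φ₀ w θ) (volume.restrict (Set.Ioo 0 T)) := by
    have h1 : ∀ k, AEMeasurable (fun t => ENNReal.ofReal (energy (translate φ₀ k) (w t) (θ t))) (volume.restrict (Set.Ioo 0 T)) :=
      fun k => by
        have := (h.absolutelyContinuous_energy hs hs1 hT (hloc (WithLp.toLp 2 fun i => (k i : ℝ)))).continuousOn
        rw [Set.uIcc_of_le hT.le] at this
        exact ((this.mono Set.Ioo_subset_Icc_self).aemeasurable measurableSet_Ioo).ennreal_ofReal
    refine (AEMeasurable.iSup h1).ennreal_toReal.congr ?_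
    filter_upwards [self_mem_ae_restrict measurableSet_Ioo] with t ht
    exact congrArg ENNReal.toReal (iSup_congr fun k => (h.locEnergy_translate hφ₀ k (Set.Ioo_subset_Icc_self ht)).symm)
  refine ⟨hm.aestronglyMeasurable, .restrict_of_bounded K measure_Ioo_lt_top ?_⟩
  filter_upwards [self_mem_ae_restrict measurableSet_Ioo] with t ht
  rw [Real.norm_of_nonneg (show 0 ≤ ulocReal φ₀ w θ t from ENNReal.toReal_nonneg)]
  exact ENNReal.toReal_le_of_le_ofReal hK0 (hK t (Set.Ioo_subset_Icc_self ht))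

lemma IsWeakSolution.ub (h : IsWeakSolution s T wI w θ u v) {φ₀ : Plane → ℝ} (hφ₀ : IsLocalizer φ₀) :
    ∀ t ∈ Set.Icc 0 T, 0 ≤ 2 * ulocReal φ₀ w θ t ∧ UB (w t) (2 * ulocReal φ₀ w θ t) ∧ UB (θ t) (2 * ulocReal φ₀ w θ t) :=
  fun _ ht => ⟨mul_nonneg zero_le_two ENNReal.toReal_nonneg, UB.of_uloc hφ₀ (h.ulocNormSq_eq hφ₀ ht).le⟩

/-- Grönwall's inequality for the norm in `H^s_uloc`. -/
lemma IsWeakSolution.ulocReal_le_exp (hs : 1 / 2 < s) (hs1 : s < 1) (hT : 0 < T) (h : IsWeakSolution s T wI w θ u v) {φ₀ : Plane → ℝ}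
    (hφ₀ : IsLocalizer φ₀) {C : ℝ} (hC : 0 ≤ C) (hk : ∀ k q t, 0 ≤ q → q ≤ t → t ≤ T → energy (translate φ₀ k) (w t) (θ t) -
      energy (translate φ₀ k) (w q) (θ q) ≤ ∫ τ in q..t, C * ulocReal φ₀ w θ τ) {t : ℝ} (ht : t ∈ Set.Icc 0 T) :
    ulocReal φ₀ w θ t ≤ ulocReal φ₀ w θ 0 * Real.exp (C * t) ∧
    ∫ τ in (0 : ℝ)..t, C * ulocReal φ₀ w θ τ ≤ ulocReal φ₀ w θ 0 * Real.exp (C * t) := by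
  have h0 : (0 : ℝ) ∈ Set.Icc 0 T := ⟨le_rfl, hT.le⟩
  have hU0 : ∀ t, 0 ≤ ulocReal φ₀ w θ t := fun t => ENNReal.toReal_nonneg
  have hle : ∀ t ∈ Set.Icc 0 T, ulocReal φ₀ w θ t ≤ ulocReal φ₀ w θ 0 + C * ∫ τ in (0 : ℝ)..t, ulocReal φ₀ w θ τ := fun t ht => by
    refine h.ulocReal_le hφ₀ (add_nonneg (hU0 0) (mul_nonneg hC (intervalIntegral.integral_nonneg ht.1 fun τ _ => hU0 τ))) ht fun k => ?_
    have h1 := hk k 0 t le_rfl ht.1 ht.2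
    rw [intervalIntegral.integral_const_mul] at h1
    linarith [h.energy_le_ulocReal hφ₀ k h0]
  have hG := le_mul_exp_of_le_integral hC (h.integrableOn_ulocReal hs hs1 hT hφ₀) hle t ht
  refine ⟨(hle t ht).trans hG, ?_⟩
  rw [intervalIntegral.integral_const_mul]
  linarith [hU0 0]

lemma IsWeakSolution.lintegral_half_le (hT : 0 < T) (h : IsWeakSolution s T wI w θ u v) {φ ψ : Plane → ℝ} {a : Plane} {r L Lφ A : ℝ}
    (hψ : Loc ψ a r L) (hφ : ∀ x, φ x ≤ Lφ * ψ x ^ 2) (hL : 0 ≤ Lφ)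
    (hA : ∫ τ in (0 : ℝ)..T, n2 (fun x => ψ x * v τ x) ^ 2 ≤ A) :
    ∫⁻ t in Set.Ioo 0 T, ∫⁻ x, ENNReal.ofReal (φ x * v t x ^ 2) ≤ ENNReal.ofReal (Lφ * A) := by
  rw [intervalIntegral.integral_of_le hT.le, integral_Ioc_eq_integral_Ioo] at hA
  refine le_trans (lintegral_mono_ae ?_) ((ofReal_integral_eq_lintegral_ofReal ((h.integrableOn_mul_half hψ).const_mul Lφ)
    (.of_forall fun τ => mul_nonneg hL (sq_nonneg _))).symm.le.trans (ENNReal.ofReal_le_ofReal ?_))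
  · filter_upwards [h.ae_half] with τ hτ
    have hv := memLp_mul_bdd (.of_forall hψ.bd) hψ.test.continuous.aestronglyMeasurable hτ.2.1
    rw [n2_sq, ← integral_const_mul, ofReal_integral_eq_lintegral_ofReal (hv.integrable_sq.const_mul _)
      (.of_forall fun x => mul_nonneg hL (sq_nonneg _))]
    refine lintegral_mono fun x => ENNReal.ofReal_le_ofReal ?_
    rw [mul_pow, ← mul_assoc]
    exact mul_le_mul_of_nonneg_right (hφ x) (sq_nonneg _)
  · rw [integral_const_mul]
    gcongr

end

section
variable {s T : ℝ} {wI : Plane → ℝ} {w θ : ℝ → Plane → ℝ} {u : ℝ → Plane → Plane} {v : ℝ → Plane → ℝ}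

lemma IsWeakSolution.ae_hasDerivAt_locEnergy (hs : 1 / 2 < s) (hs1 : s < 1) (hT : 0 < T) (h : IsWeakSolution s T wI w θ u v) {φ₀ : Plane → ℝ}
    (hφ₀ : IsLocalizer φ₀) {C : ℝ} (k : Fin 2 → ℤ) (hk : ∀ q t, 0 ≤ q → q ≤ t → t ≤ T → energy (translate φ₀ k) (w t) (θ t) -
      energy (translate φ₀ k) (w q) (θ q) ≤ ∫ τ in q..t, C * ulocReal φ₀ w θ τ) :
    AbsolutelyContinuousOnInterval (fun t => (locEnergy (translate φ₀ k) (w t) (θ t)).toReal) 0 T ∧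
    ∀ᵐ t, t ∈ Set.Ioo 0 T → ∃ d : ℝ, HasDerivAt (fun t => (locEnergy (translate φ₀ k) (w t) (θ t)).toReal) d t ∧
      d ≤ C * (ulocNormSq φ₀ (w t) (θ t)).toReal := by
  obtain ⟨r, L, hr, hL, hloc⟩ := exists_loc hφ₀.test
  have hA : ∀ t ∈ Set.Icc 0 T, (locEnergy (translate φ₀ k) (w t) (θ t)).toReal = energy (translate φ₀ k) (w t) (θ t) := fun t ht => by
    rw [h.locEnergy_translate hφ₀ k ht]
    exact ENNReal.toReal_ofReal (energy_nonneg (fun x => hφ₀.nonneg _) _ _)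
  have hU := (h.integrableOn_ulocReal hs hs1 hT hφ₀).const_mul C
  have hac : AbsolutelyContinuousOnInterval (fun t => (locEnergy (translate φ₀ k) (w t) (θ t)).toReal) 0 T := by
    have h1 := h.absolutelyContinuous_energy hs hs1 hT (hloc (WithLp.toLp 2 fun i => (k i : ℝ)))
    rw [absolutelyContinuousOnInterval_iff] at h1 ⊢
    intro ε hε
    obtain ⟨δ, hδ, h2⟩ := h1 ε hε
    refine ⟨δ, hδ, fun E hE hE' => ?_⟩
    refine (Finset.sum_congr rfl fun i hi => ?_).trans_lt (h2 E hE hE')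
    have := (hE.1 i hi)
    rw [Set.uIcc_of_le hT.le] at this
    simp only [hA _ this.1, hA _ this.2]
    rfl
  refine ⟨hac, ae_deriv_le_of_sub_le hT hU hac fun q t hq hqt ht => ?_⟩
  rw [hA t ⟨hq.trans hqt, ht⟩, hA q ⟨hq, hqt.trans ht⟩]
  exact hk q t hq hqt ht

end

lemma IsLocalizer.le_mul_dilate_sq {φ₀ : Plane → ℝ} (hφ₀ : IsLocalizer φ₀) {L : ℝ} (hL : ∀ x, |φ₀ x| ≤ L) (x : Plane) :
    φ₀ x ≤ L * φ₀ ((2 : ℝ)⁻¹ • x) ^ 2 := by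
  have hL0 : 0 ≤ L := (abs_nonneg _).trans (hL x)
  rcases le_or_gt 3 ‖x‖ with h3 | h3
  · rw [hφ₀.eq_zero x h3]
    positivity
  · rw [hφ₀.eq_one ((2 : ℝ)⁻¹ • x) (by rw [norm_smul, Real.norm_of_nonneg (by norm_num)]; linarith), one_pow, mul_one]
    exact (le_abs_self _).trans (hL x)

lemma IsTest.dilate {η : Plane → ℝ} (h : IsTest η) {c : ℝ} (hc : c ≠ 0) : IsTest fun x => η (c • x) :=
  ⟨h.1.comp (contDiff_const_smul c), h.2.comp_homeomorph (Homeomorph.smulOfNeZero c hc)⟩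

end

end SQG

theorem theorem2 (s : ℝ) (hs : 1 / 2 < s) (hs' : s < 1)
    (φ₀ χ ρ : SQG.Plane → ℝ) (hφ₀ : SQG.IsLocalizer φ₀) (hχ : SQG.IsTruncation χ)
    (hρ : SQG.IsMollifier ρ) (M N : ℝ≥0) :
    ∃ C c : ℝ≥0, ∀ w₀ θ₀ : SQG.Plane → ℝ,
      AEStronglyMeasurable w₀ volume → AEStronglyMeasurable θ₀ volume →
      SQG.IsFracLap s w₀ θ₀ →
      eLpNorm θ₀ ⊤ volume ≤ M →
      SQG.ulocNormSq φ₀ w₀ θ₀ ≤ (N : ℝ≥0∞) ^ 2 →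
      ∀ R ε T : ℝ, 1 < R → 0 < ε → 0 < T →
      ∀ (w θ : ℝ → SQG.Plane → ℝ) (u : ℝ → SQG.Plane → SQG.Plane) (v : ℝ → SQG.Plane → ℝ),
      SQG.IsWeakSolution s T (SQG.truncDatum χ ρ R ε w₀) w θ u v →
      -- the energy inequality for each localized energy
      (∀ k : Fin 2 → ℤ,
        AbsolutelyContinuousOnInterval
          (fun t => (SQG.locEnergy (SQG.translate φ₀ k) (w t) (θ t)).toReal) 0 T ∧
        ∀ᵐ t, t ∈ Set.Ioo 0 T → ∃ d : ℝ,
          HasDerivAt (fun t => (SQG.locEnergy (SQG.translate φ₀ k) (w t) (θ t)).toReal) d t ∧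
          d ≤ C * (SQG.ulocNormSq φ₀ (w t) (θ t)).toReal) ∧
      -- the uniform bound of `w` in `L^∞ H^s_uloc`
      (∀ t ∈ Set.Icc 0 T,
        SQG.ulocNormSq φ₀ (w t) (θ t) ≤
          SQG.ulocNormSq φ₀ (w 0) (θ 0) * ENNReal.ofReal (Real.exp (C * t)) ∧
        SQG.ulocNormSq φ₀ (w t) (θ t) ≤ ENNReal.ofReal (c * Real.exp (C * t))) ∧
      -- the uniform bound of `w` in `(L² Ḣ^(s + 1/2))_uloc`
      (⨆ k : Fin 2 → ℤ, ∫⁻ t in Set.Ioo 0 T, ∫⁻ x,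
          ENNReal.ofReal (SQG.translate φ₀ k x * v t x ^ 2)) ≤
        ENNReal.ofReal (c * Real.exp (C * T)) := by
  obtain ⟨B, hB0, hinit⟩ := SQG.exists_initial_bound (s := s) (by linarith) hs' hφ₀ hχ hρ M N
  obtain ⟨r, L, -, hL, hloc⟩ := SQG.exists_loc hφ₀.test
  have hψt : SQG.IsTest fun x => φ₀ ((2 : ℝ)⁻¹ • x) := hφ₀.test.dilate (by norm_num)
  have hψ2t : SQG.IsTest fun x => φ₀ ((2 : ℝ)⁻¹ • x) ^ 2 := by
    simpa only [sq] using hψt.mul_contDiff hψt.1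
  obtain ⟨r₁, L₁, -, -, hψ⟩ := SQG.exists_loc hψt
  obtain ⟨r₂, L₂, -, -, hψ2⟩ := SQG.exists_loc hψ2t
  obtain ⟨C₁, hC₁, hgrow⟩ := SQG.exists_energy_growth hs hs' r L B hB0
  obtain ⟨C₂, hC₂, hdiss⟩ := SQG.exists_energy_dissipation hs hs' r₁ L₁ r₂ L₂ B hB0
  set C : ℝ := 2 * C₁ + 2 * C₂ with hC
  have hC0 : 0 ≤ C := by positivity
  set c₀ : ℝ := B ^ 2 * ∫ x, φ₀ x with hc₀
  have hc₀0 : 0 ≤ c₀ := mul_nonneg (sq_nonneg _) (integral_nonneg hφ₀.nonneg)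
  set c₂ : ℝ := B ^ 2 * ∫ x, φ₀ ((2 : ℝ)⁻¹ • x) ^ 2 with hc₂
  have hc₂0 : 0 ≤ c₂ := mul_nonneg (sq_nonneg _) (integral_nonneg fun x => sq_nonneg _)
  have hc0 : 0 ≤ c₀ + L * (2 * (c₂ + c₀)) := by positivity
  refine ⟨C.toNNReal, (c₀ + L * (2 * (c₂ + c₀))).toNNReal, fun w₀ θ₀ hw₀ _ hfr hM hN R ε T hR hε hT w θ u v h => ?_⟩
  simp only [Real.coe_toNNReal _ hC0, Real.coe_toNNReal _ hc0]
  have h0 : (0 : ℝ) ∈ Set.Icc 0 T := ⟨le_rfl, hT.le⟩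
  have hTT : T ∈ Set.Icc 0 T := ⟨hT.le, le_rfl⟩
  obtain ⟨hBw, hBθ⟩ := hinit w₀ θ₀ hw₀ hfr hM hN R ε hR hε (w 0) (θ 0) (h.memLp_w 0 h0) (h.memLp_θ 0 h0) (h.frac 0 h0)
    fun η hη => by simpa using h.equation η hη 0 h0
  have hmax : ∀ t ∈ Set.Icc 0 T, ∀ᵐ x, |θ t x| ≤ B := fun t ht => h.maximum_principle (by linarith) hs' hT hφ₀ hB0 hBθ ht
  have hU0 : ∀ t, 0 ≤ SQG.ulocReal φ₀ w θ t := fun t => ENNReal.toReal_nonneg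
  have hUi := h.integrableOn_ulocReal hs hs' hT hφ₀
  have hUc : SQG.ulocReal φ₀ w θ 0 ≤ c₀ := ENNReal.toReal_le_of_le_ofReal hc₀0 (SQG.ulocNormSq_le_of_bdd hφ₀ hBw hBθ)
  have hk : ∀ k q t, 0 ≤ q → q ≤ t → t ≤ T → SQG.energy (SQG.translate φ₀ k) (w t) (θ t) -
      SQG.energy (SQG.translate φ₀ k) (w q) (θ q) ≤ ∫ τ in q..t, C * SQG.ulocReal φ₀ w θ τ := fun k q t hq hqt ht => by
    refine (hgrow T _ w θ u v hT h hmax _ (hUi.const_mul 2) (h.ub hφ₀) (SQG.translate φ₀ k) _ (hloc _)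
      (fun x => hφ₀.nonneg _) q t hq hqt ht).trans (intervalIntegral.integral_mono_on hqt ?_ ?_ fun τ _ => ?_)
    · exact SQG.intervalIntegrable_of_Ioo hq hqt ht ((hUi.const_mul 2).const_mul C₁)
    · exact SQG.intervalIntegrable_of_Ioo hq hqt ht (hUi.const_mul C)
    · nlinarith [mul_nonneg hC₂ (hU0 τ)]
  have hgr := fun t ht => h.ulocReal_le_exp hs hs' hT hφ₀ hC0 hk (t := t) ht
  refine ⟨fun k => h.ae_hasDerivAt_locEnergy hs hs' hT hφ₀ k (hk k), fun t ht => ?_, iSup_le fun k => ?_⟩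
  · rw [h.ulocNormSq_eq hφ₀ ht, h.ulocNormSq_eq hφ₀ h0, ← ENNReal.ofReal_mul (hU0 0)]
    refine ⟨ENNReal.ofReal_le_ofReal (hgr t ht).1, ENNReal.ofReal_le_ofReal ((hgr t ht).1.trans ?_)⟩
    gcongr
    exact hUc.trans (le_add_of_nonneg_right (by positivity))
  · set a : SQG.Plane := WithLp.toLp 2 fun i => (k i : ℝ)
    have hint := h.integrableOn_mul_half (hψ a)
    have h1 := hdiss T _ w θ u v hT h hmax _ (hUi.const_mul 2) (h.ub hφ₀) _ a (hψ a) (hψ2 a)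
    rw [intervalIntegral.integral_sub
      (SQG.intervalIntegrable_of_Ioo le_rfl hT.le le_rfl ((hUi.const_mul 2).const_mul C₂))
      (SQG.intervalIntegrable_of_Ioo le_rfl hT.le le_rfl (hint.div_const 2)), intervalIntegral.integral_div] at h1
    have h2 : ∫ τ in (0 : ℝ)..T, C₂ * (2 * SQG.ulocReal φ₀ w θ τ) ≤ ∫ τ in (0 : ℝ)..T, C * SQG.ulocReal φ₀ w θ τ :=
      intervalIntegral.integral_mono_on hT.le
        (SQG.intervalIntegrable_of_Ioo le_rfl hT.le le_rfl ((hUi.const_mul 2).const_mul C₂))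
        (SQG.intervalIntegrable_of_Ioo le_rfl hT.le le_rfl (hUi.const_mul C)) fun τ _ => by
          nlinarith [mul_nonneg hC₁ (hU0 τ)]
    have h3 := SQG.energy_nonneg (fun x => sq_nonneg (φ₀ ((2 : ℝ)⁻¹ • (x - a)))) (w T) (θ T)
    have h4 := SQG.energy_le_of_bdd (hψ2 a) (fun x => sq_nonneg _) (h.memLp_w 0 h0) (h.memLp_θ 0 h0) hBw hBθ
    rw [integral_sub_right_eq_self (fun x => φ₀ ((2 : ℝ)⁻¹ • x) ^ 2) a, ← hc₂] at h4
    have h5 := (hgr T hTT).2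
    have he : 1 ≤ Real.exp (C * T) := Real.one_le_exp (by positivity)
    have h6 := mul_le_mul_of_nonneg_right hUc (zero_le_one.trans he)
    have h7 := mul_le_mul_of_nonneg_left he hc₂0
    refine (h.lintegral_half_le hT (hψ a)
      (fun x => hφ₀.le_mul_dilate_sq (fun x => by simpa using (hloc 0).bd x) (x - a)) hL
      (A := 2 * (c₂ + c₀) * Real.exp (C * T)) (by linarith)).trans (ENNReal.ofReal_le_ofReal ?_)
    rw [← mul_assoc]
    gcongr
    exact le_add_of_nonneg_left hc₀0
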